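/- **Setting.** A locally compact groupoid is a locally compact Hausdorff topological groupoid $G$ (identified with its space of arrows, with source $s$, range $r$ and unit space $G^{(0)}$) equipped with a fixed Haar system: regular Borel measures $\mu^u$, $u\in G^{(0)}$, with $\operatorname{supp}\mu^u=G^u=r^{-1}(u)$, such that $u\mapsto\int f\,d\mu^u$ is continuous for every $f\in C_c(G)$ and $\int f(y)\,d\mu^{r(x)}(y)=\int f(xy)\,d\mu^{s(x)}(y)$ for all $x\in G$. With $f*g(x)=\int f(xy)g(y^{-1})\,d\mu^{s(x)}(y)$ and $f^*(x)=\overline{f(x^{-1})}$, $C_c(G)$ is a $*$-algebra. Let $\|f\|_I=\max\{\sup_u\int|f(x)|\,d\mu^u(x),\ \sup_u\int|f(x^{-1})|\,d\mu^u(x)\}$. The maximal C*-algebra $C^*(G)$ is the completion of $C_c(G)$ in the norm $\|f\|_{\max}=\sup_\pi\|\pi(f)\|$, where $\pi$ runs over the $\|\cdot\|_I$-continuous $*$-representations of $C_c(G)$ on Hilbert spaces; the minimal C*-algebra $C^*_r(G)$ is the completion in the norm $\|f\|_r=\sup_{u\in G^{(0)}}\|\mathrm{Ind}(\delta_u)(f)\|$,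 where $\mathrm{Ind}(\delta_u)(f)\xi(x)=\int f(xy^{-1})\xi(y)\,d\mu_u(y)$ on $L^2(\mu_u)$ and $\mu_u$ is the image of $\mu^u$ under inversion. A partial morphism $G\to H$ is a pair $(f,K)$, where $K\subseteq G$ is an open subgroupoid with the restricted Haar system and $f:K\to H$ is a proper continuous functor with $f_*\mu^u=\nu^{f(u)}$ for every unit $u\in K$, where $\nu$ is the Haar system of $H$. It is surjective if $f(K)=H$. The composite of $(f,K):G\to H$ and $(g,L):H\to M$ is $g\circ f$ on $f^{-1}(L)$. Locally compact groupoids with Haar systems and partial morphisms form the category $\mathcal G$. A partial morphism induces the map $C_c(H)\to C_c(K)\subseteq C_c(G)$ that sends $h$ to $h\circ f$ extended by $0$. Let $\mathcal T\subseteq\mathcal G$ be the full subcategory of locally compact Hausdorff spaces (all arrows are units, $\mu^u=\delta_u$), whose morphisms are the partial proper continuous maps (proper continuous maps defined on open subsets). Let $\mathcal C$ be the category of (not necessarily unital) C*-algebras and $*$-homomorphisms, and $\mathcal{COMM}\subseteq\mathcal C$ the full subcategory of commutative ones. **Theorem.** There are contravariant functors $\Gamma_{\max},\Gamma_{\min}:\mathcal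 G\to\mathcal C$ that send a groupoid $G$ to $C^*(G)$ and $C^*_r(G)$, respectively, and a partial morphism to the continuous extension of its induced map $C_c(H)\to C_c(G)$. For $\Gamma\in\{\Gamma_{\max},\Gamma_{\min}\}$: 1. $\Gamma$ respects finite sums: finite disjoint unions exist in $\mathcal G$; if $D$ is the disjoint union of $G_1,\dots,G_n$, the maps $\Gamma(D)\to\Gamma(G_i)$ induced by the inclusions $G_i\to D$ define an isomorphism $\Gamma(D)\cong\bigoplus_i\Gamma(G_i)$; and $\Gamma$ sends finite categorical sums in $\mathcal G$ to finite products in $\mathcal C$. Moreover, $\Gamma$ sends the inverse limit in $\mathcal G$ of an inverse system over a directed set with surjective bonding maps to the direct limit in $\mathcal C$ of the induced system of C*-algebras. 2. $\Gamma$ extends the Gelfand duality functor: its restriction to $\mathcal T$ is naturally isomorphic, by an isomorphism that is the identity on each $C_c(X)$, to the functor that sends $X$ to $C_0(X)$ and a partial proper map $(f,U):X\to Y$ to the map $C_0(Y)\to C_0(U)\subseteq C_0(X)$ that sends $h$ to $h\circ f$ extended by $0$. Moreover, $\Gamma$ restricts to an anti-equivalence between $\mathcal T$ and $\mathcal{COMM}$.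 -/

import Mathlib

open CategoryTheory CategoryTheory.Limits MeasureTheory Topology Filter Set Opposite
open scoped ENNReal NNReal CompactlySupported ZeroAtInfty

universe u

/-! ### Locally compact groupoids with Haar systems -/

/-- A locally compact Hausdorff groupoid, seen as its space of arrows; the objects are identified
with the units, i.e. with the arrows `u` such that `rng u = u`.  The product `mul x y` is
meaningful only if `src x = rng y`; its values at other pairs are never used.  The measurable
structure is the Borel one. -/
structure LCGroupoid : Type (u + 1) where
  Arr : Type u
  [top : TopologicalSpace Arr]
  [t2 : T2Space Arr]
  [lc : LocallyCompactSpace Arr]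
  [meas : MeasurableSpace Arr]
  [borel : BorelSpace Arr]
  src : Arr → Arr
  rng : Arr → Arr
  inv : Arr → Arr
  mul : Arr → Arr → Arr
  src_rng : ∀ x, src (rng x) = rng x
  rng_src : ∀ x, rng (src x) = src x
  src_mul : ∀ x y, src x = rng y → src (mul x y) = src y
  rng_mul : ∀ x y, src x = rng y → rng (mul x y) = rng x
  mul_assoc : ∀ x y z, src x = rng y → src y = rng z → mul (mul x y) z = mul x (mul y z)
  rng_mul_self : ∀ x, mul (rng x) x = x
  mul_src_self : ∀ x, mul x (src x) = x
  src_inv : ∀ x, src (inv x) = rng x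
  rng_inv : ∀ x, rng (inv x) = src x
  mul_inv : ∀ x, mul x (inv x) = rng x
  inv_mul : ∀ x, mul (inv x) x = src x
  continuous_inv : Continuous inv
  continuousOn_mul : ContinuousOn (fun p : Arr × Arr => mul p.1 p.2) {p | src p.1 = rng p.2}

attribute [instance] LCGroupoid.top LCGroupoid.t2 LCGroupoid.lc LCGroupoid.meas LCGroupoid.borel

namespace LCGroupoid

/-- The space of units (objects). -/
abbrev Units (G : LCGroupoid.{u}) : Type u := {x : G.Arr // G.rng x = x}

variable (G : LCGroupoid.{u})

theorem rng_rng (x : G.Arr) : G.rng (G.rng x) = G.rng x := by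
  conv_lhs => rw [← G.src_rng x]
  rw [G.rng_src, G.src_rng]

/-- The range of an arrow, as a unit. -/
def rngU (x : G.Arr) : G.Units := ⟨G.rng x, G.rng_rng x⟩

/-- The source of an arrow, as a unit. -/
def srcU (x : G.Arr) : G.Units := ⟨G.src x, G.rng_src x⟩

theorem src_eq_of_unit {x : G.Arr} (h : G.rng x = x) : G.src x = x := by
  have := G.src_rng x
  rwa [h] at this

theorem eq_rng_of_mul_self {x : G.Arr} (h : G.src x = G.rng x) (hx : G.mul x x = x) :
    G.rng x = x := by
  have h1 := G.mul_assoc (G.inv x) x x (G.src_inv x) h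
  rw [hx, G.inv_mul, h, G.rng_mul_self] at h1
  exact h1.symm

theorem inv_inv (x : G.Arr) : G.inv (G.inv x) = x := by
  have h1 := G.mul_assoc (G.inv (G.inv x)) (G.inv x) x (G.src_inv _) (G.src_inv x)
  rw [G.inv_mul (G.inv x), G.inv_mul x, G.src_inv, G.rng_mul_self] at h1
  have h2 := G.mul_src_self (G.inv (G.inv x))
  rw [G.src_inv, G.rng_inv] at h2
  rw [h2] at h1
  exact h1.symm

theorem continuous_rng : Continuous G.rng := by
  have h : Continuous (fun x : G.Arr => (fun p : G.Arr × G.Arr => G.mul p.1 p.2) (x, G.inv x)) :=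
    G.continuousOn_mul.comp_continuous (continuous_id.prodMk G.continuous_inv)
      (fun x => (G.rng_inv x).symm)
  simpa [G.mul_inv] using h

theorem continuous_src : Continuous G.src := by
  have h := G.continuous_rng.comp G.continuous_inv
  have h2 : G.rng ∘ G.inv = G.src := funext G.rng_inv
  rwa [h2] at h

theorem continuous_srcU : Continuous G.srcU := G.continuous_src.subtype_mk _

end LCGroupoid

/-- A locally compact Hausdorff groupoid with a Haar system: regular Borel measures `haar u`,
indexed by the units, with support exactly the fibre `{x | rng x = u}`, depending continuously
on `u` and invariant under left translation. -/
structure HaarGroupoid : Type (u + 1) extends LCGroupoid.{u} where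
  haar : toLCGroupoid.Units → Measure Arr
  regular : ∀ u, (haar u).Regular
  haar_compl_fibre : ∀ u : toLCGroupoid.Units, haar u {x | rng x ≠ u} = 0
  haar_pos : ∀ u : toLCGroupoid.Units, ∀ V : Set Arr, IsOpen V → (∃ x ∈ V, rng x = u) → haar u V ≠ 0
  continuous_haar : ∀ f : C_c(Arr, ℂ), Continuous fun u => ∫ x, f x ∂(haar u)
  haar_mul_left : ∀ (f : C_c(Arr, ℂ)) (x : Arr),
    ∫ y, f y ∂(haar (toLCGroupoid.rngU x)) = ∫ y, f (mul x y) ∂(haar (toLCGroupoid.srcU x))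

attribute [instance] HaarGroupoid.regular

/-! ### Partial morphisms and the category of groupoids -/

/-- A partial morphism `(f, K)` from `G` to `H`: a partial function whose domain `K` is an open
subgroupoid of `G` (carrying the restricted Haar system) and which is on `K` a proper continuous
functor that preserves the Haar systems.  As `K` is open, the push-forward along `f` of the
restriction of `G.haar u` to `K` is `S ↦ G.haar u (f⁻¹ S)`. -/
@[ext]
structure PartialMorphism (G H : HaarGroupoid.{u}) : Type u where
  toPFun : G.Arr →. H.Arr
  isOpen_dom : IsOpen toPFun.Dom
  inv_mem : ∀ x ∈ toPFun.Dom, G.inv x ∈ toPFun.Dom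
  map_mul : ∀ x y x' y', x' ∈ toPFun x → y' ∈ toPFun y → G.src x = G.rng y →
    H.src x' = H.rng y' ∧ H.mul x' y' ∈ toPFun (G.mul x y)
  isProper : IsProperMap toPFun.asSubtype
  map_haar : ∀ (u : G.Units) (v : H.Units), (v : H.Arr) ∈ toPFun (u : G.Arr) →
    ∀ S : Set H.Arr, MeasurableSet S → G.haar u (toPFun.preimage S) = H.haar v S

namespace PartialMorphism

variable {G H L : HaarGroupoid.{u}}

theorem isOpen_preimage (φ : PartialMorphism G H) {V : Set H.Arr} (hV : IsOpen V) :
    IsOpen (φ.toPFun.preimage V) := by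
  have h := hV.preimage φ.isProper.continuous
  have h2 := φ.isOpen_dom.isOpenMap_subtype_val _ h
  rw [PFun.preimage_asSubtype, Subtype.image_preimage_coe] at h2
  rwa [inter_eq_right.2 (PFun.preimage_subset_dom _ _)] at h2

theorem isCompact_preimage (φ : PartialMorphism G H) {K : Set H.Arr} (hK : IsCompact K) :
    IsCompact (φ.toPFun.preimage K) := by
  have h := (φ.isProper.isCompact_preimage hK).image continuous_subtype_val
  rw [PFun.preimage_asSubtype, Subtype.image_preimage_coe] at h
  rwa [inter_eq_right.2 (PFun.preimage_subset_dom _ _)] at h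

theorem measurableSet_preimage (φ : PartialMorphism G H) {S : Set H.Arr} (hS : MeasurableSet S) :
    MeasurableSet (φ.toPFun.preimage S) := by
  have h := φ.isProper.continuous.measurable hS
  have h2 := φ.isOpen_dom.measurableSet.subtype_image h
  rw [PFun.preimage_asSubtype, Subtype.image_preimage_coe] at h2
  rwa [inter_eq_right.2 (PFun.preimage_subset_dom _ _)] at h2

/-- A partial morphism sends units to units. -/
theorem map_unit (φ : PartialMorphism G H) {x : G.Arr} {x' : H.Arr} (hx : G.rng x = x)
    (h : x' ∈ φ.toPFun x) : H.rng x' = x' := by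
  have hs := G.src_eq_of_unit hx
  obtain ⟨h1, h2⟩ := φ.map_mul x x x' x' h h (hs.trans hx.symm)
  have h3 : G.mul x x = x := by
    conv_lhs => rw [← hx]
    rw [hx]
    have := G.rng_mul_self x
    rwa [hx] at this
  rw [h3] at h2
  exact H.eq_rng_of_mul_self h1 (Part.mem_unique h2 h)

/-- The identity morphism, defined everywhere. -/
def id (G : HaarGroupoid.{u}) : PartialMorphism G G where
  toPFun := PFun.id G.Arr
  isOpen_dom := isOpen_univ
  inv_mem := fun _ _ => trivial
  map_mul := by
    intro x y x' y' hx hy h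
    simp only [PFun.id_apply, Part.mem_some_iff] at hx hy ⊢
    subst hx hy
    exact ⟨h, rfl⟩
  isProper := by
    have h : (PFun.id G.Arr).asSubtype = (Subtype.val : (PFun.id G.Arr).Dom → G.Arr) := rfl
    rw [h]
    exact isClosed_univ.isProperMap_subtypeVal
  map_haar := by
    intro u v huv S _
    simp only [PFun.id_apply, Part.mem_some_iff] at huv
    have h1 : v = u := Subtype.ext huv
    have h2 : (PFun.id G.Arr).preimage S = S := by
      ext x; simp [PFun.mem_preimage]
    rw [h1, h2]

/-- Composition of partial morphisms, defined on the preimage of the second domain. -/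
def comp (φ : PartialMorphism G H) (ψ : PartialMorphism H L) : PartialMorphism G L where
  toPFun := ψ.toPFun.comp φ.toPFun
  isOpen_dom := by
    rw [PFun.dom_comp]
    exact φ.isOpen_preimage ψ.isOpen_dom
  inv_mem := by
    intro x hx
    rw [PFun.dom_comp, PFun.mem_preimage] at hx ⊢
    obtain ⟨y, hy, hyx⟩ := hx
    obtain ⟨z, hz⟩ := (PFun.mem_dom _ _).1
      (φ.inv_mem x ((PFun.mem_dom _ _).2 ⟨y, hyx⟩))
    obtain ⟨h1, h2⟩ := φ.map_mul _ _ _ _ hz hyx (G.src_inv x)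
    obtain ⟨h1', h2'⟩ := φ.map_mul _ _ _ _ hyx hz (G.rng_inv x).symm
    rw [G.inv_mul] at h2
    rw [G.mul_inv] at h2'
    have e1 := φ.map_unit (G.rng_src x) h2
    rw [H.rng_mul _ _ h1] at e1
    -- `z = y⁻¹`, as `z y` is a unit
    have hzy : z = H.inv y := by
      have e2 := H.mul_assoc z y (H.inv y) h1 (H.rng_inv y).symm
      have e3 := H.src_mul z y h1
      rw [← e1] at e2 e3
      have e4 : H.rng z = H.rng (H.inv y) := by
        rw [H.src_rng] at e3
        rw [e3, H.rng_inv]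
      rw [H.mul_inv, ← h1, H.mul_src_self, e4, H.rng_mul_self] at e2
      exact e2.symm
    exact ⟨z, hzy ▸ ψ.inv_mem y hy, hz⟩
  map_mul := by
    intro x y x' y' hx hy h
    obtain ⟨a, ha, hax⟩ := Part.mem_bind_iff.1 hx
    obtain ⟨b, hb, hby⟩ := Part.mem_bind_iff.1 hy
    obtain ⟨h1, h2⟩ := φ.map_mul _ _ _ _ ha hb h
    obtain ⟨h3, h4⟩ := ψ.map_mul _ _ _ _ hax hby h1
    exact ⟨h3, Part.mem_bind_iff.2 ⟨_, h2, h4⟩⟩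
  isProper := by
    rw [isProperMap_iff_isCompact_preimage]
    have hdom : IsOpen (ψ.toPFun.comp φ.toPFun).Dom := by
      rw [PFun.dom_comp]
      exact φ.isOpen_preimage ψ.isOpen_dom
    constructor
    · refine continuous_def.2 fun V hV => ?_
      rw [PFun.preimage_asSubtype, PFun.preimage_comp]
      exact (φ.isOpen_preimage (ψ.isOpen_preimage hV)).preimage continuous_subtype_val
    · intro K hK
      rw [PFun.preimage_asSubtype, Subtype.isCompact_iff, Subtype.image_preimage_coe,
        inter_eq_right.2 (PFun.preimage_subset_dom _ _), PFun.preimage_comp]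
      exact φ.isCompact_preimage (ψ.isCompact_preimage hK)
  map_haar := by
    intro u v huv S hS
    obtain ⟨w, hw, hwv⟩ := Part.mem_bind_iff.1 huv
    rw [PFun.preimage_comp]
    rw [φ.map_haar u ⟨w, φ.map_unit u.2 hw⟩ hw _ (ψ.measurableSet_preimage hS)]
    exact ψ.map_haar ⟨w, φ.map_unit u.2 hw⟩ v hwv S hS

/-- A partial morphism `(f, K)` is surjective if `f : K → H` is. -/
def Surjective (φ : PartialMorphism G H) : Prop :=
  ∀ y : H.Arr, ∃ x : G.Arr, y ∈ φ.toPFun x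

open Classical in
/-- The pull-back `h ∘ f` of a function along a partial morphism `(f, K)`, extended by zero
outside `K`. -/
noncomputable def pullFun (φ : PartialMorphism G H) (h : H.Arr → ℂ) (x : G.Arr) : ℂ :=
  if hx : x ∈ φ.toPFun.Dom then h (φ.toPFun.fn x hx) else 0

theorem pullFun_of_mem (φ : PartialMorphism G H) (h : H.Arr → ℂ) {x : G.Arr} {y : H.Arr}
    (hy : y ∈ φ.toPFun x) : φ.pullFun h x = h y := by
  have hx : x ∈ φ.toPFun.Dom := (PFun.mem_dom _ _).2 ⟨y, hy⟩
  rw [pullFun, dif_pos hx]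
  exact congrArg h (Part.get_eq_of_mem hy hx)

theorem pullFun_of_notMem (φ : PartialMorphism G H) (h : H.Arr → ℂ) {x : G.Arr}
    (hx : x ∉ φ.toPFun.Dom) : φ.pullFun h x = 0 := by
  rw [pullFun, dif_neg hx]

theorem pullFun_eq_zero (φ : PartialMorphism G H) (h : H.Arr → ℂ) {x : G.Arr} {K : Set H.Arr}
    (hx : x ∉ φ.toPFun.preimage K) (p : ℂ → Prop) (h0 : p 0) (hK : ∀ y, y ∉ K → p (h y)) :
    p (φ.pullFun h x) := by
  by_cases hd : x ∈ φ.toPFun.Dom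
  · obtain ⟨y, hy⟩ := (PFun.mem_dom _ _).1 hd
    rw [φ.pullFun_of_mem h hy]
    exact hK y fun hyK => hx ((PFun.mem_preimage _ _ _).2 ⟨y, hyK, hy⟩)
  · rw [φ.pullFun_of_notMem h hd]
    exact h0

theorem tendsto_pullFun (φ : PartialMorphism G H) (h : H.Arr → ℂ)
    (h0 : Tendsto h (cocompact H.Arr) (𝓝 0)) :
    Tendsto (φ.pullFun h) (cocompact G.Arr) (𝓝 0) := by
  rw [Metric.tendsto_nhds] at h0 ⊢
  intro ε hε
  obtain ⟨K, hK, hKs⟩ := mem_cocompact.1 (h0 ε hε)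
  refine mem_cocompact.2 ⟨_, φ.isCompact_preimage hK, fun x hx => ?_⟩
  exact φ.pullFun_eq_zero h hx (fun z => dist z 0 < ε) (by simpa using hε) fun y hy => hKs hy

theorem continuous_pullFun (φ : PartialMorphism G H) (h : H.Arr → ℂ) (hc : Continuous h)
    (h0 : Tendsto h (cocompact H.Arr) (𝓝 0)) : Continuous (φ.pullFun h) := by
  rw [continuous_iff_continuousAt]
  intro x
  by_cases hx : x ∈ φ.toPFun.Dom
  · have h1 : ContinuousOn (φ.pullFun h) φ.toPFun.Dom := by
      rw [continuousOn_iff_continuous_domRestrict]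
      refine (hc.comp φ.isProper.continuous).congr fun y => ?_
      simp only [Function.comp, Set.domRestrict_apply]
      rw [pullFun, dif_pos y.2]
      rfl
    exact h1.continuousAt (φ.isOpen_dom.mem_nhds hx)
  · rw [ContinuousAt, φ.pullFun_of_notMem h hx]
    rw [Metric.tendsto_nhds] at h0 ⊢
    intro ε hε
    obtain ⟨K, hK, hKs⟩ := mem_cocompact.1 (h0 ε hε)
    have hx' : x ∉ φ.toPFun.preimage K := fun hh => hx (PFun.preimage_subset_dom _ _ hh)
    filter_upwards [(φ.isCompact_preimage hK).isClosed.isOpen_compl.mem_nhds hx'] with y hy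
    exact φ.pullFun_eq_zero h hy (fun z => dist z 0 < ε) (by simpa using hε) fun z hz => hKs hz

/-- The induced map `C_c(H) → C_c(K) ⊆ C_c(G)` of a partial morphism. -/
noncomputable def pullCc (φ : PartialMorphism G H) (f : C_c(H.Arr, ℂ)) : C_c(G.Arr, ℂ) where
  toFun := φ.pullFun f
  continuous_toFun := φ.continuous_pullFun f f.continuous
    f.hasCompactSupport.is_zero_at_infty
  hasCompactSupport' := HasCompactSupport.intro (φ.isCompact_preimage f.hasCompactSupport)
    fun _ hx => φ.pullFun_eq_zero f hx (fun z => z = 0) rfl fun _ hy => image_eq_zero_of_notMem_tsupport hy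

/-- The induced map `C_0(H) → C_0(K) ⊆ C_0(G)` of a partial morphism, a `*`-homomorphism for the
pointwise operations. -/
noncomputable def pullC0 (φ : PartialMorphism G H) : C₀(H.Arr, ℂ) →⋆ₙₐ[ℂ] C₀(G.Arr, ℂ) where
  toFun f :=
    { toFun := φ.pullFun f
      continuous_toFun := φ.continuous_pullFun f f.continuous (zero_at_infty f)
      zero_at_infty' := φ.tendsto_pullFun f (zero_at_infty f) }
  map_smul' c f := by
    ext x
    change φ.pullFun (c • f) x = c • φ.pullFun f x
    unfold pullFun
    split_ifs <;> simp
  map_zero' := by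
    ext x
    change φ.pullFun (0 : C₀(H.Arr, ℂ)) x = 0
    unfold pullFun
    split_ifs <;> simp
  map_add' f g := by
    ext x
    change φ.pullFun (f + g : C₀(H.Arr, ℂ)) x = φ.pullFun f x + φ.pullFun g x
    unfold pullFun
    split_ifs <;> simp
  map_mul' f g := by
    ext x
    change φ.pullFun (f * g : C₀(H.Arr, ℂ)) x = φ.pullFun f x * φ.pullFun g x
    unfold pullFun
    split_ifs <;> simp
  map_star' f := by
    ext x
    change φ.pullFun (star f : C₀(H.Arr, ℂ)) x = star (φ.pullFun f x)
    unfold pullFun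
    split_ifs <;> simp

end PartialMorphism

/-- The category `𝒢` of locally compact groupoids with Haar systems and partial morphisms. -/
instance : Category HaarGroupoid.{u} where
  Hom := PartialMorphism
  id := PartialMorphism.id
  comp := PartialMorphism.comp
  id_comp _ := PartialMorphism.ext (PFun.comp_id _)
  comp_id _ := PartialMorphism.ext (PFun.id_comp _)
  assoc _ _ _ := PartialMorphism.ext (PFun.comp_assoc _ _ _).symm

/-- The locally compact Hausdorff spaces: the groupoids in which every arrow is a unit, with the
Haar system of Dirac measures. -/
def IsSpace : ObjectProperty HaarGroupoid.{u} := fun G =>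
  (∀ x : G.Arr, G.rng x = x) ∧ ∀ u : G.Units, G.haar u = Measure.dirac (u : G.Arr)

/-! ### The category of C*-algebras -/

/-- (Not necessarily unital) C*-algebras. -/
structure CStarAlg : Type (u + 1) where
  carrier : Type u
  [str : NonUnitalCStarAlgebra carrier]

attribute [instance] CStarAlg.str

instance : CoeSort CStarAlg.{u} (Type u) := ⟨CStarAlg.carrier⟩

/-- The category `𝒞` of C*-algebras and `*`-homomorphisms. -/
instance : Category CStarAlg.{u} where
  Hom A B := A →⋆ₙₐ[ℂ] B
  id A := NonUnitalStarAlgHom.id ℂ A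
  comp f g := NonUnitalStarAlgHom.comp g f

/-- The `*`-homomorphism underlying a morphism of `𝒞`. -/
def CStarAlg.starHom {A B : CStarAlg.{u}} (f : A ⟶ B) : A →⋆ₙₐ[ℂ] B := f

/-- The commutative C*-algebras. -/
def IsCommutativeCStar : ObjectProperty CStarAlg.{u} := fun A => ∀ a b : A, a * b = b * a

/-- `X ↦ C_0(X)`, with a partial proper map `(f, U)` sent to `C_0(Y) → C_0(U) ⊆ C_0(X)`.  On the
subcategory of spaces this is the (extended) Gelfand duality functor. -/
noncomputable def c0Functor : HaarGroupoid.{u}ᵒᵖ ⥤ CStarAlg.{u} where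
  obj G := ⟨C₀(G.unop.Arr, ℂ)⟩
  map φ := PartialMorphism.pullC0 φ.unop
  map_id G := by
    refine NonUnitalStarAlgHom.ext fun (f : C₀(G.unop.Arr, ℂ)) => ZeroAtInftyContinuousMap.ext
      fun x => ?_
    exact PartialMorphism.pullFun_of_mem (PartialMorphism.id G.unop) f (Part.mem_some x)
  map_comp {G H L} φ ψ := by
    refine NonUnitalStarAlgHom.ext fun (f : C₀(G.unop.Arr, ℂ)) => ZeroAtInftyContinuousMap.ext
      fun x => ?_
    change (PartialMorphism.comp ψ.unop φ.unop).pullFun f x =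
      PartialMorphism.pullFun ψ.unop (PartialMorphism.pullFun φ.unop f) x
    by_cases hx : x ∈ (ψ.unop : PartialMorphism _ _).toPFun.Dom
    · obtain ⟨y, hy⟩ := (PFun.mem_dom _ _).1 hx
      rw [PartialMorphism.pullFun_of_mem ψ.unop _ hy]
      by_cases hyd : y ∈ (φ.unop : PartialMorphism _ _).toPFun.Dom
      · obtain ⟨z, hz⟩ := (PFun.mem_dom _ _).1 hyd
        rw [PartialMorphism.pullFun_of_mem φ.unop _ hz]
        exact PartialMorphism.pullFun_of_mem _ _ (Part.mem_bind_iff.2 ⟨y, hy, hz⟩)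
      · rw [PartialMorphism.pullFun_of_notMem φ.unop _ hyd]
        refine PartialMorphism.pullFun_of_notMem _ _ fun h => hyd ?_
        obtain ⟨z, hz⟩ := (PFun.mem_dom _ _).1 h
        obtain ⟨y', hy', hz'⟩ := Part.mem_bind_iff.1 hz
        rw [Part.mem_unique hy hy']
        exact (PFun.mem_dom _ _).2 ⟨z, hz'⟩
    · rw [PartialMorphism.pullFun_of_notMem ψ.unop _ hx]
      refine PartialMorphism.pullFun_of_notMem _ _ fun h => hx ?_
      obtain ⟨z, hz⟩ := (PFun.mem_dom _ _).1 h
      obtain ⟨y', hy', -⟩ := Part.mem_bind_iff.1 hz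
      exact (PFun.mem_dom _ _).2 ⟨y', hy'⟩

/-! ### The convolution algebra -/

theorem exists_continuous_eq_of_isCompact {X : Type*} [TopologicalSpace X] [T2Space X]
    [LocallyCompactSpace X] {K : Set X} (hK : IsCompact K) {f : X → ℂ} (hf : ContinuousOn f K) :
    ∃ k : C(X, ℂ), ∀ x ∈ K, k x = f x := by
  have : CompactSpace K := isCompact_iff_compactSpace.1 hK
  have he : IsClosedEmbedding (fun x : K => ((x : X) : OnePoint X)) :=
    (OnePoint.continuous_coe.comp continuous_subtype_val).isClosedEmbedding
      (OnePoint.coe_injective.comp Subtype.val_injective)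
  obtain ⟨g, hg⟩ := ContinuousMap.exists_extension' he
    ⟨fun x : K => f x, continuousOn_iff_continuous_domRestrict.1 hf⟩
  refine ⟨⟨fun x => g x, g.continuous.comp OnePoint.continuous_coe⟩, fun x hx => ?_⟩
  exact congrFun hg ⟨x, hx⟩

namespace HaarGroupoid

variable (G : HaarGroupoid.{u})

/-- The convolution product `(f * g)(x) = ∫ f(xy) g(y⁻¹) dμ^{s(x)}(y)`. -/
noncomputable def convFun (f g : G.Arr → ℂ) (x : G.Arr) : ℂ :=
  ∫ y, f (G.mul x y) * g (G.inv y) ∂(G.haar (G.srcU x))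

theorem isCompact_inv_preimage {K : Set G.Arr} (hK : IsCompact K) : IsCompact (G.inv ⁻¹' K) := by
  have h : G.inv ⁻¹' K = G.inv '' K := by
    ext x
    constructor
    · exact fun hx => ⟨G.inv x, hx, G.inv_inv x⟩
    · rintro ⟨y, hy, rfl⟩
      rwa [mem_preimage, G.inv_inv]
  rw [h]
  exact hK.image G.continuous_inv

/-- The adjoint `f*(x) = conj (f(x⁻¹))`. -/
noncomputable def adj (f : C_c(G.Arr, ℂ)) : C_c(G.Arr, ℂ) where
  toFun x := star (f (G.inv x))
  continuous_toFun := continuous_star.comp (f.continuous.comp G.continuous_inv)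
  hasCompactSupport' := HasCompactSupport.intro (G.isCompact_inv_preimage f.hasCompactSupport)
    fun x hx => by
      have h : f (G.inv x) = 0 := image_eq_zero_of_notMem_tsupport hx
      rw [h, star_zero]

variable {G}

theorem ae_rng (u : G.Units) : ∀ᵐ y ∂(G.haar u), G.rng y = u := G.haar_compl_fibre u

theorem integrable_Cc (h : C_c(G.Arr, ℂ)) (u : G.Units) : Integrable h (G.haar u) :=
  h.continuous.integrable_of_hasCompactSupport h.hasCompactSupport

theorem exists_Cc_eq (f g : C_c(G.Arr, ℂ)) (x : G.Arr) :
    ∃ h : C_c(G.Arr, ℂ), (∀ y, G.rng y = G.src x → f (G.mul x y) * g (G.inv y) = h y) ∧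
      ∀ y, g (G.inv y) = 0 → h y = 0 := by
  have hL : IsCompact (G.inv ⁻¹' tsupport g) := G.isCompact_inv_preimage g.hasCompactSupport
  have hF : IsClosed {y : G.Arr | G.src x = G.rng y} :=
    isClosed_eq continuous_const G.continuous_rng
  have hf : ContinuousOn (fun y => f (G.mul x y))
      (G.inv ⁻¹' tsupport g ∩ {y : G.Arr | G.src x = G.rng y}) :=
    f.continuous.comp_continuousOn (G.continuousOn_mul.comp
      (continuousOn_const.prodMk continuousOn_id) fun y hy => hy.2)
  obtain ⟨k, hk⟩ := exists_continuous_eq_of_isCompact (hL.inter_right hF) hf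
  refine ⟨⟨⟨fun y => k y * g (G.inv y),
    k.continuous.mul (g.continuous.comp G.continuous_inv)⟩, ?_⟩, ?_, ?_⟩
  · refine HasCompactSupport.intro hL fun y hy => ?_
    have h : g (G.inv y) = 0 := image_eq_zero_of_notMem_tsupport hy
    simp [h]
  · intro y hy
    change _ = k y * g (G.inv y)
    by_cases hyL : G.inv y ∈ tsupport g
    · rw [hk y ⟨hyL, hy.symm⟩]
    · have h : g (G.inv y) = 0 := image_eq_zero_of_notMem_tsupport hyL
      simp [h]
  · intro y hy
    change k y * g (G.inv y) = 0
    rw [hy, mul_zero]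

theorem integrable_conv (f g : C_c(G.Arr, ℂ)) (x : G.Arr) :
    Integrable (fun y => f (G.mul x y) * g (G.inv y)) (G.haar (G.srcU x)) := by
  obtain ⟨h, hh, -⟩ := exists_Cc_eq f g x
  refine (integrable_Cc h (G.srcU x)).congr ?_
  filter_upwards [ae_rng (G.srcU x)] with y hy using (hh y hy).symm

theorem continuous_convFun (f g : C_c(G.Arr, ℂ)) : Continuous (G.convFun f g) := by
  rw [continuous_iff_continuousAt]
  intro x₀
  obtain ⟨h, hh, hh0⟩ := exists_Cc_eq f g x₀
  have hL : IsCompact (G.inv ⁻¹' tsupport g) := G.isCompact_inv_preimage g.hasCompactSupport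
  obtain ⟨ψ, hψ1, -, hψc, hψ⟩ := exists_continuous_one_zero_of_isCompact hL isClosed_empty
    (disjoint_empty _)
  let Ψ : C_c(G.Arr, ℂ) := ⟨⟨fun y => (ψ y : ℂ), Complex.continuous_ofReal.comp ψ.continuous⟩,
    hψc.comp_left (g := fun t : ℝ => (t : ℂ)) Complex.ofReal_zero⟩
  have hΨ : Continuous fun x => ∫ y, Ψ y ∂(G.haar (G.srcU x)) :=
    (G.continuous_haar Ψ).comp G.continuous_srcU
  have hH : Continuous fun x => ∫ y, h y ∂(G.haar (G.srcU x)) :=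
    (G.continuous_haar h).comp G.continuous_srcU
  have hΨr : ∀ x, ‖∫ y, Ψ y ∂(G.haar (G.srcU x))‖ = ∫ y, ψ y ∂(G.haar (G.srcU x)) := by
    intro x
    have e : ∫ y, Ψ y ∂(G.haar (G.srcU x)) = ((∫ y, ψ y ∂(G.haar (G.srcU x)) : ℝ) : ℂ) :=
      integral_ofReal
    rw [e, Complex.norm_real, Real.norm_of_nonneg (integral_nonneg fun y => (hψ y).1)]
  have key : ∀ ε > 0, ∀ᶠ x in 𝓝 x₀, ‖G.convFun f g x - ∫ y, h y ∂(G.haar (G.srcU x))‖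
      ≤ ε * ‖∫ y, Ψ y ∂(G.haar (G.srcU x))‖ := by
    intro ε hε
    obtain ⟨N, hN, hxN⟩ := exists_compact_mem_nhds x₀
    have hD : IsCompact ((N ×ˢ (G.inv ⁻¹' tsupport g)) ∩
        {p : G.Arr × G.Arr | G.src p.1 = G.rng p.2}) :=
      (hN.prod hL).inter_right (isClosed_eq (G.continuous_src.comp continuous_fst)
        (G.continuous_rng.comp continuous_snd))
    have hF : ContinuousOn
        (fun p : G.Arr × G.Arr => ‖f (G.mul p.1 p.2) * g (G.inv p.2) - h p.2‖)
        ((N ×ˢ (G.inv ⁻¹' tsupport g)) ∩ {p : G.Arr × G.Arr | G.src p.1 = G.rng p.2}) := by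
      refine ContinuousOn.norm (ContinuousOn.sub (ContinuousOn.mul ?_ ?_) ?_)
      · exact f.continuous.comp_continuousOn (G.continuousOn_mul.mono inter_subset_right)
      · exact (g.continuous.comp (G.continuous_inv.comp continuous_snd)).continuousOn
      · exact (h.continuous.comp continuous_snd).continuousOn
    have hT := hD.of_isClosed_subset (hF.preimage_isClosed_of_isClosed hD.isClosed
      (isClosed_Ici (a := ε))) inter_subset_left
    have hT1 := (hT.image continuous_fst).isClosed.isOpen_compl
    have hx₀ : x₀ ∉ Prod.fst '' (((N ×ˢ (G.inv ⁻¹' tsupport g)) ∩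
        {p : G.Arr × G.Arr | G.src p.1 = G.rng p.2}) ∩
        (fun p : G.Arr × G.Arr => ‖f (G.mul p.1 p.2) * g (G.inv p.2) - h p.2‖) ⁻¹' Ici ε) := by
      rintro ⟨⟨x, y⟩, ⟨⟨-, hxy⟩, hge⟩, rfl⟩
      change G.src x = G.rng y at hxy
      change ε ≤ ‖f (G.mul x y) * g (G.inv y) - h y‖ at hge
      rw [hh y hxy.symm, sub_self, norm_zero] at hge
      exact absurd hε (not_lt.2 hge)
    filter_upwards [hT1.mem_nhds hx₀, hxN] with x hx hxN'
    rw [convFun, ← integral_sub (integrable_conv f g x) (integrable_Cc h _), hΨr,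
      ← integral_const_mul]
    refine norm_integral_le_of_norm_le
      ((ψ.continuous.integrable_of_hasCompactSupport hψc).const_mul ε) ?_
    filter_upwards [ae_rng (G.srcU x)] with y hy
    by_cases hyL : y ∈ G.inv ⁻¹' tsupport g
    · have h1 : ψ y = 1 := hψ1 hyL
      rw [h1, mul_one]
      by_contra hlt
      exact hx ⟨(x, y), ⟨⟨⟨hxN', hyL⟩, hy.symm⟩, (not_le.1 hlt).le⟩, rfl⟩
    · have h0 : g (G.inv y) = 0 := image_eq_zero_of_notMem_tsupport hyL
      rw [h0, hh0 y h0, mul_zero, sub_zero, norm_zero]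
      exact mul_nonneg hε.le (hψ y).1
  have hx0 : G.convFun f g x₀ = ∫ y, h y ∂(G.haar (G.srcU x₀)) := by
    refine integral_congr_ae ?_
    filter_upwards [ae_rng (G.srcU x₀)] with y hy using hh y hy
  have hz : Tendsto (fun x => G.convFun f g x - ∫ y, h y ∂(G.haar (G.srcU x))) (𝓝 x₀) (𝓝 0) := by
    rw [Metric.tendsto_nhds]
    intro ε hε
    have hM : 0 < ‖∫ y, Ψ y ∂(G.haar (G.srcU x₀))‖ + 1 := by positivity
    have hev : ∀ᶠ x in 𝓝 x₀, ‖∫ y, Ψ y ∂(G.haar (G.srcU x))‖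
        < ‖∫ y, Ψ y ∂(G.haar (G.srcU x₀))‖ + 1 :=
      hΨ.norm.continuousAt.eventually_lt continuousAt_const (lt_add_one _)
    filter_upwards [key (ε / (‖∫ y, Ψ y ∂(G.haar (G.srcU x₀))‖ + 1)) (by positivity), hev]
      with x h1 h2
    rw [dist_zero_right]
    refine h1.trans_lt ?_
    rw [div_mul_eq_mul_div, div_lt_iff₀ hM]
    exact mul_lt_mul_of_pos_left h2 hε
  have := hz.add (hH.continuousAt (x := x₀))
  simp only [sub_add_cancel, zero_add] at this
  rw [ContinuousAt, hx0]
  exact this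

variable (G)

/-- The convolution product on `C_c(G)`. -/
noncomputable def conv (f g : C_c(G.Arr, ℂ)) : C_c(G.Arr, ℂ) where
  toFun := G.convFun f g
  continuous_toFun := continuous_convFun f g
  hasCompactSupport' := by
    have hD : IsCompact ((tsupport f ×ˢ tsupport g) ∩
        {p : G.Arr × G.Arr | G.src p.1 = G.rng p.2}) :=
      (f.hasCompactSupport.isCompact.prod g.hasCompactSupport.isCompact).inter_right
        (isClosed_eq (G.continuous_src.comp continuous_fst)
          (G.continuous_rng.comp continuous_snd))
    refine HasCompactSupport.intro
      (hD.image_of_continuousOn (G.continuousOn_mul.mono inter_subset_right)) fun x hx => ?_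
    refine integral_eq_zero_of_ae ?_
    filter_upwards [ae_rng (G.srcU x)] with y hy
    change f (G.mul x y) * g (G.inv y) = 0
    by_contra hne
    have hxy : G.src x = G.rng y := hy.symm
    refine hx ⟨(G.mul x y, G.inv y), ⟨⟨subset_tsupport _ (left_ne_zero_of_mul hne),
      subset_tsupport _ (right_ne_zero_of_mul hne)⟩, ?_⟩, ?_⟩
    · change G.src (G.mul x y) = G.rng (G.inv y)
      rw [G.src_mul x y hxy, G.rng_inv]
    · change G.mul (G.mul x y) (G.inv y) = x
      rw [G.mul_assoc x y _ hxy (G.rng_inv y).symm, G.mul_inv, ← hxy, G.mul_src_self]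

/-- The `I`-norm. -/
noncomputable def normI (f : C_c(G.Arr, ℂ)) : ℝ≥0∞ :=
  max (⨆ u : G.Units, ∫⁻ x, ‖f x‖ₑ ∂(G.haar u)) (⨆ u : G.Units, ∫⁻ x, ‖f (G.inv x)‖ₑ ∂(G.haar u))

/-- A `*`-representation of the convolution algebra `C_c(G)` on a Hilbert space, continuous for
the `I`-norm. -/
structure Rep where
  H : Type u
  [normed : NormedAddCommGroup H]
  [inner : InnerProductSpace ℂ H]
  [complete : CompleteSpace H]
  π : C_c(G.Arr, ℂ) →ₗ[ℂ] (H →L[ℂ] H)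
  map_conv : ∀ f g, π (G.conv f g) = π f * π g
  map_adj : ∀ f, π (G.adj f) = star (π f)
  bounded : ∃ C : ℝ≥0, ∀ f, ‖π f‖ₑ ≤ C * G.normI f

attribute [instance] Rep.normed Rep.inner Rep.complete

/-- The maximal norm on `C_c(G)`: the supremum of `‖π(f)‖` over all `I`-norm continuous
`*`-representations `π`. -/
noncomputable def normMax (f : C_c(G.Arr, ℂ)) : ℝ≥0∞ := ⨆ π : G.Rep, ‖π.π f‖ₑ

/-- The measure on the source fibre of a unit: the image of `haar u` under inversion. -/
noncomputable def haarInv (u : G.Units) : Measure G.Arr := (G.haar u).map G.inv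

/-- The operator `Ind(δ_u)(f)` on (representatives of elements of) `L²` of the source fibre of `u`:
`ξ ↦ (x ↦ ∫ f(xy⁻¹) ξ(y) dμ_u(y))`. -/
noncomputable def indOp (u : G.Units) (f : C_c(G.Arr, ℂ)) (ξ : G.Arr → ℂ) (x : G.Arr) : ℂ :=
  ∫ y, f (G.mul x (G.inv y)) * ξ y ∂(G.haarInv u)

/-- The minimal (reduced) norm on `C_c(G)`: the supremum over all units `u` of the operator norm
of `Ind(δ_u)(f)` on `L²`. -/
noncomputable def normMin (f : C_c(G.Arr, ℂ)) : ℝ≥0∞ :=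
  ⨆ (u : G.Units) (ξ : G.Arr → ℂ) (_ : MemLp ξ 2 (G.haarInv u))
    (_ : eLpNorm ξ 2 (G.haarInv u) ≤ 1), eLpNorm (G.indOp u f ξ) 2 (G.haarInv u)

end HaarGroupoid

/-! ### The functors and their properties -/

/-- `Γ` assigns to every groupoid `G` the C*-completion of the convolution algebra `C_c(G)` with
respect to the (semi)norm `N`, with `ι G : C_c(G) → Γ(G)` as the canonical map, and to every
partial morphism `φ` the extension of the induced map of the convolution algebras. -/
structure IsCompletionFunctor (N : ∀ G : HaarGroupoid.{u}, C_c(G.Arr, ℂ) → ℝ≥0∞)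
    (Γ : HaarGroupoid.{u}ᵒᵖ ⥤ CStarAlg.{u})
    (ι : ∀ G : HaarGroupoid.{u}, C_c(G.Arr, ℂ) →ₗ[ℂ] (Γ.obj (op G) : Type u)) : Prop where
  map_conv : ∀ G f g, ι G (G.conv f g) = ι G f * ι G g
  map_adj : ∀ G f, ι G (G.adj f) = star (ι G f)
  enorm_eq : ∀ G f, ‖ι G f‖ₑ = N G f
  denseRange : ∀ G, DenseRange (ι G)
  map_induced : ∀ (G H : HaarGroupoid.{u}) (φ : G ⟶ H) (f : C_c(H.Arr, ℂ)),
    CStarAlg.starHom (Γ.map φ.op) (ι H f) = ι G (PartialMorphism.pullCc φ f)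

/-- The maps `j i : G i ⟶ D` exhibit `D` as the disjoint union of the groupoids `G i`: they are
everywhere defined, are open embeddings, and their ranges partition `D`. -/
structure IsDisjointUnion {I : Type} (G : I → HaarGroupoid.{u}) (D : HaarGroupoid.{u})
    (j : ∀ i, PartialMorphism (G i) D) : Prop where
  dom_eq : ∀ i, (j i).toPFun.Dom = Set.univ
  isOpenEmbedding : ∀ i, IsOpenEmbedding (j i).toPFun.asSubtype
  disjoint : Pairwise fun i k => Disjoint (j i).toPFun.ran (j k).toPFun.ran
  covers : ⋃ i, (j i).toPFun.ran = Set.univ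

/-- `Γ` sends finite disjoint unions to direct sums (by the canonical map, a bijective
`*`-homomorphism onto the direct sum), and finite categorical sums to direct sums, i.e. to
products of C*-algebras. -/
def RespectsFiniteSums (Γ : HaarGroupoid.{u}ᵒᵖ ⥤ CStarAlg.{u}) : Prop :=
  (∀ (I : Type) [Finite I] (G : I → HaarGroupoid.{u}) (D : HaarGroupoid.{u}) (j : ∀ i, G i ⟶ D),
    IsDisjointUnion G D j →
      Function.Bijective fun (a : Γ.obj (op D)) (i : I) => CStarAlg.starHom (Γ.map (j i).op) a) ∧
  PreservesFiniteProducts Γ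

/-- `Γ` sends inverse limits in `𝒢`, of inverse systems over directed sets with surjective bonding
maps, to direct limits of C*-algebras. -/
def MapsInverseLimitsToDirectLimits (Γ : HaarGroupoid.{u}ᵒᵖ ⥤ CStarAlg.{u}) : Prop :=
  ∀ (Δ : Type u) [Preorder Δ] [IsDirectedOrder Δ] [Nonempty Δ] (F : Δᵒᵖ ⥤ HaarGroupoid.{u}),
    (∀ {α β : Δᵒᵖ} (p : α ⟶ β), PartialMorphism.Surjective (F.map p)) →
    ∀ c : Cone F, Nonempty (IsLimit c) →
      Nonempty (IsColimit (Γ.mapCocone (coconeRightOpOfCone c)))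

/-- On spaces, `Γ` is the Gelfand functor `X ↦ C_0(X)`, by a natural isomorphism that is the
identity on `C_c(X)`. -/
def ExtendsGelfand (Γ : HaarGroupoid.{u}ᵒᵖ ⥤ CStarAlg.{u})
    (ι : ∀ G : HaarGroupoid.{u}, C_c(G.Arr, ℂ) →ₗ[ℂ] (Γ.obj (op G) : Type u)) : Prop :=
  ∃ e : IsSpace.{u}.ι.op ⋙ Γ ≅ IsSpace.{u}.ι.op ⋙ c0Functor,
    ∀ (X : IsSpace.{u}.FullSubcategory) (f : C_c(X.obj.Arr, ℂ)) (x : X.obj.Arr),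
      (show C₀(X.obj.Arr, ℂ) from CStarAlg.starHom (e.hom.app (op X)) (ι X.obj f)) x = f x

/-- `Γ` restricts to an anti-equivalence between the category of locally compact Hausdorff spaces
with partial proper maps and the category of commutative C*-algebras. -/
def RestrictsToAntiEquivalence (Γ : HaarGroupoid.{u}ᵒᵖ ⥤ CStarAlg.{u}) : Prop :=
  ∃ h : ∀ X, IsCommutativeCStar.{u} ((IsSpace.{u}.ι.op ⋙ Γ).obj X),
    (IsCommutativeCStar.{u}.lift (IsSpace.{u}.ι.op ⋙ Γ) h).IsEquivalence

/-! Functoriality. The domain of a partial morphism is an open subgroupoid and the Haar systems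
match, so pull-back respects convolution and adjoint (`pullCc_conv`, `pullCc_adj`). It remains to
see that pull-back does not increase the norms. For the maximal norm, a representation composed with
pull-back is again a representation continuous for the `I`-norm (`pullRep`). For the minimal norm,
the pulled-back regular representation has a dense set of vectors whose matrix coefficients are
bounded by the uniform norm, and every such representation is bounded by the minimal norm
(`norm_le_rnormMin`). The engine of all these estimates is the power trick
`norm_apply_le_of_norm_inner_le`: a crude bound on one matrix coefficient, applied to the powers of
`a* a`, improves to a bound with constant 1.

Finite sums. Morphisms may be undefined, so each inclusion of a summand into a disjoint union has a
left inverse that is undefined on the other summands. The induced maps express each element of the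
algebra as the sum of its components.

Spaces. Convolution is the pointwise product, and every norm between the minimal one and the
`I`-norm is the uniform norm. The duality is Gelfand's theorem for unitizations and one-point
compactifications: a nonunital character is a point, and the zero functional marks the places where
a partial map is undefined.

Inverse limits. Partial morphisms extend to pointed maps of one-point compactifications, so the
limit is the space of threads in a product of compactifications, without the thread at infinity.
Stone-Weierstrass shows that functions pulled back from the stages are dense, with control of
supports (`exists_pull_approx`). Surjectivity of the bonding maps makes the stagewise Haar integrals
a positive functional on pull-backs; the extension theorem of M. Riesz and the Riesz-Markov-Kakutani
theorem turn it into a measure (`exists_haar`). Since limits are unique up to isomorphism, every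
limit cone has surjective projections and an `I`-dense space of pull-backs. A cocone of C*-algebras
therefore yields an `I`-contractive `*`-homomorphism on the convolution algebra of the limit
(`exists_extend_of_isLimit`). It is bounded by the maximal norm because C*-algebras have enough
representations (`exists_rep_norm_le`), and by the minimal norm because pull-back along a surjective
morphism does not decrease the minimal norm (`Surjective.rnormMin_le`). -/

/-! ### Operators on Hilbert spaces and homomorphisms of C*-algebras -/

/-- A family of operators on a pre-Hilbert space that respects products and adjoints and whose
matrix coefficient at `v` is bounded by a multiple of a submultiplicative function `N` is bounded
by `N` at `v`. -/
theorem norm_apply_le_of_norm_inner_le {A V E : Type*} [SeminormedAddCommGroup E]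
    [InnerProductSpace ℂ E] {m : A → A → A} {s : A → A} {N : A → ℝ} (hN : ∀ a, 0 ≤ N a)
    (hm : ∀ a b, N (m a b) ≤ N a * N b) (hs : ∀ a, N (s a) ≤ N a) {L : A → V → V} {j : V → E}
    (hL : ∀ a b v, L (m a b) v = L a (L b v))
    (hadj : ∀ a v w, inner ℂ (j (L a v)) (j w) = inner ℂ (j v) (j (L (s a) w)))
    {v : V} {C : ℝ} (hC : ∀ a, ‖inner ℂ (j v) (j (L a v))‖ ≤ C * N a) (a : A) :
    ‖j (L a v)‖ ≤ N a * ‖j v‖ := by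
  have hadj' : ∀ a v w, inner ℂ (j (L (s a) v)) (j w) = inner ℂ (j v) (j (L a w)) := by
    intro a v w
    rw [← inner_conj_symm, ← hadj, inner_conj_symm]
  -- `b n` is `(a* a) ^ (2 ^ n)`, formed by repeated squaring. It acts symmetrically, so its norm at
  -- `v` is governed by the coefficient of `b (n + 1)` at `v`.
  let b : ℕ → A := fun n => n.rec (m (s a) a) fun _ c => m c c
  have hb0 : b 0 = m (s a) a := rfl
  have hbs : ∀ n, b (n + 1) = m (b n) (b n) := fun _ => rfl
  have hsa : ∀ n v w, inner ℂ (j (L (b n) v)) (j w) = inner ℂ (j v) (j (L (b n) w)) := by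
    intro n
    induction n with
    | zero => intro v w; rw [hb0, hL, hL, hadj', hadj]
    | succ n ih => intro v w; rw [hbs, hL, hL, ih, ih]
  have hNb : ∀ n, N (b n) ≤ N a ^ 2 ^ (n + 1) := by
    intro n
    induction n with
    | zero =>
      rw [hb0]
      refine (hm _ _).trans ?_
      rw [zero_add, pow_one, sq]
      exact mul_le_mul_of_nonneg_right (hs a) (hN a)
    | succ n ih =>
      rw [hbs]
      refine (hm _ _).trans ?_
      rw [pow_succ 2 (n + 1), pow_mul, sq]
      exact mul_le_mul ih ih (hN _) (pow_nonneg (hN a) _)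
  have hsq : ∀ n, ‖j (L (b n) v)‖ ^ 2 ≤ ‖inner ℂ (j v) (j (L (b (n + 1)) v))‖ := by
    intro n
    rw [hbs, hL, ← hsa, inner_self_eq_norm_sq_to_K]
    simp
  have hsq0 : ‖j (L a v)‖ ^ 2 ≤ ‖j v‖ * ‖j (L (b 0) v)‖ := by
    refine le_trans ?_ (norm_inner_le_norm (𝕜 := ℂ) _ _)
    rw [hb0, hL, ← hadj, inner_self_eq_norm_sq_to_K]
    simp
  rcases (norm_nonneg (j v)).eq_or_lt with h0 | h0
  · rw [← h0, mul_zero]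
    rw [← h0, zero_mul] at hsq0
    nlinarith [norm_nonneg (j (L a v))]
  -- Cauchy-Schwarz at each squaring doubles the exponent of the quotient `‖a v‖ / ‖v‖`.
  · have hpow : ∀ n, (‖j (L a v)‖ / ‖j v‖) ^ 2 ^ (n + 1) ≤ ‖j (L (b n) v)‖ / ‖j v‖ := by
      intro n
      induction n with
      | zero =>
        rw [zero_add, pow_one, div_pow, sq ‖j v‖, div_le_div_iff₀ (by positivity) h0]
        nlinarith
      | succ n ih =>
        rw [pow_succ 2 (n + 1), pow_mul]
        refine (pow_le_pow_left₀ (by positivity) ih 2).trans ?_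
        rw [div_pow, sq ‖j v‖, div_le_div_iff₀ (by positivity) h0]
        have := (hsq n).trans (norm_inner_le_norm (𝕜 := ℂ) _ _)
        nlinarith
    have hfin : ∀ n, (‖j (L a v)‖ / ‖j v‖) ^ 2 ^ (n + 2) ≤ C / ‖j v‖ ^ 2 * N a ^ 2 ^ (n + 2) := by
      intro n
      rw [pow_succ 2 (n + 1), pow_mul]
      refine (pow_le_pow_left₀ (by positivity) (hpow n) 2).trans ?_
      rw [div_pow, div_mul_eq_mul_div]
      refine div_le_div_of_nonneg_right ((hsq n).trans ((hC _).trans ?_)) (by positivity)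
      rw [← pow_succ]
      rcases le_or_gt 0 C with hC0 | hC0
      · exact mul_le_mul_of_nonneg_left (hNb (n + 1)) hC0
      -- A negative `C` forces `N` to vanish at `a` and at `b (n + 1)`, and then both sides are
      -- zero.
      · by_contra hlt
        have h1 := hC (b (n + 1))
        have h2 : N (b (n + 1)) = 0 := by nlinarith [hN (b (n + 1)), norm_nonneg (inner ℂ (j v) (j (L (b (n + 1)) v)))]
        have h3 := hC a
        have h4 : N a = 0 := by nlinarith [hN a, norm_nonneg (inner ℂ (j v) (j (L a v)))]
        rw [h2, h4, zero_pow (by positivity)] at hlt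
        exact hlt le_rfl
    rw [← div_le_iff₀ h0]
    by_contra! hlt
    set t := ‖j (L a v)‖ / ‖j v‖ with ht
    rcases (hN a).eq_or_lt with hN0 | hN0
    · have := hfin 0
      rw [← hN0] at this hlt
      rw [zero_pow (by positivity), mul_zero] at this
      exact absurd this (not_le.2 (pow_pos hlt _))
    -- If `t` exceeds `N a`, the powers of `t / N a` with exponents `2 ^ (n + 2)` outgrow the
    -- constant in `hfin`, which does not depend on `n`.
    · have h1 : 1 < t / N a := (one_lt_div hN0).2 hlt
      have h2 := (tendsto_pow_atTop_atTop_of_one_lt h1).comp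
        ((tendsto_pow_atTop_atTop_of_one_lt (one_lt_two : (1 : ℕ) < 2)).comp
          (tendsto_add_atTop_nat 2))
      obtain ⟨n, hn⟩ := (h2.eventually_gt_atTop (C / ‖j v‖ ^ 2)).exists
      simp only [Function.comp] at hn
      rw [div_pow, lt_div_iff₀ (by positivity)] at hn
      exact absurd (hfin n) (not_le.2 hn)

/-- A contractive linear map on a dense subspace that respects products and adjoints extends to a
`*`-homomorphism. -/
theorem exists_starHom_extend {V A B : Type*} [AddCommGroup V] [Module ℂ V]
    [NonUnitalCStarAlgebra A] [NonUnitalCStarAlgebra B] {j : V →ₗ[ℂ] A} {T : V →ₗ[ℂ] B}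
    {m : V → V → V} {s : V → V} (hj : DenseRange j) (hjm : ∀ f g, j (m f g) = j f * j g)
    (hjs : ∀ f, j (s f) = star (j f)) (hTm : ∀ f g, T (m f g) = T f * T g)
    (hTs : ∀ f, T (s f) = star (T f)) (hT : ∀ f, ‖T f‖ ≤ ‖j f‖) :
    ∃ φ : A →⋆ₙₐ[ℂ] B, ∀ f, φ (j f) = T f := by
  have hb : ∃ C : ℝ, ∀ x, ‖T x‖ ≤ C * ‖j x‖ := ⟨1, fun x => by rw [one_mul]; exact hT x⟩
  let Φ := T.extendOfNorm j
  have hΦ : ∀ f, Φ (j f) = T f := LinearMap.extendOfNorm_eq hj hb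
  refine ⟨{ toFun := Φ
            map_smul' := fun c x => map_smul Φ c x
            map_zero' := map_zero Φ
            map_add' := map_add Φ
            map_mul' := ?_
            map_star' := ?_ }, hΦ⟩
  · intro x y
    induction x, y using hj.induction_on₂ with
    | hp => exact isClosed_eq (by fun_prop) (by fun_prop)
    | h f g => rw [← hjm, hΦ, hΦ, hΦ, hTm]
  · intro x
    induction x using hj.induction_on with
    | hp => exact isClosed_eq (by fun_prop) (by fun_prop)
    | ih f => rw [← hjs, hΦ, hΦ, hTs]

theorem starHom_continuous {A B : Type*} [NonUnitalCStarAlgebra A] [NonUnitalCStarAlgebra B]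
    (φ : A →⋆ₙₐ[ℂ] B) : Continuous φ :=
  AddMonoidHomClass.continuous_of_bound φ 1 fun x => by
    rw [one_mul]; exact NonUnitalStarAlgHom.norm_apply_le φ x

theorem starHom_ext_of_denseRange {V A B : Type*} [NonUnitalCStarAlgebra A]
    [NonUnitalCStarAlgebra B] {j : V → A} (hj : DenseRange j) {φ ψ : A →⋆ₙₐ[ℂ] B}
    (h : ∀ f, φ (j f) = ψ (j f)) : φ = ψ :=
  DFunLike.coe_injective (hj.equalizer (starHom_continuous φ) (starHom_continuous ψ) (funext h))

/-- A C*-algebra completing a `*`-algebra with respect to a family of homomorphisms to C*-algebras. -/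
theorem exists_cstar_completion {V I : Type u} [AddCommGroup V] [Module ℂ V] (B : I → Type u)
    [∀ i, NonUnitalCStarAlgebra (B i)] (π : ∀ i, V →ₗ[ℂ] B i) {m : V → V → V} {s : V → V} {N : V → ℝ≥0∞}
    (hm : ∀ i f g, π i (m f g) = π i f * π i g) (hs : ∀ i f, π i (s f) = star (π i f))
    (hN : ∀ f, N f = ⨆ i, ‖π i f‖ₑ) (hfin : ∀ f, N f ≠ ∞) :
    ∃ (A : CStarAlg.{u}) (j : V →ₗ[ℂ] A), (∀ f g, j (m f g) = j f * j g) ∧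
      (∀ f, j (s f) = star (j f)) ∧ (∀ f, ‖j f‖ₑ = N f) ∧ DenseRange j := by
  have hle : ∀ f i, ‖π i f‖ ≤ (N f).toReal := by
    intro f i
    rw [← toReal_enorm]
    refine ENNReal.toReal_mono (hfin f) ?_
    rw [hN]
    exact le_iSup (fun i => ‖π i f‖ₑ) i
  -- As `N` is finite, `V` maps to the bounded product of the `B i`, whose norm is the supremum. The
  -- closure of the image is the completion.
  let J : V →ₗ[ℂ] lp B ∞ :=
    { toFun := fun f => ⟨fun i => π i f, memℓp_infty ⟨(N f).toReal, by
        rintro _ ⟨i, rfl⟩; exact hle f i⟩⟩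
      map_add' := fun f g => by ext1; funext i; exact map_add (π i) f g
      map_smul' := fun c f => by ext1; funext i; exact map_smul (π i) c f }
  have hJm : ∀ f g, J (m f g) = J f * J g := fun f g => by ext1; funext i; exact hm i f g
  have hJs : ∀ f, J (s f) = star (J f) := fun f => by ext1; funext i; exact hs i f
  have hJN : ∀ f, ‖J f‖ₑ = N f := by
    intro f
    rw [← ENNReal.toReal_eq_toReal_iff' enorm_ne_top (hfin f), toReal_enorm]
    refine le_antisymm (lp.norm_le_of_forall_le ENNReal.toReal_nonneg (hle f)) ?_
    rw [hN, ← toReal_enorm]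
    refine ENNReal.toReal_mono enorm_ne_top (iSup_le fun i => ?_)
    rw [enorm_le_iff_norm_le]
    exact lp.norm_apply_le_norm ENNReal.top_ne_zero (J f) i
  let S : NonUnitalStarSubalgebra ℂ (lp B ∞) :=
    { carrier := Set.range J
      zero_mem' := ⟨0, map_zero J⟩
      add_mem' := by rintro _ _ ⟨f, rfl⟩ ⟨g, rfl⟩; exact ⟨f + g, map_add J f g⟩
      mul_mem' := by rintro _ _ ⟨f, rfl⟩ ⟨g, rfl⟩; exact ⟨_, hJm f g⟩
      smul_mem' := by rintro c _ ⟨f, rfl⟩; exact ⟨c • f, map_smul J c f⟩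
      star_mem' := by rintro _ ⟨f, rfl⟩; exact ⟨_, hJs f⟩ }
  have : IsClosed (S.topologicalClosure : Set (lp B ∞)) :=
    S.isClosed_topologicalClosure
  have hmem : ∀ f, J f ∈ S.topologicalClosure := fun f =>
    S.le_topologicalClosure ⟨f, rfl⟩
  refine ⟨⟨S.topologicalClosure⟩,
    { toFun := fun f => (⟨J f, hmem f⟩ : S.topologicalClosure)
      map_add' := fun f g => Subtype.ext (map_add J f g)
      map_smul' := fun c f => Subtype.ext (map_smul J c f) },
    fun f g => Subtype.ext (hJm f g), fun f => Subtype.ext (hJs f), hJN, ?_⟩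
  rintro ⟨x, hx⟩
  rw [closure_subtype]
  change x ∈ closure (S : Set _) at hx
  convert! hx
  ext y
  constructor
  · rintro ⟨_, ⟨f, rfl⟩, rfl⟩; exact ⟨f, rfl⟩
  · rintro ⟨f, rfl⟩; exact ⟨_, ⟨f, rfl⟩, rfl⟩

open scoped ComplexOrder in
/-- A functional of norm at most one with `g 1 = 1` is positive. -/
theorem nonneg_of_norm_le_one {A : Type*} [CStarAlgebra A] [PartialOrder A] [StarOrderedRing A]
    [Nontrivial A] {g : A →L[ℂ] ℂ} (hg : ‖g‖ ≤ 1) (h1 : g 1 = 1) {x : A} (hx : 0 ≤ x) :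
    0 ≤ g x := by
  have hgle : ∀ y, ‖g y‖ ≤ ‖y‖ := fun y => by
    simpa using g.le_of_opNorm_le hg y
  have hsa : IsSelfAdjoint x := .of_nonneg hx
  -- The C*-identity bounds the square of the norm of `x + i t` by `‖x‖² + t²`, while the square of
  -- `|g (x + i t)|` is at least `(im (g x) + t)²`. The cross term is linear in `t`, so it must
  -- vanish.
  have him : (g x).im = 0 := by
    have key : ∀ t : ℝ, ((g x).im + t) ^ 2 ≤ ‖x‖ ^ 2 + t ^ 2 := by
      intro t
      have e : g (x + (t * Complex.I) • 1) = g x + t * Complex.I := by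
        rw [map_add, map_smul, h1, smul_eq_mul, mul_one]
      have h2 : ‖x + (t * Complex.I) • (1 : A)‖ ^ 2 ≤ ‖x‖ ^ 2 + t ^ 2 := by
        rw [sq, ← CStarRing.norm_star_mul_self]
        have e2 : star (x + (t * Complex.I) • (1 : A)) * (x + (t * Complex.I) • 1)
            = star x * x + ((t : ℂ) ^ 2) • 1 := by
          rw [star_add, star_smul, star_one, hsa.star_eq]
          simp only [add_mul, mul_add, smul_mul_assoc, mul_smul_comm, one_mul, mul_one, smul_add,
            smul_smul]
          have : star (t * Complex.I) = -(t * Complex.I) := by simp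
          rw [this]
          have h3 : -(t * Complex.I) * (t * Complex.I) = (t : ℂ) ^ 2 := by
            linear_combination (-(t : ℂ) ^ 2) * Complex.I_sq
          have h3' : (t * Complex.I) * -(t * Complex.I) = (t : ℂ) ^ 2 := by
            rw [mul_comm, h3]
          simp only [h3', neg_smul]
          abel
        rw [e2]
        refine (norm_add_le _ _).trans (add_le_add ?_ ?_)
        · rw [CStarRing.norm_star_mul_self, sq]
        · rw [norm_smul, CStarRing.norm_one, mul_one]
          simp
      have h3 : ((g x).im + t) ^ 2 ≤ ‖g (x + (t * Complex.I) • 1)‖ ^ 2 := by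
        rw [e, ← Complex.normSq_eq_norm_sq, Complex.normSq_apply]
        simp
        nlinarith [sq_nonneg (g x).re]
      exact h3.trans ((pow_le_pow_left₀ (norm_nonneg _) (hgle _) 2).trans h2)
    by_contra hne
    -- For this `t` the cross term `2 t im (g x)` equals `‖x‖² + 1`.
    have := key ((‖x‖ ^ 2 + 1) / (2 * (g x).im))
    have e : ((g x).im + (‖x‖ ^ 2 + 1) / (2 * (g x).im)) ^ 2 = (g x).im ^ 2 + (‖x‖ ^ 2 + 1)
        + ((‖x‖ ^ 2 + 1) / (2 * (g x).im)) ^ 2 := by field_simp; ring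
    nlinarith [sq_nonneg (g x).im]
  -- Since `‖x‖ 1 - x` lies between `0` and `‖x‖ 1`, the number `‖x‖ - g x` has modulus at most
  -- `‖x‖`.
  have hre : 0 ≤ (g x).re := by
    have h2 : ‖(‖x‖ : ℂ) • (1 : A) - x‖ ≤ ‖x‖ := by
      have h3 : x ≤ algebraMap ℝ A ‖x‖ := hsa.le_algebraMap_norm_self
      have h4 : (‖x‖ : ℂ) • (1 : A) = algebraMap ℝ A ‖x‖ := by
        rw [Algebra.algebraMap_eq_smul_one, ← Complex.coe_smul]
      rw [h4]
      refine (CStarAlgebra.norm_le_norm_of_nonneg_of_le (sub_nonneg.2 h3)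
        (sub_le_self _ hx)).trans ?_
      simp
    have h3 := (hgle _).trans h2
    rw [map_sub, map_smul, h1, smul_eq_mul, mul_one] at h3
    have h4 := (Complex.re_le_norm _).trans h3
    simp at h4
    linarith
  exact Complex.nonneg_iff.2 ⟨hre, him.symm⟩

open scoped ComplexOrder in
/-- Every element of a unital C*-algebra attains its norm in some representation on a Hilbert
space. -/
theorem exists_rep_norm_le_of_unital (A : Type u) [CStarAlgebra A] [Nontrivial A] (b : A) :
    ∃ (H : Type u) (_ : NormedAddCommGroup H) (_ : InnerProductSpace ℂ H) (_ : CompleteSpace H)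
      (π : A →⋆ₙₐ[ℂ] (H →L[ℂ] H)), ‖b‖ ≤ ‖π b‖ := by
  let _ : PartialOrder A := CStarAlgebra.spectralOrder A
  let _ : StarOrderedRing A := CStarAlgebra.spectralOrderedRing A
  let a : A := star b * b
  have ha : 0 ≤ a := star_mul_self_nonneg _
  have han : ‖a‖ = ‖b‖ ^ 2 := by
    rw [CStarRing.norm_star_mul_self, sq]
  have hnorm : ‖1 + a‖ = 1 + ‖a‖ := by
    refine le_antisymm ((norm_add_le _ _).trans (by rw [CStarRing.norm_one])) ?_
    have h1 : ‖a‖ ∈ spectrum ℝ a := CStarAlgebra.norm_mem_spectrum_of_nonneg ha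
    have h2 : ‖a‖ + 1 ∈ spectrum ℝ (algebraMap ℝ A 1 + a) := spectrum.add_mem_add_iff.2 h1
    rw [map_one] at h2
    have := spectrum.norm_le_norm_of_mem h2
    rwa [Real.norm_of_nonneg (by positivity), add_comm] at this
  -- The functional norms `1 + a` and not just `a`: as `‖1 + a‖ = 1 + ‖a‖`, it has to attain its
  -- bound at `1` and at `a` simultaneously. So it is a state that norms `a = b* b`, and its GNS
  -- representation norms `b` at the cyclic vector.
  obtain ⟨g, hg, hga⟩ := exists_dual_vector'' ℂ (1 + a)
  have hgle : ∀ y, ‖g y‖ ≤ ‖y‖ := fun y => by simpa using g.le_of_opNorm_le hg y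
  have hre : (g 1).re + (g a).re = 1 + ‖a‖ := by
    rw [map_add, hnorm] at hga
    have := congrArg Complex.re hga
    simpa using this
  have hb1 := (Complex.re_le_norm (g 1)).trans (hgle 1)
  rw [CStarRing.norm_one] at hb1
  have hba := (Complex.re_le_norm (g a)).trans (hgle a)
  have hn1 := hgle 1
  rw [CStarRing.norm_one] at hn1
  have hr1 : (g 1).re = 1 := by linarith
  have hra : (g a).re = ‖a‖ := by linarith
  have h1 : g 1 = 1 := by
    refine Complex.ext hr1 ?_
    have := pow_le_pow_left₀ (norm_nonneg _) hn1 2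
    rw [← Complex.normSq_eq_norm_sq, Complex.normSq_apply, hr1] at this
    have h0 : (g 1).im * (g 1).im ≤ 0 := by linarith
    simpa using le_antisymm h0 (mul_self_nonneg _)
  let f : A →ₚ[ℂ] ℂ := PositiveLinearMap.mk₀ (g : A →ₗ[ℂ] ℂ)
    fun x hx => nonneg_of_norm_le_one hg h1 hx
  have hf : ∀ x, f x = g x := fun _ => rfl
  refine ⟨f.GNS, inferInstance, inferInstance, inferInstance, f.gnsNonUnitalStarAlgHom, ?_⟩
  let v : f.GNS := ((f.toPreGNS 1 : f.PreGNS) : f.GNS)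
  have hv : ‖v‖ ^ 2 = 1 := by
    have := f.preGNS_norm_sq (f.toPreGNS 1)
    rw [UniformSpace.Completion.norm_coe]
    simp only [PositiveLinearMap.ofPreGNS_toPreGNS, star_one, mul_one, hf, h1] at this
    exact_mod_cast this
  have hbv : ‖f.gnsNonUnitalStarAlgHom b v‖ ^ 2 = ‖b‖ ^ 2 := by
    have := f.preGNS_norm_sq (f.leftMulMapPreGNS b (f.toPreGNS 1))
    rw [PositiveLinearMap.gnsNonUnitalStarAlgHom_apply_coe, UniformSpace.Completion.norm_coe]
    rw [PositiveLinearMap.leftMulMapPreGNS_apply] at this ⊢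
    simp only [PositiveLinearMap.ofPreGNS_toPreGNS, mul_one, hf] at this
    rw [← han, ← hra]
    have h3 := congrArg Complex.re this
    rw [← h3, PositiveLinearMap.ofPreGNS_toPreGNS, mul_one]
    norm_cast
  have hv1 : ‖v‖ = 1 := by nlinarith [norm_nonneg v]
  have h4 := (f.gnsNonUnitalStarAlgHom b).le_opNorm v
  rw [hv1, mul_one] at h4
  exact ((sq_eq_sq₀ (norm_nonneg _) (norm_nonneg _)).1 hbv).symm.le.trans h4

/-- Every element of a C*-algebra attains its norm in some representation on a Hilbert space. -/
theorem exists_rep_norm_le (B : Type u) [NonUnitalCStarAlgebra B] (b : B) :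
    ∃ (H : Type u) (_ : NormedAddCommGroup H) (_ : InnerProductSpace ℂ H) (_ : CompleteSpace H)
      (π : B →⋆ₙₐ[ℂ] (H →L[ℂ] H)), ‖b‖ ≤ ‖π b‖ := by
  obtain ⟨H, h1, h2, h3, π, hπ⟩ := exists_rep_norm_le_of_unital (Unitization ℂ B) (b : Unitization ℂ B)
  refine ⟨H, h1, h2, h3, π.comp (Unitization.inrNonUnitalStarAlgHom ℂ B), ?_⟩
  rw [Unitization.norm_inr] at hπ
  exact hπ

/-! ### The convolution algebra of a groupoid -/

/-- Multiplication is continuous on composable pairs only, so most integrands are continuous just on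
a closed fibre. Tietze extension from the compact part of the fibre where a bump function lives,
multiplied by that bump function, replaces them by elements of `C_c`. -/
theorem exists_Cc_eqOn {Z : Type*} [TopologicalSpace Z] [T2Space Z] [LocallyCompactSpace Z]
    {C L : Set Z} (hC : IsClosed C) (hL : IsCompact L) {F : Z → ℂ} (hF : ContinuousOn F C)
    (h0 : ∀ z ∈ C, z ∉ L → F z = 0) : ∃ k : C_c(Z, ℂ), ∀ z ∈ C, k z = F z := by
  obtain ⟨ψ, hψ1, -, hψc, -⟩ := exists_continuous_one_zero_of_isCompact hL isClosed_empty
    (disjoint_empty _)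
  obtain ⟨k, hk⟩ := exists_continuous_eq_of_isCompact (hψc.isCompact.inter_right hC)
    (hF.mono inter_subset_right)
  refine ⟨⟨⟨fun z => (ψ z : ℂ) * k z,
    (Complex.continuous_ofReal.comp ψ.continuous).mul k.continuous⟩, ?_⟩, fun z hz => ?_⟩
  · refine HasCompactSupport.intro hψc.isCompact fun z hz => ?_
    change (ψ z : ℂ) * k z = 0
    rw [image_eq_zero_of_notMem_tsupport hz]
    simp
  · change (ψ z : ℂ) * k z = F z
    by_cases hzs : z ∈ tsupport ψ
    · rw [hk z ⟨hzs, hz⟩]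
      by_cases hzL : z ∈ L
      · rw [hψ1 hzL]; simp
      · rw [h0 z hz hzL, mul_zero]
    · rw [image_eq_zero_of_notMem_tsupport hzs]
      have hzL : z ∉ L := fun h => hzs (subset_tsupport _ (by simp [hψ1 h]))
      rw [h0 z hz hzL]; simp

/-- Haar measures need not be σ-finite. Fubini still holds, because the integrand agrees almost
everywhere in each variable with a compactly supported continuous function of both. -/
theorem integral_integral_swap_of_continuousOn {X Y : Type*} [TopologicalSpace X] [T2Space X]
    [LocallyCompactSpace X] [MeasurableSpace X] [OpensMeasurableSpace X] [TopologicalSpace Y]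
    [T2Space Y] [LocallyCompactSpace Y] [MeasurableSpace Y] [OpensMeasurableSpace Y]
    {μ : Measure X} {ν : Measure Y} [IsFiniteMeasureOnCompacts μ] [IsFiniteMeasureOnCompacts ν]
    {C : Set X} {D : Set Y} (hC : IsClosed C) (hD : IsClosed D) (hμ : ∀ᵐ x ∂μ, x ∈ C)
    (hν : ∀ᵐ y ∂ν, y ∈ D) {F : X → Y → ℂ} (hF : ContinuousOn (Function.uncurry F) (C ×ˢ D))
    {L : Set (X × Y)} (hL : IsCompact L) (h0 : ∀ x ∈ C, ∀ y ∈ D, (x, y) ∉ L → F x y = 0) :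
    ∫ x, (∫ y, F x y ∂ν) ∂μ = ∫ y, (∫ x, F x y ∂μ) ∂ν := by
  obtain ⟨k, hk⟩ := exists_Cc_eqOn (hC.prod hD) hL hF fun z hz hzL => h0 z.1 hz.1 z.2 hz.2 hzL
  have h := integral_integral_swap_of_hasCompactSupport (f := fun x y => k (x, y)) (μ := μ)
    (ν := ν) k.continuous k.hasCompactSupport
  have h1 : ∫ x, (∫ y, F x y ∂ν) ∂μ = ∫ x, (∫ y, k (x, y) ∂ν) ∂μ := by
    refine integral_congr_ae ?_
    filter_upwards [hμ] with x hx
    refine integral_congr_ae ?_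
    filter_upwards [hν] with y hy
    exact (hk (x, y) ⟨hx, hy⟩).symm
  have h2 : ∫ y, (∫ x, F x y ∂μ) ∂ν = ∫ y, (∫ x, k (x, y) ∂μ) ∂ν := by
    refine integral_congr_ae ?_
    filter_upwards [hν] with y hy
    refine integral_congr_ae ?_
    filter_upwards [hμ] with x hx
    exact (hk (x, y) ⟨hx, hy⟩).symm
  rw [h1, h2, h]

namespace LCGroupoid

variable (G : LCGroupoid.{u})

theorem inv_mul_cancel_left {x y : G.Arr} (h : G.src x = G.rng y) :
    G.mul (G.inv x) (G.mul x y) = y := by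
  rw [← G.mul_assoc _ _ _ (G.src_inv x) h, G.inv_mul, h, G.rng_mul_self]

theorem mul_inv_cancel_left {x y : G.Arr} (h : G.rng x = G.rng y) :
    G.mul x (G.mul (G.inv x) y) = y := by
  rw [← G.mul_assoc _ _ _ (G.rng_inv x).symm ((G.src_inv x).trans h), G.mul_inv, h,
    G.rng_mul_self]

theorem mul_inv_cancel_right {x y : G.Arr} (h : G.src x = G.rng y) :
    G.mul (G.mul x y) (G.inv y) = x := by
  rw [G.mul_assoc _ _ _ h (G.rng_inv y).symm, G.mul_inv, ← h, G.mul_src_self]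

theorem inv_mul_rev {x y : G.Arr} (h : G.src x = G.rng y) :
    G.inv (G.mul x y) = G.mul (G.inv y) (G.inv x) := by
  have h1 : G.src (G.inv (G.mul x y)) = G.rng (G.mul x y) := G.src_inv _
  have h2 : G.mul (G.mul x y) (G.mul (G.inv y) (G.inv x)) = G.rng (G.mul x y) := by
    rw [← G.mul_assoc _ _ _ (by rw [G.src_mul _ _ h, G.rng_inv])
      (by rw [G.src_inv, G.rng_inv, h]), G.mul_inv_cancel_right h, G.mul_inv, G.rng_mul _ _ h]
  have h3 : G.src (G.mul x y) = G.rng (G.mul (G.inv y) (G.inv x)) := by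
    rw [G.src_mul _ _ h, G.rng_mul _ _ (by rw [G.src_inv, G.rng_inv, h]), G.rng_inv]
  rw [← G.inv_mul_cancel_left h3, h2, ← G.src_inv, G.mul_src_self]

theorem rngU_eq {x : G.Arr} {u : G.Units} (h : G.rng x = u) : G.rngU x = u := Subtype.ext h

theorem srcU_eq {x : G.Arr} {u : G.Units} (h : G.src x = u) : G.srcU x = u := Subtype.ext h

theorem continuous_rngU : Continuous G.rngU := G.continuous_rng.subtype_mk _

end LCGroupoid

namespace HaarGroupoid

variable {G : HaarGroupoid.{u}}

theorem isClosed_fibre (a : G.Arr) : IsClosed {y : G.Arr | G.rng y = a} :=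
  isClosed_eq G.continuous_rng continuous_const

theorem continuousOn_inv_mul :
    ContinuousOn (fun p : G.Arr × G.Arr => G.mul (G.inv p.1) p.2) {p | G.rng p.1 = G.rng p.2} :=
  G.continuousOn_mul.comp ((G.continuous_inv.comp continuous_fst).prodMk continuous_snd).continuousOn
    fun p hp => (G.src_inv p.1).trans hp

/-- The set is `x K⁻¹`. For `K = supp h` it contains the support of `w ↦ h (w⁻¹ x)` on the range
fibre of `x`. -/
theorem isCompact_mul_inv {K : Set G.Arr} (hK : IsCompact K) (x : G.Arr) :
    IsCompact ((fun k => G.mul x (G.inv k)) '' (K ∩ {k | G.src k = G.src x})) := by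
  refine (hK.inter_right (isClosed_eq G.continuous_src continuous_const)).image_of_continuousOn ?_
  refine G.continuousOn_mul.comp (continuous_const.prodMk G.continuous_inv).continuousOn fun k hk => ?_
  change G.src x = G.rng (G.inv k)
  rw [G.rng_inv, hk.2]

theorem mem_mul_inv_image {K : Set G.Arr} {x w : G.Arr} (h : G.rng w = G.rng x)
    (hK : G.mul (G.inv w) x ∈ K) :
    w ∈ (fun k => G.mul x (G.inv k)) '' (K ∩ {k | G.src k = G.src x}) := by
  have h1 : G.src (G.inv w) = G.rng x := (G.src_inv w).trans h
  refine ⟨_, ⟨hK, G.src_mul _ _ h1⟩, ?_⟩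
  change G.mul x (G.inv (G.mul (G.inv w) x)) = w
  rw [G.inv_mul_rev h1, G.inv_inv, G.mul_inv_cancel_left h.symm]

theorem integral_mul_left (x : G.Arr) {F : G.Arr → ℂ} (hF : ContinuousOn F {y | G.rng y = G.rng x})
    {L : Set G.Arr} (hL : IsCompact L) (h0 : ∀ y, G.rng y = G.rng x → y ∉ L → F y = 0) :
    ∫ y, F y ∂(G.haar (G.rngU x)) = ∫ y, F (G.mul x y) ∂(G.haar (G.srcU x)) := by
  obtain ⟨k, hk⟩ := exists_Cc_eqOn (isClosed_fibre (G.rng x)) hL hF h0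
  have h1 : ∫ y, F y ∂(G.haar (G.rngU x)) = ∫ y, k y ∂(G.haar (G.rngU x)) := by
    refine integral_congr_ae ?_
    filter_upwards [ae_rng (G.rngU x)] with y hy using (hk y hy).symm
  rw [h1, G.haar_mul_left]
  refine integral_congr_ae ?_
  filter_upwards [ae_rng (G.srcU x)] with y hy
  exact hk _ (G.rng_mul _ _ hy.symm)

theorem continuousOn_conv_integrand (f g : C_c(G.Arr, ℂ)) (x : G.Arr) :
    ContinuousOn (fun y => f y * g (G.mul (G.inv y) x)) {y | G.rng y = G.rng x} :=
  f.continuous.continuousOn.mul (g.continuous.comp_continuousOn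
    (continuousOn_inv_mul.comp (continuous_id.prodMk continuous_const).continuousOn
      fun _ hy => hy))

/-- Left invariance substitutes `x⁻¹ y` for `y`. In this form the measure depends only on the range
of `x`, hence stays fixed while `x` runs through a range fibre. -/
theorem conv_apply (f g : C_c(G.Arr, ℂ)) (x : G.Arr) :
    G.conv f g x = ∫ y, f y * g (G.mul (G.inv y) x) ∂(G.haar (G.rngU x)) := by
  rw [integral_mul_left x (continuousOn_conv_integrand f g x) f.hasCompactSupport.isCompact
    fun y _ hy => by rw [image_eq_zero_of_notMem_tsupport hy, zero_mul]]
  refine integral_congr_ae ?_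
  filter_upwards [ae_rng (G.srcU x)] with y hy
  have h : G.src x = G.rng y := hy.symm
  rw [G.inv_mul_rev h, G.mul_assoc _ _ _ (by rw [G.src_inv, G.rng_inv, h]) (G.src_inv x),
    G.inv_mul, h, ← G.src_inv, G.mul_src_self]

theorem conv_apply_of_rng (f g : C_c(G.Arr, ℂ)) {x : G.Arr} {u : G.Units} (h : G.rng x = u) :
    G.conv f g x = ∫ y, f y * g (G.mul (G.inv y) x) ∂(G.haar u) := by
  rw [conv_apply, G.rngU_eq h]

theorem integrable_conv_integrand (f g : C_c(G.Arr, ℂ)) {x : G.Arr} {u : G.Units}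
    (hx : G.rng x = u) : Integrable (fun y => f y * g (G.mul (G.inv y) x)) (G.haar u) := by
  obtain ⟨k, hk⟩ := exists_Cc_eqOn (isClosed_fibre (G.rng x)) f.hasCompactSupport.isCompact
    (continuousOn_conv_integrand f g x)
    fun y _ hy => by rw [image_eq_zero_of_notMem_tsupport hy, zero_mul]
  refine (integrable_Cc k u).congr ?_
  filter_upwards [ae_rng u] with y hy using hk y (hy.trans hx.symm)

/-- Both sides are double integrals of `f z · g (z⁻¹ w) · h (w⁻¹ x)` over the range fibre of `x`:
left translation by `z` brings the right side to this form, and Fubini exchanges the variables. -/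
theorem conv_assoc (f g h : C_c(G.Arr, ℂ)) :
    G.conv (G.conv f g) h = G.conv f (G.conv g h) := by
  ext x
  have e1 : G.conv (G.conv f g) h x = ∫ w, ∫ z, f z * g (G.mul (G.inv z) w)
      * h (G.mul (G.inv w) x) ∂(G.haar (G.rngU x)) ∂(G.haar (G.rngU x)) := by
    rw [conv_apply]
    refine integral_congr_ae ?_
    filter_upwards [ae_rng (G.rngU x)] with w hw
    rw [conv_apply_of_rng f g hw, integral_mul_const]
  have e2 : G.conv f (G.conv g h) x = ∫ z, ∫ w, f z * g (G.mul (G.inv z) w)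
      * h (G.mul (G.inv w) x) ∂(G.haar (G.rngU x)) ∂(G.haar (G.rngU x)) := by
    rw [conv_apply]
    refine integral_congr_ae ?_
    filter_upwards [ae_rng (G.rngU x)] with z hz
    have hz' : G.rng z = G.rng x := hz
    have hzx : G.src (G.inv z) = G.rng x := (G.src_inv z).trans hz'
    rw [conv_apply_of_rng g h (u := G.srcU z) (by rw [G.rng_mul _ _ hzx, G.rng_inv]; rfl),
      ← integral_const_mul, ← G.rngU_eq hz]
    have hF : ContinuousOn (fun w => f z * g (G.mul (G.inv z) w) * h (G.mul (G.inv w) x))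
        {w | G.rng w = G.rng z} := by
      refine (continuousOn_const.mul (g.continuous.comp_continuousOn
        (continuousOn_inv_mul.comp (continuous_const.prodMk continuous_id).continuousOn
        fun w hw => hw.symm))).mul (h.continuous.comp_continuousOn
        (continuousOn_inv_mul.comp (continuous_id.prodMk continuous_const).continuousOn
        fun w hw => hw.trans hz'))
    rw [integral_mul_left z hF (isCompact_mul_inv h.hasCompactSupport.isCompact x) ?_]
    · refine integral_congr_ae ?_
      filter_upwards [ae_rng (G.srcU z)] with y hy
      have hy' : G.src z = G.rng y := hy.symm
      rw [G.inv_mul_cancel_left hy', G.inv_mul_rev hy', mul_assoc,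
        G.mul_assoc _ _ _ (by rw [G.src_inv, G.rng_inv, hy']) hzx]
    · intro w hw hwL
      have : h (G.mul (G.inv w) x) = 0 := by
        by_contra hne
        exact hwL (mem_mul_inv_image (hw.trans hz') (subset_tsupport _ hne))
      rw [this, mul_zero]
  rw [e1, e2]
  symm
  refine integral_integral_swap_of_continuousOn (isClosed_fibre (G.rng x))
    (isClosed_fibre (G.rng x)) (ae_rng (G.rngU x)) (ae_rng (G.rngU x)) ?_
    (L := tsupport f ×ˢ ((fun k => G.mul x (G.inv k)) '' (tsupport h ∩ {k | G.src k = G.src x})))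
    (f.hasCompactSupport.isCompact.prod (isCompact_mul_inv h.hasCompactSupport.isCompact x)) ?_
  · refine ((f.continuous.comp continuous_fst).continuousOn.mul (g.continuous.comp_continuousOn
      (continuousOn_inv_mul.mono fun p hp => hp.1.trans hp.2.symm))).mul
      (h.continuous.comp_continuousOn (continuousOn_inv_mul.comp
        (continuous_snd.prodMk continuous_const).continuousOn fun p hp => hp.2))
  · intro z _ w hw hn
    by_contra hne
    exact hn ⟨subset_tsupport _ (left_ne_zero_of_mul (left_ne_zero_of_mul hne)),
      mem_mul_inv_image hw (subset_tsupport _ (right_ne_zero_of_mul hne))⟩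

theorem adj_apply (f : C_c(G.Arr, ℂ)) (x : G.Arr) : G.adj f x = star (f (G.inv x)) := rfl

theorem adj_adj (f : C_c(G.Arr, ℂ)) : G.adj (G.adj f) = f := by
  ext x
  rw [adj_apply, adj_apply, G.inv_inv, star_star]

theorem adj_conv (f g : C_c(G.Arr, ℂ)) : G.adj (G.conv f g) = G.conv (G.adj g) (G.adj f) := by
  ext x
  rw [adj_apply, conv_apply (G.adj g)]
  change star (G.convFun f g (G.inv x)) = _
  rw [convFun, G.srcU_eq (u := G.rngU x) (G.src_inv x)]
  change starRingEnd ℂ _ = _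
  rw [← integral_conj]
  refine integral_congr_ae ?_
  filter_upwards [ae_rng (G.rngU x)] with y hy
  have hy' : G.src (G.inv y) = G.rng x := (G.src_inv y).trans hy
  rw [adj_apply, adj_apply, G.inv_mul_rev hy', G.inv_inv, map_mul, mul_comm]
  rfl

/-- Fubini, followed by left invariance under `z⁻¹`. Applied to absolute values, it makes the
`I`-norm submultiplicative. -/
theorem integral_conv (f g : C_c(G.Arr, ℂ)) (u : G.Units) :
    ∫ x, G.conv f g x ∂(G.haar u) = ∫ z, f z * ∫ x, g x ∂(G.haar (G.srcU z)) ∂(G.haar u) := by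
  have e1 : ∫ x, G.conv f g x ∂(G.haar u)
      = ∫ x, ∫ z, f z * g (G.mul (G.inv z) x) ∂(G.haar u) ∂(G.haar u) := by
    refine integral_congr_ae ?_
    filter_upwards [ae_rng u] with x hx
    exact conv_apply_of_rng f g hx
  have e2 : ∫ z, f z * ∫ x, g x ∂(G.haar (G.srcU z)) ∂(G.haar u)
      = ∫ z, ∫ x, f z * g (G.mul (G.inv z) x) ∂(G.haar u) ∂(G.haar u) := by
    refine integral_congr_ae ?_
    filter_upwards [ae_rng u] with z hz
    rw [← integral_const_mul]
    have := G.haar_mul_left g (G.inv z)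
    rw [G.rngU_eq (u := G.srcU z) (G.rng_inv z), G.srcU_eq (u := u) ((G.src_inv z).trans hz)] at this
    rw [integral_const_mul, integral_const_mul, this]
  rw [e1, e2]
  symm
  -- The support of `(z, x) ↦ f z · g (z⁻¹ x)` is covered by the image of the composable pairs in
  -- `supp f × supp g` under `(z, y) ↦ (z, z y)`.
  have hL : IsCompact ((fun p : G.Arr × G.Arr => (p.1, G.mul p.1 p.2)) ''
      ((tsupport f ×ˢ tsupport g) ∩ {p | G.src p.1 = G.rng p.2})) :=
    ((f.hasCompactSupport.isCompact.prod g.hasCompactSupport.isCompact).inter_right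
      (isClosed_eq (G.continuous_src.comp continuous_fst)
        (G.continuous_rng.comp continuous_snd))).image_of_continuousOn
      (continuous_fst.continuousOn.prodMk (G.continuousOn_mul.mono inter_subset_right))
  refine integral_integral_swap_of_continuousOn (isClosed_fibre (u : G.Arr))
    (isClosed_fibre (u : G.Arr)) (ae_rng u) (ae_rng u) ?_ hL ?_
  · exact (f.continuous.comp continuous_fst).continuousOn.mul (g.continuous.comp_continuousOn
      (continuousOn_inv_mul.mono fun p hp => hp.1.trans hp.2.symm))
  · intro z hz x hx hn
    by_contra hne
    have hzx : G.src (G.inv z) = G.rng x := (G.src_inv z).trans (hz.trans hx.symm)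
    refine hn ⟨(z, G.mul (G.inv z) x), ⟨⟨subset_tsupport _ (left_ne_zero_of_mul hne),
      subset_tsupport _ (right_ne_zero_of_mul hne)⟩, ?_⟩, ?_⟩
    · change G.src z = G.rng (G.mul (G.inv z) x)
      rw [G.rng_mul _ _ hzx, G.rng_inv]
    · change (z, G.mul z (G.mul (G.inv z) x)) = (z, x)
      rw [G.mul_inv_cancel_left (hz.trans hx.symm)]

end HaarGroupoid

/-! ### The `I`-norm -/

namespace HaarGroupoid

variable {G : HaarGroupoid.{u}}

/-- The convolution product as a bilinear map. -/
noncomputable def convₗ (G : HaarGroupoid.{u}) :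
    C_c(G.Arr, ℂ) →ₗ[ℂ] C_c(G.Arr, ℂ) →ₗ[ℂ] C_c(G.Arr, ℂ) :=
  LinearMap.mk₂ ℂ G.conv
    (fun f f' g => by
      ext x
      change G.conv (f + f') g x = G.conv f g x + G.conv f' g x
      rw [conv_apply, conv_apply, conv_apply, ← integral_add (integrable_conv_integrand f g rfl)
        (integrable_conv_integrand f' g rfl)]
      exact integral_congr_ae (.of_forall fun y => add_mul _ _ _))
    (fun c f g => by
      ext x
      change G.conv (c • f) g x = c * G.conv f g x
      rw [conv_apply, conv_apply, ← integral_const_mul]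
      exact integral_congr_ae (.of_forall fun y => mul_assoc _ _ _))
    (fun f g g' => by
      ext x
      change G.conv f (g + g') x = G.conv f g x + G.conv f g' x
      rw [conv_apply, conv_apply, conv_apply, ← integral_add (integrable_conv_integrand f g rfl)
        (integrable_conv_integrand f g' rfl)]
      exact integral_congr_ae (.of_forall fun y => mul_add _ _ _))
    (fun c f g => by
      ext x
      change G.conv f (c • g) x = c * G.conv f g x
      rw [conv_apply, conv_apply, ← integral_const_mul]
      exact integral_congr_ae (.of_forall fun y => mul_left_comm _ _ _))

theorem convₗ_apply (f g : C_c(G.Arr, ℂ)) : G.convₗ f g = G.conv f g := rfl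

theorem adj_add (f g : C_c(G.Arr, ℂ)) : G.adj (f + g) = G.adj f + G.adj g := by
  ext x
  exact star_add _ _

theorem adj_sub (f g : C_c(G.Arr, ℂ)) : G.adj (f - g) = G.adj f - G.adj g := by
  ext x
  exact star_sub _ _

theorem adj_smul (c : ℂ) (f : C_c(G.Arr, ℂ)) : G.adj (c • f) = star c • G.adj f := by
  ext x
  change star (c * f (G.inv x)) = star c * star (f (G.inv x))
  rw [star_mul']

/-- The integral of `|f|` depends continuously on the unit and vanishes off the compact image of
`supp f` under the range map. -/
theorem exists_integral_norm_le (f : C_c(G.Arr, ℂ)) :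
    ∃ M : ℝ, ∀ u, ∫ x, ‖f x‖ ∂(G.haar u) ≤ M := by
  let a : C_c(G.Arr, ℂ) := ⟨⟨fun x => (‖f x‖ : ℂ), Complex.continuous_ofReal.comp
    f.continuous.norm⟩, f.hasCompactSupport.comp_left (g := fun t : ℂ => (‖t‖ : ℂ)) (by simp)⟩
  have ha : ∀ u, ‖∫ x, a x ∂(G.haar u)‖ = ∫ x, ‖f x‖ ∂(G.haar u) := by
    intro u
    have e : ∫ x, a x ∂(G.haar u) = ((∫ x, ‖f x‖ ∂(G.haar u) : ℝ) : ℂ) := integral_ofReal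
    rw [e, Complex.norm_real, Real.norm_of_nonneg (integral_nonneg fun y => norm_nonneg _)]
  obtain ⟨M, hM⟩ := (f.hasCompactSupport.isCompact.image G.continuous_rngU).exists_bound_of_continuousOn
    (G.continuous_haar a).continuousOn
  refine ⟨max M 0, fun u => ?_⟩
  by_cases hu : u ∈ G.rngU '' tsupport f
  · rw [← ha]; exact (hM u hu).trans (le_max_left _ _)
  · refine le_trans (le_of_eq ?_) (le_max_right _ _)
    refine integral_eq_zero_of_ae ?_
    filter_upwards [ae_rng u] with x hx
    rw [image_eq_zero_of_notMem_tsupport fun h => hu ⟨x, h, G.rngU_eq hx⟩]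
    simp

theorem integrable_norm (f : C_c(G.Arr, ℂ)) (u : G.Units) :
    Integrable (fun x => ‖f x‖) (G.haar u) := (integrable_Cc f u).norm

theorem lintegral_enorm (f : C_c(G.Arr, ℂ)) (u : G.Units) :
    ∫⁻ x, ‖f x‖ₑ ∂(G.haar u) = ENNReal.ofReal (∫ x, ‖f x‖ ∂(G.haar u)) :=
  (ofReal_integral_norm_eq_lintegral_enorm (integrable_Cc f u)).symm

theorem normI_eq (f : C_c(G.Arr, ℂ)) :
    G.normI f = max (⨆ u : G.Units, ENNReal.ofReal (∫ x, ‖f x‖ ∂(G.haar u)))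
      (⨆ u : G.Units, ENNReal.ofReal (∫ x, ‖G.adj f x‖ ∂(G.haar u))) := by
  simp_rw [← lintegral_enorm]
  have h : ∀ x, ‖G.adj f x‖ₑ = ‖f (G.inv x)‖ₑ := fun x => by
    rw [adj_apply, ← enorm_norm, norm_star, enorm_norm]
  simp_rw [h]
  rfl

theorem normI_le {f : C_c(G.Arr, ℂ)} {c : ℝ} (h : ∀ u, ∫ x, ‖f x‖ ∂(G.haar u) ≤ c)
    (h' : ∀ u, ∫ x, ‖G.adj f x‖ ∂(G.haar u) ≤ c) : G.normI f ≤ ENNReal.ofReal c := by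
  rw [normI_eq]
  exact max_le (iSup_le fun u => ENNReal.ofReal_le_ofReal (h u))
    (iSup_le fun u => ENNReal.ofReal_le_ofReal (h' u))

theorem normI_ne_top (f : C_c(G.Arr, ℂ)) : G.normI f ≠ ∞ := by
  obtain ⟨M, hM⟩ := exists_integral_norm_le f
  obtain ⟨M', hM'⟩ := exists_integral_norm_le (G.adj f)
  exact ((normI_le (c := max M M') (fun u => (hM u).trans (le_max_left _ _))
    fun u => (hM' u).trans (le_max_right _ _)).trans_lt ENNReal.ofReal_lt_top).ne

/-- The `I`-norm as a real number. -/
noncomputable def rnormI (G : HaarGroupoid.{u}) (f : C_c(G.Arr, ℂ)) : ℝ := (G.normI f).toReal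

theorem rnormI_nonneg (f : C_c(G.Arr, ℂ)) : 0 ≤ G.rnormI f := ENNReal.toReal_nonneg

theorem ofReal_rnormI (f : C_c(G.Arr, ℂ)) : ENNReal.ofReal (G.rnormI f) = G.normI f :=
  ENNReal.ofReal_toReal (normI_ne_top f)

theorem integral_norm_le_rnormI (f : C_c(G.Arr, ℂ)) (u : G.Units) :
    ∫ x, ‖f x‖ ∂(G.haar u) ≤ G.rnormI f := by
  refine (ENNReal.ofReal_le_iff_le_toReal (normI_ne_top f)).1 ?_
  rw [normI_eq]
  exact le_max_of_le_left (le_iSup (fun u => ENNReal.ofReal (∫ x, ‖f x‖ ∂(G.haar u))) u)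

theorem integral_norm_adj_le_rnormI (f : C_c(G.Arr, ℂ)) (u : G.Units) :
    ∫ x, ‖G.adj f x‖ ∂(G.haar u) ≤ G.rnormI f := by
  refine (ENNReal.ofReal_le_iff_le_toReal (normI_ne_top f)).1 ?_
  rw [normI_eq]
  exact le_max_of_le_right (le_iSup (fun u => ENNReal.ofReal (∫ x, ‖G.adj f x‖ ∂(G.haar u))) u)

theorem rnormI_le {f : C_c(G.Arr, ℂ)} {c : ℝ} (hc : 0 ≤ c) (h : ∀ u, ∫ x, ‖f x‖ ∂(G.haar u) ≤ c)
    (h' : ∀ u, ∫ x, ‖G.adj f x‖ ∂(G.haar u) ≤ c) : G.rnormI f ≤ c :=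
  ENNReal.toReal_le_of_le_ofReal hc (normI_le h h')

theorem rnormI_adj_le (f : C_c(G.Arr, ℂ)) : G.rnormI (G.adj f) ≤ G.rnormI f :=
  rnormI_le (rnormI_nonneg f) (integral_norm_adj_le_rnormI f) (by
    rw [adj_adj]; exact integral_norm_le_rnormI f)

theorem rnormI_add_le (f g : C_c(G.Arr, ℂ)) : G.rnormI (f + g) ≤ G.rnormI f + G.rnormI g := by
  have key : ∀ (f g : C_c(G.Arr, ℂ)) (u : G.Units), ∫ x, ‖(f + g) x‖ ∂(G.haar u)
      ≤ ∫ x, ‖f x‖ ∂(G.haar u) + ∫ x, ‖g x‖ ∂(G.haar u) := fun f g u => by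
    rw [← integral_add (integrable_norm f u) (integrable_norm g u)]
    exact integral_mono (integrable_norm _ u) ((integrable_norm f u).add (integrable_norm g u))
      fun x => norm_add_le _ _
  refine rnormI_le (add_nonneg (rnormI_nonneg f) (rnormI_nonneg g)) (fun u => ?_) fun u => ?_
  · exact (key f g u).trans
      (add_le_add (integral_norm_le_rnormI f u) (integral_norm_le_rnormI g u))
  · rw [adj_add]
    exact (key _ _ u).trans
      (add_le_add (integral_norm_adj_le_rnormI f u) (integral_norm_adj_le_rnormI g u))

theorem rnormI_smul_le (c : ℂ) (f : C_c(G.Arr, ℂ)) : G.rnormI (c • f) ≤ ‖c‖ * G.rnormI f := by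
  have key : ∀ (c : ℂ) (f : C_c(G.Arr, ℂ)) (u : G.Units), ∫ x, ‖(c • f) x‖ ∂(G.haar u)
      = ‖c‖ * ∫ x, ‖f x‖ ∂(G.haar u) := fun c f u => by
    rw [← integral_const_mul]
    exact integral_congr_ae (.of_forall fun x => norm_mul _ _)
  refine rnormI_le (mul_nonneg (norm_nonneg _) (rnormI_nonneg f)) (fun u => ?_) fun u => ?_
  · rw [key]
    exact mul_le_mul_of_nonneg_left (integral_norm_le_rnormI f u) (norm_nonneg _)
  · rw [adj_smul, key, norm_star]
    exact mul_le_mul_of_nonneg_left (integral_norm_adj_le_rnormI f u) (norm_nonneg _)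

/-- Pointwise `|f * g| ≤ |f| * |g|`, and `integral_conv` computes the integral of the right side. -/
theorem integral_norm_conv_le (f g : C_c(G.Arr, ℂ)) {c : ℝ}
    (hg : ∀ u, ∫ x, ‖g x‖ ∂(G.haar u) ≤ c) (u : G.Units) :
    ∫ x, ‖G.conv f g x‖ ∂(G.haar u) ≤ (∫ x, ‖f x‖ ∂(G.haar u)) * c := by
  let a : C_c(G.Arr, ℂ) → C_c(G.Arr, ℂ) := fun f => ⟨⟨fun x => (‖f x‖ : ℂ),
    Complex.continuous_ofReal.comp f.continuous.norm⟩,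
    f.hasCompactSupport.comp_left (g := fun t : ℂ => (‖t‖ : ℂ)) (by simp)⟩
  have ha : ∀ f x, a f x = (‖f x‖ : ℂ) := fun _ _ => rfl
  have hi : ∀ f u, ∫ x, a f x ∂(G.haar u) = ((∫ x, ‖f x‖ ∂(G.haar u) : ℝ) : ℂ) :=
    fun f u => integral_ofReal
  have h1 : ∀ x, G.conv (a f) (a g) x
      = ((∫ y, ‖f y * g (G.mul (G.inv y) x)‖ ∂(G.haar (G.rngU x)) : ℝ) : ℂ) := by
    intro x
    rw [conv_apply, ← integral_complex_ofReal]
    refine integral_congr_ae (.of_forall fun y => ?_)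
    simp only [ha, norm_mul, Complex.ofReal_mul]
  have h2 : ∀ x, ‖G.conv f g x‖ ≤ (G.conv (a f) (a g) x).re := by
    intro x
    rw [h1, Complex.ofReal_re, conv_apply]
    exact norm_integral_le_integral_norm _
  calc ∫ x, ‖G.conv f g x‖ ∂(G.haar u) ≤ ∫ x, (G.conv (a f) (a g) x).re ∂(G.haar u) :=
        integral_mono (integrable_norm _ u) (integrable_Cc _ u).re h2
    _ = (∫ x, G.conv (a f) (a g) x ∂(G.haar u)).re := integral_re (integrable_Cc _ u)
    _ = ∫ z, ‖f z‖ * ∫ x, ‖g x‖ ∂(G.haar (G.srcU z)) ∂(G.haar u) := by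
        rw [integral_conv]
        simp_rw [hi, ha, ← Complex.ofReal_mul]
        rw [integral_complex_ofReal, Complex.ofReal_re]
    _ ≤ ∫ z, ‖f z‖ * c ∂(G.haar u) := by
        refine integral_mono_of_nonneg (.of_forall fun z => mul_nonneg (norm_nonneg _)
          (integral_nonneg fun x => norm_nonneg _)) ((integrable_norm f u).mul_const c)
          (.of_forall fun z => mul_le_mul_of_nonneg_left (hg _) (norm_nonneg _))
    _ = _ := integral_mul_const _ _

theorem rnormI_conv_le (f g : C_c(G.Arr, ℂ)) : G.rnormI (G.conv f g) ≤ G.rnormI f * G.rnormI g := by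
  refine rnormI_le (mul_nonneg (rnormI_nonneg f) (rnormI_nonneg g)) (fun u => ?_) fun u => ?_
  · exact (integral_norm_conv_le f g (integral_norm_le_rnormI g) u).trans
      (mul_le_mul_of_nonneg_right (integral_norm_le_rnormI f u) (rnormI_nonneg g))
  · rw [adj_conv, mul_comm]
    exact (integral_norm_conv_le _ _ (integral_norm_adj_le_rnormI f) u).trans
      (mul_le_mul_of_nonneg_right (integral_norm_adj_le_rnormI g u) (rnormI_nonneg f))

/-- This mixed bound supplies the crude constants that `norm_apply_le_of_norm_inner_le` then
removes. -/
theorem norm_conv_apply_le (f g : C_c(G.Arr, ℂ)) {c : ℝ} (hg : ∀ x, ‖g x‖ ≤ c)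
    (x : G.Arr) : ‖G.conv f g x‖ ≤ G.rnormI f * c := by
  have hc : 0 ≤ c := (norm_nonneg _).trans (hg x)
  rw [conv_apply]
  refine (norm_integral_le_of_norm_le ((integrable_norm f _).mul_const c)
    (.of_forall fun y => ?_)).trans ?_
  · rw [norm_mul]
    exact mul_le_mul_of_nonneg_left (hg _) (norm_nonneg _)
  · rw [integral_mul_const]
    exact mul_le_mul_of_nonneg_right (integral_norm_le_rnormI f _) hc

theorem exists_norm_le (f : C_c(G.Arr, ℂ)) : ∃ c : ℝ, ∀ x, ‖f x‖ ≤ c :=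
  f.continuous.bounded_above_of_compact_support f.hasCompactSupport

theorem rep_inner_adj (π : G.Rep) (f : C_c(G.Arr, ℂ)) (v w : π.H) :
    inner ℂ (π.π f v) w = inner ℂ v (π.π (G.adj f) w) := by
  rw [π.map_adj, ContinuousLinearMap.star_eq_adjoint, ContinuousLinearMap.adjoint_inner_right]

/-- A `*`-representation that is continuous for the `I`-norm is contractive. -/
theorem Rep.norm_le (π : G.Rep) (f : C_c(G.Arr, ℂ)) : ‖π.π f‖ ≤ G.rnormI f := by
  obtain ⟨C, hC⟩ := π.bounded
  have hC' : ∀ f, ‖π.π f‖ ≤ C * G.rnormI f := by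
    intro f
    have := ENNReal.toReal_mono (ENNReal.mul_ne_top ENNReal.coe_ne_top (normI_ne_top f)) (hC f)
    rwa [toReal_enorm, ENNReal.toReal_mul, ENNReal.coe_toReal] at this
  refine ContinuousLinearMap.opNorm_le_bound _ (rnormI_nonneg f) fun v => ?_
  -- The unknown continuity constant enters only through the matrix coefficients, where the power
  -- trick eliminates it.
  refine norm_apply_le_of_norm_inner_le (m := G.conv) (s := G.adj) (L := fun f v => π.π f v)
    (j := fun v => v) rnormI_nonneg rnormI_conv_le rnormI_adj_le
    (fun a b v => by rw [π.map_conv]; rfl) (fun a v w => rep_inner_adj π a v w)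
    (C := ‖v‖ * ‖v‖ * C) (fun a => ?_) f
  refine (norm_inner_le_norm _ _).trans ?_
  calc ‖v‖ * ‖π.π a v‖ ≤ ‖v‖ * (C * G.rnormI a * ‖v‖) := by
        gcongr
        exact (π.π a).le_of_opNorm_le (hC' a) v
    _ = _ := by ring

theorem normMax_le_normI (f : C_c(G.Arr, ℂ)) : G.normMax f ≤ G.normI f := by
  refine iSup_le fun π => ?_
  rw [← ofReal_rnormI, ← ofReal_norm]
  exact ENNReal.ofReal_le_ofReal (π.norm_le f)

end HaarGroupoid

/-! ### The regular representations and the minimal norm -/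

/-- Functions in `L^p` can be approximated by continuous functions of compact support, on a locally
compact Hausdorff space that need not be normal. -/
theorem exists_Cc_eLpNorm_sub_le {Z : Type*} [TopologicalSpace Z] [T2Space Z]
    [LocallyCompactSpace Z] [MeasurableSpace Z] [BorelSpace Z] {μ : Measure Z} [μ.Regular]
    {p : ℝ≥0∞} (hp : p ≠ ∞) {f : Z → ℂ} (hf : MemLp f p μ) {ε : ℝ≥0∞} (hε : ε ≠ 0) :
    ∃ g : C_c(Z, ℂ), eLpNorm (f - ⇑g) p μ ≤ ε := by
  suffices H : ∃ g : Z → ℂ, eLpNorm (f - g) p μ ≤ ε ∧ Continuous g ∧ HasCompactSupport g by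
    obtain ⟨g, hg, g_cont, g_support⟩ := H
    exact ⟨⟨⟨g, g_cont⟩, g_support⟩, hg⟩
  refine hf.induction_dense hp (fun g => Continuous g ∧ HasCompactSupport g) ?_ ?_ ?_ hε
  rotate_left
  · rintro f g ⟨f_cont, hf⟩ ⟨g_cont, hg⟩
    exact ⟨f_cont.add g_cont, hf.add hg⟩
  · rintro f ⟨f_cont, f_supp⟩
    exact (f_cont.memLp_of_hasCompactSupport f_supp (p := p)).aestronglyMeasurable
  intro c t ht htμ ε hε
  obtain ⟨δ, δpos, hδ⟩ := exists_Lp_half ℂ μ p hε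
  obtain ⟨η, ηpos, hη⟩ := exists_eLpNorm_indicator_le (μ := μ) hp c δpos.ne'
  have hη' : (0 : ℝ≥0∞) < η := ENNReal.coe_pos.2 ηpos
  -- The set `t` is approximated from inside by a compact `s`, and `s` from outside by an open `V`.
  -- Separating a compact set from a closed one needs only local compactness.
  obtain ⟨s, st, s_compact, s_closed, μs⟩ := ht.exists_isCompact_isClosed_sdiff_lt htμ.ne hη'.ne'
  have hsμ : μ s < ∞ := (measure_mono st).trans_lt htμ
  have I1 : eLpNorm ((s.indicator fun _ => c) - t.indicator fun _ => c) p μ ≤ δ := by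
    rw [← eLpNorm_neg, neg_sub, ← indicator_sdiff st]
    exact hη _ μs.le
  obtain ⟨V, sV, V_open, -, hV⟩ := s_closed.measurableSet.exists_isOpen_sdiff_lt hsμ.ne hη'.ne'
  obtain ⟨g, hg1, hg0, hgc, hg⟩ := exists_continuous_one_zero_of_isCompact s_compact
    V_open.isClosed_compl (disjoint_compl_right_iff_subset.2 sV)
  have g_norm : ∀ x, ‖(g x : ℂ)‖ = g x := fun x => by
    rw [Complex.norm_real, Real.norm_of_nonneg (hg x).1]
  have hcont : Continuous fun x => (g x : ℂ) * c :=
    (Complex.continuous_ofReal.comp g.continuous).mul continuous_const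
  have hsupp : HasCompactSupport fun x => (g x : ℂ) * c :=
    hgc.comp_left (g := fun r : ℝ => (r : ℂ) * c) (by simp)
  have I2 : eLpNorm ((fun x => (g x : ℂ) * c) - s.indicator fun _ => c) p μ ≤ δ := by
    refine (eLpNorm_mono (g := (V \ s).indicator fun _ => c) fun x => ?_).trans (hη _ hV.le)
    by_cases hs : x ∈ s
    · simp [hs, hg1 hs]
    · by_cases hv : x ∈ V
      · simp only [Pi.sub_apply, indicator_of_notMem hs, sub_zero,
          indicator_of_mem (show x ∈ V \ s from ⟨hv, hs⟩), norm_mul, g_norm]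
        exact mul_le_of_le_one_left (norm_nonneg _) (hg x).2
      · simp [hs, hg0 hv, hv]
  refine ⟨_, ?_, hcont, hsupp⟩
  have hm := (hcont.memLp_of_hasCompactSupport hsupp (p := p) (μ := μ)).aestronglyMeasurable
  have hms : AEStronglyMeasurable (s.indicator fun _ => c) μ :=
    aestronglyMeasurable_const.indicator s_closed.measurableSet
  have hmt : AEStronglyMeasurable (t.indicator fun _ => c) μ :=
    aestronglyMeasurable_const.indicator ht
  have h := (hδ _ _ (hm.sub hms) (hms.sub hmt) I2 I1).le
  simpa only [sub_add_sub_cancel] using h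

namespace HaarGroupoid

variable {G : HaarGroupoid.{u}}

/-- Inversion as a homeomorphism. -/
def invHomeo (G : HaarGroupoid.{u}) : G.Arr ≃ₜ G.Arr where
  toFun := G.inv
  invFun := G.inv
  left_inv := G.inv_inv
  right_inv := G.inv_inv
  continuous_toFun := G.continuous_inv
  continuous_invFun := G.continuous_inv

instance (u : G.Units) : (G.haarInv u).Regular :=
  Measure.Regular.map G.invHomeo (μ := G.haar u)

theorem integral_haarInv {E : Type*} [NormedAddCommGroup E] [NormedSpace ℝ E] (u : G.Units)
    (f : G.Arr → E) : ∫ x, f x ∂(G.haarInv u) = ∫ x, f (G.inv x) ∂(G.haar u) :=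
  integral_map_equiv G.invHomeo.toMeasurableEquiv f

theorem ae_src (u : G.Units) : ∀ᵐ y ∂(G.haarInv u), G.src y = u := by
  refine (ae_map_iff G.continuous_inv.measurable.aemeasurable
    (isClosed_eq G.continuous_src continuous_const).measurableSet).2 ?_
  filter_upwards [ae_rng u] with y hy
  rw [G.src_inv, hy]

theorem memLp_Cc (f : C_c(G.Arr, ℂ)) (u : G.Units) : MemLp f 2 (G.haarInv u) :=
  f.continuous.memLp_of_hasCompactSupport f.hasCompactSupport

/-- The map `C_c(G) → L²` for the source fibre of a unit. -/
noncomputable def toL2 (G : HaarGroupoid.{u}) (u : G.Units) :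
    C_c(G.Arr, ℂ) →ₗ[ℂ] Lp ℂ 2 (G.haarInv u) where
  toFun f := (memLp_Cc f u).toLp f
  map_add' f g := MemLp.toLp_add (memLp_Cc f u) (memLp_Cc g u)
  map_smul' c f := MemLp.toLp_const_smul c (memLp_Cc f u)

theorem denseRange_toL2 (u : G.Units) : DenseRange (G.toL2 u) := by
  intro v
  refine EMetric.mem_closure_iff.2 fun ε hε => ?_
  obtain ⟨δ, hδ, hδε⟩ := exists_between hε
  obtain ⟨g, hg⟩ := exists_Cc_eLpNorm_sub_le ENNReal.ofNat_ne_top (Lp.memLp v) hδ.ne'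
  refine ⟨_, ⟨g, rfl⟩, lt_of_le_of_lt ?_ hδε⟩
  rw [Lp.edist_def]
  refine le_trans (le_of_eq (eLpNorm_congr_ae ?_)) hg
  filter_upwards [(memLp_Cc g u).coeFn_toLp] with x hx
  change (v : G.Arr → ℂ) x - (G.toL2 u g : G.Arr → ℂ) x = _
  exact congrArg _ hx

theorem enorm_toL2 (u : G.Units) (f : C_c(G.Arr, ℂ)) :
    ‖G.toL2 u f‖ₑ = eLpNorm f 2 (G.haarInv u) := Lp.enorm_toLp (memLp_Cc f u)

/-- The `L²` space of the source fibre is the GNS space of evaluation at `u`. Adjoints and norms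
thereby become identities in the convolution algebra. -/
theorem inner_toL2 (u : G.Units) (f g : C_c(G.Arr, ℂ)) :
    inner ℂ (G.toL2 u f) (G.toL2 u g) = G.conv (G.adj f) g u := by
  have h1 : inner ℂ (G.toL2 u f) (G.toL2 u g) = ∫ x, g x * star (f x) ∂(G.haarInv u) := by
    rw [L2.inner_def]
    refine integral_congr_ae ?_
    filter_upwards [(memLp_Cc f u).coeFn_toLp, (memLp_Cc g u).coeFn_toLp] with x hf hg
    change inner ℂ ((memLp_Cc f u).toLp f x) ((memLp_Cc g u).toLp g x) = _
    rw [hf, hg]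
    rfl
  rw [h1, integral_haarInv]
  change _ = G.convFun (G.adj f) g u
  rw [convFun, G.srcU_eq (G.src_eq_of_unit u.2)]
  refine integral_congr_ae ?_
  filter_upwards [ae_rng u] with y hy
  rw [adj_apply, ← hy, G.rng_mul_self, mul_comm]

theorem inner_toL2_conv (u : G.Units) (f ξ η : C_c(G.Arr, ℂ)) :
    inner ℂ (G.toL2 u (G.conv f ξ)) (G.toL2 u η)
      = inner ℂ (G.toL2 u ξ) (G.toL2 u (G.conv (G.adj f) η)) := by
  rw [inner_toL2, inner_toL2, adj_conv, conv_assoc]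

/-- The matrix coefficient of `a` at `ξ` is the value at `u` of `ξ* * (a * ξ)`, which is at most the
product of the `I`-norms of `ξ*` and `a` and the uniform norm of `ξ`. The power trick removes the
dependence on `ξ`. -/
theorem norm_toL2_conv_le (u : G.Units) (f ξ : C_c(G.Arr, ℂ)) :
    ‖G.toL2 u (G.conv f ξ)‖ ≤ G.rnormI f * ‖G.toL2 u ξ‖ := by
  obtain ⟨c, hc⟩ := exists_norm_le ξ
  refine norm_apply_le_of_norm_inner_le (m := G.conv) (s := G.adj) (L := G.conv) (j := G.toL2 u)
    rnormI_nonneg rnormI_conv_le rnormI_adj_le conv_assoc (inner_toL2_conv u)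
    (C := G.rnormI (G.adj ξ) * c) (fun a => ?_) f
  rw [inner_toL2]
  refine (norm_conv_apply_le _ _ (norm_conv_apply_le a ξ hc) _).trans (le_of_eq ?_)
  ring

/-- The operator of left convolution on `L²`. -/
noncomputable def indCLM (G : HaarGroupoid.{u}) (u : G.Units) (f : C_c(G.Arr, ℂ)) :
    Lp ℂ 2 (G.haarInv u) →L[ℂ] Lp ℂ 2 (G.haarInv u) :=
  (G.toL2 u ∘ₗ G.convₗ f).extendOfNorm (G.toL2 u)

theorem indCLM_toL2 (u : G.Units) (f ξ : C_c(G.Arr, ℂ)) :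
    G.indCLM u f (G.toL2 u ξ) = G.toL2 u (G.conv f ξ) :=
  LinearMap.extendOfNorm_eq (denseRange_toL2 u) ⟨G.rnormI f, norm_toL2_conv_le u f⟩ ξ

theorem clm_ext_toL2 {u : G.Units} {S T : Lp ℂ 2 (G.haarInv u) →L[ℂ] Lp ℂ 2 (G.haarInv u)}
    (h : ∀ ξ, S (G.toL2 u ξ) = T (G.toL2 u ξ)) : S = T :=
  DFunLike.coe_injective ((denseRange_toL2 u).equalizer S.continuous T.continuous (funext h))

theorem norm_indCLM_le (u : G.Units) (f : C_c(G.Arr, ℂ)) : ‖G.indCLM u f‖ ≤ G.rnormI f :=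
  LinearMap.opNorm_extendOfNorm_le (denseRange_toL2 u) (rnormI_nonneg f) (norm_toL2_conv_le u f)

/-- The representation `Ind(δ_u)` on `L²` of the source fibre of the unit `u`. -/
noncomputable def ind (G : HaarGroupoid.{u}) (u : G.Units) : G.Rep where
  H := Lp ℂ 2 (G.haarInv u)
  π :=
    { toFun := G.indCLM u
      map_add' := fun f g => clm_ext_toL2 fun ξ => by
        rw [add_apply, indCLM_toL2, indCLM_toL2, indCLM_toL2, ← map_add, ← convₗ_apply,
          map_add, LinearMap.add_apply]
        rfl
      map_smul' := fun c f => clm_ext_toL2 fun ξ => by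
        rw [smul_apply, indCLM_toL2, indCLM_toL2, ← convₗ_apply, map_smul,
          LinearMap.smul_apply, map_smul]
        rfl }
  map_conv f g := clm_ext_toL2 fun ξ => by
    change G.indCLM u (G.conv f g) (G.toL2 u ξ) = G.indCLM u f (G.indCLM u g (G.toL2 u ξ))
    rw [indCLM_toL2, indCLM_toL2, indCLM_toL2, conv_assoc]
  map_adj f := by
    change G.indCLM u (G.adj f) = star (G.indCLM u f)
    rw [ContinuousLinearMap.star_eq_adjoint, ContinuousLinearMap.eq_adjoint_iff]
    intro x y
    induction x, y using (denseRange_toL2 u).induction_on₂ with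
    | hp => exact isClosed_eq (by fun_prop) (by fun_prop)
    | h ξ η => rw [indCLM_toL2, indCLM_toL2, inner_toL2_conv, adj_adj]
  bounded := ⟨1, fun f => by
    rw [ENNReal.coe_one, one_mul, ← ofReal_rnormI, ← ofReal_norm]
    exact ENNReal.ofReal_le_ofReal (norm_indCLM_le u f)⟩

theorem conv_eq_indOp {u : G.Units} (f ξ : C_c(G.Arr, ℂ)) {x : G.Arr} (hx : G.src x = u) :
    G.indOp u f ξ x = G.conv f ξ x := by
  rw [indOp, integral_haarInv]
  change _ = G.convFun f ξ x
  rw [convFun, G.srcU_eq hx]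
  simp_rw [G.inv_inv]

/-- On the fibre, `y ↦ f (x y⁻¹)` is continuous with compact support, so it is square integrable.
Hence the value at `x` is continuous in `ξ` for the `L²` norm. -/
theorem exists_indOp_eq_inner {u : G.Units} (f : C_c(G.Arr, ℂ)) {x : G.Arr} (hx : G.src x = u) :
    ∃ k : Lp ℂ 2 (G.haarInv u), ∀ (ξ : G.Arr → ℂ) (hξ : MemLp ξ 2 (G.haarInv u)),
      G.indOp u f ξ x = inner ℂ k (hξ.toLp ξ) := by
  have hC : IsClosed {y : G.Arr | G.src y = u} := isClosed_eq G.continuous_src continuous_const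
  have hL : IsCompact ((fun k => G.mul (G.inv k) x) '' (tsupport f ∩ {k | G.rng k = G.rng x})) :=
    (f.hasCompactSupport.isCompact.inter_right (isClosed_fibre _)).image_of_continuousOn
      (continuousOn_inv_mul.comp (continuous_id.prodMk continuous_const).continuousOn
        fun k hk => hk.2)
  have hF : ContinuousOn (fun y => star (f (G.mul x (G.inv y)))) {y : G.Arr | G.src y = u} :=
    continuous_star.comp_continuousOn (f.continuous.comp_continuousOn (G.continuousOn_mul.comp
      (continuous_const.prodMk G.continuous_inv).continuousOn fun y hy => by
        change G.src x = G.rng (G.inv y)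
        rw [G.rng_inv, hx]; exact hy.symm))
  obtain ⟨k, hk⟩ := exists_Cc_eqOn hC hL hF fun y hy hyL => by
    have h1 : G.src x = G.rng (G.inv y) := by rw [G.rng_inv, hx]; exact hy.symm
    have : f (G.mul x (G.inv y)) = 0 := by
      by_contra hne
      refine hyL ⟨_, ⟨subset_tsupport _ hne, G.rng_mul _ _ h1⟩, ?_⟩
      change G.mul (G.inv (G.mul x (G.inv y))) x = y
      rw [G.inv_mul_rev h1, G.inv_inv, G.mul_assoc _ _ _ (by rw [G.rng_inv, hx]; exact hy)
        (G.src_inv x), G.inv_mul, hx, ← show G.src y = u from hy, G.mul_src_self]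
    rw [this, star_zero]
  refine ⟨G.toL2 u k, fun ξ hξ => ?_⟩
  rw [L2.inner_def, indOp]
  refine integral_congr_ae ?_
  filter_upwards [(memLp_Cc k u).coeFn_toLp, hξ.coeFn_toLp, ae_src u] with y hky hξy hy
  change _ = inner ℂ ((memLp_Cc k u).toLp k y) (hξ.toLp ξ y)
  rw [hky, hξy, hk y hy]
  change _ = ξ y * (starRingEnd ℂ) (star (f (G.mul x (G.inv y))))
  rw [mul_comm]
  congr 1
  exact (star_star _).symm

/-- Approximate `ξ` in `L²` by functions in `C_c`, on which `indOp` is convolution. By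
`exists_indOp_eq_inner` the images converge pointwise on the fibre, and Fatou's lemma bounds the
norm of the limit. -/
theorem eLpNorm_indOp_le (u : G.Units) (f : C_c(G.Arr, ℂ)) {ξ : G.Arr → ℂ}
    (hξ : MemLp ξ 2 (G.haarInv u)) :
    eLpNorm (G.indOp u f ξ) 2 (G.haarInv u) ≤ ‖(G.ind u).π f‖ₑ * eLpNorm ξ 2 (G.haarInv u) := by
  obtain ⟨v, hv⟩ : ∃ v : ℕ → C_c(G.Arr, ℂ), Tendsto (fun n => G.toL2 u (v n)) atTop
      (𝓝 (hξ.toLp ξ)) := by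
    obtain ⟨w, hw, hwl⟩ := mem_closure_iff_seq_limit.1 (denseRange_toL2 u (hξ.toLp ξ))
    choose v hv using hw
    exact ⟨v, by simpa only [hv] using hwl⟩
  have hlim : ∀ᵐ x ∂(G.haarInv u), Tendsto (fun n => G.conv f (v n) x) atTop
      (𝓝 (G.indOp u f ξ x)) := by
    filter_upwards [ae_src u] with x hx
    obtain ⟨k, hk⟩ := exists_indOp_eq_inner f hx
    simp_rw [← conv_eq_indOp f _ hx]
    rw [hk ξ hξ]
    simp_rw [hk _ (memLp_Cc _ u)]
    exact tendsto_const_nhds.inner hv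
  refine (Lp.eLpNorm_lim_le_liminf_eLpNorm (fun n => (memLp_Cc _ u).aestronglyMeasurable) _
    hlim).trans ?_
  have hle : ∀ n, eLpNorm (G.conv f (v n)) 2 (G.haarInv u)
      ≤ ‖(G.ind u).π f‖ₑ * ‖G.toL2 u (v n)‖ₑ := by
    intro n
    rw [← enorm_toL2, ← indCLM_toL2]
    exact ContinuousLinearMap.le_opENorm (G.indCLM u f) _
  refine (liminf_le_liminf (.of_forall hle)).trans (le_of_eq ?_)
  rw [← Lp.enorm_toLp hξ]
  exact (ENNReal.Tendsto.const_mul (hv.enorm) (.inr enorm_ne_top)).liminf_eq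

/-- Passes from integral operators on representatives to the bounded operators of `ind`. For the
lower bound on the minimal norm, the density of `C_c` in `L²` allows testing on `C_c` alone. -/
theorem normMin_eq_iSup (f : C_c(G.Arr, ℂ)) : G.normMin f = ⨆ u, ‖(G.ind u).π f‖ₑ := by
  refine le_antisymm ?_ ?_
  · refine iSup_mono fun u => iSup_le fun ξ => iSup_le fun hξ => iSup_le fun h1 => ?_
    exact (eLpNorm_indOp_le u f hξ).trans (mul_le_of_le_one_right' h1)
  · refine iSup_le fun u => ?_
    by_cases htop : G.normMin f = ∞
    · rw [htop]; exact le_top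
    have hone : ∀ ξ : C_c(G.Arr, ℂ), ‖G.toL2 u ξ‖ ≤ 1 →
        ‖G.toL2 u (G.conv f ξ)‖ ≤ (G.normMin f).toReal := by
      intro ξ hξ
      rw [← toReal_enorm]
      refine ENNReal.toReal_mono htop ?_
      have h1 : eLpNorm ξ 2 (G.haarInv u) ≤ 1 := by
        rw [← enorm_toL2, ← ofReal_norm]
        simpa using ENNReal.ofReal_le_ofReal hξ
      refine le_trans (le_of_eq ?_) (le_iSup_of_le u (le_iSup_of_le (ξ : G.Arr → ℂ)
        (le_iSup_of_le (memLp_Cc ξ u) (le_iSup_of_le h1 le_rfl))))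
      rw [enorm_toL2]
      refine eLpNorm_congr_ae ?_
      filter_upwards [ae_src u] with x hx using (conv_eq_indOp f ξ hx).symm
    have hall : ∀ ξ : C_c(G.Arr, ℂ),
        ‖(G.toL2 u ∘ₗ G.convₗ f) ξ‖ ≤ (G.normMin f).toReal * ‖G.toL2 u ξ‖ := by
      intro ξ
      -- A vector of norm zero cannot be scaled to norm one. There the bound by the `I`-norm shows
      -- that the image vanishes too.
      rcases (norm_nonneg (G.toL2 u ξ)).eq_or_lt with h0 | h0
      · have := norm_toL2_conv_le u f ξ
        rw [← h0, mul_zero] at this ⊢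
        exact this
      · have := hone (((‖G.toL2 u ξ‖⁻¹ : ℝ) : ℂ) • ξ) (by
          rw [map_smul, norm_smul, Complex.norm_real, norm_inv, norm_norm,
            inv_mul_cancel₀ h0.ne'])
        rw [← convₗ_apply, map_smul, map_smul, norm_smul, Complex.norm_real, norm_inv,
          norm_norm, inv_mul_le_iff₀ h0, mul_comm] at this
        exact this
    have := LinearMap.opNorm_extendOfNorm_le (denseRange_toL2 u) ENNReal.toReal_nonneg hall
    rw [← ofReal_norm]
    exact ENNReal.ofReal_le_of_le_toReal this

theorem normMin_le_normMax (f : C_c(G.Arr, ℂ)) : G.normMin f ≤ G.normMax f := by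
  rw [normMin_eq_iSup]
  exact iSup_le fun u => le_iSup (fun π : G.Rep => ‖π.π f‖ₑ) (G.ind u)

theorem normMax_ne_top (f : C_c(G.Arr, ℂ)) : G.normMax f ≠ ∞ :=
  ne_top_of_le_ne_top (normI_ne_top f) (normMax_le_normI f)

theorem normMin_ne_top (f : C_c(G.Arr, ℂ)) : G.normMin f ≠ ∞ :=
  ne_top_of_le_ne_top (normMax_ne_top f) (normMin_le_normMax f)

/-- The minimal norm as a real number. -/
noncomputable def rnormMin (G : HaarGroupoid.{u}) (f : C_c(G.Arr, ℂ)) : ℝ := (G.normMin f).toReal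

theorem rnormMin_nonneg (f : C_c(G.Arr, ℂ)) : 0 ≤ G.rnormMin f := ENNReal.toReal_nonneg

theorem norm_ind_le (u : G.Units) (f : C_c(G.Arr, ℂ)) : ‖(G.ind u).π f‖ ≤ G.rnormMin f := by
  rw [← toReal_enorm]
  refine ENNReal.toReal_mono (normMin_ne_top f) ?_
  rw [normMin_eq_iSup]
  exact le_iSup (fun u => ‖(G.ind u).π f‖ₑ) u

theorem rnormMin_le {f : C_c(G.Arr, ℂ)} {c : ℝ} (hc : 0 ≤ c) (h : ∀ u, ‖(G.ind u).π f‖ ≤ c) :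
    G.rnormMin f ≤ c := by
  refine ENNReal.toReal_le_of_le_ofReal hc ?_
  rw [normMin_eq_iSup]
  exact iSup_le fun u => by
    rw [← ofReal_norm]
    exact ENNReal.ofReal_le_ofReal (h u)

theorem norm_toL2_conv_le_rnormMin (u : G.Units) (f ξ : C_c(G.Arr, ℂ)) :
    ‖G.toL2 u (G.conv f ξ)‖ ≤ G.rnormMin f * ‖G.toL2 u ξ‖ := by
  rw [← indCLM_toL2]
  exact ContinuousLinearMap.le_of_opNorm_le _ (norm_ind_le u f) _

theorem rnormMin_conv_le (f g : C_c(G.Arr, ℂ)) :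
    G.rnormMin (G.conv f g) ≤ G.rnormMin f * G.rnormMin g :=
  rnormMin_le (mul_nonneg (rnormMin_nonneg f) (rnormMin_nonneg g)) fun u => by
    rw [(G.ind u).map_conv]
    exact (norm_mul_le _ _).trans (mul_le_mul (norm_ind_le u f) (norm_ind_le u g)
      (norm_nonneg _) (rnormMin_nonneg f))

theorem rnormMin_adj_le (f : C_c(G.Arr, ℂ)) : G.rnormMin (G.adj f) ≤ G.rnormMin f :=
  rnormMin_le (rnormMin_nonneg f) fun u => by
    rw [(G.ind u).map_adj, norm_star]
    exact norm_ind_le u f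

end HaarGroupoid

/-! ### The map induced by a partial morphism -/

namespace PartialMorphism

variable {G H : HaarGroupoid.{u}} (φ : PartialMorphism G H)

theorem mem_dom_of_mem {x : G.Arr} {x' : H.Arr} (h : x' ∈ φ.toPFun x) : x ∈ φ.toPFun.Dom :=
  (PFun.mem_dom _ _).2 ⟨x', h⟩

theorem exists_mem {x : G.Arr} (h : x ∈ φ.toPFun.Dom) : ∃ x', x' ∈ φ.toPFun x :=
  (PFun.mem_dom _ _).1 h

/-- `inv_mem` places the inverse in the domain but says nothing about its image. That image is a
left inverse of `x'`, because units go to units. -/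
theorem map_inv {x : G.Arr} {x' : H.Arr} (h : x' ∈ φ.toPFun x) :
    H.inv x' ∈ φ.toPFun (G.inv x) := by
  obtain ⟨z, hz⟩ := φ.exists_mem (φ.inv_mem x (φ.mem_dom_of_mem h))
  obtain ⟨h1, h2⟩ := φ.map_mul _ _ _ _ hz h (G.src_inv x)
  rw [G.inv_mul] at h2
  have e1 := φ.map_unit (G.rng_src x) h2
  rw [H.rng_mul _ _ h1] at e1
  have e2 := H.mul_inv_cancel_right h1
  have e3 := H.src_mul z x' h1
  rw [← e1, H.src_rng] at e3
  rw [← e1, e3, ← H.rng_inv, H.rng_mul_self] at e2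
  rwa [e2]

theorem map_rng {x : G.Arr} {x' : H.Arr} (h : x' ∈ φ.toPFun x) :
    H.rng x' ∈ φ.toPFun (G.rng x) := by
  rw [← G.mul_inv, ← H.mul_inv]
  exact (φ.map_mul _ _ _ _ h (φ.map_inv h) (G.rng_inv x).symm).2

theorem map_src {x : G.Arr} {x' : H.Arr} (h : x' ∈ φ.toPFun x) :
    H.src x' ∈ φ.toPFun (G.src x) := by
  rw [← G.inv_mul, ← H.inv_mul]
  exact (φ.map_mul _ _ _ _ (φ.map_inv h) h (G.src_inv x)).2

theorem inv_mem_iff {x : G.Arr} : G.inv x ∈ φ.toPFun.Dom ↔ x ∈ φ.toPFun.Dom :=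
  ⟨fun h => by simpa [G.inv_inv] using φ.inv_mem _ h, φ.inv_mem x⟩

theorem mul_mem {x y : G.Arr} (hx : x ∈ φ.toPFun.Dom) (hy : y ∈ φ.toPFun.Dom)
    (h : G.src x = G.rng y) : G.mul x y ∈ φ.toPFun.Dom := by
  obtain ⟨x', hx'⟩ := φ.exists_mem hx
  obtain ⟨y', hy'⟩ := φ.exists_mem hy
  exact φ.mem_dom_of_mem (φ.map_mul _ _ _ _ hx' hy' h).2

theorem rng_mem {x : G.Arr} (h : x ∈ φ.toPFun.Dom) : G.rng x ∈ φ.toPFun.Dom := by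
  obtain ⟨x', hx'⟩ := φ.exists_mem h
  exact φ.mem_dom_of_mem (φ.map_rng hx')

theorem map_comap_haar {u : G.Units} {v : H.Units} (h : (v : H.Arr) ∈ φ.toPFun (u : G.Arr)) :
    ((G.haar u).comap (Subtype.val : φ.toPFun.Dom → G.Arr)).map φ.toPFun.asSubtype = H.haar v := by
  ext S hS
  rw [Measure.map_apply φ.isProper.continuous.measurable hS,
    (MeasurableEmbedding.subtype_coe φ.isOpen_dom.measurableSet).comap_apply,
    PFun.preimage_asSubtype, Subtype.image_preimage_coe,
    inter_eq_right.2 (PFun.preimage_subset_dom _ _), φ.map_haar u v h S hS]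

theorem integral_pullFun {u : G.Units} {v : H.Units} (h : (v : H.Arr) ∈ φ.toPFun (u : G.Arr))
    {f : H.Arr → ℂ} (hf : Continuous f) :
    ∫ x, φ.pullFun f x ∂(G.haar u) = ∫ y, f y ∂(H.haar v) := by
  rw [← φ.map_comap_haar h, integral_map φ.isProper.continuous.measurable.aemeasurable
    hf.aestronglyMeasurable]
  have e : ∀ x : φ.toPFun.Dom, f (φ.toPFun.asSubtype x) = φ.pullFun f x := fun x => by
    rw [pullFun, dif_pos x.2]
    rfl
  simp_rw [e]
  rw [integral_subtype_comap φ.isOpen_dom.measurableSet (φ.pullFun f)]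
  exact (setIntegral_eq_integral_of_forall_compl_eq_zero
    fun x hx => φ.pullFun_of_notMem f hx).symm

/-- The range of an arrow in the domain lies in the domain, so the fibre over a unit outside the
domain misses it. -/
theorem pullFun_ae_eq_zero {u : G.Units} (h : (u : G.Arr) ∉ φ.toPFun.Dom) (f : H.Arr → ℂ) :
    φ.pullFun f =ᵐ[G.haar u] 0 := by
  filter_upwards [HaarGroupoid.ae_rng u] with x hx
  exact φ.pullFun_of_notMem f fun hd => h (hx ▸ φ.rng_mem hd)

theorem pullCc_apply (f : C_c(H.Arr, ℂ)) (x : G.Arr) : φ.pullCc f x = φ.pullFun f x := rfl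

/-- The induced map of a partial morphism as a linear map. -/
noncomputable def pullₗ : C_c(H.Arr, ℂ) →ₗ[ℂ] C_c(G.Arr, ℂ) where
  toFun := φ.pullCc
  map_add' f g := by
    ext x
    change φ.pullFun (f + g : C_c(H.Arr, ℂ)) x = φ.pullFun f x + φ.pullFun g x
    unfold pullFun
    split_ifs <;> simp
  map_smul' c f := by
    ext x
    change φ.pullFun (c • f : C_c(H.Arr, ℂ)) x = c * φ.pullFun f x
    unfold pullFun
    split_ifs <;> simp

theorem pullₗ_apply (f : C_c(H.Arr, ℂ)) : φ.pullₗ f = φ.pullCc f := rfl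

theorem pullCc_adj (f : C_c(H.Arr, ℂ)) : φ.pullCc (H.adj f) = G.adj (φ.pullCc f) := by
  ext x
  rw [HaarGroupoid.adj_apply, pullCc_apply, pullCc_apply]
  by_cases hx : x ∈ φ.toPFun.Dom
  · obtain ⟨x', hx'⟩ := φ.exists_mem hx
    rw [φ.pullFun_of_mem _ hx', φ.pullFun_of_mem _ (φ.map_inv hx')]
    rfl
  · rw [φ.pullFun_of_notMem _ hx, φ.pullFun_of_notMem _ (fun h => hx (φ.inv_mem_iff.1 h)),
      star_zero]

/-- At an arrow of the domain, the integrand is the pull-back of the integrand in `H` and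
`integral_pullFun` applies. Elsewhere the integrand vanishes, as `x = (x y) y⁻¹` prevents both
factors from lying in the domain. -/
theorem pullCc_conv (f g : C_c(H.Arr, ℂ)) :
    φ.pullCc (H.conv f g) = G.conv (φ.pullCc f) (φ.pullCc g) := by
  ext x
  change φ.pullFun (H.conv f g) x = G.convFun (φ.pullCc f) (φ.pullCc g) x
  rw [HaarGroupoid.convFun]
  by_cases hx : x ∈ φ.toPFun.Dom
  · obtain ⟨x', hx'⟩ := φ.exists_mem hx
    obtain ⟨h, hh, -⟩ := HaarGroupoid.exists_Cc_eq f g x'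
    rw [φ.pullFun_of_mem _ hx']
    change H.convFun f g x' = _
    have e : H.convFun f g x' = ∫ y, h y ∂(H.haar (H.srcU x')) := by
      refine integral_congr_ae ?_
      filter_upwards [HaarGroupoid.ae_rng (H.srcU x')] with y hy using hh y hy
    rw [e, ← φ.integral_pullFun (u := G.srcU x) (v := H.srcU x') (φ.map_src hx')
      (f := h) h.continuous]
    refine integral_congr_ae ?_
    filter_upwards [HaarGroupoid.ae_rng (G.srcU x)] with y hy
    rw [pullCc_apply, pullCc_apply]
    by_cases hyd : y ∈ φ.toPFun.Dom
    · obtain ⟨y', hy'⟩ := φ.exists_mem hyd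
      obtain ⟨h1, h2⟩ := φ.map_mul _ _ _ _ hx' hy' hy.symm
      rw [φ.pullFun_of_mem _ hy', φ.pullFun_of_mem _ h2, φ.pullFun_of_mem _ (φ.map_inv hy'),
        hh y' h1.symm]
    · rw [φ.pullFun_of_notMem _ hyd, φ.pullFun_of_notMem g (fun h => hyd (φ.inv_mem_iff.1 h)),
        mul_zero]
  · rw [φ.pullFun_of_notMem _ hx]
    symm
    refine integral_eq_zero_of_ae ?_
    filter_upwards [HaarGroupoid.ae_rng (G.srcU x)] with y hy
    have hy' : G.src x = G.rng y := hy.symm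
    change φ.pullFun f (G.mul x y) * φ.pullFun g (G.inv y) = 0
    by_cases h1 : G.mul x y ∈ φ.toPFun.Dom
    · by_cases h2 : G.inv y ∈ φ.toPFun.Dom
      · refine absurd ?_ hx
        rw [← G.mul_inv_cancel_right hy']
        exact φ.mul_mem h1 h2 (by rw [G.src_mul _ _ hy', G.rng_inv])
      · rw [φ.pullFun_of_notMem g h2, mul_zero]
    · rw [φ.pullFun_of_notMem f h1, zero_mul]

theorem integral_norm_pullCc {u : G.Units} {v : H.Units} (h : (v : H.Arr) ∈ φ.toPFun (u : G.Arr))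
    (f : C_c(H.Arr, ℂ)) :
    ∫ x, ‖φ.pullCc f x‖ ∂(G.haar u) = ∫ y, ‖f y‖ ∂(H.haar v) := by
  have e : ∀ x, φ.pullFun (fun y => (‖f y‖ : ℂ)) x = ((‖φ.pullCc f x‖ : ℝ) : ℂ) := by
    intro x
    rw [pullCc_apply]
    unfold pullFun
    split_ifs <;> simp
  have h1 := φ.integral_pullFun h (f := fun y => (‖f y‖ : ℂ))
    (Complex.continuous_ofReal.comp f.continuous.norm)
  simp_rw [e] at h1
  rw [integral_complex_ofReal, integral_complex_ofReal] at h1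
  exact_mod_cast h1

theorem integral_norm_pullCc_le {f : C_c(H.Arr, ℂ)} {c : ℝ} (hc : 0 ≤ c)
    (hf : ∀ v, ∫ y, ‖f y‖ ∂(H.haar v) ≤ c) (u : G.Units) :
    ∫ x, ‖φ.pullCc f x‖ ∂(G.haar u) ≤ c := by
  by_cases hu : (u : G.Arr) ∈ φ.toPFun.Dom
  · obtain ⟨v, hv⟩ := φ.exists_mem hu
    rw [φ.integral_norm_pullCc (v := ⟨v, φ.map_unit u.2 hv⟩) hv]
    exact hf _
  · refine le_trans (le_of_eq (integral_eq_zero_of_ae ?_)) hc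
    filter_upwards [φ.pullFun_ae_eq_zero hu f] with x hx
    rw [pullCc_apply, hx]
    simp

theorem rnormI_pullCc_le (f : C_c(H.Arr, ℂ)) : G.rnormI (φ.pullCc f) ≤ H.rnormI f := by
  refine HaarGroupoid.rnormI_le (HaarGroupoid.rnormI_nonneg f) (fun u => ?_) fun u => ?_
  · exact φ.integral_norm_pullCc_le (HaarGroupoid.rnormI_nonneg f)
      (HaarGroupoid.integral_norm_le_rnormI f) u
  · rw [← pullCc_adj]
    exact φ.integral_norm_pullCc_le (HaarGroupoid.rnormI_nonneg f)
      (HaarGroupoid.integral_norm_adj_le_rnormI f) u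

/-- The pull-back of a representation along the induced map of a partial morphism. -/
noncomputable def pullRep (π : G.Rep) : H.Rep where
  H := π.H
  π := π.π ∘ₗ φ.pullₗ
  map_conv f g := by
    change π.π (φ.pullCc _) = π.π (φ.pullCc _) * π.π (φ.pullCc _)
    rw [pullCc_conv, π.map_conv]
  map_adj f := by
    change π.π (φ.pullCc _) = star (π.π (φ.pullCc _))
    rw [pullCc_adj, π.map_adj]
  bounded := ⟨1, fun f => by
    rw [ENNReal.coe_one, one_mul, ← HaarGroupoid.ofReal_rnormI, ← ofReal_norm]
    exact ENNReal.ofReal_le_ofReal ((π.norm_le _).trans (φ.rnormI_pullCc_le f))⟩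

theorem normMax_pullCc_le (f : C_c(H.Arr, ℂ)) : G.normMax (φ.pullCc f) ≤ H.normMax f :=
  iSup_le fun π => le_iSup (fun ρ : H.Rep => ‖ρ.π f‖ₑ) (φ.pullRep π)

end PartialMorphism

/-! ### Contractivity of the induced map for the minimal norm -/

namespace HaarGroupoid

variable {G : HaarGroupoid.{u}}

theorem inner_toL2_eq_integral (u : G.Units) (f g : C_c(G.Arr, ℂ)) :
    inner ℂ (G.toL2 u f) (G.toL2 u g) = ∫ x, star (f (G.inv x)) * g (G.inv x) ∂(G.haar u) := by
  rw [inner_toL2]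
  change G.convFun (G.adj f) g u = _
  rw [convFun, G.srcU_eq (G.src_eq_of_unit u.2)]
  refine integral_congr_ae ?_
  filter_upwards [ae_rng u] with y hy
  rw [adj_apply, ← hy, G.rng_mul_self]

/-- The Cauchy–Schwarz inequality for convolutions. -/
theorem norm_conv_adj_le (g k : C_c(G.Arr, ℂ)) (x : G.Arr) :
    ‖G.conv (G.adj g) k x‖ ≤ ‖G.toL2 (G.rngU x) g‖ * ‖G.toL2 (G.srcU x) k‖ := by
  have hC : IsClosed {z : G.Arr | G.src z = G.rng x} :=
    isClosed_eq G.continuous_src continuous_const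
  have hL := isCompact_mul_inv k.hasCompactSupport.isCompact x
  -- Here `k₂ z = k (z x)` on the source fibre of `rng x`. Right translation by `x` identifies this
  -- fibre with the source fibre of `src x`, and by left invariance and inversion it preserves `L²`
  -- norms.
  obtain ⟨k₂, hk₂⟩ := exists_Cc_eqOn hC (G.isCompact_inv_preimage hL)
    (F := fun z => k (G.mul z x))
    (k.continuous.comp_continuousOn (G.continuousOn_mul.comp
      (continuous_id.prodMk continuous_const).continuousOn fun z hz => hz)) fun z hz hzL => by
    by_contra hne
    refine hzL (mem_mul_inv_image ?_ (subset_tsupport _ ?_))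
    · rw [G.rng_inv]; exact hz
    · rw [G.inv_inv]; exact hne
  have hk₂' : ∀ y, G.rng y = G.rng x → k₂ (G.inv y) = k (G.mul (G.inv y) x) := fun y hy =>
    hk₂ _ ((G.src_inv y).trans hy)
  have h1 : G.conv (G.adj g) k x
      = inner ℂ (G.toL2 (G.rngU x) g) (G.toL2 (G.rngU x) k₂) := by
    rw [inner_toL2_eq_integral, conv_apply]
    refine integral_congr_ae ?_
    filter_upwards [ae_rng (G.rngU x)] with y hy
    rw [adj_apply, hk₂' y hy]
  have h2 : inner ℂ (G.toL2 (G.rngU x) k₂) (G.toL2 (G.rngU x) k₂)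
      = inner ℂ (G.toL2 (G.srcU x) k) (G.toL2 (G.srcU x) k) := by
    rw [inner_toL2_eq_integral, inner_toL2_eq_integral]
    have hcont : Continuous fun y => star (k₂ (G.inv y)) * k₂ (G.inv y) :=
      (continuous_star.comp (k₂.continuous.comp G.continuous_inv)).mul
        (k₂.continuous.comp G.continuous_inv)
    rw [integral_mul_left x hcont.continuousOn
      (G.isCompact_inv_preimage k₂.hasCompactSupport.isCompact) fun y _ hy => by
        rw [image_eq_zero_of_notMem_tsupport (f := k₂) hy, mul_zero]]
    refine integral_congr_ae ?_
    filter_upwards [ae_rng (G.srcU x)] with y hy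
    have hy' : G.src x = G.rng y := hy.symm
    rw [hk₂' _ (G.rng_mul _ _ hy'), G.inv_mul_rev hy', G.mul_assoc _ _ _
      (by rw [G.src_inv, G.rng_inv, hy']) (G.src_inv x), G.inv_mul, hy', ← G.src_inv,
      G.mul_src_self]
  have h3 : ‖G.toL2 (G.rngU x) k₂‖ = ‖G.toL2 (G.srcU x) k‖ := by
    rw [inner_self_eq_norm_sq_to_K, inner_self_eq_norm_sq_to_K] at h2
    exact (sq_eq_sq₀ (norm_nonneg _) (norm_nonneg _)).1 (by exact_mod_cast h2)
  rw [h1, ← h3]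
  exact norm_inner_le_norm _ _

theorem exists_norm_toL2_le (g : C_c(G.Arr, ℂ)) : ∃ M : ℝ, 0 ≤ M ∧ ∀ u, ‖G.toL2 u g‖ ≤ M := by
  obtain ⟨c, hc⟩ := exists_norm_le (G.conv (G.adj g) g)
  refine ⟨√c, Real.sqrt_nonneg _, fun u => Real.le_sqrt_of_sq_le ?_⟩
  refine le_trans (le_of_eq ?_) (hc u)
  rw [← inner_toL2, inner_self_eq_norm_sq_to_K]
  simp

/-- A representation with a dense set of vectors whose matrix coefficients are bounded by the
uniform norm is bounded by the minimal norm. -/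
theorem norm_le_rnormMin (ρ : G.Rep) {D : Set ρ.H} (hD : Dense D)
    (h : ∀ η ∈ D, ∃ C : ℝ, ∀ (f : C_c(G.Arr, ℂ)) (c : ℝ), 0 ≤ c → (∀ x, ‖f x‖ ≤ c) →
      ‖inner ℂ η (ρ.π f η)‖ ≤ C * c) (f : C_c(G.Arr, ℂ)) : ‖ρ.π f‖ ≤ G.rnormMin f := by
  -- The coefficient of `a` at `g η` is that of `g* * (a * g)` at `η`. Cauchy-Schwarz bounds the
  -- uniform norm of this convolution by a multiple of the minimal norm of `a`, which is what the
  -- power trick needs.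
  have h1 : ∀ g, ∀ η ∈ D, ∀ f, ‖ρ.π f (ρ.π g η)‖ ≤ G.rnormMin f * ‖ρ.π g η‖ := by
    intro g η hη f
    obtain ⟨C, hC⟩ := h η hη
    obtain ⟨M, hM0, hM⟩ := exists_norm_toL2_le g
    refine norm_apply_le_of_norm_inner_le (m := G.conv) (s := G.adj) (L := fun f v => ρ.π f v)
      (j := fun v => v) rnormMin_nonneg rnormMin_conv_le rnormMin_adj_le
      (fun a b v => by rw [ρ.map_conv]; rfl) (fun a v w => rep_inner_adj ρ a v w)
      (C := C * (M * M)) (fun a => ?_) f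
    have e : inner ℂ (ρ.π g η) (ρ.π a (ρ.π g η))
        = inner ℂ η (ρ.π (G.conv (G.adj g) (G.conv a g)) η) := by
      rw [rep_inner_adj, ρ.map_conv, ρ.map_conv]
      rfl
    rw [e]
    refine (hC _ (M * (G.rnormMin a * M))
      (mul_nonneg hM0 (mul_nonneg (rnormMin_nonneg a) hM0)) fun x => ?_).trans (le_of_eq (by ring))
    refine (norm_conv_adj_le g _ x).trans (mul_le_mul (hM _) ?_ (norm_nonneg _) hM0)
    exact (norm_toL2_conv_le_rnormMin _ a g).trans
      (mul_le_mul_of_nonneg_left (hM _) (rnormMin_nonneg a))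
  have h2 : ∀ g η, ‖ρ.π f (ρ.π g η)‖ ≤ G.rnormMin f * ‖ρ.π g η‖ := fun g η =>
    hD.induction (P := fun η => ‖ρ.π f (ρ.π g η)‖ ≤ G.rnormMin f * ‖ρ.π g η‖)
      (fun η hη => h1 g η hη f) (isClosed_le (by fun_prop) (by fun_prop)) η
  -- By the C*-identity it suffices to know `f` on vectors in the range of `f*`, that is, to take `g
  -- = f*`. So the representation may be degenerate.
  have h3 : ‖ρ.π f * star (ρ.π f)‖ ≤ G.rnormMin f * ‖ρ.π f‖ := by
    refine ContinuousLinearMap.opNorm_le_bound _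
      (mul_nonneg (rnormMin_nonneg f) (norm_nonneg _)) fun η => ?_
    rw [← ρ.map_adj, mul_assoc]
    refine (h2 _ η).trans (mul_le_mul_of_nonneg_left ?_ (rnormMin_nonneg f))
    refine (ContinuousLinearMap.le_opNorm _ _).trans (le_of_eq ?_)
    rw [ρ.map_adj, norm_star]
  rw [CStarRing.norm_self_mul_star] at h3
  rcases (norm_nonneg (ρ.π f)).eq_or_lt with h0 | h0
  · rw [← h0]; exact rnormMin_nonneg f
  · exact le_of_mul_le_mul_right h3 h0

end HaarGroupoid

theorem PartialMorphism.normMin_pullCc_le {G H : HaarGroupoid.{u}} (φ : PartialMorphism G H)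
    (f : C_c(H.Arr, ℂ)) : G.normMin (φ.pullCc f) ≤ H.normMin f := by
  rw [HaarGroupoid.normMin_eq_iSup]
  refine iSup_le fun u => ?_
  rw [← ofReal_norm, ← ENNReal.ofReal_toReal (HaarGroupoid.normMin_ne_top f)]
  refine ENNReal.ofReal_le_ofReal ?_
  refine HaarGroupoid.norm_le_rnormMin (φ.pullRep (G.ind u)) (HaarGroupoid.denseRange_toL2 u) ?_ f
  rintro _ ⟨ξ, rfl⟩
  refine ⟨G.rnormI (G.adj ξ) * G.rnormI (G.adj ξ), fun a c hc0 hc => ?_⟩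
  change ‖inner ℂ (G.toL2 u ξ) (G.indCLM u (φ.pullCc a) (G.toL2 u ξ))‖ ≤ _
  rw [HaarGroupoid.indCLM_toL2, HaarGroupoid.inner_toL2, mul_assoc]
  refine HaarGroupoid.norm_conv_apply_le _ _ (fun x => ?_) _
  -- `norm_conv_apply_le` uses the uniform norm of the right factor. Taking adjoints moves the
  -- pulled-back function to the right.
  rw [← HaarGroupoid.adj_adj (G.conv _ ξ), HaarGroupoid.adj_conv, HaarGroupoid.adj_apply,
    norm_star]
  refine HaarGroupoid.norm_conv_apply_le _ _ (fun y => ?_) _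
  rw [HaarGroupoid.adj_apply, norm_star, pullCc_apply]
  unfold pullFun
  split_ifs
  · exact hc _
  · rwa [norm_zero]

/-! ### The functors -/

theorem HaarGroupoid.exists_completion_normMax (G : HaarGroupoid.{u}) :
    ∃ (A : CStarAlg.{u}) (j : C_c(G.Arr, ℂ) →ₗ[ℂ] A), (∀ f g, j (G.conv f g) = j f * j g) ∧
      (∀ f, j (G.adj f) = star (j f)) ∧ (∀ f, ‖j f‖ₑ = G.normMax f) ∧ DenseRange j := by
  -- Representations live in a higher universe. One representation for each function `f ↦ ‖π f‖`
  -- gives a small index type with the same supremum.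
  let I := Set.range fun (π : G.Rep) (f : C_c(G.Arr, ℂ)) => ‖π.π f‖ₑ
  choose π hπ using fun i : I => i.2
  refine exists_cstar_completion (I := I) (fun i => (π i).H →L[ℂ] (π i).H) (fun i => (π i).π)
    (fun i => (π i).map_conv) (fun i => (π i).map_adj) (fun f => ?_) normMax_ne_top
  refine le_antisymm (iSup_le fun ρ => ?_)
    (iSup_le fun i => le_iSup (fun ρ : G.Rep => ‖ρ.π f‖ₑ) (π i))
  refine le_iSup_of_le (⟨_, ⟨ρ, rfl⟩⟩ : I) (le_of_eq ?_)
  exact (congrFun (hπ ⟨_, ⟨ρ, rfl⟩⟩) f).symm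

theorem HaarGroupoid.exists_completion_normMin (G : HaarGroupoid.{u}) :
    ∃ (A : CStarAlg.{u}) (j : C_c(G.Arr, ℂ) →ₗ[ℂ] A), (∀ f g, j (G.conv f g) = j f * j g) ∧
      (∀ f, j (G.adj f) = star (j f)) ∧ (∀ f, ‖j f‖ₑ = G.normMin f) ∧ DenseRange j :=
  exists_cstar_completion (fun u => (G.ind u).H →L[ℂ] (G.ind u).H) (fun u => (G.ind u).π)
    (fun u => (G.ind u).map_conv) (fun u => (G.ind u).map_adj) normMin_eq_iSup normMin_ne_top

theorem PartialMorphism.pullCc_id (G : HaarGroupoid.{u}) (f : C_c(G.Arr, ℂ)) :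
    PartialMorphism.pullCc (𝟙 G) f = f := by
  ext x
  exact pullFun_of_mem (PartialMorphism.id G) f (Part.mem_some x)

/-- Inherited from `c0Functor`, since both induced maps are given by `pullFun`. -/
theorem PartialMorphism.pullCc_comp {G H L : HaarGroupoid.{u}} (φ : G ⟶ H) (ψ : H ⟶ L)
    (f : C_c(L.Arr, ℂ)) :
    PartialMorphism.pullCc (φ ≫ ψ) f = PartialMorphism.pullCc φ (PartialMorphism.pullCc ψ f) := by
  let g : C₀(L.Arr, ℂ) := ⟨⟨f, f.continuous⟩, f.hasCompactSupport.is_zero_at_infty⟩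
  have h := c0Functor.map_comp ψ.op φ.op
  ext x
  exact congrArg (fun k : C₀(G.Arr, ℂ) => k x) (DFunLike.congr_fun (F := C₀(L.Arr, ℂ) →⋆ₙₐ[ℂ]
    C₀(G.Arr, ℂ)) h g)

/-- Reduces both functors to two inputs: a completion of each convolution algebra, and contractivity
of pull-back. -/
theorem exists_isCompletionFunctor {N : ∀ G : HaarGroupoid.{u}, C_c(G.Arr, ℂ) → ℝ≥0∞}
    (hN : ∀ G : HaarGroupoid.{u}, ∃ (A : CStarAlg.{u}) (j : C_c(G.Arr, ℂ) →ₗ[ℂ] A),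
      (∀ f g, j (G.conv f g) = j f * j g) ∧ (∀ f, j (G.adj f) = star (j f)) ∧
      (∀ f, ‖j f‖ₑ = N G f) ∧ DenseRange j)
    (hpull : ∀ (G H : HaarGroupoid.{u}) (φ : PartialMorphism G H) (f : C_c(H.Arr, ℂ)),
      N G (φ.pullCc f) ≤ N H f) :
    ∃ (Γ : HaarGroupoid.{u}ᵒᵖ ⥤ CStarAlg.{u})
      (ι : ∀ G : HaarGroupoid.{u}, C_c(G.Arr, ℂ) →ₗ[ℂ] (Γ.obj (op G) : Type u)),
      IsCompletionFunctor N Γ ι := by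
  choose A j hjm hjs hjN hjd using hN
  have hext : ∀ (G H : HaarGroupoid.{u}) (φ : PartialMorphism G H),
      ∃ Φ : A H →⋆ₙₐ[ℂ] A G, ∀ f, Φ (j H f) = j G (φ.pullCc f) := by
    intro G H φ
    refine exists_starHom_extend (T := j G ∘ₗ φ.pullₗ) (hjd H) (hjm H) (hjs H) (fun f g => ?_)
      (fun f => ?_) fun f => ?_
    · change j G (φ.pullCc _) = j G (φ.pullCc _) * j G (φ.pullCc _)
      rw [φ.pullCc_conv, hjm]
    · change j G (φ.pullCc _) = star (j G (φ.pullCc _))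
      rw [φ.pullCc_adj, hjs]
    · rw [← enorm_le_iff_norm_le, hjN]
      exact (hjN G _).le.trans (hpull G H φ f)
  choose Φ hΦ using hext
  let Γ : HaarGroupoid.{u}ᵒᵖ ⥤ CStarAlg.{u} :=
    { obj := fun G => A G.unop
      map := fun φ => Φ _ _ φ.unop
      map_id := fun G => by
        refine starHom_ext_of_denseRange (φ := Φ _ _ (𝟙 G.unop))
          (ψ := NonUnitalStarAlgHom.id ℂ (A G.unop)) (hjd G.unop) fun f => ?_
        rw [hΦ, PartialMorphism.pullCc_id]
        rfl
      map_comp := fun {G H L} φ ψ => by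
        refine starHom_ext_of_denseRange (φ := Φ _ _ (ψ.unop ≫ φ.unop))
          (ψ := (Φ _ _ ψ.unop).comp (Φ _ _ φ.unop)) (hjd G.unop) fun f => ?_
        rw [hΦ, PartialMorphism.pullCc_comp, NonUnitalStarAlgHom.comp_apply, hΦ, hΦ] }
  exact ⟨Γ, j, hjm, hjs, hjN, hjd, fun G H φ f => hΦ G H φ f⟩

namespace IsCompletionFunctor

variable {N : ∀ G : HaarGroupoid.{u}, C_c(G.Arr, ℂ) → ℝ≥0∞} {Γ : HaarGroupoid.{u}ᵒᵖ ⥤ CStarAlg.{u}}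
  {ι : ∀ G : HaarGroupoid.{u}, C_c(G.Arr, ℂ) →ₗ[ℂ] (Γ.obj (op G) : Type u)}

theorem norm_eq (h : IsCompletionFunctor N Γ ι) (G : HaarGroupoid.{u}) (f : C_c(G.Arr, ℂ)) :
    ‖ι G f‖ = (N G f).toReal := by
  rw [← h.enorm_eq, toReal_enorm]

theorem hom_ext (h : IsCompletionFunctor N Γ ι) {G : HaarGroupoid.{u}} {B : CStarAlg.{u}}
    {φ ψ : Γ.obj (op G) ⟶ B} (hφ : ∀ f, CStarAlg.starHom φ (ι G f) = CStarAlg.starHom ψ (ι G f)) :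
    φ = ψ :=
  starHom_ext_of_denseRange (h.denseRange G) hφ

end IsCompletionFunctor

/-! ### Disjoint unions -/

theorem isFiniteMeasureOnCompacts_map_of_isProperMap {X Y : Type*} [TopologicalSpace X]
    [TopologicalSpace Y] [T2Space Y] [MeasurableSpace X] [BorelSpace X] [MeasurableSpace Y]
    [BorelSpace Y] {f : X → Y} (hf : IsProperMap f) (μ : Measure X) [IsFiniteMeasureOnCompacts μ] :
    IsFiniteMeasureOnCompacts (μ.map f) where
  lt_top_of_isCompact K hK := by
    rw [Measure.map_apply hf.continuous.measurable hK.isClosed.measurableSet]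
    exact (hf.isCompact_preimage hK).measure_lt_top

/-- The image of a regular measure under a proper continuous map is regular. -/
theorem regular_map_of_isProperMap {X Y : Type*} [TopologicalSpace X] [TopologicalSpace Y]
    [T2Space Y] [MeasurableSpace X] [BorelSpace X] [MeasurableSpace Y] [BorelSpace Y] {f : X → Y}
    (hf : IsProperMap f) (μ : Measure X) [μ.Regular] : (μ.map f).Regular := by
  have hm := hf.continuous.measurable
  have := isFiniteMeasureOnCompacts_map_of_isProperMap hf μ
  have : (μ.map f).OuterRegular := by
    refine ⟨fun A hA r hr => ?_⟩
    rw [Measure.map_apply hm hA] at hr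
    obtain ⟨U, hAU, hU, hUr⟩ := Set.exists_isOpen_lt_of_lt _ _ hr
    -- A proper map is closed, so the points whose entire fibre lies in `U` form an open set.
    have hV : IsOpen (f '' Uᶜ)ᶜ := (hf.isClosedMap _ hU.isClosed_compl).isOpen_compl
    refine ⟨(f '' Uᶜ)ᶜ, ?_, hV, ?_⟩
    · rintro _ ha ⟨x, hx, rfl⟩
      exact hx (hAU ha)
    · rw [Measure.map_apply hm hV.measurableSet]
      refine (measure_mono fun x hx => ?_).trans_lt hUr
      by_contra hxU
      exact hx ⟨x, hxU, rfl⟩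
  refine ⟨fun U hU r hr => ?_⟩
  rw [Measure.map_apply hm hU.measurableSet] at hr
  obtain ⟨K, hKU, hK, hKr⟩ := (hU.preimage hf.continuous).exists_lt_isCompact hr
  refine ⟨f '' K, image_subset_iff.2 hKU, hK.image hf.continuous, hKr.trans_le ?_⟩
  rw [Measure.map_apply hm (hK.image hf.continuous).isClosed.measurableSet]
  exact measure_mono (subset_preimage_image f K)

theorem locallyCompactSpace_sigma {I : Type*} {X : I → Type*} [∀ i, TopologicalSpace (X i)]
    [∀ i, LocallyCompactSpace (X i)] : LocallyCompactSpace (Σ i, X i) := by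
  refine ⟨fun p n hn => ?_⟩
  obtain ⟨i, x⟩ := p
  have he : IsOpenEmbedding (Sigma.mk i : X i → Σ i, X i) := .sigmaMk
  obtain ⟨s, hs, hsn, hsc⟩ := LocallyCompactSpace.local_compact_nhds x _
    (he.continuous.continuousAt.preimage_mem_nhds hn)
  exact ⟨_, he.isOpenMap.image_mem_nhds hs, image_subset_iff.2 hsn, hsc.image he.continuous⟩

section Sigma

variable {I : Type} (G : I → HaarGroupoid.{u})

open Classical in
/-- The product of the disjoint union of groupoids. -/
noncomputable def sigmaMul (p q : Σ i, (G i).Arr) : Σ i, (G i).Arr :=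
  -- Arrows in different summands are never composable, so `p` is a harmless default.
  if h : q.1 = p.1 then ⟨p.1, (G p.1).mul p.2 (h ▸ q.2)⟩ else p

theorem sigmaMul_mk (i : I) (x y : (G i).Arr) :
    sigmaMul G ⟨i, x⟩ ⟨i, y⟩ = ⟨i, (G i).mul x y⟩ := dif_pos rfl

/-- Composable arrows lie in one summand. This removes the dependent equality, and the axioms can be
checked inside `G i`. -/
theorem exists_eq_of_sigma_eq {i k : I} {x : (G i).Arr} {y : (G k).Arr}
    (h : (⟨i, (G i).src x⟩ : Σ i, (G i).Arr) = ⟨k, (G k).rng y⟩) :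
    ∃ z : (G i).Arr, (⟨k, y⟩ : Σ i, (G i).Arr) = ⟨i, z⟩ ∧ (G i).src x = (G i).rng z := by
  obtain ⟨rfl, h⟩ := Sigma.mk.inj_iff.1 h
  exact ⟨y, rfl, eq_of_heq h⟩

theorem continuousOn_sigmaMul : ContinuousOn
    (fun p : (Σ i, (G i).Arr) × Σ i, (G i).Arr => sigmaMul G p.1 p.2)
    {p | (⟨p.1.1, (G p.1.1).src p.1.2⟩ : Σ i, (G i).Arr) = ⟨p.2.1, (G p.2.1).rng p.2.2⟩} := by
  rintro ⟨⟨i, x⟩, q⟩ h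
  obtain ⟨y, rfl, hxy⟩ : ∃ z : (G i).Arr, q = ⟨i, z⟩ ∧ (G i).src x = (G i).rng z :=
    exists_eq_of_sigma_eq G h
  let m : (G i).Arr → Σ i, (G i).Arr := fun z => ⟨i, z⟩
  have h1 : IsOpenEmbedding m := IsOpenEmbedding.sigmaMk (σ := fun i => (G i).Arr)
  have he := h1.prodMap h1
  rw [ContinuousWithinAt, show ((⟨i, x⟩, ⟨i, y⟩) : (Σ i, (G i).Arr) × Σ i, (G i).Arr)
    = Prod.map m m (x, y) from rfl, ← he.map_nhdsWithin_preimage_eq, tendsto_map'_iff]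
  have hs : Prod.map m m ⁻¹'
      {p : (Σ i, (G i).Arr) × Σ i, (G i).Arr | (⟨p.1.1, (G p.1.1).src p.1.2⟩ : Σ i, (G i).Arr)
        = ⟨p.2.1, (G p.2.1).rng p.2.2⟩} = {p | (G i).src p.1 = (G i).rng p.2} := by
    ext p; simp [m]
  rw [hs]
  have hc := h1.continuous.continuousAt.tendsto.comp ((G i).continuousOn_mul (x, y) hxy).tendsto
  simpa [Function.comp_def, sigmaMul_mk, m] using hc

/-- The disjoint union of groupoids, without its Haar system. -/
noncomputable def sigmaLC : LCGroupoid.{u} where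
  Arr := Σ i, (G i).Arr
  top := inferInstance
  lc := locallyCompactSpace_sigma
  meas := borel _
  borel := @BorelSpace.mk _ _ (borel _) rfl
  src p := ⟨p.1, (G p.1).src p.2⟩
  rng p := ⟨p.1, (G p.1).rng p.2⟩
  inv p := ⟨p.1, (G p.1).inv p.2⟩
  mul := sigmaMul G
  src_rng := by rintro ⟨i, x⟩; simp [(G i).src_rng]
  rng_src := by rintro ⟨i, x⟩; simp [(G i).rng_src]
  src_mul := by
    rintro ⟨i, x⟩ ⟨k, y⟩ h
    obtain ⟨y, e, h⟩ := exists_eq_of_sigma_eq G h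
    rw [e, sigmaMul_mk, (G i).src_mul x y h]
  rng_mul := by
    rintro ⟨i, x⟩ ⟨k, y⟩ h
    obtain ⟨y, e, h⟩ := exists_eq_of_sigma_eq G h
    rw [e, sigmaMul_mk, (G i).rng_mul x y h]
  mul_assoc := by
    rintro ⟨i, x⟩ ⟨k, y⟩ ⟨l, z⟩ h h'
    obtain ⟨y, e, h⟩ := exists_eq_of_sigma_eq G h
    rw [e] at h' ⊢
    obtain ⟨z, e', h'⟩ := exists_eq_of_sigma_eq G h'
    rw [e', sigmaMul_mk, sigmaMul_mk, sigmaMul_mk, sigmaMul_mk, (G i).mul_assoc x y z h h']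
  rng_mul_self := by rintro ⟨i, x⟩; rw [sigmaMul_mk, (G i).rng_mul_self]
  mul_src_self := by rintro ⟨i, x⟩; rw [sigmaMul_mk, (G i).mul_src_self]
  src_inv := by rintro ⟨i, x⟩; simp [(G i).src_inv]
  rng_inv := by rintro ⟨i, x⟩; simp [(G i).rng_inv]
  mul_inv := by rintro ⟨i, x⟩; rw [sigmaMul_mk, (G i).mul_inv]
  inv_mul := by rintro ⟨i, x⟩; rw [sigmaMul_mk, (G i).inv_mul]
  continuous_inv := continuous_sigma fun i => continuous_sigmaMk.comp (G i).continuous_inv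
  continuousOn_mul := continuousOn_sigmaMul G

/-- The inclusion of a groupoid into the disjoint union. -/
def sigmaMk (i : I) (x : (G i).Arr) : (sigmaLC G).Arr := ⟨i, x⟩

theorem isOpenEmbedding_sigmaMk (i : I) : IsOpenEmbedding (sigmaMk G i) :=
  IsOpenEmbedding.sigmaMk (σ := fun i => (G i).Arr)

theorem isClosedEmbedding_sigmaMk (i : I) : IsClosedEmbedding (sigmaMk G i) :=
  IsClosedEmbedding.sigmaMk (σ := fun i => (G i).Arr)

theorem sigmaMk_mul (i : I) (x y : (G i).Arr) :
    (sigmaLC G).mul (sigmaMk G i x) (sigmaMk G i y) = sigmaMk G i ((G i).mul x y) := by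
  exact sigmaMul_mk G i x y

/-- The units of the disjoint union that come from a given groupoid. -/
def sigmaUnit (i : I) (v : (G i).Units) : (sigmaLC G).Units :=
  ⟨sigmaMk G i v, congrArg (sigmaMk G i) v.2⟩

theorem isOpenEmbedding_sigmaUnit (i : I) : IsOpenEmbedding (sigmaUnit G i) := by
  refine ⟨(IsEmbedding.subtypeVal.of_comp_iff).1 ?_, ?_⟩
  · exact (isOpenEmbedding_sigmaMk G i).isEmbedding.comp .subtypeVal
  · have h : range (sigmaUnit G i) = Subtype.val ⁻¹' range (sigmaMk G i) := by
      ext ⟨d, hd⟩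
      constructor
      · rintro ⟨v, hv⟩; exact ⟨v, congrArg Subtype.val hv⟩
      · rintro ⟨x, rfl⟩
        exact ⟨⟨x, (isOpenEmbedding_sigmaMk G i).injective hd⟩, rfl⟩
    rw [h]
    exact (isOpenEmbedding_sigmaMk G i).isOpen_range.preimage continuous_subtype_val

theorem exists_eq_sigmaUnit (d : (sigmaLC G).Units) : ∃ i v, d = sigmaUnit G i v := by
  obtain ⟨⟨i, x⟩, hd⟩ := d
  exact ⟨i, ⟨x, (isOpenEmbedding_sigmaMk G i).injective hd⟩, rfl⟩

/-- The Haar system of the disjoint union. -/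
noncomputable def sigmaHaar (d : (sigmaLC G).Units) : Measure (sigmaLC G).Arr :=
  ((G d.1.1).haar ⟨d.1.2, (isOpenEmbedding_sigmaMk G d.1.1).injective d.2⟩).map (sigmaMk G d.1.1)

theorem sigmaHaar_sigmaUnit (i : I) (v : (G i).Units) :
    sigmaHaar G (sigmaUnit G i v) = ((G i).haar v).map (sigmaMk G i) := rfl

theorem integral_sigmaHaar (i : I) (v : (G i).Units) (f : (sigmaLC G).Arr → ℂ) :
    ∫ x, f x ∂(sigmaHaar G (sigmaUnit G i v)) = ∫ x, f (sigmaMk G i x) ∂((G i).haar v) :=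
  (isOpenEmbedding_sigmaMk G i).measurableEmbedding.integral_map f

/-- The restriction of a function on the disjoint union. -/
noncomputable def sigmaRestrict (i : I) (f : C_c((sigmaLC G).Arr, ℂ)) : C_c((G i).Arr, ℂ) where
  toFun x := f (sigmaMk G i x)
  continuous_toFun := f.continuous.comp (isOpenEmbedding_sigmaMk G i).continuous
  hasCompactSupport' := f.hasCompactSupport.comp_isClosedEmbedding (isClosedEmbedding_sigmaMk G i)

/-- The disjoint union of groupoids. -/
noncomputable def sigmaGroupoid : HaarGroupoid.{u} where
  toLCGroupoid := sigmaLC G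
  haar := sigmaHaar G
  regular d := regular_map_of_isProperMap (isClosedEmbedding_sigmaMk G d.1.1).isProperMap _
  haar_compl_fibre d := by
    obtain ⟨i, v, rfl⟩ := exists_eq_sigmaUnit G d
    rw [sigmaHaar_sigmaUnit, (isOpenEmbedding_sigmaMk G i).measurableEmbedding.map_apply]
    refine measure_mono_null (fun x hx => ?_) ((G i).haar_compl_fibre v)
    exact fun h => hx (congrArg (sigmaMk G i) h)
  haar_pos d V hV := by
    obtain ⟨i, v, rfl⟩ := exists_eq_sigmaUnit G d
    rintro ⟨⟨k, x⟩, hxV, hx⟩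
    obtain ⟨rfl, hx⟩ := Sigma.mk.inj_iff.1 hx
    rw [sigmaHaar_sigmaUnit, (isOpenEmbedding_sigmaMk G k).measurableEmbedding.map_apply]
    exact (G k).haar_pos v _ (hV.preimage (isOpenEmbedding_sigmaMk G k).continuous)
      ⟨x, hxV, eq_of_heq hx⟩
  continuous_haar f := by
    rw [continuous_iff_continuousAt]
    intro d
    obtain ⟨i, v, rfl⟩ := exists_eq_sigmaUnit G d
    rw [← (isOpenEmbedding_sigmaUnit G i).continuousAt_iff]
    refine ((G i).continuous_haar (sigmaRestrict G i f)).continuousAt.congr (.of_forall fun w => ?_)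
    exact (integral_sigmaHaar G i w f).symm
  haar_mul_left f x := by
    obtain ⟨i, x⟩ := x
    change ∫ y, f y ∂(sigmaHaar G (sigmaUnit G i ((G i).rngU x)))
      = ∫ y, f ((sigmaLC G).mul (sigmaMk G i x) y) ∂(sigmaHaar G (sigmaUnit G i ((G i).srcU x)))
    rw [integral_sigmaHaar, integral_sigmaHaar]
    simp_rw [sigmaMk_mul]
    exact (G i).haar_mul_left (sigmaRestrict G i f) x

/-- The inclusion of a groupoid into the disjoint union, as a partial morphism. -/
noncomputable def sigmaInclusion (i : I) : PartialMorphism (G i) (sigmaGroupoid G) where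
  toPFun := PFun.lift (sigmaMk G i)
  isOpen_dom := isOpen_univ
  inv_mem _ _ := trivial
  map_mul x y x' y' hx hy h := by
    obtain rfl := Part.mem_some_iff.1 hx
    obtain rfl := Part.mem_some_iff.1 hy
    refine ⟨congrArg (sigmaMk G i) h, ?_⟩
    exact Part.mem_some_iff.2 (sigmaMk_mul G i x y)
  isProper := by
    have h := (isClosedEmbedding_sigmaMk G i).isProperMap.comp
      (isClosed_univ (X := (G i).Arr)).isProperMap_subtypeVal
    exact h
  map_haar v d h S hS := by
    obtain rfl : d = sigmaUnit G i v := Subtype.ext (Part.mem_some_iff.1 h)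
    refine Eq.trans ?_ ((isOpenEmbedding_sigmaMk G i).measurableEmbedding.map_apply _ S).symm
    exact congrArg ((G i).haar v) (PFun.coe_preimage _ _)

theorem isDisjointUnion_sigmaGroupoid :
    IsDisjointUnion G (sigmaGroupoid G) (sigmaInclusion G) where
  dom_eq _ := rfl
  isOpenEmbedding i := (isOpenEmbedding_sigmaMk G i).comp isOpen_univ.isOpenEmbedding_subtypeVal
  disjoint i k hik := by
    refine Set.disjoint_left.2 ?_
    rintro d ⟨x, hx⟩ ⟨y, hy⟩
    have h := (Part.mem_some_iff.1 hx).symm.trans (Part.mem_some_iff.1 hy)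
    exact hik (Sigma.mk.inj_iff.1 h).1
  covers := by
    refine Set.eq_univ_of_forall fun ⟨i, x⟩ => Set.mem_iUnion.2 ⟨i, x, ?_⟩
    exact Part.mem_some_iff.2 rfl

end Sigma

/-! ### Finite sums -/

/-- The partial morphism with empty domain. -/
def PartialMorphism.empty (G H : HaarGroupoid.{u}) : PartialMorphism G H where
  toPFun _ := Part.none
  isOpen_dom := by
    have h : PFun.Dom (fun _ : G.Arr => (Part.none : Part H.Arr)) = ∅ :=
      Set.eq_empty_of_forall_notMem fun _ h => h
    rw [h]
    exact isOpen_empty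
  inv_mem _ h := h.elim
  map_mul _ _ _ _ h := (Part.notMem_none _ h).elim
  isProper := by
    have : IsEmpty (PFun.Dom fun _ : G.Arr => (Part.none : Part H.Arr)) := ⟨fun x => x.2⟩
    rw [isProperMap_iff_isCompact_preimage]
    exact ⟨continuous_of_discreteTopology, fun _ _ => (Set.finite_empty.subset fun x =>
      (this.false x).elim).isCompact⟩
  map_haar _ _ h := (Part.notMem_none _ h).elim

theorem PartialMorphism.pullCc_empty {G H : HaarGroupoid.{u}} (f : C_c(H.Arr, ℂ)) :
    (PartialMorphism.empty G H).pullCc f = 0 := by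
  ext x
  exact pullFun_of_notMem _ f fun h => h

namespace IsDisjointUnion

variable {I : Type} {G : I → HaarGroupoid.{u}} {D : HaarGroupoid.{u}}
  {j : ∀ i, PartialMorphism (G i) D} (h : IsDisjointUnion G D j)

include h

/-- Trades the everywhere defined partial maps for ordinary injections with disjoint images covering
`D`. -/
theorem exists_embedding : ∃ e : ∀ i, (G i).Arr → D.Arr, (∀ i x d, d ∈ (j i).toPFun x ↔ d = e i x) ∧
    (∀ i, IsOpenEmbedding (e i)) ∧ (∀ d, ∃ i x, d = e i x) ∧
    ∀ i k x y, e i x = e k y → (⟨i, x⟩ : Σ i, (G i).Arr) = ⟨k, y⟩ := by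
  have hd : ∀ i (x : (G i).Arr), x ∈ (j i).toPFun.Dom := fun i x => by
    rw [h.dom_eq]; trivial
  have he : ∀ i x d, d ∈ (j i).toPFun x ↔ d = (j i).toPFun.fn x (hd i x) := fun i x d =>
    ⟨fun hm => (Part.get_eq_of_mem hm _).symm, fun hm => hm ▸ Part.get_mem _⟩
  have hopen : ∀ i, IsOpenEmbedding fun x => (j i).toPFun.fn x (hd i x) := fun i => by
    have h1 := (h.isOpenEmbedding i).comp
      ((Homeomorph.setCongr (h.dom_eq i)).symm.isOpenEmbedding.comp
        (Homeomorph.Set.univ (G i).Arr).symm.isOpenEmbedding)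
    exact h1
  refine ⟨fun i x => (j i).toPFun.fn x (hd i x), he, hopen, fun d => ?_, fun i k x y hxy => ?_⟩
  · have h1 : d ∈ ⋃ i, (j i).toPFun.ran := by rw [h.covers]; trivial
    obtain ⟨i, x, hx⟩ := Set.mem_iUnion.1 h1
    exact ⟨i, x, (he i x d).1 hx⟩
  · by_cases hik : i = k
    · subst hik
      rw [(hopen i).injective hxy]
    · refine (Set.disjoint_left.1 (h.disjoint hik) (?_ : (j i).toPFun.fn x (hd i x) ∈ _) ?_).elim
      · exact ⟨x, (he i x _).2 rfl⟩
      · exact ⟨y, (he k y _).2 hxy⟩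

/-- The maps `k i` are glued along the summands. The result is proper because the preimage of a
compact set is a finite union of compact sets. -/
theorem exists_desc [Finite I] {X : HaarGroupoid.{u}} (k : ∀ i, PartialMorphism (G i) X) :
    ∃ φ : PartialMorphism D X, ∀ i x d, d ∈ (j i).toPFun x → φ.toPFun d = (k i).toPFun x := by
  obtain ⟨e, he, hopen, hcov, hinj⟩ := h.exists_embedding
  choose p q hpq using hcov
  let f : D.Arr →. X.Arr := fun d => (k (p d)).toPFun (q d)
  have hf : ∀ i x, f (e i x) = (k i).toPFun x := fun i x => by
    have h1 := hinj _ _ _ _ (hpq (e i x))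
    exact (congrArg (fun s : Σ i, (G i).Arr => (k s.1).toPFun s.2) h1).symm
  have hpre : ∀ S, f.preimage S = ⋃ i, e i '' (k i).toPFun.preimage S := fun S => by
    ext d
    simp only [PFun.mem_preimage, Set.mem_iUnion, Set.mem_image]
    constructor
    · intro hd
      exact ⟨p d, q d, hd, (hpq d).symm⟩
    · rintro ⟨i, x, hx, rfl⟩
      rwa [hf]
  have hpre' : ∀ i S, e i ⁻¹' f.preimage S = (k i).toPFun.preimage S := fun i S => by
    ext x
    simp only [Set.mem_preimage, PFun.mem_preimage, hf]
  have hdom : f.Dom = ⋃ i, e i '' (k i).toPFun.Dom := by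
    rw [← PFun.preimage_univ, hpre]
    simp_rw [PFun.preimage_univ]
  have hdom' : ∀ i x, e i x ∈ f.Dom ↔ x ∈ (k i).toPFun.Dom := fun i x => by
    change (f (e i x)).Dom ↔ _
    rw [hf]
    rfl
  have hrng : ∀ i x, D.rng (e i x) = e i ((G i).rng x) := fun i x =>
    (he i _ _).1 ((j i).map_rng ((he i x _).2 rfl))
  have hsrc : ∀ i x, D.src (e i x) = e i ((G i).src x) := fun i x =>
    (he i _ _).1 ((j i).map_src ((he i x _).2 rfl))
  refine ⟨⟨f, ?_, ?_, ?_, ?_, ?_⟩, fun i x d hd => ?_⟩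
  · rw [hdom]
    exact isOpen_iUnion fun i => (hopen i).isOpenMap _ (k i).isOpen_dom
  · intro d hd
    obtain ⟨i, x, rfl⟩ : ∃ i x, d = e i x := ⟨_, _, hpq d⟩
    rw [(he i _ _).1 ((j i).map_inv ((he i x _).2 rfl)), hdom']
    exact (k i).inv_mem x ((hdom' i x).1 hd)
  · intro d d' x' y' hx hy hs
    obtain ⟨i, x, rfl⟩ : ∃ i x, d = e i x := ⟨_, _, hpq d⟩
    obtain ⟨l, y, rfl⟩ : ∃ i x, d' = e i x := ⟨_, _, hpq d'⟩
    rw [hsrc, hrng] at hs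
    obtain ⟨rfl, hs⟩ := Sigma.mk.inj_iff.1 (hinj _ _ _ _ hs)
    replace hs := eq_of_heq hs
    rw [hf] at hx hy
    have h1 := (he i _ _).1 ((j i).map_mul x y _ _ ((he i x _).2 rfl) ((he i y _).2 rfl) hs).2
    rw [h1, hf]
    exact (k i).map_mul x y x' y' hx hy hs
  · rw [isProperMap_iff_isCompact_preimage]
    constructor
    · refine continuous_def.2 fun V hV => ?_
      rw [PFun.preimage_asSubtype, hpre]
      exact (isOpen_iUnion fun i => (hopen i).isOpenMap _ ((k i).isOpen_preimage hV)).preimage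
        continuous_subtype_val
    · intro K hK
      rw [PFun.preimage_asSubtype, Subtype.isCompact_iff, Subtype.image_preimage_coe,
        inter_eq_right.2 (PFun.preimage_subset_dom _ _), hpre]
      exact isCompact_iUnion fun i => ((k i).isCompact_preimage hK).image (hopen i).continuous
  · rintro ⟨d, hd⟩ v hv S hS
    obtain ⟨i, x, rfl⟩ : ∃ i x, d = e i x := ⟨_, _, hpq d⟩
    have hx : (G i).rng x = x := (hopen i).injective (by rw [← hrng, hd])
    have hm : MeasurableSet (f.preimage S) := by
      rw [hpre]
      exact .iUnion fun i => (hopen i).measurableEmbedding.measurableSet_image.2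
        ((k i).measurableSet_preimage hS)
    -- The Haar measure of `D` at a unit of the `i`-th summand is the image of that of `G i`, so the
    -- claim reduces to the axiom for `k i`.
    rw [← (j i).map_haar ⟨x, hx⟩ ⟨_, hd⟩ ((he i x _).2 rfl) _ hm]
    have h1 : (j i).toPFun.preimage (f.preimage S) = (k i).toPFun.preimage S := by
      rw [← hpre' i]
      ext y
      simp [PFun.mem_preimage, he]
    rw [h1]
    refine (k i).map_haar ⟨x, hx⟩ v ?_ S hS
    rw [← hf]
    exact hv
  · rw [(he i x d).1 hd]
    exact hf i x

theorem hom_ext {X : HaarGroupoid.{u}} {φ ψ : D ⟶ X}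
    (hφ : ∀ i, (show G i ⟶ D from j i) ≫ φ = (show G i ⟶ D from j i) ≫ ψ) : φ = ψ := by
  obtain ⟨e, he, -, hcov, -⟩ := h.exists_embedding
  refine PartialMorphism.ext (funext fun d => ?_)
  obtain ⟨i, x, rfl⟩ := hcov d
  have h1 : ∀ ρ : D ⟶ X, ((show G i ⟶ D from j i) ≫ ρ : PartialMorphism _ _).toPFun x
      = PartialMorphism.toPFun ρ (e i x) := fun ρ => by
    change ((j i).toPFun x).bind (PartialMorphism.toPFun ρ) = _
    have h2 : (j i).toPFun x = Part.some (e i x) := Part.eq_some_iff.2 ((he i x _).2 rfl)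
    rw [h2]
    exact Part.bind_some _ _
  rw [← h1, ← h1, hφ]

theorem exists_comp_eq [Finite I] {X : HaarGroupoid.{u}} (k : ∀ i, G i ⟶ X) :
    ∃ φ : D ⟶ X, ∀ i, (show G i ⟶ D from j i) ≫ φ = k i := by
  obtain ⟨φ, hφ⟩ := h.exists_desc k
  obtain ⟨e, he, -, -, -⟩ := h.exists_embedding
  refine ⟨φ, fun i => PartialMorphism.ext (funext fun x => ?_)⟩
  change ((j i).toPFun x).bind φ.toPFun = (k i).toPFun x
  have h2 : (j i).toPFun x = Part.some (e i x) := Part.eq_some_iff.2 ((he i x _).2 rfl)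
  rw [h2, ← hφ i x _ ((he i x _).2 rfl)]
  exact Part.bind_some _ _

end IsDisjointUnion

/-- A disjoint union is a categorical sum of groupoids. -/
theorem IsDisjointUnion.nonempty_isLimit {I : Type} [Finite I] {G : I → HaarGroupoid.{u}}
    {D : HaarGroupoid.{u}} {j : ∀ i, G i ⟶ D} (h : IsDisjointUnion G D j) :
    Nonempty (IsLimit (Fan.mk (op D) fun i => (j i).op : Fan fun i => op (G i))) := by
  choose l hl using fun (s : Fan fun i => op (G i)) =>
    h.exists_comp_eq (X := s.pt.unop) fun i => (s.proj i).unop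
  refine ⟨Fan.IsLimit.mk _ (fun s => (l s).op) (fun s i => ?_) fun s m hm => ?_⟩
  · exact congrArg Quiver.Hom.op (hl s i)
  · refine Quiver.Hom.unop_inj (h.hom_ext fun i => ?_)
    exact (congrArg Quiver.Hom.unop (hm i)).trans (hl s i).symm

/-- A lift is determined in each coordinate, and its algebraic laws are verified there. No
continuity has to be checked, since the morphisms are arbitrary `*`-homomorphisms. -/
theorem CStarAlg.nonempty_isLimit_of_bijective {I : Type} {A : I → CStarAlg.{u}} {P : CStarAlg.{u}}
    (p : ∀ i, P ⟶ A i)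
    (hp : Function.Bijective fun (a : P) (i : I) => CStarAlg.starHom (p i) a) :
    Nonempty (IsLimit (Fan.mk P p)) := by
  have hl : ∀ s : Fan A, ∃ l : s.pt →⋆ₙₐ[ℂ] P, ∀ b i,
      CStarAlg.starHom (p i) (l b) = CStarAlg.starHom (s.proj i) b := by
    intro s
    choose l hl using fun b : s.pt => hp.2 fun i => CStarAlg.starHom (s.proj i) b
    have hl' : ∀ b i, CStarAlg.starHom (p i) (l b) = CStarAlg.starHom (s.proj i) b :=
      fun b i => congrFun (hl b) i
    have hi : ∀ a b : P, (∀ i, CStarAlg.starHom (p i) a = CStarAlg.starHom (p i) b) → a = b :=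
      fun a b hab => hp.1 (funext hab)
    refine ⟨{ toFun := l, map_smul' := fun c b => ?_, map_zero' := ?_, map_add' := fun a b => ?_,
              map_mul' := fun a b => ?_, map_star' := fun a => ?_ }, hl'⟩
    · exact hi _ _ fun i => by rw [map_smul, hl', hl']; exact map_smul _ _ _
    · exact hi _ _ fun i => by rw [hl', map_zero, map_zero]
    · exact hi _ _ fun i => by rw [map_add, hl', hl', hl', map_add]
    · exact hi _ _ fun i => by rw [map_mul, hl', hl', hl', map_mul]
    · exact hi _ _ fun i => by rw [map_star, hl', hl', map_star]
  choose l hl using hl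
  refine ⟨Fan.IsLimit.mk _ (fun s => l s) (fun s i => ?_) fun s m hm => ?_⟩
  · exact NonUnitalStarAlgHom.ext fun b => hl s b i
  · refine NonUnitalStarAlgHom.ext fun b => hp.1 (funext fun i => ?_)
    exact (DFunLike.congr_fun (F := s.pt →⋆ₙₐ[ℂ] A i) (hm i) b).trans (hl s b i).symm

namespace IsCompletionFunctor

variable {N : ∀ G : HaarGroupoid.{u}, C_c(G.Arr, ℂ) → ℝ≥0∞} {Γ : HaarGroupoid.{u}ᵒᵖ ⥤ CStarAlg.{u}}
  {ι : ∀ G : HaarGroupoid.{u}, C_c(G.Arr, ℂ) →ₗ[ℂ] (Γ.obj (op G) : Type u)}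

theorem bijective_of_isDisjointUnion (hΓ : IsCompletionFunctor N Γ ι) {I : Type} [Finite I]
    {G : I → HaarGroupoid.{u}} {D : HaarGroupoid.{u}} {j : ∀ i, G i ⟶ D}
    (h : IsDisjointUnion G D j) :
    Function.Bijective fun (a : Γ.obj (op D)) (i : I) => CStarAlg.starHom (Γ.map (j i).op) a := by
  classical
  have := Fintype.ofFinite I
  -- `ψ i` is the identity on the `i`-th summand and undefined on the others. Such a retraction
  -- exists only because morphisms may be partial.
  have hψ : ∀ i, ∃ ψ : D ⟶ G i, j i ≫ ψ = 𝟙 (G i) ∧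
      ∀ k, k ≠ i → j k ≫ ψ = PartialMorphism.empty (G k) (G i) := fun i => by
    obtain ⟨ψ, hψ⟩ := h.exists_comp_eq (X := G i) fun k =>
      if hk : k = i then eqToHom (congrArg G hk) else PartialMorphism.empty (G k) (G i)
    refine ⟨ψ, ?_, fun k hk => ?_⟩
    · exact (hψ i).trans (dif_pos rfl)
    · exact (hψ k).trans (dif_neg hk)
  choose ψ hψ1 hψ2 using hψ
  have hcomp : ∀ {X Y Z : HaarGroupoid.{u}} (φ : X ⟶ Y) (χ : Y ⟶ Z) a,
      CStarAlg.starHom (Γ.map φ.op) (CStarAlg.starHom (Γ.map χ.op) a)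
        = CStarAlg.starHom (Γ.map (φ ≫ χ).op) a := fun φ χ a => by
    rw [op_comp, Γ.map_comp]
    rfl
  have h1 : ∀ i b, CStarAlg.starHom (Γ.map (j i).op) (CStarAlg.starHom (Γ.map (ψ i).op) b) = b :=
    fun i b => by
      rw [hcomp, hψ1, op_id, Γ.map_id]
      rfl
  have h2 : ∀ i k, k ≠ i → ∀ b,
      CStarAlg.starHom (Γ.map (j k).op) (CStarAlg.starHom (Γ.map (ψ i).op) b) = 0 :=
    fun i k hk b => by
      rw [hcomp, hψ2 i k hk]
      have h3 : Γ.map (show G k ⟶ G i from PartialMorphism.empty (G k) (G i)).op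
          = (0 : Γ.obj (op (G i)) →⋆ₙₐ[ℂ] Γ.obj (op (G k))) := hΓ.hom_ext fun f => by
        rw [hΓ.map_induced, PartialMorphism.pullCc_empty, map_zero]
        rfl
      rw [h3]
      rfl
  -- On `C_c(D)` this says that a function is the sum of its restrictions to the summands, extended
  -- by zero. Density and continuity do the rest.
  have h3 : ∀ a, ∑ i, CStarAlg.starHom (Γ.map (ψ i).op) (CStarAlg.starHom (Γ.map (j i).op) a) = a := by
    intro a
    have hc : Continuous fun a => ∑ i, CStarAlg.starHom (Γ.map (ψ i).op)
        (CStarAlg.starHom (Γ.map (j i).op) a) := continuous_finsetSum _ fun i _ =>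
      (starHom_continuous _).comp (starHom_continuous _)
    refine congrFun (hc.ext_on (hΓ.denseRange D) continuous_id ?_) a
    rintro _ ⟨f, rfl⟩
    simp_rw [hcomp, hΓ.map_induced, ← map_sum]
    congr 1
    have hj : ∀ k, PartialMorphism.pullCc (j k) (∑ i, PartialMorphism.pullCc (ψ i ≫ j i) f)
        = PartialMorphism.pullCc (j k) f := fun k => by
      change PartialMorphism.pullₗ (j k) _ = _
      rw [map_sum]
      simp only [PartialMorphism.pullₗ_apply, PartialMorphism.pullCc_comp]
      rw [Finset.sum_eq_single k]
      · rw [← PartialMorphism.pullCc_comp, hψ1, PartialMorphism.pullCc_id]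
      · intro i _ hi
        rw [← PartialMorphism.pullCc_comp, hψ2 i k hi.symm, PartialMorphism.pullCc_empty]
      · simp
    obtain ⟨e, he, -, hcov, -⟩ := h.exists_embedding
    ext d
    obtain ⟨i, x, rfl⟩ := hcov d
    have h4 := DFunLike.congr_fun (hj i) x
    rwa [PartialMorphism.pullCc_apply, PartialMorphism.pullCc_apply,
      PartialMorphism.pullFun_of_mem _ _ ((he i x _).2 rfl),
      PartialMorphism.pullFun_of_mem _ _ ((he i x _).2 rfl)] at h4
  refine ⟨fun a b hab => ?_, fun b => ⟨∑ i, CStarAlg.starHom (Γ.map (ψ i).op) (b i),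
    funext fun k => ?_⟩⟩
  · rw [← h3 a, ← h3 b]
    exact Finset.sum_congr rfl fun i _ => congrArg _ (congrFun hab i)
  · change CStarAlg.starHom (Γ.map (j k).op) _ = b k
    rw [map_sum, Finset.sum_eq_single k, h1]
    · exact fun i _ hi => h2 i k hi.symm _
    · simp

/-- Preservation may be tested on one limit cone for each diagram, and `sigmaGroupoid` provides one
whose image is a direct sum. -/
theorem respectsFiniteSums (hΓ : IsCompletionFunctor N Γ ι) : RespectsFiniteSums Γ := by
  refine ⟨fun I _ G D j h => hΓ.bijective_of_isDisjointUnion h, ⟨fun n => ⟨fun {K} => ?_⟩⟩⟩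
  have h := isDisjointUnion_sigmaGroupoid fun i : Fin n => (K.obj ⟨i⟩).unop
  obtain ⟨hl⟩ := h.nonempty_isLimit
  obtain ⟨hl'⟩ := CStarAlg.nonempty_isLimit_of_bijective _ (hΓ.bijective_of_isDisjointUnion h)
  have : PreservesLimit (Discrete.functor (K.obj ∘ Discrete.mk)) Γ :=
    preservesLimit_of_preserves_limit_cone hl ((isLimitMapConeFanMkEquiv _ _ _).symm hl')
  exact preservesLimit_of_iso_diagram Γ (Discrete.natIsoFunctor (F := K)).symm

end IsCompletionFunctor

/-! ### Spaces -/

/-- A compactly supported continuous function as a function vanishing at infinity. -/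
noncomputable def toC0 (X : Type*) [TopologicalSpace X] : C_c(X, ℂ) →ₗ[ℂ] C₀(X, ℂ) where
  toFun f := ⟨⟨f, f.continuous⟩, f.hasCompactSupport.is_zero_at_infty⟩
  map_add' _ _ := rfl
  map_smul' _ _ := rfl

theorem norm_toC0_le {X : Type*} [TopologicalSpace X] (f : C₀(X, ℂ)) {c : ℝ} (hc : 0 ≤ c)
    (h : ∀ x, ‖f x‖ ≤ c) : ‖f‖ ≤ c := by
  rw [← ZeroAtInftyContinuousMap.norm_toBCF_eq_norm]
  exact (BoundedContinuousFunction.norm_le hc).2 h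

theorem norm_apply_le_norm {X : Type*} [TopologicalSpace X] (f : C₀(X, ℂ)) (x : X) :
    ‖f x‖ ≤ ‖f‖ := by
  rw [← ZeroAtInftyContinuousMap.norm_toBCF_eq_norm]
  exact f.toBCF.norm_coe_le_norm x

theorem denseRange_toC0 (X : Type*) [TopologicalSpace X] [T2Space X] [LocallyCompactSpace X] :
    DenseRange (toC0 X) := by
  refine Metric.dense_iff.2 fun f ε hε => ?_
  have h0 := zero_at_infty f
  rw [Metric.tendsto_nhds] at h0
  obtain ⟨K, hK, hKs⟩ := mem_cocompact.1 (h0 (ε / 2) (half_pos hε))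
  obtain ⟨ψ, hψ1, -, hψc, hψ⟩ := exists_continuous_one_zero_of_isCompact hK isClosed_empty
    (disjoint_empty _)
  let k : C_c(X, ℂ) := ⟨⟨fun x => (ψ x : ℂ) * f x,
    (Complex.continuous_ofReal.comp ψ.continuous).mul f.continuous⟩,
    HasCompactSupport.mul_right (hψc.comp_left (g := fun t : ℝ => (t : ℂ)) Complex.ofReal_zero)⟩
  refine ⟨toC0 X k, ?_, k, rfl⟩
  rw [Metric.mem_ball, dist_eq_norm]
  refine (norm_toC0_le _ (half_pos hε).le fun x => ?_).trans_lt (half_lt_self hε)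
  have e : (toC0 X k - f) x = ((ψ x : ℂ) - 1) * f x := by
    rw [ZeroAtInftyContinuousMap.sub_apply]
    change (ψ x : ℂ) * f x - f x = _
    ring
  rw [e, norm_mul]
  by_cases hx : x ∈ K
  · rw [hψ1 hx]
    simpa using (half_pos hε).le
  · have h1 : ‖f x‖ < ε / 2 := by simpa using hKs hx
    have h2 : ‖(ψ x : ℂ) - 1‖ ≤ 1 := by
      rw [← Complex.ofReal_one, ← Complex.ofReal_sub, Complex.norm_real, Real.norm_eq_abs, abs_le]
      constructor <;> linarith [(hψ x).1, (hψ x).2]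
    calc _ ≤ 1 * ‖f x‖ := by gcongr
      _ ≤ ε / 2 := by linarith

namespace IsSpace

variable {X : HaarGroupoid.{u}}

theorem src_eq (hX : IsSpace X) (x : X.Arr) : X.src x = x := X.src_eq_of_unit (hX.1 x)

theorem inv_eq (hX : IsSpace X) (x : X.Arr) : X.inv x = x := by
  rw [← hX.1 (X.inv x), X.rng_inv, hX.src_eq]

theorem mul_self (hX : IsSpace X) (x : X.Arr) : X.mul x x = x := by
  have h := X.rng_mul_self x
  rwa [hX.1] at h

theorem adj_apply (hX : IsSpace X) (f : C_c(X.Arr, ℂ)) (x : X.Arr) : X.adj f x = star (f x) := by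
  rw [HaarGroupoid.adj_apply, hX.inv_eq]

theorem conv_apply (hX : IsSpace X) (f g : C_c(X.Arr, ℂ)) (x : X.Arr) :
    X.conv f g x = f x * g x := by
  rw [HaarGroupoid.conv_apply_of_rng f g (u := ⟨x, hX.1 x⟩) (hX.1 x), hX.2, integral_dirac,
    hX.inv_eq, hX.mul_self]

theorem norm_toL2 (hX : IsSpace X) (u : X.Units) (f : C_c(X.Arr, ℂ)) : ‖X.toL2 u f‖ = ‖f u‖ := by
  have h : (‖X.toL2 u f‖ : ℂ) ^ 2 = (‖f u‖ : ℂ) ^ 2 := by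
    refine (inner_self_eq_norm_sq_to_K (𝕜 := ℂ) (X.toL2 u f)).symm.trans ?_
    rw [HaarGroupoid.inner_toL2, hX.conv_apply, hX.adj_apply]
    exact Complex.conj_mul' _
  have h2 : ‖X.toL2 u f‖ ^ 2 = ‖f u‖ ^ 2 := by exact_mod_cast h
  exact (sq_eq_sq₀ (norm_nonneg _) (norm_nonneg _)).1 h2

/-- At the unit `x` the Haar measure is a point mass and `f` acts as multiplication by `f x`, as
seen on a function with value 1 at `x`. -/
theorem norm_apply_le (hX : IsSpace X) (f : C_c(X.Arr, ℂ)) (x : X.Arr) : ‖f x‖ ≤ X.rnormMin f := by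
  obtain ⟨g, hg⟩ := exists_Cc_eqOn (Z := X.Arr) (C := {x}) (L := {x}) (F := fun _ => 1)
    isClosed_singleton isCompact_singleton continuousOn_const fun z hz hz' => (hz' hz).elim
  have h := HaarGroupoid.norm_toL2_conv_le_rnormMin ⟨x, hX.1 x⟩ f g
  rw [hX.norm_toL2, hX.norm_toL2, hX.conv_apply] at h
  simpa [hg x rfl] using h

theorem normI_le (hX : IsSpace X) (f : C_c(X.Arr, ℂ)) : X.normI f ≤ ‖toC0 X.Arr f‖ₑ := by
  have h : ∀ x, ‖f x‖ₑ ≤ ‖toC0 X.Arr f‖ₑ := fun x =>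
    enorm_le_iff_norm_le.2 (norm_apply_le_norm (toC0 X.Arr f) x)
  refine max_le (iSup_le fun u => ?_) (iSup_le fun u => ?_)
  · rw [hX.2, lintegral_dirac]
    exact h _
  · rw [hX.2, lintegral_dirac]
    exact h _

/-- The minimal norm and the `I`-norm both agree with the uniform norm, so everything between them
does. This covers both functors at once. -/
theorem norm_toC0 (hX : IsSpace X) (f : C_c(X.Arr, ℂ)) {N : ℝ≥0∞} (h1 : X.normMin f ≤ N)
    (h2 : N ≤ X.normI f) : ‖toC0 X.Arr f‖ₑ = N := by
  refine le_antisymm (le_trans ?_ h1) (h2.trans (hX.normI_le f))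
  rw [← ENNReal.ofReal_toReal (HaarGroupoid.normMin_ne_top f), ← ofReal_norm]
  exact ENNReal.ofReal_le_ofReal (norm_toC0_le _ (HaarGroupoid.rnormMin_nonneg f) (hX.norm_apply_le f))

end IsSpace

namespace IsCompletionFunctor

variable {N : ∀ G : HaarGroupoid.{u}, C_c(G.Arr, ℂ) → ℝ≥0∞} {Γ : HaarGroupoid.{u}ᵒᵖ ⥤ CStarAlg.{u}}
  {ι : ∀ G : HaarGroupoid.{u}, C_c(G.Arr, ℂ) →ₗ[ℂ] (Γ.obj (op G) : Type u)}

theorem exists_iso_c0 (hΓ : IsCompletionFunctor N Γ ι)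
    (hmin : ∀ (G : HaarGroupoid.{u}) f, G.normMin f ≤ N G f)
    (hI : ∀ (G : HaarGroupoid.{u}) f, N G f ≤ G.normI f) {X : HaarGroupoid.{u}} (hX : IsSpace X) :
    ∃ e : Γ.obj (op X) ≅ c0Functor.obj (op X),
      ∀ f, CStarAlg.starHom e.hom (ι X f) = toC0 X.Arr f := by
  have hn : ∀ f, ‖toC0 X.Arr f‖ = ‖ι X f‖ := fun f => by
    rw [← toReal_enorm, ← toReal_enorm, hX.norm_toC0 f (hmin X f) (hI X f), hΓ.enorm_eq]
  have hm : ∀ f g, toC0 X.Arr (X.conv f g) = toC0 X.Arr f * toC0 X.Arr g := fun f g =>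
    ZeroAtInftyContinuousMap.ext fun x => hX.conv_apply f g x
  have hs : ∀ f, toC0 X.Arr (X.adj f) = star (toC0 X.Arr f) := fun f =>
    ZeroAtInftyContinuousMap.ext fun x => hX.adj_apply f x
  obtain ⟨φ, hφ⟩ := exists_starHom_extend (hΓ.denseRange X) (hΓ.map_conv X) (hΓ.map_adj X) hm hs
    fun f => (hn f).le
  obtain ⟨ψ, hψ⟩ := exists_starHom_extend (denseRange_toC0 X.Arr) hm hs (hΓ.map_conv X)
    (hΓ.map_adj X) fun f => (hn f).ge
  refine ⟨⟨φ, ψ, ?_, ?_⟩, hφ⟩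
  · refine starHom_ext_of_denseRange (φ := ψ.comp φ) (ψ := NonUnitalStarAlgHom.id ℂ _)
      (hΓ.denseRange X) fun f => ?_
    rw [NonUnitalStarAlgHom.comp_apply, hφ, hψ]
    rfl
  · refine starHom_ext_of_denseRange (φ := φ.comp ψ) (ψ := NonUnitalStarAlgHom.id ℂ C₀(X.Arr, ℂ))
      (denseRange_toC0 X.Arr) fun f => ?_
    rw [NonUnitalStarAlgHom.comp_apply, hψ, hφ]
    rfl

theorem extendsGelfand (hΓ : IsCompletionFunctor N Γ ι)
    (hmin : ∀ (G : HaarGroupoid.{u}) f, G.normMin f ≤ N G f)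
    (hI : ∀ (G : HaarGroupoid.{u}) f, N G f ≤ G.normI f) : ExtendsGelfand Γ ι := by
  choose e he using fun X : IsSpace.{u}.FullSubcategory => hΓ.exists_iso_c0 hmin hI X.property
  refine ⟨NatIso.ofComponents (fun X => e X.unop) fun {X Y} φ => ?_, fun X f x => ?_⟩
  · refine hΓ.hom_ext fun f => ?_
    have h1 : CStarAlg.starHom ((IsSpace.ι.op ⋙ Γ).map φ ≫ (e Y.unop).hom) (ι X.unop.obj f)
        = CStarAlg.starHom (e Y.unop).hom
          (CStarAlg.starHom (Γ.map (IsSpace.ι.map φ.unop).op) (ι X.unop.obj f)) := rfl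
    have h2 : CStarAlg.starHom ((e X.unop).hom ≫ (IsSpace.ι.op ⋙ c0Functor).map φ)
        (ι X.unop.obj f) = PartialMorphism.pullC0 (IsSpace.ι.map φ.unop)
          (CStarAlg.starHom (e X.unop).hom (ι X.unop.obj f)) := rfl
    refine h1.trans (Eq.trans ?_ h2.symm)
    have h3 := hΓ.map_induced _ _ (IsSpace.ι.map φ.unop) f
    rw [he]
    exact (congrArg _ h3).trans (he _ _)
  · exact congrArg (fun k : C₀(X.obj.Arr, ℂ) => k x) (he X f)

end IsCompletionFunctor

/-! ### Gelfand duality -/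

theorem continuous_extend_zero {X Z : Type*} [TopologicalSpace X] [TopologicalSpace Z] [T2Space Z]
    {e : X → Z} (he : IsOpenEmbedding e) (h : C₀(X, ℂ)) : Continuous (Function.extend e h 0) := by
  rw [continuous_iff_continuousAt]
  intro z
  by_cases hz : z ∈ range e
  · obtain ⟨x, rfl⟩ := hz
    rw [← he.continuousAt_iff]
    have h1 : Function.extend e h 0 ∘ e = h := funext fun y => he.injective.extend_apply _ _ _
    rw [h1]
    exact h.continuous.continuousAt
  · rw [ContinuousAt, Function.extend_apply' _ _ _ (fun hh => hz hh), Metric.tendsto_nhds]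
    intro ε hε
    have h0 := zero_at_infty h
    rw [Metric.tendsto_nhds] at h0
    obtain ⟨K, hK, hKs⟩ := mem_cocompact.1 (h0 ε hε)
    have hz' : z ∉ e '' K := fun hh => hz (image_subset_range _ _ hh)
    filter_upwards [(hK.image he.continuous).isClosed.isOpen_compl.mem_nhds hz'] with y hy
    by_cases hy' : y ∈ range e
    · obtain ⟨x, rfl⟩ := hy'
      rw [he.injective.extend_apply]
      exact hKs fun hx => hy ⟨x, hx, rfl⟩
    · rw [Function.extend_apply' _ _ _ (fun hh => hy' hh)]
      simpa using hε

/-- The characters of `C₀(X)` are the evaluations at points. -/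
theorem exists_eq_eval_of_character {X : Type*} [TopologicalSpace X] [T2Space X]
    [LocallyCompactSpace X] (χ : C₀(X, ℂ) →ₙₐ[ℂ] ℂ) (hχ : χ ≠ 0) : ∃ x, ∀ h, χ h = h x := by
  have hr : ∀ F : C(OnePoint X, ℂ), Tendsto (fun x : X => F x - F OnePoint.infty) (cocompact X) (𝓝 0) := by
    intro F
    have h1 := (F.continuous.tendsto OnePoint.infty).comp OnePoint.tendsto_coe_infty
    rw [coclosedCompact_eq_cocompact] at h1
    simpa using h1.sub_const (F OnePoint.infty)
  let r : C(OnePoint X, ℂ) → C₀(X, ℂ) := fun F =>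
    ⟨⟨fun x : X => F x - F OnePoint.infty,
      (F.continuous.comp OnePoint.continuous_coe).sub continuous_const⟩, hr F⟩
  have hr' : ∀ F x, r F x = F x - F OnePoint.infty := fun _ _ => rfl
  -- `Φ` is the unital extension of `χ`: a function on the compactification is the constant `F ∞`
  -- plus an element of `C₀(X)`. Characters of a compact space are evaluations, and evaluation at
  -- infinity would mean `χ = 0`.
  let Φ : C(OnePoint X, ℂ) →ₐ[ℂ] ℂ := AlgHom.ofLinearMap
    { toFun := fun F => F OnePoint.infty + χ (r F)
      map_add' := fun F F' => by
        have e : r (F + F') = r F + r F' := ZeroAtInftyContinuousMap.ext fun x => by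
          simp only [hr', ContinuousMap.add_apply, ZeroAtInftyContinuousMap.add_apply]; ring
        rw [e, map_add, ContinuousMap.add_apply]
        ring
      map_smul' := fun c F => by
        have e : r (c • F) = c • r F := ZeroAtInftyContinuousMap.ext fun x => by
          simp only [hr', ContinuousMap.smul_apply, ZeroAtInftyContinuousMap.smul_apply, smul_sub]
        rw [e, map_smul, ContinuousMap.smul_apply, RingHom.id_apply, smul_add] }
    (by
      have e : r 1 = 0 := ZeroAtInftyContinuousMap.ext fun x => by
        simp [hr']
      change (1 : C(OnePoint X, ℂ)) OnePoint.infty + χ (r 1) = 1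
      rw [e, map_zero, add_zero, ContinuousMap.one_apply])
    (fun F F' => by
      have e : r (F * F') = F OnePoint.infty • r F' + F' OnePoint.infty • r F + r F * r F' :=
        ZeroAtInftyContinuousMap.ext fun x => by
          simp only [hr', ContinuousMap.mul_apply, ZeroAtInftyContinuousMap.add_apply,
            ZeroAtInftyContinuousMap.smul_apply, ZeroAtInftyContinuousMap.mul_apply, smul_eq_mul]
          ring
      change (F * F') OnePoint.infty + χ (r (F * F'))
        = (F OnePoint.infty + χ (r F)) * (F' OnePoint.infty + χ (r F'))
      rw [e, map_add, map_add, map_smul, map_smul, map_mul, ContinuousMap.mul_apply, smul_eq_mul,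
        smul_eq_mul]
      ring)
  obtain ⟨z, hz⟩ := (WeakDual.CharacterSpace.continuousMapEval_bijective (X := OnePoint X) (𝕜 := ℂ)).2
    (WeakDual.CharacterSpace.equivAlgHom.symm Φ)
  have hz' : ∀ F : C(OnePoint X, ℂ), F z = F OnePoint.infty + χ (r F) := fun F =>
    DFunLike.congr_fun hz F
  let E : C₀(X, ℂ) → C(OnePoint X, ℂ) := fun h =>
    ⟨_, continuous_extend_zero (OnePoint.isOpenEmbedding_coe (X := X)) h⟩
  have hE : ∀ h (x : X), E h x = h x := fun h x =>
    (OnePoint.isOpenEmbedding_coe (X := X)).injective.extend_apply _ _ _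
  have hE' : ∀ h, E h OnePoint.infty = 0 := fun h =>
    Function.extend_apply' _ _ _ fun ⟨x, hx⟩ => OnePoint.coe_ne_infty x hx
  have hrE : ∀ h, r (E h) = h := fun h => ZeroAtInftyContinuousMap.ext fun x => by
    rw [hr', hE, hE', sub_zero]
  have hχ' : ∀ h, χ h = E h z := fun h => by rw [hz', hE', hrE, zero_add]
  induction z using OnePoint.rec with
  | infty => exact (hχ (NonUnitalAlgHom.ext fun h => (hχ' h).trans (hE' h))).elim
  | coe x => exact ⟨x, fun h => (hχ' h).trans (hE h x)⟩

theorem exists_C0_eq_one {X : Type*} [TopologicalSpace X] [T2Space X] [LocallyCompactSpace X]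
    {K V : Set X} (hK : IsCompact K) (hV : IsOpen V) (hKV : K ⊆ V) :
    ∃ h : C₀(X, ℂ), (∀ x ∈ K, h x = 1) ∧ ∀ x ∉ V, h x = 0 := by
  obtain ⟨ψ, hψ1, hψ0, hψc, -⟩ := exists_continuous_one_zero_of_isCompact hK hV.isClosed_compl
    (disjoint_compl_right_iff_subset.2 hKV)
  refine ⟨toC0 X ⟨⟨fun x => (ψ x : ℂ), Complex.continuous_ofReal.comp ψ.continuous⟩,
    hψc.comp_left (g := fun t : ℝ => (t : ℂ)) Complex.ofReal_zero⟩, fun x hx => ?_, fun x hx => ?_⟩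
  · change (ψ x : ℂ) = 1
    rw [hψ1 hx]; simp
  · change (ψ x : ℂ) = 0
    rw [hψ0 hx]; simp

theorem eq_of_forall_C0_eq {X : Type*} [TopologicalSpace X] [T2Space X] [LocallyCompactSpace X]
    {x y : X} (h : ∀ f : C₀(X, ℂ), f x = f y) : x = y := by
  by_contra hne
  obtain ⟨f, h1, h0⟩ := exists_C0_eq_one (K := {x}) (V := {y}ᶜ) isCompact_singleton
    isOpen_compl_singleton (by simpa using Ne.symm hne)
  have h2 := h f
  rw [h1 x rfl, h0 y (by simp)] at h2
  exact one_ne_zero h2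

namespace PartialMorphism

variable {G H : HaarGroupoid.{u}}

/-- Functions in `C₀` separate points and have no common zero, so pull-back also detects where `φ`
is undefined. -/
theorem mem_iff_forall_pullC0 (φ : PartialMorphism G H) (x : G.Arr) (y : H.Arr) :
    y ∈ φ.toPFun x ↔ ∀ h, φ.pullC0 h x = h y := by
  refine ⟨fun hy h => φ.pullFun_of_mem h hy, fun hh => ?_⟩
  by_cases hx : x ∈ φ.toPFun.Dom
  · obtain ⟨z, hz⟩ := φ.exists_mem hx
    rwa [← eq_of_forall_C0_eq fun f => (φ.pullFun_of_mem f hz).symm.trans (hh f)]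
  · obtain ⟨f, h1, -⟩ := exists_C0_eq_one (K := {y}) (V := univ) isCompact_singleton isOpen_univ
      (subset_univ _)
    have h2 := hh f
    rw [h1 y rfl] at h2
    exact absurd ((φ.pullFun_of_notMem f hx).symm.trans h2) zero_ne_one

theorem pullC0_injective {φ ψ : PartialMorphism G H} (h : φ.pullC0 = ψ.pullC0) : φ = ψ := by
  refine PartialMorphism.ext (funext fun x => Part.ext fun y => ?_)
  rw [mem_iff_forall_pullC0, mem_iff_forall_pullC0, h]

end PartialMorphism

/-- For each `x`, the functional `h ↦ T h x` is zero or a character. In the first case `φ` is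
undefined at `x`; in the second the character is evaluation at the point `φ x`. -/
theorem IsSpace.exists_pullC0_eq {X Y : HaarGroupoid.{u}} (hX : IsSpace X) (hY : IsSpace Y)
    (T : C₀(Y.Arr, ℂ) →⋆ₙₐ[ℂ] C₀(X.Arr, ℂ)) : ∃ φ : PartialMorphism X Y, φ.pullC0 = T := by
  classical
  have hex : ∀ x, (∃ h, T h x ≠ 0) → ∃ y, ∀ h, T h x = h y := by
    rintro x ⟨h₀, hh₀⟩
    let χ : C₀(Y.Arr, ℂ) →ₙₐ[ℂ] ℂ :=
      { toFun := fun h => T h x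
        map_smul' := fun c h => by rw [map_smul]; rfl
        map_zero' := by rw [map_zero]; rfl
        map_add' := fun h h' => by rw [map_add]; rfl
        map_mul' := fun h h' => by rw [map_mul]; rfl }
    exact exists_eq_eval_of_character χ fun h0 => hh₀ (DFunLike.congr_fun h0 h₀)
  choose f hf using hex
  let F : X.Arr →. Y.Arr := fun x => ⟨∃ h, T h x ≠ 0, f x⟩
  have hmem : ∀ x y, y ∈ F x ↔ ∀ h, T h x = h y := by
    refine fun x y => ⟨?_, fun hy => ?_⟩
    · rintro ⟨hx, rfl⟩
      exact hf x hx
    · obtain ⟨h, h1, -⟩ := exists_C0_eq_one (K := {y}) (V := univ) isCompact_singleton isOpen_univ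
        (subset_univ _)
      have hx : ∃ h, T h x ≠ 0 := ⟨h, by rw [hy, h1 y rfl]; exact one_ne_zero⟩
      exact ⟨hx, eq_of_forall_C0_eq fun k => (hf x hx k).symm.trans (hy k)⟩
  have hdom : F.Dom = ⋃ h, {x | T h x ≠ 0} := by
    ext x
    simp only [Set.mem_iUnion]
    rfl
  have hopen : ∀ h, IsOpen {x | T h x ≠ 0} := fun h => isOpen_ne_fun (T h).continuous continuous_const
  have hsub : ∀ x : F.Dom, F.asSubtype x ∈ F x := fun x => Part.get_mem _
  have hcont : Continuous F.asSubtype := by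
    rw [continuous_iff_continuousAt]
    intro x V hV
    obtain ⟨W, hWV, hW, hxW⟩ := mem_nhds_iff.1 hV
    obtain ⟨h, h1, h0⟩ := exists_C0_eq_one (K := {F.asSubtype x}) (V := W) isCompact_singleton hW
      (by simpa using hxW)
    have hx : T h x ≠ 0 := by
      rw [(hmem _ _).1 (hsub x) h, h1 _ rfl]
      exact one_ne_zero
    change ∀ᶠ x' in 𝓝 x, F.asSubtype x' ∈ V
    filter_upwards [((hopen h).preimage continuous_subtype_val).mem_nhds hx] with x' hx'
    refine hWV (by_contra fun hn => hx' ?_)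
    rw [(hmem _ _).1 (hsub x') h, h0 _ hn]
  refine ⟨⟨F, ?_, fun x hx => by rwa [hX.inv_eq], ?_, ?_, ?_⟩, ?_⟩
  · rw [hdom]
    exact isOpen_iUnion hopen
  · intro x y x' y' hx hy h
    rw [hX.src_eq, hX.1] at h
    subst h
    obtain rfl := Part.mem_unique hx hy
    rw [hX.mul_self, hY.mul_self, hY.src_eq, hY.1]
    exact ⟨rfl, hx⟩
  · rw [isProperMap_iff_isCompact_preimage]
    refine ⟨hcont, fun K hK => ?_⟩
    -- If `h = 1` on `K`, the preimage of `K` lies where `|T h| ≥ 1`. This set is compact, as `T h`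
    -- vanishes at infinity.
    obtain ⟨h, h1, -⟩ := exists_C0_eq_one (V := univ) hK isOpen_univ (subset_univ _)
    have h0 := zero_at_infty (T h)
    rw [Metric.tendsto_nhds] at h0
    obtain ⟨L, hL, hLs⟩ := mem_cocompact.1 (h0 1 one_pos)
    have hM : IsCompact {x | 1 ≤ ‖T h x‖} := hL.of_isClosed_subset
      (isClosed_le continuous_const (T h).continuous.norm) fun x hx => by
        by_contra hxL
        have h2 : ‖T h x‖ < 1 := by simpa using hLs hxL
        exact absurd h2 (not_lt.2 hx)
    have hM' : IsCompact ((↑) ⁻¹' {x | 1 ≤ ‖T h x‖} : Set F.Dom) := by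
      rw [Subtype.isCompact_iff, Subtype.image_preimage_coe, inter_eq_right.2]
      · exact hM
      · intro x hx
        rw [hdom, Set.mem_iUnion]
        exact ⟨h, norm_pos_iff.1 (one_pos.trans_le hx)⟩
    refine hM'.of_isClosed_subset (hK.isClosed.preimage hcont) fun x hx => ?_
    change 1 ≤ ‖T h x‖
    rw [(hmem _ _).1 (hsub x) h, h1 _ hx, norm_one]
  · intro u v huv S hS
    rw [hX.2, hY.2, Measure.dirac_apply, Measure.dirac_apply]
    have h1 : (u : X.Arr) ∈ F.preimage S ↔ (v : Y.Arr) ∈ S := by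
      rw [PFun.mem_preimage]
      refine ⟨?_, fun hv => ⟨v, hv, huv⟩⟩
      rintro ⟨y, hy, hyu⟩
      rwa [Part.mem_unique huv hyu]
    by_cases hv : (v : Y.Arr) ∈ S
    · rw [indicator_of_mem (h1.2 hv), indicator_of_mem hv]
      rfl
    · rw [indicator_of_notMem (mt h1.1 hv), indicator_of_notMem hv]
  · refine NonUnitalStarAlgHom.ext fun h => ZeroAtInftyContinuousMap.ext fun x => ?_
    by_cases hx : x ∈ F.Dom
    · have hy : F.fn x hx ∈ F x := Part.get_mem _
      rw [(hmem _ _).1 hy]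
      exact PartialMorphism.pullFun_of_mem _ h hy
    · have h2 : T h x = 0 := by
        by_contra h2
        exact hx ⟨h, h2⟩
      rw [h2]
      exact PartialMorphism.pullFun_of_notMem _ h hx

/-- A locally compact Hausdorff space as a groupoid. -/
noncomputable def spaceGroupoid (X : Type u) [TopologicalSpace X] [T2Space X]
    [LocallyCompactSpace X] : HaarGroupoid.{u} where
  Arr := X
  meas := borel X
  borel := @BorelSpace.mk _ _ (borel X) rfl
  src := id
  rng := id
  inv := id
  mul x _ := x
  src_rng _ := rfl
  rng_src _ := rfl
  src_mul _ _ h := h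
  rng_mul _ _ _ := rfl
  mul_assoc _ _ _ _ _ := rfl
  rng_mul_self _ := rfl
  mul_src_self _ := rfl
  src_inv _ := rfl
  rng_inv _ := rfl
  mul_inv _ := rfl
  inv_mul _ := rfl
  continuous_inv := continuous_id
  continuousOn_mul := continuous_fst.continuousOn
  haar u := @Measure.dirac X (borel X) u
  regular u := by
    let _ : MeasurableSpace X := borel X
    have : BorelSpace X := ⟨rfl⟩
    refine @Measure.Regular.mk _ _ _ _ inferInstance ⟨fun A hA r hr => ?_⟩ fun U hU r hr => ?_
    · rw [Measure.dirac_apply] at hr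
      by_cases hu : (u : X) ∈ A
      · refine ⟨univ, subset_univ _, isOpen_univ, ?_⟩
        rw [indicator_of_mem hu] at hr
        rwa [Measure.dirac_apply, indicator_of_mem (mem_univ _)]
      · refine ⟨{(u : X)}ᶜ, fun a ha h => hu (h ▸ ha), isOpen_compl_singleton, ?_⟩
        rw [indicator_of_notMem hu] at hr
        rwa [Measure.dirac_apply, indicator_of_notMem (by simp)]
    · rw [Measure.dirac_apply] at hr
      by_cases hu : (u : X) ∈ U
      · refine ⟨{(u : X)}, by simpa using hu, isCompact_singleton, ?_⟩
        rw [indicator_of_mem hu] at hr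
        rwa [Measure.dirac_apply, indicator_of_mem (mem_singleton _)]
      · rw [indicator_of_notMem hu] at hr
        exact absurd hr not_lt_zero
  haar_compl_fibre u := by
    let _ : MeasurableSpace X := borel X
    have : BorelSpace X := ⟨rfl⟩
    change Measure.dirac (u : X) {x | x ≠ u} = 0
    rw [Measure.dirac_apply]
    exact indicator_of_notMem (by simp) _
  haar_pos u V hV := by
    let _ : MeasurableSpace X := borel X
    have : BorelSpace X := ⟨rfl⟩
    rintro ⟨x, hx, rfl⟩
    change Measure.dirac (_ : X) V ≠ 0
    rw [Measure.dirac_apply, indicator_of_mem hx]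
    exact one_ne_zero
  continuous_haar f := by
    let _ : MeasurableSpace X := borel X
    have : BorelSpace X := ⟨rfl⟩
    have h : ∀ x : X, ∫ y, f y ∂(Measure.dirac x) = f x := fun x => integral_dirac _ _
    exact (f.continuous.comp continuous_subtype_val).congr fun u => (h u).symm
  haar_mul_left f x := by
    let _ : MeasurableSpace X := borel X
    have : BorelSpace X := ⟨rfl⟩
    change ∫ y, f y ∂(Measure.dirac (x : X)) = ∫ y, f x ∂(Measure.dirac (x : X))
    rw [integral_dirac, integral_dirac]

theorem isSpace_spaceGroupoid (X : Type u) [TopologicalSpace X] [T2Space X]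
    [LocallyCompactSpace X] : IsSpace (spaceGroupoid X) := ⟨fun _ => rfl, fun _ => rfl⟩

theorem CStarAlg.nonempty_iso_of_bijective {A B : CStarAlg.{u}} (φ : A →⋆ₙₐ[ℂ] B)
    (h : Function.Bijective φ) : Nonempty (A ≅ B) := by
  let e := StarAlgEquiv.ofBijective φ h
  have he : ∀ a, e a = φ a := fun a => rfl
  let ψ : B →⋆ₙₐ[ℂ] A :=
    { toFun := e.symm
      map_smul' := fun c b => map_smul e.symm c b
      map_zero' := map_zero e.symm
      map_add' := map_add e.symm
      map_mul' := map_mul e.symm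
      map_star' := map_star e.symm }
  exact ⟨⟨φ, ψ, NonUnitalStarAlgHom.ext fun a => e.symm_apply_apply a,
    NonUnitalStarAlgHom.ext fun b => e.apply_symm_apply b⟩⟩

/-- The spectrum of a commutative C*-algebra. -/
theorem exists_iso_c0Functor {A : CStarAlg.{u}} (hA : IsCommutativeCStar A) :
    ∃ X : HaarGroupoid.{u}, IsSpace X ∧ Nonempty (c0Functor.obj (op X) ≅ A) := by
  let _ : NonUnitalCommCStarAlgebra A := { (inferInstance : NonUnitalCStarAlgebra A) with
    mul_comm := hA }
  let Ω := WeakDual.characterSpace ℂ (Unitization ℂ A)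
  -- `ω₀` is the character of the unitization that kills `A`. The spectrum of `A` is what remains
  -- without it.
  let ω₀ : Ω := WeakDual.CharacterSpace.equivAlgHom.symm (Unitization.fstHom ℂ A)
  have hω₀ : ∀ a, ω₀ a = a.fst := fun a => rfl
  let U : Set Ω := {ω₀}ᶜ
  have hU : IsOpen U := isOpen_compl_singleton
  have hLC : LocallyCompactSpace U := hU.locallyCompactSpace
  let γ := gelfandStarTransform (Unitization ℂ A)
  have hγ : ∀ a (ω : Ω), γ a ω = ω a := fun a ω => rfl
  have hγ0 : ∀ a : A, γ (a : Unitization ℂ A) ω₀ = 0 := fun a => by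
    rw [hγ, hω₀, Unitization.fst_inr]
  have hz : ∀ a : A, Tendsto (fun ω : U => γ (a : Unitization ℂ A) ω) (cocompact U) (𝓝 0) := by
    intro a
    rw [Metric.tendsto_nhds]
    intro ε hε
    have hC : IsCompact {ω : Ω | ε ≤ ‖γ (a : Unitization ℂ A) ω‖} :=
      (isClosed_le continuous_const (γ (a : Unitization ℂ A)).continuous.norm).isCompact
    refine mem_cocompact.2 ⟨(↑) ⁻¹' {ω : Ω | ε ≤ ‖γ (a : Unitization ℂ A) ω‖}, ?_, fun ω hω => ?_⟩
    · rw [Subtype.isCompact_iff, Subtype.image_preimage_coe, inter_eq_right.2]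
      · exact hC
      · rintro ω hω rfl
        have h1 : ε ≤ ‖γ (a : Unitization ℂ A) ω₀‖ := hω
        rw [hγ0, norm_zero] at h1
        exact absurd hε (not_lt.2 h1)
    · have h1 : ¬ ε ≤ ‖γ (a : Unitization ℂ A) ω‖ := hω
      simpa using h1
  let φ : A →⋆ₙₐ[ℂ] C₀(U, ℂ) :=
    { toFun := fun a => ⟨⟨fun ω => γ (a : Unitization ℂ A) ω,
        (γ (a : Unitization ℂ A)).continuous.comp continuous_subtype_val⟩, hz a⟩
      map_smul' := fun c a => ZeroAtInftyContinuousMap.ext fun ω => by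
        change γ ((c • a : A) : Unitization ℂ A) ω = c • γ (a : Unitization ℂ A) ω
        rw [Unitization.inr_smul, map_smul]; rfl
      map_zero' := ZeroAtInftyContinuousMap.ext fun ω => by
        change γ ((0 : A) : Unitization ℂ A) ω = 0
        rw [Unitization.inr_zero, map_zero]; rfl
      map_add' := fun a b => ZeroAtInftyContinuousMap.ext fun ω => by
        change γ ((a + b : A) : Unitization ℂ A) ω = γ (a : Unitization ℂ A) ω + γ (b : Unitization ℂ A) ω
        rw [Unitization.inr_add, map_add]; rfl
      map_mul' := fun a b => ZeroAtInftyContinuousMap.ext fun ω => by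
        change γ ((a * b : A) : Unitization ℂ A) ω = γ (a : Unitization ℂ A) ω * γ (b : Unitization ℂ A) ω
        rw [Unitization.inr_mul, map_mul]; rfl
      map_star' := fun a => ZeroAtInftyContinuousMap.ext fun ω => by
        change γ ((star a : A) : Unitization ℂ A) ω = star (γ (a : Unitization ℂ A) ω)
        rw [Unitization.inr_star, map_star]; rfl }
  have hφ : ∀ a (ω : U), φ a ω = γ (a : Unitization ℂ A) ω := fun _ _ => rfl
  have hbij : Function.Bijective φ := by
    constructor
    · intro a b hab
      refine Unitization.inr_injective (R := ℂ) (γ.injective (ContinuousMap.ext fun ω => ?_))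
      by_cases hω : ω = ω₀
      · rw [hω]
        exact (hγ0 a).trans (hγ0 b).symm
      · exact DFunLike.congr_fun hab (⟨ω, hω⟩ : U)
    · intro h
      -- The extension of `h` by zero is the Gelfand transform of some `a` in the unitization. Its
      -- value at `ω₀` is the scalar part of `a`, which is therefore zero, so `a` belongs to `A`.
      obtain ⟨a, ha⟩ := γ.surjective ⟨_, continuous_extend_zero hU.isOpenEmbedding_subtypeVal h⟩
      have ha' : ∀ ω, γ a ω = Function.extend (Subtype.val : U → Ω) h 0 ω := fun ω =>
        DFunLike.congr_fun ha ω
      have h0 : a.fst = 0 := by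
        rw [← hω₀, ← hγ, ha', Function.extend_apply' _ _ _ (fun ⟨ω, hω⟩ => ω.2 hω)]
        rfl
      refine ⟨a.snd, ZeroAtInftyContinuousMap.ext fun ω => ?_⟩
      have h1 : ((a.snd : A) : Unitization ℂ A) = a := Unitization.ext (by simp [h0]) (by simp)
      rw [hφ, h1, ha', Subtype.val_injective.extend_apply]
  obtain ⟨e⟩ := CStarAlg.nonempty_iso_of_bijective (A := A) (B := ⟨C₀(U, ℂ)⟩) φ hbij
  exact ⟨spaceGroupoid U, isSpace_spaceGroupoid U, ⟨e.symm⟩⟩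

instance : (IsSpace.{u}.ι.op ⋙ c0Functor).Faithful where
  map_injective {X Y} φ ψ h := by
    refine Quiver.Hom.unop_inj (IsSpace.ι.map_injective ?_)
    exact PartialMorphism.pullC0_injective h

instance : (IsSpace.{u}.ι.op ⋙ c0Functor).Full where
  map_surjective {X Y} T := by
    obtain ⟨φ, hφ⟩ := Y.unop.property.exists_pullC0_eq X.unop.property T
    exact ⟨(IsSpace.ι.preimage φ).op, by
      refine Eq.trans ?_ hφ
      exact congrArg PartialMorphism.pullC0 (IsSpace.ι.map_preimage φ)⟩

/-- Full faithfulness is transported along `e` from the `C₀` functor. Essential surjectivity is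
`exists_iso_c0Functor`. -/
theorem restrictsToAntiEquivalence {Γ : HaarGroupoid.{u}ᵒᵖ ⥤ CStarAlg.{u}}
    (e : IsSpace.{u}.ι.op ⋙ Γ ≅ IsSpace.{u}.ι.op ⋙ c0Functor) : RestrictsToAntiEquivalence Γ := by
  have hf : (IsSpace.{u}.ι.op ⋙ Γ).Faithful := Functor.Faithful.of_iso e.symm
  have hF : (IsSpace.{u}.ι.op ⋙ Γ).Full := Functor.Full.of_iso e.symm
  have hc : ∀ X, IsCommutativeCStar.{u} ((IsSpace.{u}.ι.op ⋙ Γ).obj X) := fun X a b => by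
    have h1 : ∀ a, CStarAlg.starHom (e.inv.app X) (CStarAlg.starHom (e.hom.app X) a) = a := fun a =>
      DFunLike.congr_fun (F := ((IsSpace.{u}.ι.op ⋙ Γ).obj X) →⋆ₙₐ[ℂ] ((IsSpace.{u}.ι.op ⋙ Γ).obj X))
        (e.hom_inv_id_app X) a
    rw [← h1 (a * b), ← h1 (b * a)]
    refine congrArg _ ?_
    rw [map_mul, map_mul]
    exact mul_comm (G := C₀(X.unop.obj.Arr, ℂ)) _ _
  refine ⟨hc, ⟨inferInstance, inferInstance, ⟨fun A => ?_⟩⟩⟩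
  obtain ⟨X, hX, ⟨i⟩⟩ := exists_iso_c0Functor A.property
  exact ⟨op ⟨X, hX⟩, ⟨IsCommutativeCStar.ι.preimageIso (e.app (op ⟨X, hX⟩) ≪≫ i)⟩⟩

/-! ### Partial morphisms and one-point compactifications -/

namespace PartialMorphism

variable {G H L : HaarGroupoid.{u}}

open Classical in
/-- The extension of a partial morphism to the one-point compactifications. -/
noncomputable def onePoint (φ : PartialMorphism G H) (z : OnePoint G.Arr) : OnePoint H.Arr :=
  z.elim OnePoint.infty fun x =>
    if h : x ∈ φ.toPFun.Dom then OnePoint.some (φ.toPFun.fn x h) else OnePoint.infty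

theorem onePoint_infty (φ : PartialMorphism G H) : φ.onePoint OnePoint.infty = OnePoint.infty := rfl

theorem onePoint_coe_eq_iff (φ : PartialMorphism G H) {x : G.Arr} {y : H.Arr} :
    φ.onePoint (OnePoint.some x) = OnePoint.some y ↔ y ∈ φ.toPFun x := by
  rw [onePoint, OnePoint.elim_some]
  split_ifs with h
  · rw [OnePoint.some_eq_iff]
    exact ⟨fun h' => h' ▸ Part.get_mem _, fun h' => Part.get_eq_of_mem h' h⟩
  · exact ⟨fun h' => (OnePoint.infty_ne_coe _ h').elim, fun h' => (h (φ.mem_dom_of_mem h')).elim⟩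

theorem onePoint_eq_coe_iff (φ : PartialMorphism G H) {z : OnePoint G.Arr} {y : H.Arr} :
    φ.onePoint z = OnePoint.some y ↔ ∃ x, z = OnePoint.some x ∧ y ∈ φ.toPFun x := by
  induction z using OnePoint.rec with
  | infty =>
    rw [onePoint_infty]
    exact ⟨fun h => (OnePoint.infty_ne_coe _ h).elim, fun ⟨_, h, _⟩ => (OnePoint.infty_ne_coe _ h).elim⟩
  | coe x =>
    rw [onePoint_coe_eq_iff]
    refine ⟨fun h => ⟨x, rfl, h⟩, ?_⟩
    rintro ⟨x', h, hy⟩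
    rwa [OnePoint.coe_injective h]

theorem OnePoint.ext_coe {X : Type*} {z w : OnePoint X}
    (h : ∀ y, z = OnePoint.some y ↔ w = OnePoint.some y) : z = w := by
  induction z using OnePoint.rec with
  | infty =>
    by_contra hw
    obtain ⟨y, hy⟩ := OnePoint.ne_infty_iff_exists.1 (Ne.symm hw)
    exact OnePoint.infty_ne_coe _ ((h y).2 hy.symm)
  | coe x => exact ((h x).1 rfl).symm

theorem onePoint_id (z : OnePoint G.Arr) : (PartialMorphism.id G).onePoint z = z := by
  refine OnePoint.ext_coe fun y => ?_
  rw [onePoint_eq_coe_iff]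
  constructor
  · rintro ⟨x, rfl, hx⟩
    rw [Part.mem_some_iff.1 hx]
  · rintro rfl
    exact ⟨y, rfl, Part.mem_some y⟩

theorem onePoint_comp (φ : PartialMorphism G H) (ψ : PartialMorphism H L) (z : OnePoint G.Arr) :
    (φ.comp ψ).onePoint z = ψ.onePoint (φ.onePoint z) := by
  refine OnePoint.ext_coe fun y => ?_
  rw [onePoint_eq_coe_iff, onePoint_eq_coe_iff]
  constructor
  · rintro ⟨x, rfl, hx⟩
    obtain ⟨w, hw, hy⟩ := Part.mem_bind_iff.1 hx
    exact ⟨w, φ.onePoint_coe_eq_iff.2 hw, hy⟩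
  · rintro ⟨w, hw, hy⟩
    obtain ⟨x, rfl, hx⟩ := φ.onePoint_eq_coe_iff.1 hw
    exact ⟨x, rfl, Part.mem_bind_iff.2 ⟨w, hx, hy⟩⟩

theorem ext_onePoint {φ ψ : PartialMorphism G H}
    (h : ∀ x : G.Arr, φ.onePoint (OnePoint.some x) = ψ.onePoint (OnePoint.some x)) : φ = ψ :=
  PartialMorphism.ext (funext fun x => Part.ext fun y => by
    rw [← onePoint_coe_eq_iff, ← onePoint_coe_eq_iff, h])

/-- Neighbourhoods of infinity are handled by properness, and the other open sets by openness of the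
domain. Partial morphisms thus become continuous pointed maps of compact spaces. -/
theorem continuous_onePoint (φ : PartialMorphism G H) : Continuous φ.onePoint := by
  refine continuous_def.2 fun V hV => ?_
  by_cases h : OnePoint.infty ∈ V
  · obtain ⟨-, hK⟩ := (OnePoint.isOpen_iff_of_mem h).1 hV
    have h1 : φ.onePoint ⁻¹' V = ((↑) '' φ.toPFun.preimage ((↑) ⁻¹' V)ᶜ)ᶜ := by
      ext z
      rw [Set.mem_preimage, Set.mem_compl_iff, ← not_iff_not, not_not]
      constructor
      · intro hz
        obtain ⟨y, hy⟩ := OnePoint.ne_infty_iff_exists.1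
          (show φ.onePoint z ≠ OnePoint.infty from fun h' => hz (by rw [h']; exact h))
        obtain ⟨x, rfl, hx⟩ := φ.onePoint_eq_coe_iff.1 hy.symm
        refine ⟨x, (PFun.mem_preimage _ _ _).2 ⟨y, fun hyV => hz ?_, hx⟩, rfl⟩
        rw [← hy]
        exact hyV
      · rintro ⟨x, hx, rfl⟩ hz
        obtain ⟨y, hyV, hy⟩ := (PFun.mem_preimage _ _ _).1 hx
        rw [φ.onePoint_coe_eq_iff.2 hy] at hz
        exact hyV hz
    rw [h1, OnePoint.isOpen_compl_image_coe]
    exact ⟨(φ.isCompact_preimage hK).isClosed, φ.isCompact_preimage hK⟩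
  · rw [OnePoint.isOpen_iff_of_notMem h] at hV
    have h1 : φ.onePoint ⁻¹' V = (↑) '' φ.toPFun.preimage ((↑) ⁻¹' V) := by
      ext z
      constructor
      · intro hz
        obtain ⟨y, hy⟩ := OnePoint.ne_infty_iff_exists.1
          (show φ.onePoint z ≠ OnePoint.infty from fun h' => h (h' ▸ hz : OnePoint.infty ∈ V))
        obtain ⟨x, rfl, hx⟩ := φ.onePoint_eq_coe_iff.1 hy.symm
        refine ⟨x, (PFun.mem_preimage _ _ _).2 ⟨y, ?_, hx⟩, rfl⟩
        rw [Set.mem_preimage, hy]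
        exact hz
      · rintro ⟨x, hx, rfl⟩
        obtain ⟨y, hyV, hy⟩ := (PFun.mem_preimage _ _ _).1 hx
        rw [Set.mem_preimage, φ.onePoint_coe_eq_iff.2 hy]
        exact hyV
    rw [h1]
    exact OnePoint.isOpenMap_coe _ (φ.isOpen_preimage hV)

end PartialMorphism

/-! ### Inverse limits of groupoids -/

section Limit

variable {Δ : Type u} [Preorder Δ] (F : Δᵒᵖ ⥤ HaarGroupoid.{u})

/-- The groupoids of an inverse system. -/
abbrev stage (a : Δ) : HaarGroupoid.{u} := F.obj (op a)

/-- The bonding maps of an inverse system. -/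
def bond {a b : Δ} (h : a ≤ b) : PartialMorphism (stage F b) (stage F a) := F.map (homOfLE h).op

theorem bond_comp {a b c : Δ} (h : a ≤ b) (h' : b ≤ c) :
    (bond F h').comp (bond F h) = bond F (h.trans h') := (F.map_comp (homOfLE h').op (homOfLE h).op).symm

theorem bond_onePoint {a b c : Δ} (h : a ≤ b) (h' : b ≤ c) (z : OnePoint (stage F c).Arr) :
    (bond F h).onePoint ((bond F h').onePoint z) = (bond F (h.trans h')).onePoint z := by
  rw [← bond_comp F h h', PartialMorphism.onePoint_comp]

/-- The threads of an inverse system: the arrows of its limit. -/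
def Thread : Type u :=
  {x : ∀ a : Δ, OnePoint (stage F a).Arr //
    (∀ (a b : Δ) (h : a ≤ b), (bond F h).onePoint (x b) = x a) ∧ ∃ a, x a ≠ OnePoint.infty}

instance : TopologicalSpace (Thread F) := instTopologicalSpaceSubtype

instance : T2Space (Thread F) :=
  inferInstanceAs (T2Space {x : ∀ a : Δ, OnePoint (stage F a).Arr //
    (∀ (a b : Δ) (h : a ≤ b), (bond F h).onePoint (x b) = x a) ∧ ∃ a, x a ≠ OnePoint.infty})

theorem isClosed_compatible : IsClosed {x : ∀ a : Δ, OnePoint (stage F a).Arr |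
    ∀ (a b : Δ) (h : a ≤ b), (bond F h).onePoint (x b) = x a} := by
  simp only [Set.ofPred_forall]
  exact isClosed_iInter fun a => isClosed_iInter fun b => isClosed_iInter fun h =>
    isClosed_eq ((bond F h).continuous_onePoint.comp (continuous_apply b)) (continuous_apply a)

/-- In the compact product of one-point compactifications, compatibility is a closed condition and
having some finite coordinate an open one. -/
instance : LocallyCompactSpace (Thread F) := by
  refine IsLocallyClosed.locallyCompactSpace (s := {x : ∀ a : Δ, OnePoint (stage F a).Arr |
    (∀ (a b : Δ) (h : a ≤ b), (bond F h).onePoint (x b) = x a) ∧ ∃ a, x a ≠ OnePoint.infty}) ?_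
  have h : IsOpen (⋃ a, (fun x : ∀ a : Δ, OnePoint (stage F a).Arr => x a) ⁻¹' {OnePoint.infty}ᶜ) :=
    isOpen_iUnion fun a => OnePoint.isClosed_infty.isOpen_compl.preimage (continuous_apply a)
  have h' : {x : ∀ a : Δ, OnePoint (stage F a).Arr | ∃ a, x a ≠ OnePoint.infty}
      = ⋃ a, (fun x : ∀ a : Δ, OnePoint (stage F a).Arr => x a) ⁻¹' {OnePoint.infty}ᶜ := by
    ext x; simp
  rw [← h'] at h
  exact (isClosed_compatible F).isLocallyClosed.inter h.isLocallyClosed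

variable {F}

namespace Thread

theorem continuous_coord (a : Δ) : Continuous fun x : Thread F => x.1 a :=
  (continuous_apply a).comp continuous_subtype_val

theorem bond_coord (x : Thread F) {a b : Δ} (h : a ≤ b) : (bond F h).onePoint (x.1 b) = x.1 a :=
  x.2.1 a b h

/-- Bonding maps fix infinity. So once a coordinate of a thread is finite, all later ones are. -/
theorem exists_of_le (x : Thread F) {a b : Δ} (h : a ≤ b) {y : (stage F a).Arr}
    (hy : x.1 a = OnePoint.some y) : ∃ z, x.1 b = OnePoint.some z ∧ y ∈ (bond F h).toPFun z := by
  rw [← x.bond_coord h] at hy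
  exact (bond F h).onePoint_eq_coe_iff.1 hy

/-- A finite coordinate excludes the family that is constantly infinite, so the set is already
closed in the compact product. -/
theorem isCompact_preimage {a : Δ} {K : Set (stage F a).Arr} (hK : IsCompact K) :
    IsCompact {x : Thread F | ∃ y ∈ K, x.1 a = OnePoint.some y} := by
  have hC : IsCompact ({x : ∀ a : Δ, OnePoint (stage F a).Arr |
      ∀ (a b : Δ) (h : a ≤ b), (bond F h).onePoint (x b) = x a} ∩
      (fun x => x a) ⁻¹' ((↑) '' K : Set (OnePoint (stage F a).Arr))) :=
    ((isClosed_compatible F).inter ((hK.image OnePoint.continuous_coe).isClosed.preimage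
      (continuous_apply a))).isCompact
  refine Subtype.isCompact_iff.2 ?_
  convert hC using 1
  ext x
  constructor
  · rintro ⟨x, ⟨y, hy, hx⟩, rfl⟩
    exact ⟨x.2.1, y, hy, hx.symm⟩
  · rintro ⟨hx, y, hy, hyx⟩
    refine ⟨⟨x, hx, a, ?_⟩, ⟨y, hy, hyx.symm⟩, rfl⟩
    have h : x a = OnePoint.some y := hyx.symm
    rw [h]
    exact OnePoint.coe_ne_infty y

theorem isOpen_coord_mem (a : Δ) {V : Set (stage F a).Arr} (hV : IsOpen V) :
    IsOpen {x : Thread F | ∃ y ∈ V, x.1 a = OnePoint.some y} := by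
  have h := (OnePoint.isOpenMap_coe V hV).preimage (continuous_coord (F := F) a)
  convert h using 1
  ext x
  exact ⟨fun ⟨y, hy, hx⟩ => ⟨y, hy, hx.symm⟩, fun ⟨y, hy, hx⟩ => ⟨y, hy, hx.symm⟩⟩

theorem eventually_coe (x : Thread F) : ∀ᶠ b in atTop, ∃ y, x.1 b = OnePoint.some y := by
  obtain ⟨a, ha⟩ := x.2.2
  obtain ⟨y, hy⟩ := OnePoint.ne_infty_iff_exists.1 ha
  filter_upwards [eventually_ge_atTop a] with b hb
  obtain ⟨z, hz, -⟩ := x.exists_of_le hb hy.symm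
  exact ⟨z, hz⟩

/-- A map to the space of threads is continuous if cofinally many of its coordinates are. -/
theorem continuousWithinAt_of_frequently {Z : Type*} [TopologicalSpace Z] {m : Z → Thread F}
    {S : Set Z} {z : Z} (h : ∃ᶠ b in atTop, ContinuousWithinAt (fun z => (m z).1 b) S z) :
    ContinuousWithinAt m S z := by
  refine (IsInducing.subtypeVal.continuousWithinAt_iff).2 (continuousWithinAt_pi.2 fun a => ?_)
  obtain ⟨b, hb, hab⟩ := (h.and_eventually (eventually_ge_atTop a)).exists
  refine ((bond F hab).continuous_onePoint.continuousAt.comp_continuousWithinAt hb).congr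
    (fun y _ => ?_) ?_
  · exact ((m y).bond_coord hab).symm
  · exact ((m z).bond_coord hab).symm

theorem nhds_eq_iInf (x : Thread F) : 𝓝 x = ⨅ a, comap (fun z : Thread F => z.1 a) (𝓝 (x.1 a)) := by
  have h : 𝓝 x = comap Subtype.val (𝓝 x.1) := nhds_induced _ _
  rw [h, nhds_pi, Filter.pi, Filter.comap_iInf]
  simp only [Filter.comap_comap]
  rfl

variable [IsDirectedOrder Δ]

/-- A neighbourhood of a thread contains a cylinder. -/
theorem eventually_cylinder {x : Thread F} {V : Set (Thread F)} (hV : V ∈ 𝓝 x) :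
    ∀ᶠ a in atTop, ∃ W : Set (stage F a).Arr, IsOpen W ∧ (∃ y ∈ W, x.1 a = OnePoint.some y) ∧
      {x : Thread F | ∃ y ∈ W, x.1 a = OnePoint.some y} ⊆ V := by
  -- The filters induced by single coordinates refine along the order. The infimum is therefore
  -- directed, and a neighbourhood is detected by one coordinate.
  have hle : ∀ a b, a ≤ b → comap (fun z : Thread F => z.1 b) (𝓝 (x.1 b)) ≤
      comap (fun z : Thread F => z.1 a) (𝓝 (x.1 a)) := fun a b h => by
    have h1 := (bond F h).continuous_onePoint.tendsto (x.1 b)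
    rw [x.bond_coord h, tendsto_iff_comap] at h1
    have h2 : (fun z : Thread F => z.1 a) = (bond F h).onePoint ∘ fun z : Thread F => z.1 b :=
      funext fun z => (z.bond_coord h).symm
    rw [h2, ← Filter.comap_comap]
    exact Filter.comap_mono h1
  have : Nonempty Δ := ⟨x.2.2.choose⟩
  rw [nhds_eq_iInf, Filter.mem_iInf_of_directed fun a b => by
    obtain ⟨c, hac, hbc⟩ := exists_ge_ge a b
    exact ⟨c, hle a c hac, hle b c hbc⟩] at hV
  obtain ⟨a, ha⟩ := hV
  filter_upwards [x.eventually_coe, eventually_ge_atTop a] with b ⟨y, hy⟩ hab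
  obtain ⟨U, hU, hUV⟩ := Filter.mem_comap.1 (hle a b hab ha)
  rw [hy, OnePoint.nhds_coe_eq, Filter.mem_map] at hU
  obtain ⟨W, hWU, hW, hyW⟩ := mem_nhds_iff.1 hU
  refine ⟨W, hW, ⟨y, hyW, hy⟩, ?_⟩
  rintro z ⟨v, hv, hz⟩
  refine hUV ?_
  change z.1 b ∈ U
  rw [hz]
  exact hWU hv

/-- A compact set of threads has a common stage. -/
theorem exists_coord_of_isCompact [Nonempty Δ] {K : Set (Thread F)} (hK : IsCompact K) :
    ∃ a, ∀ x ∈ K, ∃ y, x.1 a = OnePoint.some y := by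
  obtain ⟨a, ha⟩ := hK.elim_directed_cover (fun a : Δ => {x : Thread F | ∃ y ∈ univ, x.1 a = OnePoint.some y})
    (fun a => isOpen_coord_mem a isOpen_univ) (fun x _ => by
      obtain ⟨b, y, hy⟩ := x.eventually_coe.exists
      exact Set.mem_iUnion.2 ⟨b, y, mem_univ y, hy⟩) (fun a b => by
      obtain ⟨c, hac, hbc⟩ := exists_ge_ge a b
      refine ⟨c, ?_, ?_⟩
      · rintro x ⟨y, -, hy⟩
        obtain ⟨z, hz, -⟩ := x.exists_of_le hac hy
        exact ⟨z, mem_univ z, hz⟩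
      · rintro x ⟨y, -, hy⟩
        obtain ⟨z, hz, -⟩ := x.exists_of_le hbc hy
        exact ⟨z, mem_univ z, hz⟩)
  exact ⟨a, fun x hx => by
    obtain ⟨y, -, hy⟩ := ha hx
    exact ⟨y, hy⟩⟩

/-- A partially defined compatible family extends to a thread. -/
theorem exists_eq_of_partial (w : ∀ b : Δ, OnePoint (stage F b).Arr)
    (hw : ∀ (a b : Δ) (h : a ≤ b) (y : (stage F a).Arr), w a = OnePoint.some y →
      (bond F h).onePoint (w b) = OnePoint.some y) (hne : ∃ a, w a ≠ OnePoint.infty) :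
    ∃ z : Thread F, ∀ a y, w a = OnePoint.some y → z.1 a = OnePoint.some y := by
  obtain ⟨a₀, ha₀⟩ := hne
  obtain ⟨y₀, hy₀⟩ := OnePoint.ne_infty_iff_exists.1 ha₀
  have hge : ∀ c, a₀ ≤ c → ∀ d (h : c ≤ d), (bond F h).onePoint (w d) = w c := by
    intro c hc d h
    obtain ⟨y, hy, -⟩ := (bond F hc).onePoint_eq_coe_iff.1 (hw a₀ c hc y₀ hy₀.symm)
    rw [hw c d h y hy, hy]
  -- Above `a₀` the family is compatible by `hge`. The coordinate at `d` is read off from a stage `c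
  -- d` above both `d` and `a₀`, and does not depend on that choice by `hz`.
  choose c hc hc₀ using fun d : Δ => exists_ge_ge d a₀
  have hz : ∀ d e (h : d ≤ e), a₀ ≤ e →
      (bond F h).onePoint (w e) = (bond F (hc d)).onePoint (w (c d)) := by
    intro d e h he
    obtain ⟨f, hf, hf'⟩ := exists_ge_ge e (c d)
    rw [← hge e he f hf, ← hge _ (hc₀ d) f hf', bond_onePoint, bond_onePoint]
  let z : ∀ d, OnePoint (stage F d).Arr := fun d => (bond F (hc d)).onePoint (w (c d))
  have hza : ∀ a y, w a = OnePoint.some y → z a = OnePoint.some y := fun a y hy =>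
    hw a _ (hc a) y hy
  refine ⟨⟨z, fun a b h => ?_, a₀, ?_⟩, hza⟩
  · change (bond F h).onePoint ((bond F (hc b)).onePoint (w (c b))) = _
    rw [bond_onePoint]
    exact hz a _ _ (hc₀ b)
  · rw [hza a₀ y₀ hy₀.symm]
    exact OnePoint.coe_ne_infty y₀

variable [Nonempty Δ]

theorem ext_eventually {x y : Thread F} (h : ∀ᶠ b in atTop, x.1 b = y.1 b) : x = y := by
  refine Subtype.ext (funext fun a => ?_)
  obtain ⟨b, hb, hab⟩ := (h.and (eventually_ge_atTop a)).exists
  rw [← x.bond_coord hab, ← y.bond_coord hab, hb]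

/-- A coordinate of `x` may be infinite where that of its image is finite: an arrow outside a domain
can have its range inside. Applying `f` coordinatewise gives only a partial family, which
`exists_eq_of_partial` completes. -/
theorem exists_map (f : ∀ a : Δ, (stage F a).Arr → (stage F a).Arr)
    (hf : ∀ (a b : Δ) (h : a ≤ b) x y, y ∈ (bond F h).toPFun x → f a y ∈ (bond F h).toPFun (f b x))
    (x : Thread F) : ∃ z : Thread F, ∀ a y, x.1 a = OnePoint.some y → z.1 a = OnePoint.some (f a y) := by
  have h1 : ∀ (a b : Δ) (h : a ≤ b) (y : (stage F a).Arr), (x.1 a).map (f a) = OnePoint.some y →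
      (bond F h).onePoint ((x.1 b).map (f b)) = OnePoint.some y := fun a b h y hy => by
    by_cases hx : x.1 a = OnePoint.infty
    · rw [hx, OnePoint.map_infty] at hy
      exact (OnePoint.infty_ne_coe _ hy).elim
    · obtain ⟨x', hx'⟩ := OnePoint.ne_infty_iff_exists.1 hx
      obtain ⟨z, hz, hzx⟩ := x.exists_of_le h hx'.symm
      rw [← hx', OnePoint.map_some] at hy
      rw [hz, OnePoint.map_some, PartialMorphism.onePoint_coe_eq_iff, ← OnePoint.coe_injective hy]
      exact hf a b h _ _ hzx
  have h2 : ∃ a, (x.1 a).map (f a) ≠ OnePoint.infty := by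
    obtain ⟨a, y, hy⟩ := x.eventually_coe.exists
    refine ⟨a, ?_⟩
    rw [hy, OnePoint.map_some]
    exact OnePoint.coe_ne_infty _
  obtain ⟨z, hz⟩ := exists_eq_of_partial _ h1 h2
  refine ⟨z, fun a y hy => hz a _ ?_⟩
  rw [hy, OnePoint.map_some]

theorem exists_src (x : Thread F) : ∃ z : Thread F, ∀ a y, x.1 a = OnePoint.some y →
    z.1 a = OnePoint.some ((stage F a).src y) :=
  exists_map (fun a => (stage F a).src) (fun _ _ h _ _ hy => (bond F h).map_src hy) x

theorem exists_rng (x : Thread F) : ∃ z : Thread F, ∀ a y, x.1 a = OnePoint.some y →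
    z.1 a = OnePoint.some ((stage F a).rng y) :=
  exists_map (fun a => (stage F a).rng) (fun _ _ h _ _ hy => (bond F h).map_rng hy) x

theorem exists_inv (x : Thread F) : ∃ z : Thread F, ∀ a y, x.1 a = OnePoint.some y →
    z.1 a = OnePoint.some ((stage F a).inv y) :=
  exists_map (fun a => (stage F a).inv) (fun _ _ h _ _ hy => (bond F h).map_inv hy) x

/-- The source of a thread. -/
noncomputable def src (x : Thread F) : Thread F := x.exists_src.choose

/-- The range of a thread. -/
noncomputable def rng (x : Thread F) : Thread F := x.exists_rng.choose

/-- The inverse of a thread. -/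
noncomputable def inv (x : Thread F) : Thread F := x.exists_inv.choose

theorem src_coord {x : Thread F} {a : Δ} {y : (stage F a).Arr} (h : x.1 a = OnePoint.some y) :
    x.src.1 a = OnePoint.some ((stage F a).src y) := x.exists_src.choose_spec a y h

theorem rng_coord {x : Thread F} {a : Δ} {y : (stage F a).Arr} (h : x.1 a = OnePoint.some y) :
    x.rng.1 a = OnePoint.some ((stage F a).rng y) := x.exists_rng.choose_spec a y h

theorem inv_coord {x : Thread F} {a : Δ} {y : (stage F a).Arr} (h : x.1 a = OnePoint.some y) :
    x.inv.1 a = OnePoint.some ((stage F a).inv y) := x.exists_inv.choose_spec a y h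

theorem src_eq_rng_coord {x y : Thread F} (h : x.src = y.rng) {a : Δ} {x' y' : (stage F a).Arr}
    (hx : x.1 a = OnePoint.some x') (hy : y.1 a = OnePoint.some y') :
    (stage F a).src x' = (stage F a).rng y' :=
  OnePoint.coe_injective ((src_coord hx).symm.trans ((congrArg (fun z => z.1 a) h).trans (rng_coord hy)))

theorem src_eq_rng_of_eventually {x y : Thread F} (h : ∀ᶠ a in atTop, ∀ x' y', x.1 a = OnePoint.some x' →
    y.1 a = OnePoint.some y' → (stage F a).src x' = (stage F a).rng y') : x.src = y.rng := by
  refine ext_eventually ?_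
  filter_upwards [h, x.eventually_coe, y.eventually_coe] with a ha ⟨x', hx⟩ ⟨y', hy⟩
  rw [src_coord hx, rng_coord hy, ha x' y' hx hy]

theorem exists_mul (x y : Thread F) : ∃ z : Thread F, x.src = y.rng → ∀ a x' y',
    x.1 a = OnePoint.some x' → y.1 a = OnePoint.some y' →
      z.1 a = OnePoint.some ((stage F a).mul x' y') := by
  classical
  by_cases hxy : x.src = y.rng
  swap
  -- The default value for threads that are not composable.
  · exact ⟨x, fun h => (hxy h).elim⟩
  let w : ∀ a, OnePoint (stage F a).Arr := fun a =>
    (x.1 a).elim OnePoint.infty fun x' => (y.1 a).elim OnePoint.infty fun y' =>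
      OnePoint.some ((stage F a).mul x' y')
  have hw : ∀ a x' y', x.1 a = OnePoint.some x' → y.1 a = OnePoint.some y' →
      w a = OnePoint.some ((stage F a).mul x' y') := fun a x' y' hx hy => by
    simp only [w, hx, hy, OnePoint.elim_some]
  have hw' : ∀ a z, w a = OnePoint.some z → ∃ x' y', x.1 a = OnePoint.some x' ∧
      y.1 a = OnePoint.some y' := fun a z hz => by
    by_contra hne
    refine OnePoint.infty_ne_coe z (Eq.trans ?_ hz)
    by_cases hx : x.1 a = OnePoint.infty
    · simp only [w, hx, OnePoint.elim_infty]
    · obtain ⟨x', hx'⟩ := OnePoint.ne_infty_iff_exists.1 hx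
      by_cases hy : y.1 a = OnePoint.infty
      · simp only [w, ← hx', hy, OnePoint.elim_infty, OnePoint.elim_some]
      · obtain ⟨y', hy'⟩ := OnePoint.ne_infty_iff_exists.1 hy
        exact (hne ⟨x', y', hx'.symm, hy'.symm⟩).elim
  have h1 : ∀ (a b : Δ) (h : a ≤ b) (v : (stage F a).Arr), w a = OnePoint.some v →
      (bond F h).onePoint (w b) = OnePoint.some v := fun a b h v hv => by
    obtain ⟨x', y', hx, hy⟩ := hw' a v hv
    obtain ⟨x'', hx', hxx⟩ := x.exists_of_le h hx
    obtain ⟨y'', hy', hyy⟩ := y.exists_of_le h hy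
    rw [hw b _ _ hx' hy', ← hv, hw a _ _ hx hy, PartialMorphism.onePoint_coe_eq_iff]
    exact ((bond F h).map_mul _ _ _ _ hxx hyy (src_eq_rng_coord hxy hx' hy')).2
  have h2 : ∃ a, w a ≠ OnePoint.infty := by
    obtain ⟨a, ⟨x', hx⟩, y', hy⟩ := (x.eventually_coe.and y.eventually_coe).exists
    refine ⟨a, ?_⟩
    rw [hw a _ _ hx hy]
    exact OnePoint.coe_ne_infty _
  obtain ⟨z, hz⟩ := exists_eq_of_partial w h1 h2
  exact ⟨z, fun _ a x' y' hx hy => hz a _ (hw a x' y' hx hy)⟩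

/-- The product of threads. -/
noncomputable def mul (x y : Thread F) : Thread F := (exists_mul x y).choose

theorem mul_coord {x y : Thread F} (h : x.src = y.rng) {a : Δ} {x' y' : (stage F a).Arr}
    (hx : x.1 a = OnePoint.some x') (hy : y.1 a = OnePoint.some y') :
    (x.mul y).1 a = OnePoint.some ((stage F a).mul x' y') :=
  (exists_mul x y).choose_spec h a x' y' hx hy

end Thread

end Limit

/-! ### Functions on the space of threads -/

section Limit

variable {Δ : Type u} [Preorder Δ] {F : Δᵒᵖ ⥤ HaarGroupoid.{u}}

instance : MeasurableSpace (Thread F) := borel _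

instance : BorelSpace (Thread F) := ⟨rfl⟩

namespace Thread

/-- The bonding maps being surjective, so are the projections of the space of threads. -/
theorem exists_coord_eq [IsDirectedOrder Δ]
    (hF : ∀ {a b : Δ} (h : a ≤ b), (bond F h).Surjective) (a : Δ) (y : (stage F a).Arr) :
    ∃ x : Thread F, x.1 a = OnePoint.some y := by
  -- `C b` holds the families with coordinate `y` at `a` that are compatible below `b`. Surjectivity
  -- of one bonding map makes it nonempty, and by compactness the decreasing closed sets `C b` have
  -- a common element.
  let C : {b // a ≤ b} → Set (∀ a : Δ, OnePoint (stage F a).Arr) := fun b =>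
    {x | x a = OnePoint.some y} ∩ {x | ∀ (c : Δ) (h : c ≤ b), (bond F h).onePoint (x b) = x c}
  have hcl : ∀ b, IsClosed (C b) := fun b => by
    refine (isClosed_eq (continuous_apply a) continuous_const).inter ?_
    simp only [Set.ofPred_forall]
    exact isClosed_iInter fun c => isClosed_iInter fun h =>
      isClosed_eq ((bond F h).continuous_onePoint.comp (continuous_apply b.1)) (continuous_apply c)
  have hanti : ∀ b c : {b // a ≤ b}, b.1 ≤ c.1 → C c ⊆ C b := fun b c hbc x hx => by
    refine ⟨hx.1, fun d hd => ?_⟩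
    rw [← hx.2 b.1 hbc, bond_onePoint, hx.2]
  have hne : ∀ b, (C b).Nonempty := fun b => by
    classical
    obtain ⟨z, hz⟩ := hF b.2 y
    refine ⟨fun c => if h : c ≤ b.1 then (bond F h).onePoint (OnePoint.some z) else OnePoint.infty, ?_, ?_⟩
    · change (if h : a ≤ b.1 then (bond F h).onePoint (OnePoint.some z) else OnePoint.infty) = _
      rw [dif_pos b.2]
      exact (bond F b.2).onePoint_coe_eq_iff.2 hz
    · intro c hc
      beta_reduce
      rw [dif_pos hc, dif_pos le_rfl, bond_onePoint]
  have : Nonempty {b // a ≤ b} := ⟨⟨a, le_rfl⟩⟩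
  obtain ⟨x, hx⟩ := IsCompact.nonempty_iInter_of_directed_nonempty_isCompact_isClosed C
    (fun b c => by
      obtain ⟨d, hbd, hcd⟩ := exists_ge_ge b.1 c.1
      exact ⟨⟨d, b.2.trans hbd⟩, hanti _ _ hbd, hanti _ _ hcd⟩)
    hne (fun b => (hcl b).isCompact) hcl
  have hx' : ∀ b, x ∈ C b := fun b => Set.mem_iInter.1 hx b
  refine ⟨⟨x, fun c d h => ?_, a, ?_⟩, (hx' ⟨a, le_rfl⟩).1⟩
  · obtain ⟨e, hde, hae⟩ := exists_ge_ge d a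
    rw [← (hx' ⟨e, hae⟩).2 d hde, ← (hx' ⟨e, hae⟩).2 c (h.trans hde), bond_onePoint]
  · rw [(hx' ⟨a, le_rfl⟩).1]
    exact OnePoint.coe_ne_infty y

/-- The pull-back of a function along the projection of the space of threads. -/
noncomputable def pull (a : Δ) (h : C_c((stage F a).Arr, ℂ)) : C_c(Thread F, ℂ) where
  toFun x := (x.1 a).elim 0 h
  continuous_toFun := by
    have h1 := (continuous_extend_zero (OnePoint.isOpenEmbedding_coe (X := (stage F a).Arr))
      (toC0 _ h)).comp (continuous_coord (F := F) a)
    refine h1.congr fun x => ?_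
    change Function.extend OnePoint.some h 0 (x.1 a) = _
    induction x.1 a using OnePoint.rec with
    | infty => exact Function.extend_apply' _ _ _ fun ⟨y, hy⟩ => OnePoint.coe_ne_infty y hy
    | coe y => exact OnePoint.coe_injective.extend_apply _ _ _
  hasCompactSupport' := HasCompactSupport.intro (isCompact_preimage h.hasCompactSupport.isCompact)
    fun x hx => by
      by_cases hxa : x.1 a = OnePoint.infty
      · rw [hxa, OnePoint.elim_infty]
      · obtain ⟨y, hy⟩ := OnePoint.ne_infty_iff_exists.1 hxa
        rw [← hy, OnePoint.elim_some]
        exact image_eq_zero_of_notMem_tsupport fun hyt => hx ⟨y, hyt, hy.symm⟩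

theorem pull_of_coe {a : Δ} (h : C_c((stage F a).Arr, ℂ)) {x : Thread F} {y : (stage F a).Arr}
    (hx : x.1 a = OnePoint.some y) : pull a h x = h y := by
  change (x.1 a).elim 0 h = h y
  rw [hx, OnePoint.elim_some]

theorem pull_of_infty {a : Δ} (h : C_c((stage F a).Arr, ℂ)) {x : Thread F}
    (hx : x.1 a = OnePoint.infty) : pull a h x = 0 := by
  change (x.1 a).elim 0 h = 0
  rw [hx, OnePoint.elim_infty]

theorem pull_bond {a b : Δ} (hab : a ≤ b) (h : C_c((stage F a).Arr, ℂ)) :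
    pull b ((bond F hab).pullCc h) = pull a h := by
  ext x
  by_cases hx : x.1 b = OnePoint.infty
  · rw [pull_of_infty _ hx, pull_of_infty]
    rw [← x.bond_coord hab, hx, PartialMorphism.onePoint_infty]
  · obtain ⟨z, hz⟩ := OnePoint.ne_infty_iff_exists.1 hx
    rw [pull_of_coe _ hz.symm, PartialMorphism.pullCc_apply]
    by_cases hd : z ∈ (bond F hab).toPFun.Dom
    · obtain ⟨y, hy⟩ := (bond F hab).exists_mem hd
      rw [(bond F hab).pullFun_of_mem _ hy, pull_of_coe]
      rw [← x.bond_coord hab, ← hz]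
      exact (bond F hab).onePoint_coe_eq_iff.2 hy
    · rw [(bond F hab).pullFun_of_notMem _ hd, pull_of_infty]
      by_contra hne
      obtain ⟨y, hy⟩ := OnePoint.ne_infty_iff_exists.1 hne
      rw [← x.bond_coord hab, ← hz] at hy
      exact hd ((bond F hab).mem_dom_of_mem ((bond F hab).onePoint_coe_eq_iff.1 hy.symm))

theorem pull_injective [IsDirectedOrder Δ]
    (hF : ∀ {a b : Δ} (h : a ≤ b), (bond F h).Surjective) (a : Δ) {h k : C_c((stage F a).Arr, ℂ)}
    (hhk : pull a h = pull (F := F) a k) : h = k := by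
  ext y
  obtain ⟨x, hx⟩ := exists_coord_eq hF a y
  rw [← pull_of_coe h hx, ← pull_of_coe k hx, hhk]

/-- A compact set of threads is cut off by a function of one coordinate. -/
theorem exists_cutoff [IsDirectedOrder Δ] [Nonempty Δ] {K : Set (Thread F)} (hK : IsCompact K) :
    ∃ a, ∃ ψ : C((stage F a).Arr, ℝ), HasCompactSupport ψ ∧ (∀ y, ψ y ∈ Icc (0 : ℝ) 1) ∧
      ∀ x ∈ K, ∃ y, x.1 a = OnePoint.some y ∧ ψ y = 1 := by
  obtain ⟨a, ha⟩ := exists_coord_of_isCompact hK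
  have hK : IsCompact {y : (stage F a).Arr | ∃ x ∈ K, x.1 a = OnePoint.some y} := by
    have h1 := hK.image (continuous_coord (F := F) a)
    rw [OnePoint.isOpenEmbedding_coe.isInducing.isCompact_iff]
    convert h1 using 1
    ext z
    constructor
    · rintro ⟨y, ⟨x, hx, hxy⟩, rfl⟩
      exact ⟨x, hx, hxy⟩
    · rintro ⟨x, hx, rfl⟩
      obtain ⟨y, hy⟩ := ha x hx
      exact ⟨y, ⟨x, hx, hy⟩, hy.symm⟩
  obtain ⟨ψ, hψ1, -, hψc, hψ⟩ := exists_continuous_one_zero_of_isCompact hK isClosed_empty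
    (disjoint_empty _)
  refine ⟨a, ψ, hψc, hψ, fun x hx => ?_⟩
  obtain ⟨y, hy⟩ := ha x hx
  exact ⟨y, hy, hψ1 ⟨x, hx, hy⟩⟩

/-- The pull-backs of compactly supported functions are uniformly dense, with control of the
supports. -/
theorem exists_pull_approx [IsDirectedOrder Δ] [Nonempty Δ] (f : C_c(Thread F, ℂ)) :
    ∃ a, ∃ k : C_c((stage F a).Arr, ℂ), (∀ y, ((k y).re : ℂ) = k y ∧ 0 ≤ (k y).re) ∧
      ∀ ε > 0, ∃ b, a ≤ b ∧ ∃ h : C_c((stage F b).Arr, ℂ),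
        ∀ x, ‖f x - pull b h x‖ ≤ ε * (pull a k x).re := by
  classical
  obtain ⟨a, ψ, hψc, hψ, ha⟩ := exists_cutoff f.hasCompactSupport.isCompact
  let k : C_c((stage F a).Arr, ℂ) := ⟨⟨fun y => (ψ y : ℂ), Complex.continuous_ofReal.comp ψ.continuous⟩,
    hψc.comp_left (g := fun t : ℝ => (t : ℂ)) Complex.ofReal_zero⟩
  have hk : ∀ y, k y = (ψ y : ℂ) := fun _ => rfl
  -- `k₁` is 1 on the support of `k`, so its pull-back represents the constant 1 on `M`.
  obtain ⟨k₁, hk₁⟩ := exists_Cc_eqOn (Z := (stage F a).Arr) (C := tsupport k) (L := tsupport k)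
    (F := fun _ => 1) (isClosed_tsupport _) k.hasCompactSupport continuousOn_const
    fun z hz hz' => (hz' hz).elim
  let M : Set (Thread F) := {x | ∃ y ∈ tsupport k, x.1 a = OnePoint.some y}
  have hM : IsCompact M := isCompact_preimage k.hasCompactSupport.isCompact
  have : CompactSpace M := isCompact_iff_compactSpace.1 hM
  -- Stone-Weierstrass on the compact set `M`: the pull-backs from stages above `a` form a
  -- `*`-algebra by directedness, and they separate points because distinct threads differ at some
  -- late stage where both are finite.
  let A : StarSubalgebra ℂ C(M, ℂ) :=
    { carrier := {g | ∃ b, a ≤ b ∧ ∃ h : C_c((stage F b).Arr, ℂ), ∀ x : M, g x = pull b h x.1}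
      mul_mem' := by
        rintro g g' ⟨b, hab, h, hg⟩ ⟨b', hab', h', hg'⟩
        obtain ⟨c, hbc, hbc'⟩ := exists_ge_ge b b'
        refine ⟨c, hab.trans hbc, (bond F hbc).pullCc h * (bond F hbc').pullCc h', fun x => ?_⟩
        obtain ⟨y, -, hy⟩ := x.2
        obtain ⟨z, hz, -⟩ := x.1.exists_of_le (hab.trans hbc) hy
        rw [pull_of_coe _ hz, CompactlySupportedContinuousMap.mul_apply, ContinuousMap.mul_apply, hg, hg',
          ← pull_bond hbc, ← pull_bond hbc', pull_of_coe _ hz, pull_of_coe _ hz]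
      add_mem' := by
        rintro g g' ⟨b, hab, h, hg⟩ ⟨b', hab', h', hg'⟩
        obtain ⟨c, hbc, hbc'⟩ := exists_ge_ge b b'
        refine ⟨c, hab.trans hbc, (bond F hbc).pullCc h + (bond F hbc').pullCc h', fun x => ?_⟩
        obtain ⟨y, -, hy⟩ := x.2
        obtain ⟨z, hz, -⟩ := x.1.exists_of_le (hab.trans hbc) hy
        rw [pull_of_coe _ hz, CompactlySupportedContinuousMap.add_apply, ContinuousMap.add_apply, hg, hg',
          ← pull_bond hbc, ← pull_bond hbc', pull_of_coe _ hz, pull_of_coe _ hz]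
      algebraMap_mem' := fun r => by
        refine ⟨a, le_rfl, r • k₁, fun x => ?_⟩
        obtain ⟨y, hyt, hy⟩ := x.2
        rw [pull_of_coe _ hy, CompactlySupportedContinuousMap.smul_apply, hk₁ y hyt]
        simp [Algebra.algebraMap_eq_smul_one]
      star_mem' := by
        rintro g ⟨b, hab, h, hg⟩
        refine ⟨b, hab, star h, fun x => ?_⟩
        obtain ⟨y, -, hy⟩ := x.2
        obtain ⟨z, hz, -⟩ := x.1.exists_of_le hab hy
        rw [pull_of_coe _ hz, ContinuousMap.star_apply, hg, pull_of_coe _ hz]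
        rfl }
  have hsep : A.toSubalgebra.SeparatesPoints := by
    intro x x' hxx
    have hne : ∃ᶠ b in atTop, x.1.1 b ≠ x'.1.1 b := fun hh => hxx (Subtype.ext (ext_eventually
      (hh.mono fun b hb => not_not.1 hb)))
    obtain ⟨b, ⟨hb, hab⟩, ⟨y, hy⟩, y', hy'⟩ := ((hne.and_eventually (eventually_ge_atTop a)).and_eventually
      (x.1.eventually_coe.and x'.1.eventually_coe)).exists
    have hyy : y ≠ y' := fun h => hb (by rw [hy, hy', h])
    obtain ⟨h, hh⟩ := exists_Cc_eqOn (Z := (stage F b).Arr) (C := {y, y'}) (L := {y, y'})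
      (F := fun z => if z = y then 1 else 0) (Set.toFinite _).isClosed (Set.toFinite _).isCompact
      ((Set.toFinite _).continuousOn _) fun z hz hz' => (hz' hz).elim
    let g : C(M, ℂ) := ⟨fun x => pull b h x.1, (pull b h).continuous.comp continuous_subtype_val⟩
    refine ⟨g, ⟨g, ⟨b, hab, h, fun _ => rfl⟩, rfl⟩, ?_⟩
    change pull b h x.1 ≠ pull b h x'.1
    rw [pull_of_coe _ hy, pull_of_coe _ hy', hh y (by simp), hh y' (by simp), if_pos rfl,
      if_neg hyy.symm]
    exact one_ne_zero
  have htop := ContinuousMap.starSubalgebra_topologicalClosure_eq_top_of_separatesPoints A hsep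
  refine ⟨a, k, fun y => ⟨by rw [hk, Complex.ofReal_re], by rw [hk, Complex.ofReal_re]; exact (hψ y).1⟩,
    fun ε hε => ?_⟩
  have hf : (⟨fun x => f x.1, f.continuous.comp continuous_subtype_val⟩ : C(M, ℂ)) ∈ A.topologicalClosure := by
    rw [htop]; trivial
  obtain ⟨g, ⟨b, hab, h, hg⟩, hfg⟩ := Metric.mem_closure_iff.1 hf ε hε
  -- As `k` pulls back to 1 on the support of `f`, multiplying by it leaves `f` unchanged. The
  -- uniform error on `M` becomes an error dominated everywhere by `ε` times the fixed function `k`,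
  -- chosen before `ε`.
  refine ⟨b, hab, (bond F hab).pullCc k * h, fun x => ?_⟩
  by_cases hxa : x.1 a = OnePoint.infty
  · have h1 : f x = 0 := image_eq_zero_of_notMem_tsupport fun hxt => by
      obtain ⟨y, hy, -⟩ := ha x hxt
      rw [hxa] at hy
      exact OnePoint.infty_ne_coe _ hy
    have h2 : pull b ((bond F hab).pullCc k * h) x = pull a k x * pull b h x := by
      rw [← pull_bond hab]
      change (x.1 b).elim 0 _ = (x.1 b).elim 0 _ * (x.1 b).elim 0 _
      induction x.1 b using OnePoint.rec with
      | infty => simp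
      | coe y => rfl
    rw [h1, h2, pull_of_infty _ hxa]
    simp
  · obtain ⟨y, hy⟩ := OnePoint.ne_infty_iff_exists.1 hxa
    obtain ⟨z, hz, hyz⟩ := x.exists_of_le hab hy.symm
    have h2 : pull b ((bond F hab).pullCc k * h) x = (ψ y : ℂ) * pull b h x := by
      rw [pull_of_coe _ hz, pull_of_coe _ hz, CompactlySupportedContinuousMap.mul_apply,
        PartialMorphism.pullCc_apply, (bond F hab).pullFun_of_mem _ hyz]
      rfl
    have h3 : f x = (ψ y : ℂ) * f x := by
      by_cases hxt : x ∈ tsupport f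
      · obtain ⟨y', hy', h1⟩ := ha x hxt
        rw [OnePoint.coe_injective (hy.trans hy'), h1]
        simp
      · rw [image_eq_zero_of_notMem_tsupport hxt, mul_zero]
    rw [h2, h3, ← mul_sub, norm_mul, pull_of_coe k hy.symm, hk, Complex.ofReal_re, Complex.norm_real,
      Real.norm_of_nonneg (hψ y).1, mul_comm]
    by_cases hyt : y ∈ tsupport k
    · refine mul_le_mul_of_nonneg_right ?_ (hψ y).1
      have h4 := (ContinuousMap.dist_apply_le_dist (⟨x, y, hyt, hy.symm⟩ : M)).trans hfg.le
      rw [hg, dist_eq_norm] at h4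
      exact h4
    · have h5 : k y = 0 := image_eq_zero_of_notMem_tsupport hyt
      rw [hk, Complex.ofReal_eq_zero] at h5
      rw [h5, mul_zero, mul_zero]

end Thread

theorem norm_integral_sub_le_of_norm_sub_le {X : Type*} [TopologicalSpace X] [T2Space X] [MeasurableSpace X]
    [BorelSpace X] (μ : Measure X) [IsFiniteMeasureOnCompacts μ] {f d k : C_c(X, ℂ)} {ε : ℝ}
    (h : ∀ x, ‖f x - d x‖ ≤ ε * (k x).re) :
    ‖∫ x, f x ∂μ - ∫ x, d x ∂μ‖ ≤ ε * (∫ x, k x ∂μ).re := by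
  have hi : ∀ f : C_c(X, ℂ), Integrable f μ := fun f =>
    f.continuous.integrable_of_hasCompactSupport f.hasCompactSupport
  rw [← integral_sub (hi f) (hi d)]
  have h1 : (∫ x, k x ∂μ).re = ∫ x, (k x).re ∂μ := (integral_re (hi k)).symm
  rw [h1, ← integral_const_mul]
  exact norm_integral_le_of_norm_le ((hi k).re.const_mul ε) (.of_forall h)

theorem nonpos_of_forall_le_mul {x C : ℝ} (h : ∀ ε > 0, x ≤ ε * C) : x ≤ 0 := by
  by_contra! hx
  have hC : 0 < C := by
    have := h 1 one_pos
    linarith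
  have := h (x / (2 * C)) (by positivity)
  rw [div_mul_eq_mul_div, le_div_iff₀ (by positivity)] at this
  nlinarith

/-- Pull-backs from any stage are pull-backs from stages above `a₀`. They suffice because the
dominating function in `exists_pull_approx` is integrable for both measures and independent of `ε`.
-/
theorem Thread.integral_eq_of_pull [IsDirectedOrder Δ] [Nonempty Δ] {μ ν : Measure (Thread F)}
    [IsFiniteMeasureOnCompacts μ] [IsFiniteMeasureOnCompacts ν] (a₀ : Δ)
    (h : ∀ a, a₀ ≤ a → ∀ k : C_c((stage F a).Arr, ℂ), ∫ x, pull a k x ∂μ = ∫ x, pull a k x ∂ν)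
    (f : C_c(Thread F, ℂ)) : ∫ x, f x ∂μ = ∫ x, f x ∂ν := by
  have h' : ∀ a, ∀ k : C_c((stage F a).Arr, ℂ), ∫ x, pull a k x ∂μ = ∫ x, pull a k x ∂ν := fun a k => by
    obtain ⟨b, hab, hb⟩ := exists_ge_ge a a₀
    rw [← pull_bond hab]
    exact h b hb _
  obtain ⟨a, k, -, hk⟩ := exists_pull_approx f
  refine sub_eq_zero.1 (norm_le_zero_iff.1 (nonpos_of_forall_le_mul (C := (∫ x, pull a k x ∂μ).re
    + (∫ x, pull a k x ∂ν).re) fun ε hε => ?_))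
  obtain ⟨b, -, d, hd⟩ := hk ε hε
  have h1 := norm_integral_sub_le_of_norm_sub_le μ hd
  have h2 := norm_integral_sub_le_of_norm_sub_le ν hd
  rw [mul_add]
  calc ‖∫ x, f x ∂μ - ∫ x, f x ∂ν‖
      = ‖(∫ x, f x ∂μ - ∫ x, pull b d x ∂μ) - (∫ x, f x ∂ν - ∫ x, pull b d x ∂ν)‖ := by
        rw [h' b d]; congr 1; ring
    _ ≤ _ := (norm_sub_le _ _).trans (add_le_add h1 h2)

end Limit

/-! ### Push-forward of measures along partial maps -/

section Push

variable {X Y : Type*} [TopologicalSpace X] [T2Space X] [LocallyCompactSpace X] [MeasurableSpace X]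
  [BorelSpace X] [TopologicalSpace Y] [T2Space Y] [LocallyCompactSpace Y] [MeasurableSpace Y]
  [BorelSpace Y]

omit [LocallyCompactSpace X] in
theorem regular_comap_subtype {U : Set X} (hU : IsOpen U) (μ : Measure X) [μ.Regular] :
    (μ.comap (Subtype.val : U → X)).Regular := by
  have he := MeasurableEmbedding.subtype_coe hU.measurableSet
  have h1 : IsFiniteMeasureOnCompacts (μ.comap (Subtype.val : U → X)) := ⟨fun K hK => by
    rw [he.comap_apply]
    exact (hK.image continuous_subtype_val).measure_lt_top⟩
  have h2 : (μ.comap (Subtype.val : U → X)).OuterRegular :=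
    Measure.OuterRegular.comap' μ continuous_subtype_val he
  refine ⟨fun V hV r hr => ?_⟩
  rw [he.comap_apply] at hr
  obtain ⟨K, hKV, hK, hr⟩ := (hU.isOpenMap_subtype_val V hV).exists_lt_isCompact hr
  have hKU : K ⊆ U := hKV.trans (by rintro _ ⟨x, -, rfl⟩; exact x.2)
  have h3 : ((↑) : U → X) '' ((↑) ⁻¹' K) = K := by
    rw [Subtype.image_preimage_coe, inter_eq_right.2 hKU]
  refine ⟨(↑) ⁻¹' K, fun x hx => ?_, ?_, ?_⟩
  · obtain ⟨y, hy, hyx⟩ := hKV hx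
    rwa [← Subtype.val_injective hyx]
  · rw [Subtype.isCompact_iff, h3]
    exact hK
  · rwa [he.comap_apply, h3]

theorem ext_of_integral_Cc_eq {μ ν : Measure X} [μ.Regular] [ν.Regular]
    (h : ∀ f : C_c(X, ℂ), ∫ x, f x ∂μ = ∫ x, f x ∂ν) : μ = ν := by
  refine Measure.ext_of_integral_eq_on_compactlySupported fun f => ?_
  have h1 := h ⟨⟨fun x => (f x : ℂ), Complex.continuous_ofReal.comp f.continuous⟩,
    f.hasCompactSupport.comp_left (g := fun t : ℝ => (t : ℂ)) Complex.ofReal_zero⟩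
  have h2 : ∀ μ : Measure X, ∫ x, (f x : ℂ) ∂μ = ((∫ x, f x ∂μ : ℝ) : ℂ) := fun μ => integral_ofReal
  exact Complex.ofReal_injective ((h2 μ).symm.trans (h1.trans (h2 ν)))

/-- The image of a measure under a partial map. -/
noncomputable def pushPFun (p : X →. Y) (μ : Measure X) : Measure Y :=
  (μ.comap (Subtype.val : p.Dom → X)).map p.asSubtype

variable {p : X →. Y} (hd : IsOpen p.Dom) (hp : IsProperMap p.asSubtype)
include hd hp

omit [LocallyCompactSpace X] [LocallyCompactSpace Y] in
theorem regular_pushPFun (μ : Measure X) [μ.Regular] : (pushPFun p μ).Regular := by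
  have := regular_comap_subtype hd μ
  exact regular_map_of_isProperMap hp _

omit [T2Space X] [LocallyCompactSpace X] [T2Space Y] [LocallyCompactSpace Y] in
theorem pushPFun_apply (μ : Measure X) {S : Set Y} (hS : MeasurableSet S) :
    pushPFun p μ S = μ (p.preimage S) := by
  rw [pushPFun, Measure.map_apply hp.continuous.measurable hS,
    (MeasurableEmbedding.subtype_coe hd.measurableSet).comap_apply,
    PFun.preimage_asSubtype, Subtype.image_preimage_coe,
    inter_eq_right.2 (PFun.preimage_subset_dom _ _)]

omit [T2Space X] [LocallyCompactSpace X] [T2Space Y] [LocallyCompactSpace Y] in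
theorem integral_pushPFun (μ : Measure X) {f : Y → ℂ} (hf : Continuous f) {g : X → ℂ}
    (hg : ∀ x y, y ∈ p x → g x = f y) (hg0 : ∀ x, x ∉ p.Dom → g x = 0) :
    ∫ y, f y ∂(pushPFun p μ) = ∫ x, g x ∂μ := by
  rw [pushPFun, integral_map hp.continuous.measurable.aemeasurable hf.aestronglyMeasurable]
  have e : ∀ x : p.Dom, f (p.asSubtype x) = g x := fun x => (hg x _ (Part.get_mem _)).symm
  simp_rw [e]
  rw [integral_subtype_comap hd.measurableSet g]
  exact setIntegral_eq_integral_of_forall_compl_eq_zero fun x hx => hg0 x hx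

end Push

/-! ### The Haar system of the limit -/

section Limit

variable {Δ : Type u} [Preorder Δ] {F : Δᵒᵖ ⥤ HaarGroupoid.{u}}

namespace Thread

theorem rng_coord_eq [IsDirectedOrder Δ] [Nonempty Δ] {u : Thread F} (hu : u.rng = u) {a : Δ} {y : (stage F a).Arr}
    (h : u.1 a = OnePoint.some y) : (stage F a).rng y = y := by
  have h1 := rng_coord h
  rw [hu, h] at h1
  exact (OnePoint.coe_injective h1).symm

variable (F) in
/-- The projection of the space of threads. -/
noncomputable def coord (a : Δ) : Thread F →. (stage F a).Arr := fun x =>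
  ⟨∃ y, x.1 a = OnePoint.some y, fun h => h.choose⟩

theorem mem_coord {a : Δ} {x : Thread F} {y : (stage F a).Arr} :
    y ∈ coord F a x ↔ x.1 a = OnePoint.some y := by
  constructor
  · rintro ⟨h, rfl⟩
    exact h.choose_spec
  · intro h
    have h' : ∃ y, x.1 a = OnePoint.some y := ⟨y, h⟩
    exact ⟨h', OnePoint.coe_injective (h'.choose_spec.symm.trans h)⟩

theorem preimage_coord {a : Δ} (S : Set (stage F a).Arr) :
    (coord F a).preimage S = {x : Thread F | ∃ y ∈ S, x.1 a = OnePoint.some y} := by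
  ext x
  simp only [PFun.mem_preimage, mem_coord]
  rfl

theorem isOpen_dom_coord (a : Δ) : IsOpen (coord F a).Dom := by
  rw [← PFun.preimage_univ, preimage_coord]
  exact isOpen_coord_mem a isOpen_univ

theorem isProperMap_coord (a : Δ) : IsProperMap (coord F a).asSubtype := by
  rw [isProperMap_iff_isCompact_preimage]
  constructor
  · refine continuous_def.2 fun V hV => ?_
    rw [PFun.preimage_asSubtype, preimage_coord]
    exact (isOpen_coord_mem a hV).preimage continuous_subtype_val
  · intro K hK
    rw [PFun.preimage_asSubtype, Subtype.isCompact_iff, Subtype.image_preimage_coe,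
      inter_eq_right.2 (PFun.preimage_subset_dom _ _), preimage_coord]
    exact isCompact_preimage hK

theorem integral_pushPFun_coord (a : Δ) (μ : Measure (Thread F)) (h : C_c((stage F a).Arr, ℂ)) :
    ∫ y, h y ∂(pushPFun (coord F a) μ) = ∫ x, pull a h x ∂μ := by
  refine integral_pushPFun (isOpen_dom_coord a) (isProperMap_coord a) μ h.continuous
    (fun x y hy => pull_of_coe h (mem_coord.1 hy)) fun x hx => pull_of_infty h ?_
  by_contra hne
  obtain ⟨y, hy⟩ := OnePoint.ne_infty_iff_exists.1 hne
  exact hx ((PFun.mem_dom _ _).2 ⟨y, mem_coord.2 hy.symm⟩)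

theorem pull_smul {a : Δ} (c : ℂ) (h : C_c((stage F a).Arr, ℂ)) (x : Thread F) :
    pull a (c • h) x = c * pull a h x := by
  by_cases hx : x.1 a = OnePoint.infty
  · rw [pull_of_infty _ hx, pull_of_infty _ hx, mul_zero]
  · obtain ⟨y, hy⟩ := OnePoint.ne_infty_iff_exists.1 hx
    rw [pull_of_coe _ hy.symm, pull_of_coe _ hy.symm]
    rfl

theorem pull_add {a : Δ} (h k : C_c((stage F a).Arr, ℂ)) (x : Thread F) :
    pull a (h + k) x = pull a h x + pull a k x := by
  by_cases hx : x.1 a = OnePoint.infty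
  · rw [pull_of_infty _ hx, pull_of_infty _ hx, pull_of_infty _ hx, zero_add]
  · obtain ⟨y, hy⟩ := OnePoint.ne_infty_iff_exists.1 hx
    rw [pull_of_coe _ hy.symm, pull_of_coe _ hy.symm, pull_of_coe _ hy.symm]
    rfl

variable [IsDirectedOrder Δ] [Nonempty Δ]

theorem exists_unit_ge {u : Thread F} (hu : u.rng = u) {a b : Δ} (hab : a ≤ b)
    {v : (stage F a).Units} (hv : u.1 a = OnePoint.some v.1) :
    ∃ w : (stage F b).Units, u.1 b = OnePoint.some w.1 ∧ ∀ h : C_c((stage F a).Arr, ℂ),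
      ∫ y, (bond F hab).pullCc h y ∂((stage F b).haar w) = ∫ y, h y ∂((stage F a).haar v) := by
  obtain ⟨w, hw, hvw⟩ := u.exists_of_le hab hv
  exact ⟨⟨w, rng_coord_eq hu hw⟩, hw, fun h => (bond F hab).integral_pullFun hvw h.continuous⟩

/-- The values at the unit `u` of the Haar system of the limit, on pull-backs. -/
def HaarValue (u : Thread F) (f : C_c(Thread F, ℝ)) (c : ℝ) : Prop :=
  ∃ (a : Δ) (v : (stage F a).Units) (h : C_c((stage F a).Arr, ℂ)), u.1 a = OnePoint.some v.1 ∧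
    (∀ x, (f x : ℂ) = pull a h x) ∧ c = (∫ y, h y ∂((stage F a).haar v)).re

namespace HaarValue

variable {u : Thread F} (hu : u.rng = u)
include hu

/-- Directedness moves two representations to one stage. The unit there is unambiguous, being a
coordinate of `u`, and the bonding maps preserve the integrals. -/
theorem common {f f' : C_c(Thread F, ℝ)} {c c' : ℝ} (h : HaarValue u f c) (h' : HaarValue u f' c') :
    ∃ (a : Δ) (v : (stage F a).Units) (h h' : C_c((stage F a).Arr, ℂ)), u.1 a = OnePoint.some v.1 ∧
      (∀ x, (f x : ℂ) = pull a h x) ∧ (∀ x, (f' x : ℂ) = pull a h' x) ∧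
      c = (∫ y, h y ∂((stage F a).haar v)).re ∧ c' = (∫ y, h' y ∂((stage F a).haar v)).re := by
  obtain ⟨a, v, k, hv, hf, rfl⟩ := h
  obtain ⟨b, w, k', hw, hf', rfl⟩ := h'
  obtain ⟨d, had, hbd⟩ := exists_ge_ge a b
  obtain ⟨z, hz, hzk⟩ := exists_unit_ge hu had hv
  obtain ⟨z', hz', hzk'⟩ := exists_unit_ge hu hbd hw
  obtain rfl : z = z' := Subtype.ext (OnePoint.coe_injective (hz.symm.trans hz'))
  exact ⟨d, z, (bond F had).pullCc k, (bond F hbd).pullCc k', hz, fun x => by rw [pull_bond, hf],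
    fun x => by rw [pull_bond, hf'], by rw [hzk], by rw [hzk']⟩

theorem add {f f' : C_c(Thread F, ℝ)} {c c' : ℝ} (h : HaarValue u f c) (h' : HaarValue u f' c') :
    HaarValue u (f + f') (c + c') := by
  obtain ⟨a, v, k, k', hv, hf, hf', rfl, rfl⟩ := common hu h h'
  refine ⟨a, v, k + k', hv, fun x => ?_, ?_⟩
  · rw [pull_add, ← hf, ← hf', CompactlySupportedContinuousMap.add_apply, Complex.ofReal_add]
  · rw [← Complex.add_re, ← integral_add (HaarGroupoid.integrable_Cc k v)
      (HaarGroupoid.integrable_Cc k' v)]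
    rfl

omit [IsDirectedOrder Δ] [Nonempty Δ] hu in
theorem smul {f : C_c(Thread F, ℝ)} {c : ℝ} (t : ℝ) (h : HaarValue u f c) :
    HaarValue u (t • f) (t * c) := by
  obtain ⟨a, v, k, hv, hf, rfl⟩ := h
  refine ⟨a, v, (t : ℂ) • k, hv, fun x => ?_, ?_⟩
  · rw [pull_smul, ← hf, CompactlySupportedContinuousMap.smul_apply, smul_eq_mul, Complex.ofReal_mul]
  · rw [← Complex.re_ofReal_mul, ← integral_const_mul]
    rfl

-- Every arrow of a stage is a coordinate of a thread, by surjectivity. So a function with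
-- nonnegative pull-back is itself nonnegative.
omit [Nonempty Δ] hu in
theorem nonneg (hF : ∀ {a b : Δ} (h : a ≤ b), (bond F h).Surjective) {f : C_c(Thread F, ℝ)} {c : ℝ}
    (h : HaarValue u f c) (hf0 : ∀ x, 0 ≤ f x) : 0 ≤ c := by
  obtain ⟨a, v, k, hv, hf, rfl⟩ := h
  have h1 : (∫ y, k y ∂((stage F a).haar v)).re = ∫ y, (k y).re ∂((stage F a).haar v) :=
    (integral_re (HaarGroupoid.integrable_Cc k v)).symm
  rw [h1]
  refine integral_nonneg fun y => ?_
  obtain ⟨x, hx⟩ := exists_coord_eq hF a y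
  change 0 ≤ (k y).re
  rw [← pull_of_coe k hx, ← hf, Complex.ofReal_re]
  exact hf0 x

theorem unique (hF : ∀ {a b : Δ} (h : a ≤ b), (bond F h).Surjective) {f : C_c(Thread F, ℝ)}
    {c c' : ℝ} (h : HaarValue u f c) (h' : HaarValue u f c') : c = c' := by
  obtain ⟨a, v, k, k', hv, hf, hf', rfl, rfl⟩ := common hu h h'
  have h1 : pull a k = pull (F := F) a k' := by
    ext x
    rw [← hf, ← hf']
  rw [pull_injective hF a h1]

omit hu in
theorem zero (hu : u.rng = u) : HaarValue u 0 0 := by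
  obtain ⟨a, y, hy⟩ := u.eventually_coe.exists
  refine ⟨a, ⟨y, rng_coord_eq hu hy⟩, 0, hy, fun x => ?_, ?_⟩
  · have h := pull_smul (F := F) (a := a) 0 0 x
    rw [zero_smul, zero_mul] at h
    rw [h]
    simp
  · have h : ∀ y, (0 : C_c((stage F a).Arr, ℂ)) y = 0 := fun _ => rfl
    simp [h]

-- The domination hypothesis of the extension theorem of M. Riesz, met by a bound of `f` times a
-- cutoff. The point `u` is added to the compact set to make its coordinate at that stage finite, as
-- `HaarValue` demands.
omit hu in
theorem exists_ge (u : Thread F) (hu : u.rng = u) (f : C_c(Thread F, ℝ)) :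
    ∃ g c, HaarValue u g c ∧ ∀ x, 0 ≤ g x + f x := by
  obtain ⟨C, hC⟩ : ∃ C, ∀ x, ‖f x‖ ≤ C := f.hasCompactSupport.exists_bound_of_continuous f.continuous
  have hC0 : 0 ≤ C := (norm_nonneg _).trans (hC u)
  obtain ⟨a, ψ, hψc, hψ, ha⟩ := exists_cutoff (f.hasCompactSupport.isCompact.insert u)
  obtain ⟨v, hv, -⟩ := ha u (mem_insert _ _)
  let k : C_c((stage F a).Arr, ℂ) := ⟨⟨fun y => ((C * ψ y : ℝ) : ℂ), Complex.continuous_ofReal.comp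
    (continuous_const.mul ψ.continuous)⟩,
    hψc.comp_left (g := fun t : ℝ => ((C * t : ℝ) : ℂ)) (by simp)⟩
  have hk : ∀ y, k y = ((C * ψ y : ℝ) : ℂ) := fun _ => rfl
  let g : C_c(Thread F, ℝ) := ⟨⟨fun x => (pull a k x).re, Complex.continuous_re.comp (pull a k).continuous⟩,
    (pull a k).hasCompactSupport.comp_left (g := fun z : ℂ => z.re) Complex.zero_re⟩
  have hg : ∀ x, g x = (pull a k x).re := fun _ => rfl
  have hg1 : ∀ x y, x.1 a = OnePoint.some y → g x = C * ψ y := fun x y hy => by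
    rw [hg, pull_of_coe _ hy, hk, Complex.ofReal_re]
  have hg0 : ∀ x, x.1 a = OnePoint.infty → g x = 0 := fun x hx => by
    rw [hg, pull_of_infty _ hx, Complex.zero_re]
  refine ⟨g, _, ⟨a, ⟨v, rng_coord_eq hu hv⟩, k, hv, fun x => ?_, rfl⟩, fun x => ?_⟩
  · by_cases hx : x.1 a = OnePoint.infty
    · rw [hg0 x hx, pull_of_infty _ hx, Complex.ofReal_zero]
    · obtain ⟨y, hy⟩ := OnePoint.ne_infty_iff_exists.1 hx
      rw [hg1 x y hy.symm, pull_of_coe _ hy.symm, hk]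
  · by_cases hxt : x ∈ tsupport f
    · obtain ⟨y, hy, h1⟩ := ha x (mem_insert_of_mem _ hxt)
      rw [hg1 x y hy, h1, mul_one]
      have := neg_le_of_abs_le (hC x)
      linarith
    · rw [image_eq_zero_of_notMem_tsupport hxt, add_zero]
      by_cases hx : x.1 a = OnePoint.infty
      · rw [hg0 x hx]
      · obtain ⟨y, hy⟩ := OnePoint.ne_infty_iff_exists.1 hx
        rw [hg1 x y hy.symm]
        exact mul_nonneg hC0 (hψ y).1

end HaarValue

/-- The Haar measure of the limit at a unit. -/
theorem exists_haar (hF : ∀ {a b : Δ} (h : a ≤ b), (bond F h).Surjective) (u : Thread F)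
    (hu : u.rng = u) : ∃ μ : Measure (Thread F), μ.Regular ∧
      ∀ (a : Δ) (v : (stage F a).Units), u.1 a = OnePoint.some v.1 →
        ∀ h : C_c((stage F a).Arr, ℂ), ∫ x, pull a h x ∂μ = ∫ y, h y ∂((stage F a).haar v) := by
  -- On the space `D` of real pull-backs the stagewise integrals give a well-defined positive
  -- functional. It is extended to a positive functional on all of `C_c` and then represented by a
  -- measure.
  let D : Submodule ℝ C_c(Thread F, ℝ) :=
    { carrier := {f | ∃ c, HaarValue u f c}
      add_mem' := fun ⟨c, h⟩ ⟨c', h'⟩ => ⟨_, h.add hu h'⟩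
      zero_mem' := ⟨0, HaarValue.zero hu⟩
      smul_mem' := fun t _ ⟨c, h⟩ => ⟨_, h.smul t⟩ }
  choose L hL using fun f : D => f.2
  let Λ₀ : C_c(Thread F, ℝ) →ₗ.[ℝ] ℝ :=
    { domain := D
      toFun :=
        { toFun := L
          map_add' := fun f f' => (hL (f + f')).unique hu hF ((hL f).add hu (hL f'))
          map_smul' := fun t f => (hL (t • f)).unique hu hF ((hL f).smul t) } }
  let s : PointedCone ℝ C_c(Thread F, ℝ) :=
    { carrier := {f | ∀ x, 0 ≤ f x}
      add_mem' := fun hf hg x => add_nonneg (hf x) (hg x)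
      zero_mem' := fun x => le_rfl
      smul_mem' := fun t f hf x => mul_nonneg t.2 (hf x) }
  obtain ⟨Λ, hΛ, hΛs⟩ := riesz_extension s Λ₀ (fun f hf => (hL f).nonneg hF hf) fun f => by
    obtain ⟨g, c, hg, hgf⟩ := HaarValue.exists_ge u hu f
    exact ⟨⟨g, c, hg⟩, hgf⟩
  let Λ' : C_c(Thread F, ℝ) →ₚ[ℝ] ℝ := PositiveLinearMap.mk₀ Λ fun f hf => hΛs f fun x => hf x
  have hval : ∀ f c, HaarValue u f c → ∫ x, f x ∂(RealRMK.rieszMeasure Λ') = c := fun f c h => by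
    rw [RealRMK.integral_rieszMeasure]
    exact (hΛ ⟨f, c, h⟩).trans ((hL ⟨f, c, h⟩).unique hu hF h)
  have hreg : (RealRMK.rieszMeasure Λ').Regular := inferInstance
  refine ⟨RealRMK.rieszMeasure Λ', hreg, fun a v hv => ?_⟩
  have hre : ∀ h : C_c((stage F a).Arr, ℂ), (∫ x, pull a h x ∂(RealRMK.rieszMeasure Λ')).re
      = (∫ y, h y ∂((stage F a).haar v)).re := fun h => by
    let k : C_c((stage F a).Arr, ℂ) := ⟨⟨fun y => ((h y).re : ℂ), Complex.continuous_ofReal.comp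
      (Complex.continuous_re.comp h.continuous)⟩,
      h.hasCompactSupport.comp_left (g := fun z : ℂ => (z.re : ℂ)) (by simp)⟩
    let f : C_c(Thread F, ℝ) := ⟨⟨fun x => (pull a h x).re, Complex.continuous_re.comp (pull a h).continuous⟩,
      (pull a h).hasCompactSupport.comp_left (g := fun z : ℂ => z.re) Complex.zero_re⟩
    have h1 : HaarValue u f (∫ y, k y ∂((stage F a).haar v)).re := by
      refine ⟨a, v, k, hv, fun x => ?_, rfl⟩
      change ((pull a h x).re : ℂ) = pull a k x
      by_cases hx : x.1 a = OnePoint.infty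
      · rw [pull_of_infty _ hx, pull_of_infty _ hx, Complex.zero_re, Complex.ofReal_zero]
      · obtain ⟨y, hy⟩ := OnePoint.ne_infty_iff_exists.1 hx
        rw [pull_of_coe _ hy.symm, pull_of_coe _ hy.symm]
        rfl
    have h2 : (∫ x, pull a h x ∂(RealRMK.rieszMeasure Λ')).re
        = ∫ x, (pull a h x).re ∂(RealRMK.rieszMeasure Λ') :=
      (integral_re ((pull a h).continuous.integrable_of_hasCompactSupport
        (pull a h).hasCompactSupport)).symm
    have h3 : ∫ y, k y ∂((stage F a).haar v) = ((∫ y, (h y).re ∂((stage F a).haar v) : ℝ) : ℂ) :=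
      integral_ofReal
    have h4 : (∫ y, h y ∂((stage F a).haar v)).re = ∫ y, (h y).re ∂((stage F a).haar v) :=
      (integral_re (HaarGroupoid.integrable_Cc h v)).symm
    rw [h2, h4]
    refine (hval f _ h1).trans ?_
    rw [h3, Complex.ofReal_re]
  intro h
  refine Complex.ext (hre h) ?_
  -- The imaginary part of `z` is the real part of `-i z`.
  have h1 := hre ((-Complex.I) • h)
  have h2 : ∫ x, pull a ((-Complex.I) • h) x ∂(RealRMK.rieszMeasure Λ')
      = -Complex.I * ∫ x, pull a h x ∂(RealRMK.rieszMeasure Λ') := by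
    simp_rw [pull_smul]
    exact integral_const_mul _ _
  have h3 : ∫ y, ((-Complex.I) • h) y ∂((stage F a).haar v)
      = -Complex.I * ∫ y, h y ∂((stage F a).haar v) := integral_const_mul _ _
  rw [h2, h3] at h1
  simpa using h1

end Thread

end Limit

namespace LCGroupoid

/-- The translate is continuous on the fibre only, where its support lies in the compact set `x⁻¹
supp f`. -/
theorem exists_translate (G : LCGroupoid.{u}) (f : C_c(G.Arr, ℂ)) (x : G.Arr) :
    ∃ g : C_c(G.Arr, ℂ), ∀ y, G.rng y = G.src x → g y = f (G.mul x y) := by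
  have hD : IsCompact (tsupport f ∩ {z : G.Arr | G.rng z = G.rng x}) :=
    f.hasCompactSupport.isCompact.inter_right (isClosed_eq G.continuous_rng continuous_const)
  have hL : IsCompact (G.mul (G.inv x) '' (tsupport f ∩ {z : G.Arr | G.rng z = G.rng x})) :=
    hD.image_of_continuousOn (G.continuousOn_mul.comp (continuousOn_const.prodMk continuousOn_id)
      fun z hz => (G.src_inv x).trans hz.2.symm)
  have hC : IsClosed {y : G.Arr | G.rng y = G.src x} := isClosed_eq G.continuous_rng continuous_const
  refine exists_Cc_eqOn hC hL (f.continuous.comp_continuousOn (G.continuousOn_mul.comp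
    (continuousOn_const.prodMk continuousOn_id) fun y hy => Eq.symm hy)) fun y hy hyL => ?_
  by_contra hne
  have hxy : G.src x = G.rng y := Eq.symm hy
  exact hyL ⟨G.mul x y, ⟨subset_tsupport _ hne, G.rng_mul x y hxy⟩, G.inv_mul_cancel_left hxy⟩

end LCGroupoid

/-! ### The limit as a topological groupoid -/

section Limit

variable {Δ : Type u} [Preorder Δ] {F : Δᵒᵖ ⥤ HaarGroupoid.{u}}

namespace Thread

theorem eventually_coord {x : Thread F} {a : Δ} {y : (stage F a).Arr} (h : x.1 a = OnePoint.some y) :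
    ∀ᶠ z in 𝓝 x, ∃ y, z.1 a = OnePoint.some y := by
  filter_upwards [(isOpen_coord_mem a isOpen_univ).mem_nhds (x := x) ⟨y, mem_univ y, h⟩] with z ⟨y, _, hy⟩
  exact ⟨y, hy⟩

/-- The point `y` is a default for infinite coordinates. It plays no role near `x`, by
`eventually_coord`. -/
theorem tendsto_coord {x : Thread F} {a : Δ} {y : (stage F a).Arr} (h : x.1 a = OnePoint.some y) :
    Tendsto (fun z : Thread F => (z.1 a).elim y fun w => w) (𝓝 x) (𝓝 y) := by
  have h1 : ContinuousAt (fun z : OnePoint (stage F a).Arr => z.elim y fun w => w) (OnePoint.some y) :=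
    OnePoint.continuousAt_coe.2 continuousAt_id
  have h2 := (continuous_coord (F := F) a).tendsto x
  rw [h] at h2
  exact h1.tendsto.comp h2

variable [IsDirectedOrder Δ] [Nonempty Δ]

theorem frequently_coe (x : Thread F) : ∃ᶠ b in atTop, ∃ y, x.1 b = OnePoint.some y :=
  x.eventually_coe.frequently

theorem continuous_inv : Continuous (inv : Thread F → Thread F) := by
  refine continuous_iff_continuousAt.2 fun x => continuousWithinAt_univ _ _ |>.1 ?_
  refine continuousWithinAt_of_frequently (x.frequently_coe.mono fun b ⟨y, hy⟩ => ?_)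
  refine ContinuousAt.continuousWithinAt ?_
  rw [ContinuousAt, inv_coord hy]
  refine Tendsto.congr' ?_ ((OnePoint.continuous_coe.tendsto _).comp
    (((stage F b).continuous_inv.tendsto y).comp (tendsto_coord hy)))
  filter_upwards [eventually_coord hy] with z ⟨w, hw⟩
  simp only [Function.comp, hw, OnePoint.elim_some, inv_coord hw]

theorem continuousOn_mul :
    ContinuousOn (fun p : Thread F × Thread F => p.1.mul p.2) {p | p.1.src = p.2.rng} := by
  rintro ⟨x, y⟩ hxy
  have hxy : x.src = y.rng := hxy
  refine continuousWithinAt_of_frequently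
    ((x.eventually_coe.and y.eventually_coe).frequently.mono fun b ⟨⟨x', hx⟩, y', hy⟩ => ?_)
  rw [ContinuousWithinAt, mul_coord hxy hx hy]
  have hc := (stage F b).continuousOn_mul (x', y') (src_eq_rng_coord hxy hx hy)
  have hev : ∀ᶠ p : Thread F × Thread F in 𝓝[{p | p.1.src = p.2.rng}] (x, y),
      p.1.src = p.2.rng ∧ (∃ v, p.1.1 b = OnePoint.some v) ∧ ∃ w, p.2.1 b = OnePoint.some w := by
    filter_upwards [self_mem_nhdsWithin, mem_nhdsWithin_of_mem_nhds
      ((eventually_coord hx).prod_inl_nhds y), mem_nhdsWithin_of_mem_nhds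
      ((eventually_coord hy).prod_inr_nhds x)] with p h1 h2 h3
    exact ⟨h1, h2, h3⟩
  have ht : Tendsto (fun p : Thread F × Thread F => ((p.1.1 b).elim x' fun w => w, (p.2.1 b).elim y' fun w => w))
      (𝓝[{p | p.1.src = p.2.rng}] (x, y)) (𝓝[{p | (stage F b).src p.1 = (stage F b).rng p.2}] (x', y')) := by
    refine tendsto_nhdsWithin_iff.2 ⟨tendsto_nhdsWithin_of_tendsto_nhds ?_, ?_⟩
    · exact ((tendsto_coord hx).comp (continuous_fst.tendsto (x, y))).prodMk_nhds
        ((tendsto_coord hy).comp (continuous_snd.tendsto (x, y)))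
    · filter_upwards [hev] with p ⟨hp, ⟨v, hv⟩, w, hw⟩
      rw [hv, hw]
      exact src_eq_rng_coord hp hv hw
  refine Tendsto.congr' ?_ ((OnePoint.continuous_coe.tendsto _).comp (hc.tendsto.comp ht))
  filter_upwards [hev] with p ⟨hp, ⟨v, hv⟩, w, hw⟩
  simp only [Function.comp, hv, hw, OnePoint.elim_some, mul_coord hp hv hw]

end Thread

variable [IsDirectedOrder Δ] [Nonempty Δ]

open Thread in
variable (F) in
/-- The limit of an inverse system of groupoids, without its Haar system. -/
noncomputable abbrev limitGroupoid : LCGroupoid.{u} where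
  Arr := Thread F
  src := src
  rng := rng
  inv := inv
  mul := mul
  -- Each algebraic axiom is an identity of threads. It is enough to check it at late stages, where
  -- all coordinates involved are finite and the axiom of the stage applies.
  src_rng x := ext_eventually <| by
    filter_upwards [x.eventually_coe] with a ⟨y, hy⟩
    rw [src_coord (rng_coord hy), rng_coord hy, (stage F a).src_rng]
  rng_src x := ext_eventually <| by
    filter_upwards [x.eventually_coe] with a ⟨y, hy⟩
    rw [rng_coord (src_coord hy), src_coord hy, (stage F a).rng_src]
  src_mul x y h := ext_eventually <| by
    filter_upwards [x.eventually_coe, y.eventually_coe] with a ⟨x', hx⟩ ⟨y', hy⟩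
    rw [src_coord (mul_coord h hx hy), src_coord hy, (stage F a).src_mul _ _ (src_eq_rng_coord h hx hy)]
  rng_mul x y h := ext_eventually <| by
    filter_upwards [x.eventually_coe, y.eventually_coe] with a ⟨x', hx⟩ ⟨y', hy⟩
    rw [rng_coord (mul_coord h hx hy), rng_coord hx, (stage F a).rng_mul _ _ (src_eq_rng_coord h hx hy)]
  mul_assoc x y z h h' := ext_eventually <| by
    have h1 : (x.mul y).src = z.rng := src_eq_rng_of_eventually <| by
      filter_upwards [x.eventually_coe, y.eventually_coe] with a ⟨x', hx⟩ ⟨y', hy⟩ v w hv hw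
      rw [mul_coord h hx hy] at hv
      rw [← OnePoint.coe_injective hv, (stage F a).src_mul _ _ (src_eq_rng_coord h hx hy)]
      exact src_eq_rng_coord h' hy hw
    have h2 : x.src = (y.mul z).rng := src_eq_rng_of_eventually <| by
      filter_upwards [y.eventually_coe, z.eventually_coe] with a ⟨y', hy⟩ ⟨z', hz⟩ v w hv hw
      rw [mul_coord h' hy hz] at hw
      rw [← OnePoint.coe_injective hw, (stage F a).rng_mul _ _ (src_eq_rng_coord h' hy hz)]
      exact src_eq_rng_coord h hv hy
    filter_upwards [x.eventually_coe, y.eventually_coe, z.eventually_coe] with a ⟨x', hx⟩ ⟨y', hy⟩ ⟨z', hz⟩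
    rw [mul_coord h1 (mul_coord h hx hy) hz, mul_coord h2 hx (mul_coord h' hy hz),
      (stage F a).mul_assoc _ _ _ (src_eq_rng_coord h hx hy) (src_eq_rng_coord h' hy hz)]
  rng_mul_self x := ext_eventually <| by
    have h : x.rng.src = x.rng := src_eq_rng_of_eventually <| by
      filter_upwards [x.eventually_coe] with a ⟨y, hy⟩ v w hv hw
      rw [rng_coord hy] at hv
      rw [← OnePoint.coe_injective hv, (stage F a).src_rng, OnePoint.coe_injective (hy.symm.trans hw)]
    filter_upwards [x.eventually_coe] with a ⟨y, hy⟩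
    rw [mul_coord h (rng_coord hy) hy, hy, (stage F a).rng_mul_self]
  mul_src_self x := ext_eventually <| by
    have h : x.src = x.src.rng := src_eq_rng_of_eventually <| by
      filter_upwards [x.eventually_coe] with a ⟨y, hy⟩ v w hv hw
      rw [src_coord hy] at hw
      rw [← OnePoint.coe_injective hw, (stage F a).rng_src, OnePoint.coe_injective (hy.symm.trans hv)]
    filter_upwards [x.eventually_coe] with a ⟨y, hy⟩
    rw [mul_coord h hy (src_coord hy), hy, (stage F a).mul_src_self]
  src_inv x := ext_eventually <| by
    filter_upwards [x.eventually_coe] with a ⟨y, hy⟩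
    rw [src_coord (inv_coord hy), rng_coord hy, (stage F a).src_inv]
  rng_inv x := ext_eventually <| by
    filter_upwards [x.eventually_coe] with a ⟨y, hy⟩
    rw [rng_coord (inv_coord hy), src_coord hy, (stage F a).rng_inv]
  mul_inv x := ext_eventually <| by
    have h : x.src = x.inv.rng := src_eq_rng_of_eventually <| by
      filter_upwards [x.eventually_coe] with a ⟨y, hy⟩ v w hv hw
      rw [inv_coord hy] at hw
      rw [← OnePoint.coe_injective hw, (stage F a).rng_inv, OnePoint.coe_injective (hy.symm.trans hv)]
    filter_upwards [x.eventually_coe] with a ⟨y, hy⟩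
    rw [mul_coord h hy (inv_coord hy), rng_coord hy, (stage F a).mul_inv]
  inv_mul x := ext_eventually <| by
    have h : x.inv.src = x.rng := src_eq_rng_of_eventually <| by
      filter_upwards [x.eventually_coe] with a ⟨y, hy⟩ v w hv hw
      rw [inv_coord hy] at hv
      rw [← OnePoint.coe_injective hv, (stage F a).src_inv, OnePoint.coe_injective (hy.symm.trans hw)]
    filter_upwards [x.eventually_coe] with a ⟨y, hy⟩
    rw [mul_coord h (inv_coord hy) hy, src_coord hy, (stage F a).inv_mul]
  continuous_inv := continuous_inv
  continuousOn_mul := continuousOn_mul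

end Limit

/-! ### Support, continuity and invariance of the limit measures -/

section Limit

variable {Δ : Type u} [Preorder Δ] {F : Δᵒᵖ ⥤ HaarGroupoid.{u}} [IsDirectedOrder Δ] [Nonempty Δ]

namespace Thread

/-- The Haar measure of the limit at a unit. -/
noncomputable def haar (hF : ∀ {a b : Δ} (h : a ≤ b), (bond F h).Surjective)
    (u : (limitGroupoid F).Units) : Measure (Thread F) := (exists_haar hF u.1 u.2).choose

variable (hF : ∀ {a b : Δ} (h : a ≤ b), (bond F h).Surjective)

theorem regular_haar (u : (limitGroupoid F).Units) : (haar hF u).Regular :=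
  (exists_haar hF u.1 u.2).choose_spec.1

theorem integral_pull_haar {u : (limitGroupoid F).Units} {a : Δ} {v : (stage F a).Units}
    (h : u.1.1 a = OnePoint.some v.1) (k : C_c((stage F a).Arr, ℂ)) :
    ∫ x, pull a k x ∂(haar hF u) = ∫ y, k y ∂((stage F a).haar v) :=
  (exists_haar hF u.1 u.2).choose_spec.2 a v h k

/-- The image of a regular measure under a proper map is regular, and a regular measure is
determined by its integrals on `C_c`. -/
theorem haar_preimage_coord {u : (limitGroupoid F).Units} {a : Δ} {v : (stage F a).Units}
    (h : u.1.1 a = OnePoint.some v.1) {S : Set (stage F a).Arr} (hS : MeasurableSet S) :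
    haar hF u ((coord F a).preimage S) = (stage F a).haar v S := by
  have := regular_haar hF u
  have := regular_pushPFun (isOpen_dom_coord a) (isProperMap_coord a) (haar hF u)
  rw [← pushPFun_apply (isOpen_dom_coord a) (isProperMap_coord a) _ hS]
  congr 1
  refine ext_of_integral_Cc_eq fun k => ?_
  rw [integral_pushPFun_coord, integral_pull_haar hF h]

/-- If the range of a thread is not `u`, this shows at a stage where the coordinates are finite.
Hence the thread has a cylinder neighbourhood that is null by the axiom of that stage. Inner
regularity turns locally null into null. -/
theorem haar_compl_fibre (u : (limitGroupoid F).Units) :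
    haar hF u {x | x.rng ≠ u.1} = 0 := by
  have := regular_haar hF u
  have hU : IsOpen {x : Thread F | x.rng ≠ u.1} :=
    isOpen_ne_fun (limitGroupoid F).continuous_rng continuous_const
  by_contra hne
  obtain ⟨K, hKU, hK, hpos⟩ := hU.exists_lt_isCompact (pos_iff_ne_zero.2 hne)
  refine hpos.ne' (hK.measure_zero_of_nhdsWithin fun x hx => ?_)
  have hfr : ∃ᶠ a in atTop, x.rng.1 a ≠ u.1.1 a := fun hh =>
    hKU hx (ext_eventually (hh.mono fun a ha => not_not.1 ha))
  obtain ⟨a, ⟨ha, y, hy⟩, v, hv⟩ :=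
    ((hfr.and_eventually x.eventually_coe).and_eventually u.1.eventually_coe).exists
  have hv' : (stage F a).rng v = v := rng_coord_eq u.2 hv
  have hW : IsOpen {y : (stage F a).Arr | (stage F a).rng y ≠ v} :=
    isOpen_ne_fun (stage F a).continuous_rng continuous_const
  refine ⟨(coord F a).preimage {y | (stage F a).rng y ≠ v}, mem_nhdsWithin_of_mem_nhds ?_, ?_⟩
  · rw [preimage_coord]
    refine (isOpen_coord_mem a hW).mem_nhds ⟨y, fun h => ha ?_, hy⟩
    rw [rng_coord hy, hv, h]
  · rw [haar_preimage_coord hF (v := ⟨v, hv'⟩) hv hW.measurableSet]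
    exact (stage F a).haar_compl_fibre ⟨v, hv'⟩

/-- A neighbourhood contains a cylinder, whose measure is computed at a single stage. -/
theorem haar_pos (u : (limitGroupoid F).Units) (V : Set (Thread F)) (hV : IsOpen V)
    (h : ∃ x ∈ V, x.rng = u.1) : haar hF u V ≠ 0 := by
  obtain ⟨x, hx, hxu⟩ := h
  obtain ⟨a, W, hW, ⟨y, hyW, hy⟩, hWV⟩ := (eventually_cylinder (hV.mem_nhds hx)).exists
  have hu : u.1.1 a = OnePoint.some ((stage F a).rngU y).1 := by
    rw [← hxu]
    exact rng_coord hy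
  rw [← preimage_coord] at hWV
  refine fun h0 => (stage F a).haar_pos ((stage F a).rngU y) W hW ⟨y, hyW, rfl⟩ ?_
  rw [← haar_preimage_coord hF hu hW.measurableSet]
  exact measure_mono_null hWV h0

theorem continuous_integral_pull (a : Δ) (k : C_c((stage F a).Arr, ℂ)) :
    Continuous fun u => ∫ x, pull a k x ∂(haar hF u) := by
  refine continuous_iff_continuousAt.2 fun u => ?_
  obtain ⟨b, ⟨v, hv⟩, hab⟩ := (u.1.eventually_coe.and (eventually_ge_atTop a)).exists
  have hv' : (stage F b).rng v = v := rng_coord_eq u.2 hv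
  rw [← pull_bond hab]
  set k' := (bond F hab).pullCc k
  have hev : ∀ᶠ w : (limitGroupoid F).Units in 𝓝 u, ∃ y, w.1.1 b = OnePoint.some y :=
    (continuous_subtype_val.tendsto u).eventually (eventually_coord hv)
  -- Applying `rngU` makes the coordinate a unit for every `w`. Near `u` it changes nothing, since
  -- the coordinate is finite and already a unit.
  have ht : Tendsto (fun w : (limitGroupoid F).Units => (stage F b).rngU ((w.1.1 b).elim v fun y => y))
      (𝓝 u) (𝓝 ⟨v, hv'⟩) := by
    refine tendsto_subtype_rng.2 ?_
    have h1 := ((stage F b).continuous_rng.tendsto v).comp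
      ((tendsto_coord hv).comp (continuous_subtype_val.tendsto u))
    rw [hv'] at h1
    exact h1
  rw [ContinuousAt, integral_pull_haar hF (v := ⟨v, hv'⟩) hv]
  refine Tendsto.congr' ?_ (((stage F b).continuous_haar k').continuousAt.tendsto.comp ht)
  filter_upwards [hev] with w ⟨y, hy⟩
  have hy' : (stage F b).rng y = y := rng_coord_eq w.2 hy
  refine (integral_pull_haar hF (v := (stage F b).rngU ((w.1.1 b).elim v fun y => y)) ?_ k').symm
  rw [hy]
  exact congrArg OnePoint.some hy'.symm

/-- A locally uniform limit of the functions in `continuous_integral_pull`: the error is at most `ε`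
times the integral of one fixed pull-back, which is locally bounded. -/
theorem continuous_haar (f : C_c(Thread F, ℂ)) : Continuous fun u => ∫ x, f x ∂(haar hF u) := by
  refine continuous_iff_continuousAt.2 fun u => ?_
  obtain ⟨a, k, hk, happ⟩ := exists_pull_approx f
  refine continuousAt_of_locally_uniform_approx_of_continuousAt fun U hU => ?_
  obtain ⟨ε, hε, hεU⟩ := Metric.mem_uniformity_dist.1 hU
  have hc := Complex.continuous_re.comp (continuous_integral_pull hF a k)
  have hM0 : ∀ w, 0 ≤ (∫ x, pull a k x ∂(haar hF w)).re := fun w => by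
    have h1 : (∫ x, pull a k x ∂(haar hF w)).re = ∫ x, (pull a k x).re ∂(haar hF w) := by
      have := regular_haar hF w
      exact (integral_re ((pull a k).continuous.integrable_of_hasCompactSupport
        (pull a k).hasCompactSupport)).symm
    rw [h1]
    refine integral_nonneg fun x => ?_
    change 0 ≤ (pull a k x).re
    by_cases hx : x.1 a = OnePoint.infty
    · rw [pull_of_infty _ hx, Complex.zero_re]
    · obtain ⟨y, hy⟩ := OnePoint.ne_infty_iff_exists.1 hx
      rw [pull_of_coe _ hy.symm]
      exact (hk y).2
  set M := (∫ x, pull a k x ∂(haar hF u)).re + 1 with hM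
  have hMp : 0 < M := by have := hM0 u; positivity
  obtain ⟨b, -, d, hd⟩ := happ (ε / (2 * M)) (by positivity)
  refine ⟨{w | (∫ x, pull a k x ∂(haar hF w)).re < M}, hc.continuousAt.eventually_lt continuousAt_const
    (lt_add_one _), _, (continuous_integral_pull hF b d).continuousAt, fun w hw => hεU ?_⟩
  have := regular_haar hF w
  rw [dist_eq_norm]
  refine (norm_integral_sub_le_of_norm_sub_le _ hd).trans_lt ?_
  have hw : (∫ x, pull a k x ∂(haar hF w)).re < M := hw
  calc ε / (2 * M) * (∫ x, pull a k x ∂(haar hF w)).re ≤ ε / (2 * M) * M := by gcongr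
    _ = ε / 2 := by field_simp
    _ < ε := half_lt_self hε

theorem integral_pull_mul_left {x : Thread F} {a : Δ} {x' : (stage F a).Arr}
    (hx : x.1 a = OnePoint.some x') (k : C_c((stage F a).Arr, ℂ)) :
    ∫ y, pull a k y ∂(haar hF ((limitGroupoid F).rngU x))
      = ∫ y, pull a k (x.mul y) ∂(haar hF ((limitGroupoid F).srcU x)) := by
  obtain ⟨g, hg⟩ := (stage F a).exists_translate k x'
  have h1 : ∫ y, pull a k (x.mul y) ∂(haar hF ((limitGroupoid F).srcU x))
      = ∫ y, pull a g y ∂(haar hF ((limitGroupoid F).srcU x)) := by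
    refine integral_congr_ae ?_
    have hae : ∀ᵐ y ∂(haar hF ((limitGroupoid F).srcU x)), y.rng = x.src :=
      haar_compl_fibre hF ((limitGroupoid F).srcU x)
    filter_upwards [hae] with y hy
    by_cases hya : y.1 a = OnePoint.infty
    -- With `x` finite at `a` and `y` infinite there, `x y` is infinite too: otherwise `y = x⁻¹ (x
    -- y)` would be finite.
    · rw [pull_of_infty _ hya, pull_of_infty]
      by_contra hne
      obtain ⟨z, hz⟩ := OnePoint.ne_infty_iff_exists.1 hne
      have e1 : x.inv.src = (x.mul y).rng :=
        ((limitGroupoid F).src_inv x).trans ((limitGroupoid F).rng_mul x y hy.symm).symm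
      have e2 := mul_coord e1 (inv_coord hx) hz.symm
      have e3 : x.inv.mul (x.mul y) = y := (limitGroupoid F).inv_mul_cancel_left hy.symm
      rw [e3, hya] at e2
      exact OnePoint.infty_ne_coe _ e2
    · obtain ⟨y', hy'⟩ := OnePoint.ne_infty_iff_exists.1 hya
      rw [pull_of_coe _ hy'.symm, pull_of_coe _ (mul_coord hy.symm hx hy'.symm),
        hg y' (src_eq_rng_coord hy.symm hx hy'.symm).symm]
  rw [h1, integral_pull_haar hF (v := (stage F a).rngU x') (rng_coord hx),
    integral_pull_haar hF (v := (stage F a).srcU x') (src_coord hx), (stage F a).haar_mul_left k x']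
  refine integral_congr_ae ?_
  filter_upwards [HaarGroupoid.ae_rng ((stage F a).srcU x')] with y hy using (hg y hy).symm

theorem haar_mul_left (f : C_c(Thread F, ℂ)) (x : Thread F) :
    ∫ y, f y ∂(haar hF ((limitGroupoid F).rngU x))
      = ∫ y, f (x.mul y) ∂(haar hF ((limitGroupoid F).srcU x)) := by
  have := regular_haar hF ((limitGroupoid F).rngU x)
  have := regular_haar hF ((limitGroupoid F).srcU x)
  have hae : ∀ᵐ y ∂(haar hF ((limitGroupoid F).srcU x)), y.rng = x.src :=
    haar_compl_fibre hF ((limitGroupoid F).srcU x)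
  have htr : ∀ f : C_c(Thread F, ℂ), Integrable (fun y => f (x.mul y)) (haar hF ((limitGroupoid F).srcU x)) :=
    fun f => by
      obtain ⟨g, hg⟩ := (limitGroupoid F).exists_translate f x
      refine (g.continuous.integrable_of_hasCompactSupport g.hasCompactSupport).congr ?_
      filter_upwards [hae] with y hy using hg y hy
  obtain ⟨a, k, -, happ⟩ := exists_pull_approx f
  refine sub_eq_zero.1 (norm_le_zero_iff.1 (nonpos_of_forall_le_mul
    (C := (∫ y, pull a k y ∂(haar hF ((limitGroupoid F).rngU x))).re
      + ∫ y, (pull a k (x.mul y)).re ∂(haar hF ((limitGroupoid F).srcU x))) fun ε hε => ?_))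
  obtain ⟨b, -, d, hd⟩ := happ ε hε
  obtain ⟨c, hbc, x', hx⟩ := ((eventually_ge_atTop b).and x.eventually_coe).exists
  have h1 := norm_integral_sub_le_of_norm_sub_le (haar hF ((limitGroupoid F).rngU x)) hd
  have h2 : ‖∫ y, f (x.mul y) ∂(haar hF ((limitGroupoid F).srcU x))
      - ∫ y, pull b d (x.mul y) ∂(haar hF ((limitGroupoid F).srcU x))‖
      ≤ ε * ∫ y, (pull a k (x.mul y)).re ∂(haar hF ((limitGroupoid F).srcU x)) := by
    rw [← integral_sub (htr f) (htr _), ← integral_const_mul]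
    exact norm_integral_le_of_norm_le ((htr (pull a k)).re.const_mul ε) (.of_forall fun y => hd _)
  have h3 := integral_pull_mul_left hF hx ((bond F hbc).pullCc d)
  rw [pull_bond] at h3
  rw [mul_add]
  calc _ = ‖(∫ y, f y ∂(haar hF ((limitGroupoid F).rngU x))
          - ∫ y, pull b d y ∂(haar hF ((limitGroupoid F).rngU x)))
        - (∫ y, f (x.mul y) ∂(haar hF ((limitGroupoid F).srcU x))
          - ∫ y, pull b d (x.mul y) ∂(haar hF ((limitGroupoid F).srcU x)))‖ := by
        rw [h3]; congr 1; ring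
    _ ≤ _ := (norm_sub_le _ _).trans (add_le_add h1 h2)

end Thread

variable (F) in
/-- The limit of an inverse system of groupoids with surjective bonding maps. -/
noncomputable abbrev limitHaarGroupoid (hF : ∀ {a b : Δ} (h : a ≤ b), (bond F h).Surjective) :
    HaarGroupoid.{u} where
  toLCGroupoid := limitGroupoid F
  haar := Thread.haar hF
  regular := Thread.regular_haar hF
  haar_compl_fibre := Thread.haar_compl_fibre hF
  haar_pos := Thread.haar_pos hF
  continuous_haar := Thread.continuous_haar hF
  haar_mul_left := Thread.haar_mul_left hF

end Limit

/-! ### The universal property of the limit -/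

section Limit

variable {Δ : Type u} [Preorder Δ] {F : Δᵒᵖ ⥤ HaarGroupoid.{u}} [IsDirectedOrder Δ] [Nonempty Δ]
  (hF : ∀ {a b : Δ} (h : a ≤ b), (bond F h).Surjective)

/-- The projections of the limit of an inverse system of groupoids. -/
noncomputable def limitProj (a : Δ) : PartialMorphism (limitHaarGroupoid F hF) (stage F a) where
  toPFun := Thread.coord F a
  isOpen_dom := Thread.isOpen_dom_coord a
  inv_mem x hx := by
    obtain ⟨y, hy⟩ := (PFun.mem_dom _ _).1 hx
    exact (PFun.mem_dom _ _).2 ⟨_, Thread.mem_coord.2 (Thread.inv_coord (Thread.mem_coord.1 hy))⟩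
  map_mul x y x' y' hx hy h :=
    ⟨Thread.src_eq_rng_coord h (Thread.mem_coord.1 hx) (Thread.mem_coord.1 hy),
      Thread.mem_coord.2 (Thread.mul_coord h (Thread.mem_coord.1 hx) (Thread.mem_coord.1 hy))⟩
  isProper := Thread.isProperMap_coord a
  map_haar u v huv S hS := Thread.haar_preimage_coord hF (Thread.mem_coord.1 huv) hS

theorem limitProj_onePoint (a : Δ) (x : Thread F) :
    (limitProj hF a).onePoint (OnePoint.some x) = x.1 a :=
  PartialMorphism.OnePoint.ext_coe fun _ =>
    ((limitProj hF a).onePoint_coe_eq_iff).trans Thread.mem_coord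

omit [IsDirectedOrder Δ] [Nonempty Δ] in
theorem map_eq_bond {α β : Δᵒᵖ} (p : α ⟶ β) : F.map p = bond F (leOfHom p.unop) :=
  congrArg F.map (Subsingleton.elim _ _)

/-- The limit cone of an inverse system of groupoids. -/
noncomputable def limitCone : Cone F where
  pt := limitHaarGroupoid F hF
  π :=
    { app := fun α => limitProj hF α.unop
      naturality := fun α β p => by
        rw [map_eq_bond]
        refine PartialMorphism.ext_onePoint fun x => ?_
        change ((PartialMorphism.id _).comp (limitProj hF β.unop)).onePoint _ =
          ((limitProj hF α.unop).comp (bond F (leOfHom p.unop))).onePoint _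
        rw [PartialMorphism.onePoint_comp, PartialMorphism.onePoint_comp, PartialMorphism.onePoint_id,
          limitProj_onePoint, limitProj_onePoint, Thread.bond_coord] }

variable (G : HaarGroupoid.{u}) (t : ∀ a, PartialMorphism G (stage F a))
  (ht : ∀ {a b : Δ} (h : a ≤ b), (t b).comp (bond F h) = t a)

omit [IsDirectedOrder Δ] [Nonempty Δ] in
include ht in
theorem bond_onePoint_cone {a b : Δ} (h : a ≤ b) (z : OnePoint G.Arr) :
    (bond F h).onePoint ((t b).onePoint z) = (t a).onePoint z := by
  rw [← ht h, PartialMorphism.onePoint_comp]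

/-- The partial map to the limit defined by a cone. -/
noncomputable def limitLiftPFun : G.Arr →. Thread F := fun x =>
  ⟨∃ a, (t a).onePoint (OnePoint.some x) ≠ OnePoint.infty, fun h =>
    ⟨fun a => (t a).onePoint (OnePoint.some x), fun _ _ hab => bond_onePoint_cone G t ht hab _, h⟩⟩

omit [IsDirectedOrder Δ] [Nonempty Δ] in
theorem mem_limitLiftPFun {x : G.Arr} {z : Thread F} :
    z ∈ limitLiftPFun G t ht x ↔ ∀ a, (t a).onePoint (OnePoint.some x) = z.1 a := by
  constructor
  · rintro ⟨h, rfl⟩ a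
    rfl
  · intro h
    obtain ⟨a, ha⟩ := z.2.2
    refine ⟨⟨a, ?_⟩, Subtype.ext (funext h)⟩
    rwa [h]

omit [IsDirectedOrder Δ] [Nonempty Δ] in
theorem mem_dom_limitLiftPFun {x : G.Arr} :
    x ∈ (limitLiftPFun G t ht).Dom ↔ ∃ a, x ∈ (t a).toPFun.Dom := by
  refine exists_congr fun a => ?_
  rw [OnePoint.ne_infty_iff_exists, PFun.mem_dom]
  exact exists_congr fun y => eq_comm.trans (t a).onePoint_coe_eq_iff

omit [IsDirectedOrder Δ] [Nonempty Δ] in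
theorem isOpen_dom_limitLiftPFun : IsOpen (limitLiftPFun G t ht).Dom := by
  have h : (limitLiftPFun G t ht).Dom = ⋃ a, (t a).toPFun.Dom := by
    ext x
    rw [mem_dom_limitLiftPFun, Set.mem_iUnion]
  rw [h]
  exact isOpen_iUnion fun a => (t a).isOpen_dom

/-- A compact set of threads is finite at one common stage `a`. Its preimage is closed in the
preimage of a compact set under the proper map `t a`. -/
theorem isProperMap_limitLiftPFun : IsProperMap (limitLiftPFun G t ht).asSubtype := by
  have hc : Continuous (limitLiftPFun G t ht).asSubtype :=
    (continuous_pi fun a => (t a).continuous_onePoint.comp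
      (OnePoint.continuous_coe.comp continuous_subtype_val)).subtype_mk _
  refine (isProperMap_iff_isCompact_preimage).2 ⟨hc, fun K hK => ?_⟩
  obtain ⟨a, ha⟩ := Thread.exists_coord_of_isCompact hK
  have hKa : IsCompact {y : (stage F a).Arr | ∃ x ∈ K, x.1 a = OnePoint.some y} := by
    have h1 := hK.image (Thread.continuous_coord (F := F) a)
    rw [OnePoint.isOpenEmbedding_coe.isInducing.isCompact_iff]
    convert h1 using 1
    ext z
    constructor
    · rintro ⟨y, ⟨x, hx, hxy⟩, rfl⟩
      exact ⟨x, hx, hxy⟩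
    · rintro ⟨x, hx, rfl⟩
      obtain ⟨y, hy⟩ := ha x hx
      exact ⟨y, ⟨x, hx, hy⟩, hy.symm⟩
  have hP : IsCompact ((↑) ⁻¹' ((t a).toPFun.preimage {y | ∃ x ∈ K, x.1 a = OnePoint.some y}) :
      Set (limitLiftPFun G t ht).Dom) := by
    rw [Subtype.isCompact_iff, Subtype.image_preimage_coe, inter_eq_right.2]
    · exact (t a).isCompact_preimage hKa
    · exact fun x hx => (mem_dom_limitLiftPFun G t ht).2 ⟨a, PFun.preimage_subset_dom _ _ hx⟩
  refine hP.of_isClosed_subset (hK.isClosed.preimage hc) fun x hx => ?_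
  obtain ⟨y, hy⟩ := ha _ hx
  exact (PFun.mem_preimage _ _ _).2 ⟨y, ⟨_, hx, hy⟩, (t a).onePoint_coe_eq_iff.1 hy⟩

/-- The morphism to the limit defined by a cone. -/
noncomputable def limitLift : PartialMorphism G (limitHaarGroupoid F hF) where
  toPFun := limitLiftPFun G t ht
  isOpen_dom := isOpen_dom_limitLiftPFun G t ht
  inv_mem x hx := by
    obtain ⟨a, ha⟩ := (mem_dom_limitLiftPFun G t ht).1 hx
    exact (mem_dom_limitLiftPFun G t ht).2 ⟨a, (t a).inv_mem x ha⟩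
  map_mul x y x' y' hx hy h := by
    rw [mem_limitLiftPFun] at hx hy
    have hmul : ∀ a v w, x'.1 a = OnePoint.some v → y'.1 a = OnePoint.some w →
        (stage F a).src v = (stage F a).rng w ∧ (stage F a).mul v w ∈ (t a).toPFun (G.mul x y) :=
      fun a v w hv hw => (t a).map_mul x y v w ((t a).onePoint_coe_eq_iff.1 ((hx a).trans hv))
        ((t a).onePoint_coe_eq_iff.1 ((hy a).trans hw)) h
    have hxy : x'.src = y'.rng := Thread.src_eq_rng_of_eventually
      (.of_forall fun a v w hv hw => (hmul a v w hv hw).1)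
    refine ⟨hxy, ?_⟩
    have hev : ∀ᶠ a in atTop, ∃ v, (x'.mul y').1 a = OnePoint.some v ∧
        (t a).onePoint (OnePoint.some (G.mul x y)) = OnePoint.some v := by
      filter_upwards [x'.eventually_coe, y'.eventually_coe] with a ⟨v, hv⟩ ⟨w, hw⟩
      exact ⟨_, Thread.mul_coord hxy hv hw, (t a).onePoint_coe_eq_iff.2 (hmul a v w hv hw).2⟩
    obtain ⟨a, v, -, ha⟩ := hev.exists
    obtain ⟨z, hz⟩ := (PFun.mem_dom _ _).1 ((mem_dom_limitLiftPFun G t ht).2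
      ⟨a, (t a).mem_dom_of_mem ((t a).onePoint_coe_eq_iff.1 ha)⟩)
    have hz' := (mem_limitLiftPFun G t ht).1 hz
    have e : x'.mul y' = z := Thread.ext_eventually <| by
      filter_upwards [hev] with b ⟨w, hw, hw'⟩
      rw [hw, ← hz', hw']
    change x'.mul y' ∈ _
    rw [e]
    exact hz
  isProper := isProperMap_limitLiftPFun G t ht
  map_haar u v huv S hS := by
    have hd := isOpen_dom_limitLiftPFun G t ht
    have hp := isProperMap_limitLiftPFun G t ht
    have := Thread.regular_haar hF v
    have := regular_pushPFun hd hp (G.haar u)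
    have huv := (mem_limitLiftPFun G t ht).1 huv
    rw [← pushPFun_apply hd hp _ hS]
    congr 1
    refine ext_of_integral_Cc_eq fun f => ?_
    obtain ⟨a₀, y₀, hy₀⟩ := v.1.eventually_coe.exists
    -- Beyond a stage where `v` is finite, both integrals of a pull-back are equal to the Haar
    -- integral of that stage.
    refine Thread.integral_eq_of_pull a₀ (fun a ha k => ?_) f
    obtain ⟨y, hy, -⟩ := v.1.exists_of_le ha hy₀
    have h1 := (t a).integral_pullFun (v := ⟨y, Thread.rng_coord_eq v.2 hy⟩)
      ((t a).onePoint_coe_eq_iff.1 ((huv a).trans hy)) k.continuous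
    refine Eq.trans ?_ (h1.trans
      (Thread.integral_pull_haar hF (v := ⟨y, Thread.rng_coord_eq v.2 hy⟩) hy k).symm)
    refine integral_pushPFun hd hp _ (Thread.pull a k).continuous (fun x z hz => ?_) fun x hx => ?_
    · have hz := (mem_limitLiftPFun G t ht).1 hz a
      change (t a).pullFun k x = Thread.pull a k z
      by_cases hza : z.1 a = OnePoint.infty
      · rw [Thread.pull_of_infty _ hza, PartialMorphism.pullFun_of_notMem]
        intro hx
        obtain ⟨w, hw⟩ := (PFun.mem_dom _ _).1 hx
        rw [(t a).onePoint_coe_eq_iff.2 hw, hza] at hz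
        exact OnePoint.coe_ne_infty _ hz
      · obtain ⟨w, hw⟩ := OnePoint.ne_infty_iff_exists.1 hza
        rw [Thread.pull_of_coe _ hw.symm]
        exact (t a).pullFun_of_mem _ ((t a).onePoint_coe_eq_iff.1 (hz.trans hw.symm))
    · exact (t a).pullFun_of_notMem _ fun h => hx ((mem_dom_limitLiftPFun G t ht).2 ⟨a, h⟩)

/-- Yields uniqueness of the lift: the cone determines the graph of `m`. Where `m` is undefined all
coordinates would be infinite, which no thread allows. -/
theorem mem_iff_of_comp_limitProj {m : PartialMorphism G (limitHaarGroupoid F hF)}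
    (hm : ∀ a, m.comp (limitProj hF a) = t a) {x : G.Arr} {z : Thread F} :
    z ∈ m.toPFun x ↔ ∀ a, (t a).onePoint (OnePoint.some x) = z.1 a := by
  constructor
  · intro h a
    rw [← hm, PartialMorphism.onePoint_comp, m.onePoint_coe_eq_iff.2 h, limitProj_onePoint]
  · intro h
    obtain ⟨a, ha⟩ := z.2.2
    have h' : ∀ a, (limitProj hF a).onePoint (m.onePoint (OnePoint.some x)) = z.1 a := fun a => by
      rw [← PartialMorphism.onePoint_comp, hm, h]
    obtain ⟨z', hz'⟩ := OnePoint.ne_infty_iff_exists.1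
      (show m.onePoint (OnePoint.some x) ≠ OnePoint.infty from fun h0 => ha (by
        rw [← h' a, h0, PartialMorphism.onePoint_infty]))
    have e : z' = z := Subtype.ext (funext fun a => by
      rw [← h' a, ← hz', limitProj_onePoint])
    rw [← e]
    exact m.onePoint_coe_eq_iff.1 hz'.symm

theorem limitLift_comp (a : Δ) : (limitLift hF G t ht).comp (limitProj hF a) = t a := by
  refine PartialMorphism.ext_onePoint fun x => ?_
  rw [PartialMorphism.onePoint_comp]
  by_cases hx : x ∈ (limitLiftPFun G t ht).Dom
  · obtain ⟨z, hz⟩ := (PFun.mem_dom _ _).1 hx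
    have hz' : (limitLift hF G t ht).onePoint (OnePoint.some x) = OnePoint.some z :=
      (limitLift hF G t ht).onePoint_coe_eq_iff.2 hz
    rw [hz', limitProj_onePoint, (mem_limitLiftPFun G t ht).1 hz]
  · have h1 : (limitLift hF G t ht).onePoint (OnePoint.some x) = OnePoint.infty := by
      by_contra hne
      obtain ⟨z, hz⟩ := OnePoint.ne_infty_iff_exists.1 hne
      exact hx ((limitLift hF G t ht).mem_dom_of_mem
        ((limitLift hF G t ht).onePoint_coe_eq_iff.1 hz.symm))
    rw [h1, PartialMorphism.onePoint_infty]
    by_contra hne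
    exact hx ⟨a, fun h => hne h.symm⟩

omit [IsDirectedOrder Δ] [Nonempty Δ] in
theorem cone_comp_bond (s : Cone F) {a b : Δ} (h : a ≤ b) :
    PartialMorphism.comp (s.π.app (op b)) (bond F h) = s.π.app (op a) := s.w (homOfLE h).op

/-- The limit cone of an inverse system of groupoids is a limit. -/
noncomputable def isLimitLimitCone : IsLimit (limitCone hF) where
  lift s := limitLift hF s.pt (fun a => s.π.app (op a)) (cone_comp_bond s)
  fac s α := limitLift_comp hF s.pt _ _ α.unop
  uniq s m hm := PartialMorphism.ext (funext fun _ => Part.ext fun _ =>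
    (mem_iff_of_comp_limitProj hF s.pt (fun a => s.π.app (op a)) (m := m) (fun a => hm (op a))).trans
      (mem_limitLiftPFun s.pt (fun a => s.π.app (op a)) (cone_comp_bond s)).symm)

end Limit

/-! ### Direct limits of C*-algebras -/

/-- A `*`-homomorphism on a subspace that is dense and on which it is bounded for a submultiplicative
seminorm extends to a `*`-homomorphism. -/
theorem exists_extend_of_seminorm {E V B : Type*} [AddCommGroup E] [Module ℂ E] [AddCommGroup V]
    [Module ℂ V] [NonUnitalCStarAlgebra B] (p : Seminorm ℂ V) (m : V →ₗ[ℂ] V →ₗ[ℂ] V) {s : V → V}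
    (hm : ∀ f g, p (m f g) ≤ p f * p g) (hs : ∀ f, p (s f) ≤ p f) (hs' : ∀ f g, s (f - g) = s f - s g)
    (e : E →ₗ[ℂ] V) (he : ∀ f, ∀ ε > 0, ∃ x, p (f - e x) ≤ ε) (T : E →ₗ[ℂ] B)
    (hT : ∀ x, ‖T x‖ ≤ p (e x)) (hTm : ∀ x y, ∃ z, e z = m (e x) (e y) ∧ T z = T x * T y)
    (hTs : ∀ x, ∃ z, e z = s (e x) ∧ T z = star (T x)) :
    ∃ T' : V →ₗ[ℂ] B, (∀ f g, T' (m f g) = T' f * T' g) ∧ (∀ f, T' (s f) = star (T' f)) ∧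
      (∀ f, ‖T' f‖ ≤ p f) ∧ ∀ x, T' (e x) = T x := by
  obtain ⟨T', hT', hTe⟩ : ∃ T' : V →ₗ[ℂ] B, (∀ f, ‖T' f‖ ≤ p f) ∧ ∀ x, T' (e x) = T x := by
    -- With `p` as the norm of `V`, the range of `e` is dense and `T` extends by continuity.
    let _ : SeminormedAddCommGroup V := AddGroupSeminorm.toSeminormedAddCommGroup p.toAddGroupSeminorm
    have hb : IsBoundedSMul ℂ V := .of_norm_smul_le fun c x => (map_smul_eq_mul p c x).le
    have hd : DenseRange e := fun f => Metric.mem_closure_iff.2 fun ε hε => by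
      obtain ⟨x, hx⟩ := he f (ε / 2) (half_pos hε)
      refine ⟨e x, ⟨x, rfl⟩, ?_⟩
      rw [dist_eq_norm]
      exact hx.trans_lt (half_lt_self hε)
    have hT1 : ∀ x, ‖T x‖ ≤ 1 * ‖e x‖ := fun x => by rw [one_mul]; exact hT x
    refine ⟨(T.extendOfNorm e).toLinearMap, fun f => ?_, LinearMap.extendOfNorm_eq hd ⟨1, hT1⟩⟩
    exact (LinearMap.norm_extendOfNorm_apply_le hd 1 hT1 f).trans_eq (one_mul _)
  -- Multiplicativity is extended in one variable at a time, each time by approximation in `p`.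
  have hm1 : ∀ x g, T' (m (e x) g) = T' (e x) * T' g := fun x g => by
    refine sub_eq_zero.1 (norm_le_zero_iff.1 (nonpos_of_forall_le_mul (C := 2 * p (e x)) fun ε hε => ?_))
    obtain ⟨y, hy⟩ := he g ε hε
    obtain ⟨z, hz, hz'⟩ := hTm x y
    have h1 : T' (m (e x) g) - T' (e x) * T' g
        = T' (m (e x) (g - e y)) - T' (e x) * T' (g - e y) := by
      rw [map_sub, map_sub, map_sub, mul_sub, ← hz, hTe z, hz', hTe x, hTe y]
      abel
    rw [h1]
    have h2 : p (e x) * p (g - e y) ≤ p (e x) * ε := mul_le_mul_of_nonneg_left hy (apply_nonneg p _)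
    calc _ ≤ ‖T' (m (e x) (g - e y))‖ + ‖T' (e x) * T' (g - e y)‖ := norm_sub_le _ _
      _ ≤ p (e x) * p (g - e y) + p (e x) * p (g - e y) := add_le_add ((hT' _).trans (hm _ _))
          ((norm_mul_le _ _).trans (mul_le_mul (hT' _) (hT' _) (norm_nonneg _) (apply_nonneg p _)))
      _ ≤ _ := by linarith
  refine ⟨T', fun f g => ?_, fun f => ?_, hT', hTe⟩
  · refine sub_eq_zero.1 (norm_le_zero_iff.1 (nonpos_of_forall_le_mul (C := 2 * p g) fun ε hε => ?_))
    obtain ⟨x, hx⟩ := he f ε hε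
    have h1 : T' (m f g) - T' f * T' g = T' (m (f - e x) g) - T' (f - e x) * T' g := by
      rw [map_sub, LinearMap.sub_apply, map_sub, map_sub, sub_mul, hm1]
      abel
    rw [h1]
    have h2 : p (f - e x) * p g ≤ ε * p g := mul_le_mul_of_nonneg_right hx (apply_nonneg p _)
    calc _ ≤ ‖T' (m (f - e x) g)‖ + ‖T' (f - e x) * T' g‖ := norm_sub_le _ _
      _ ≤ p (f - e x) * p g + p (f - e x) * p g := add_le_add ((hT' _).trans (hm _ _))
          ((norm_mul_le _ _).trans (mul_le_mul (hT' _) (hT' _) (norm_nonneg _) (apply_nonneg p _)))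
      _ ≤ _ := by linarith
  · refine sub_eq_zero.1 (norm_le_zero_iff.1 (nonpos_of_forall_le_mul (C := 2) fun ε hε => ?_))
    obtain ⟨x, hx⟩ := he f ε hε
    obtain ⟨z, hz, hz'⟩ := hTs x
    have h1 : T' (s f) - star (T' f) = T' (s (f - e x)) - star (T' (f - e x)) := by
      rw [hs', map_sub, map_sub, star_sub, ← hz, hTe, hz', hTe]
      abel
    rw [h1]
    calc _ ≤ ‖T' (s (f - e x))‖ + ‖star (T' (f - e x))‖ := norm_sub_le _ _
      _ ≤ p (f - e x) + p (f - e x) := by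
          rw [norm_star]
          exact add_le_add ((hT' _).trans (hs _)) (hT' _)
      _ ≤ _ := by linarith

namespace HaarGroupoid

variable {G : HaarGroupoid.{u}}

/-- The `I`-norm as a seminorm. -/
noncomputable def seminormI (G : HaarGroupoid.{u}) : Seminorm ℂ C_c(G.Arr, ℂ) :=
  Seminorm.ofSMulLE G.rnormI
    (le_antisymm (by simpa using rnormI_smul_le (0 : ℂ) (0 : C_c(G.Arr, ℂ))) (rnormI_nonneg _))
    rnormI_add_le rnormI_smul_le

theorem rnormI_le_of_norm_le {f k : C_c(G.Arr, ℂ)} {ε : ℝ} (hε : 0 ≤ ε)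
    (h : ∀ x, ‖f x‖ ≤ ε * ‖k x‖) : G.rnormI f ≤ ε * G.rnormI k := by
  have key : ∀ (f k : C_c(G.Arr, ℂ)) (u : G.Units), (∀ x, ‖f x‖ ≤ ε * ‖k x‖) →
      ∫ x, ‖f x‖ ∂(G.haar u) ≤ ε * ∫ x, ‖k x‖ ∂(G.haar u) := fun f k u h => by
    rw [← integral_const_mul]
    exact integral_mono (integrable_norm f u) ((integrable_norm k u).const_mul ε) h
  refine rnormI_le (mul_nonneg hε (rnormI_nonneg k)) (fun u => ?_) fun u => ?_
  · exact (key f k u h).trans (mul_le_mul_of_nonneg_left (integral_norm_le_rnormI k u) hε)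
  · refine (key _ (G.adj k) u fun x => ?_).trans
      (mul_le_mul_of_nonneg_left (integral_norm_adj_le_rnormI k u) hε)
    rw [adj_apply, adj_apply, norm_star, norm_star]
    exact h _

/-- A `*`-homomorphism from the convolution algebra to a C*-algebra that is contractive for the
`I`-norm is contractive for the maximal norm. -/
theorem norm_le_normMax {B : Type u} [NonUnitalCStarAlgebra B] (T : C_c(G.Arr, ℂ) →ₗ[ℂ] B)
    (hm : ∀ f g, T (G.conv f g) = T f * T g) (hs : ∀ f, T (G.adj f) = star (T f))
    (hT : ∀ f, ‖T f‖ ≤ G.rnormI f) (f : C_c(G.Arr, ℂ)) : ‖T f‖ ≤ (G.normMax f).toReal := by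
  -- A representation of `B` that norms `T f`, composed with `T`, is one of the representations that
  -- define the maximal norm.
  obtain ⟨H, h1, h2, h3, π, hπ⟩ := exists_rep_norm_le B (T f)
  let πₗ : B →ₗ[ℂ] (H →L[ℂ] H) :=
    { toFun := π, map_add' := map_add π, map_smul' := map_smul π }
  let ρ : G.Rep :=
    { H := H
      π := πₗ ∘ₗ T
      map_conv := fun f g => by
        change π (T _) = π (T _) * π (T _)
        rw [hm, map_mul]
      map_adj := fun f => by
        change π (T _) = star (π (T _))
        rw [hs, map_star]
      bounded := ⟨1, fun f => by
        rw [ENNReal.coe_one, one_mul, ← ofReal_rnormI, ← ofReal_norm]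
        exact ENNReal.ofReal_le_ofReal ((NonUnitalStarAlgHom.norm_apply_le π (T f)).trans (hT f))⟩ }
  refine hπ.trans ?_
  rw [← toReal_enorm]
  exact ENNReal.toReal_mono (normMax_ne_top f) (le_iSup (fun ρ : G.Rep => ‖ρ.π f‖ₑ) ρ)

theorem rnormMin_le_rnormI (f : C_c(G.Arr, ℂ)) : G.rnormMin f ≤ G.rnormI f :=
  ENNReal.toReal_mono (normI_ne_top f) ((normMin_le_normMax f).trans (normMax_le_normI f))

theorem rnormMin_add_le (f g : C_c(G.Arr, ℂ)) : G.rnormMin (f + g) ≤ G.rnormMin f + G.rnormMin g :=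
  rnormMin_le (add_nonneg (rnormMin_nonneg f) (rnormMin_nonneg g)) fun u => by
    rw [map_add]
    exact (norm_add_le _ _).trans (add_le_add (norm_ind_le u f) (norm_ind_le u g))

end HaarGroupoid

namespace PartialMorphism

variable {G H : HaarGroupoid.{u}} (φ : PartialMorphism G H)

/-- The squares of both norms are values of `η* * η`, at `v` and pulled back to `u`. -/
theorem norm_toL2_pullCc {u : G.Units} {v : H.Units} (h : (v : H.Arr) ∈ φ.toPFun (u : G.Arr))
    (η : C_c(H.Arr, ℂ)) : ‖G.toL2 u (φ.pullCc η)‖ = ‖H.toL2 v η‖ := by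
  have h1 : inner ℂ (G.toL2 u (φ.pullCc η)) (G.toL2 u (φ.pullCc η))
      = inner ℂ (H.toL2 v η) (H.toL2 v η) := by
    rw [HaarGroupoid.inner_toL2, HaarGroupoid.inner_toL2, ← pullCc_adj, ← pullCc_conv, pullCc_apply,
      φ.pullFun_of_mem _ h]
  rw [inner_self_eq_norm_sq_to_K, inner_self_eq_norm_sq_to_K] at h1
  exact (sq_eq_sq₀ (norm_nonneg _) (norm_nonneg _)).1 (by exact_mod_cast h1)

variable {φ}

theorem Surjective.exists_unit (hφ : φ.Surjective) (v : H.Units) :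
    ∃ u : G.Units, (v : H.Arr) ∈ φ.toPFun (u : G.Arr) := by
  obtain ⟨x, hx⟩ := hφ v
  refine ⟨G.rngU x, ?_⟩
  have h := φ.map_rng hx
  rwa [v.2] at h

theorem Surjective.rnormI_le (hφ : φ.Surjective) (f : C_c(H.Arr, ℂ)) :
    H.rnormI f ≤ G.rnormI (φ.pullCc f) := by
  refine HaarGroupoid.rnormI_le (HaarGroupoid.rnormI_nonneg _) (fun v => ?_) fun v => ?_
  · obtain ⟨u, hu⟩ := hφ.exists_unit v
    rw [← φ.integral_norm_pullCc hu]
    exact HaarGroupoid.integral_norm_le_rnormI _ u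
  · obtain ⟨u, hu⟩ := hφ.exists_unit v
    rw [← φ.integral_norm_pullCc hu, pullCc_adj]
    exact HaarGroupoid.integral_norm_adj_le_rnormI _ u

/-- Every unit `v` of `H` is the image of a unit `u` of `G`. Pull-back embeds the `L²` space at `v`
isometrically into that at `u` and intertwines the actions. -/
theorem Surjective.rnormMin_le (hφ : φ.Surjective) (f : C_c(H.Arr, ℂ)) :
    H.rnormMin f ≤ G.rnormMin (φ.pullCc f) := by
  refine HaarGroupoid.rnormMin_le (HaarGroupoid.rnormMin_nonneg _) fun v => ?_
  obtain ⟨u, hu⟩ := hφ.exists_unit v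
  refine LinearMap.opNorm_extendOfNorm_le (HaarGroupoid.denseRange_toL2 v)
    (HaarGroupoid.rnormMin_nonneg _) fun ξ => ?_
  change ‖H.toL2 v (H.conv f ξ)‖ ≤ _
  rw [← φ.norm_toL2_pullCc hu, ← φ.norm_toL2_pullCc hu, pullCc_conv]
  exact HaarGroupoid.norm_toL2_conv_le_rnormMin u _ _

end PartialMorphism

/-! ### Approximation on a limit by functions from the stages -/

section Limit

variable {Δ : Type u} [Preorder Δ] {F : Δᵒᵖ ⥤ HaarGroupoid.{u}} [IsDirectedOrder Δ] [Nonempty Δ]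
  (hF : ∀ {a b : Δ} (h : a ≤ b), (bond F h).Surjective)

theorem limitProj_surjective (a : Δ) : (limitProj hF a).Surjective := fun y => by
  obtain ⟨x, hx⟩ := Thread.exists_coord_eq hF a y
  exact ⟨x, Thread.mem_coord.2 hx⟩

theorem limitProj_pullCc (a : Δ) (h : C_c((stage F a).Arr, ℂ)) :
    (limitProj hF a).pullCc h = Thread.pull a h := by
  ext x
  rw [PartialMorphism.pullCc_apply]
  by_cases hx : x.1 a = OnePoint.infty
  · rw [Thread.pull_of_infty _ hx, PartialMorphism.pullFun_of_notMem]
    intro hd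
    obtain ⟨y, hy⟩ := (PFun.mem_dom _ _).1 hd
    rw [Thread.mem_coord.1 hy] at hx
    exact OnePoint.coe_ne_infty _ hx
  · obtain ⟨y, hy⟩ := OnePoint.ne_infty_iff_exists.1 hx
    rw [Thread.pull_of_coe _ hy.symm]
    exact PartialMorphism.pullFun_of_mem _ _ (Thread.mem_coord.2 hy.symm)

/-- The error in `exists_pull_approx` is dominated pointwise by a small multiple of one fixed
function, hence is small in the `I`-norm. -/
theorem exists_rnormI_sub_limitProj_le (f : C_c((limitHaarGroupoid F hF).Arr, ℂ)) {ε : ℝ}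
    (hε : 0 < ε) : ∃ a h, (limitHaarGroupoid F hF).rnormI (f - (limitProj hF a).pullCc h) ≤ ε := by
  obtain ⟨a, k, -, hk⟩ := Thread.exists_pull_approx f
  set M := (limitHaarGroupoid F hF).rnormI (Thread.pull a k) + 1 with hM
  have hM0 : 0 < M := by
    have := HaarGroupoid.rnormI_nonneg (G := limitHaarGroupoid F hF) (Thread.pull a k)
    positivity
  obtain ⟨b, -, h, hh⟩ := hk (ε / M) (by positivity)
  refine ⟨b, h, ?_⟩
  rw [limitProj_pullCc]
  refine (HaarGroupoid.rnormI_le_of_norm_le (G := limitHaarGroupoid F hF) (k := Thread.pull a k)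
    (by positivity : 0 ≤ ε / M) fun x => (hh x).trans
      (mul_le_mul_of_nonneg_left (Complex.re_le_norm _) (by positivity))).trans ?_
  rw [div_mul_eq_mul_div, div_le_iff₀ hM0]
  exact mul_le_mul_of_nonneg_left (by linarith) hε.le

/-- The projections of a cone. -/
def coneProj (c : Cone F) (a : Δ) : PartialMorphism c.pt (stage F a) := c.π.app (op a)

omit [IsDirectedOrder Δ] [Nonempty Δ] in
theorem coneProj_comp_bond (c : Cone F) {a b : Δ} (h : a ≤ b) :
    (coneProj c b).comp (bond F h) = coneProj c a := c.w (homOfLE h).op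

variable {c : Cone F} (hc : IsLimit c)

-- Transported from the explicit limit along the isomorphism of limit cones.
include hF hc in
theorem cone_surjective (a : Δ) : (coneProj c a).Surjective := fun y => by
  obtain ⟨z, hz⟩ := limitProj_surjective hF a y
  let e := hc.conePointUniqueUpToIso (isLimitLimitCone hF)
  have h1 : PartialMorphism.comp e.hom (limitProj hF a) = coneProj c a :=
    hc.conePointUniqueUpToIso_hom_comp (isLimitLimitCone hF) (op a)
  have h2 : PartialMorphism.comp e.inv e.hom = PartialMorphism.id _ := e.inv_hom_id
  have h3 : z ∈ (PartialMorphism.comp e.inv e.hom).toPFun z := by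
    rw [h2]
    exact Part.mem_some z
  obtain ⟨x, -, hx⟩ := Part.mem_bind_iff.1 h3
  refine ⟨x, ?_⟩
  rw [← h1]
  exact Part.mem_bind_iff.2 ⟨z, hx, hz⟩

include hF hc in
theorem exists_rnormI_sub_cone_le (f : C_c(c.pt.Arr, ℂ)) {ε : ℝ} (hε : 0 < ε) :
    ∃ a h, c.pt.rnormI (f - (coneProj c a).pullCc h) ≤ ε := by
  let e := hc.conePointUniqueUpToIso (isLimitLimitCone hF)
  obtain ⟨a, h, hh⟩ := exists_rnormI_sub_limitProj_le hF (PartialMorphism.pullCc e.inv f) hε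
  refine ⟨a, h, ?_⟩
  have h1 : (coneProj c a).pullCc h = PartialMorphism.pullCc e.hom ((limitProj hF a).pullCc h) :=
    (congrArg (fun φ => PartialMorphism.pullCc φ h)
      (hc.conePointUniqueUpToIso_hom_comp (isLimitLimitCone hF) (op a)).symm).trans
      (PartialMorphism.pullCc_comp e.hom (limitProj hF a) h)
  have h2 : f = PartialMorphism.pullCc e.hom (PartialMorphism.pullCc e.inv f) := by
    rw [← PartialMorphism.pullCc_comp, e.hom_inv_id, PartialMorphism.pullCc_id]
  rw [h1]
  conv_lhs => rw [h2]
  refine le_trans (le_of_eq ?_) ((PartialMorphism.rnormI_pullCc_le e.hom _).trans hh)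
  congr 1
  exact (map_sub (PartialMorphism.pullₗ e.hom) _ _).symm

end Limit

/-! ### Extension of a cocone to the convolution algebra of the limit -/

section Limit

variable {Δ : Type u} [Preorder Δ] {F : Δᵒᵖ ⥤ HaarGroupoid.{u}}

theorem pullCc_coneProj_bond (c : Cone F) {a b : Δ} (hab : a ≤ b) (k : C_c((stage F a).Arr, ℂ)) :
    (coneProj c b).pullCc ((bond F hab).pullCc k) = (coneProj c a).pullCc k := by
  rw [← coneProj_comp_bond c hab]
  exact (PartialMorphism.pullCc_comp (coneProj c b) (bond F hab) k).symm

variable {B : Type u} [NonUnitalCStarAlgebra B] {ψ : ∀ a, C_c((stage F a).Arr, ℂ) →ₗ[ℂ] B} {c : Cone F}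

variable (c ψ) in
/-- The values on pull-backs of the linear map on the limit defined by a cocone of linear maps. -/
def ConeValue (f : C_c(c.pt.Arr, ℂ)) (x : B) : Prop :=
  ∃ a k, f = (coneProj c a).pullCc k ∧ x = ψ a k

namespace ConeValue

variable [IsDirectedOrder Δ]
  (hψ : ∀ {a b : Δ} (hab : a ≤ b) k, ψ b ((bond F hab).pullCc k) = ψ a k)
include hψ

theorem common {f f' : C_c(c.pt.Arr, ℂ)} {x x' : B} (h : ConeValue ψ c f x) (h' : ConeValue ψ c f' x') :
    ∃ a k k', f = (coneProj c a).pullCc k ∧ x = ψ a k ∧ f' = (coneProj c a).pullCc k' ∧ x' = ψ a k' := by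
  obtain ⟨a, k, rfl, rfl⟩ := h
  obtain ⟨b, k', rfl, rfl⟩ := h'
  obtain ⟨d, had, hbd⟩ := exists_ge_ge a b
  exact ⟨d, (bond F had).pullCc k, (bond F hbd).pullCc k', (pullCc_coneProj_bond c had k).symm,
    (hψ had k).symm, (pullCc_coneProj_bond c hbd k').symm, (hψ hbd k').symm⟩

theorem add {f f' : C_c(c.pt.Arr, ℂ)} {x x' : B} (h : ConeValue ψ c f x) (h' : ConeValue ψ c f' x') :
    ConeValue ψ c (f + f') (x + x') := by
  obtain ⟨a, k, k', rfl, rfl, rfl, rfl⟩ := h.common hψ h'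
  exact ⟨a, k + k', (map_add (coneProj c a).pullₗ k k').symm, (map_add _ _ _).symm⟩

/-- Pull-back along a surjective projection does not decrease the `I`-norm. So two functions of a
stage with the same pull-back differ by one of `I`-norm zero, which the contraction `ψ a` kills. -/
theorem unique (hS : ∀ a, (coneProj c a).Surjective) (hn : ∀ a k, ‖ψ a k‖ ≤ (stage F a).rnormI k)
    {f : C_c(c.pt.Arr, ℂ)} {x x' : B} (h : ConeValue ψ c f x) (h' : ConeValue ψ c f x') : x = x' := by
  obtain ⟨a, k, k', rfl, rfl, hk, rfl⟩ := h.common hψ h'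
  rw [← sub_eq_zero, ← map_sub, ← norm_le_zero_iff]
  refine ((hn a _).trans ((hS a).rnormI_le _)).trans (le_of_eq ?_)
  have h0 : (coneProj c a).pullCc (k - k') = 0 := by
    have := map_sub (coneProj c a).pullₗ k k'
    rwa [PartialMorphism.pullₗ_apply, PartialMorphism.pullₗ_apply, PartialMorphism.pullₗ_apply, ← hk,
      sub_self] at this
  rw [h0]
  exact map_zero c.pt.seminormI

end ConeValue

variable [IsDirectedOrder Δ] [Nonempty Δ]

theorem ConeValue.exists_linearMap (hψ : ∀ {a b : Δ} (hab : a ≤ b) k, ψ b ((bond F hab).pullCc k) = ψ a k)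
    (hS : ∀ a, (coneProj c a).Surjective) (hn : ∀ a k, ‖ψ a k‖ ≤ (stage F a).rnormI k) :
    ∃ (E : Type u) (_ : AddCommGroup E) (_ : Module ℂ E) (e : E →ₗ[ℂ] C_c(c.pt.Arr, ℂ)) (T : E →ₗ[ℂ] B),
      (∀ f, ConeValue ψ c (e f) (T f)) ∧ ∀ f x, ConeValue ψ c f x → ∃ z, e z = f := by
  have hsmul : ∀ (t : ℂ) f x, ConeValue ψ c f x → ConeValue ψ c (t • f) (t • x) :=
    fun t f x ⟨a, k, h, h'⟩ => ⟨a, t • k,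
      (congrArg (t • ·) h).trans (map_smul (coneProj c a).pullₗ t k).symm,
      (congrArg (t • ·) h').trans (map_smul (ψ a) t k).symm⟩
  let D : Submodule ℂ C_c(c.pt.Arr, ℂ) :=
    { carrier := {f | ∃ x, ConeValue ψ c f x}
      add_mem' := fun ⟨x, h⟩ ⟨x', h'⟩ => ⟨_, h.add hψ h'⟩
      zero_mem' := ⟨0, Classical.arbitrary Δ, 0, (map_zero (coneProj c _).pullₗ).symm, (map_zero _).symm⟩
      smul_mem' := fun t f ⟨x, h⟩ => ⟨_, hsmul t f x h⟩ }
  choose L hL using fun f : D => f.2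
  refine ⟨D, inferInstance, inferInstance, D.subtype,
    { toFun := L
      map_add' := fun f f' => (hL (f + f')).unique hψ hS hn ((hL f).add hψ (hL f'))
      map_smul' := fun t f => (hL (t • f)).unique hψ hS hn (hsmul t _ _ (hL f)) }, hL, fun f x h => ⟨⟨f, x, h⟩, rfl⟩⟩

/-- A compatible family of `*`-homomorphisms on the convolution algebras of an inverse system
extends to the convolution algebra of the limit. -/
theorem exists_extend_of_isLimit (hF : ∀ {a b : Δ} (h : a ≤ b), (bond F h).Surjective) (hc : IsLimit c)
    (hψ : ∀ {a b : Δ} (hab : a ≤ b) k, ψ b ((bond F hab).pullCc k) = ψ a k)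
    (hn : ∀ a k, ‖ψ a k‖ ≤ (stage F a).rnormI k)
    (hm : ∀ a k k', ψ a ((stage F a).conv k k') = ψ a k * ψ a k')
    (hs : ∀ a k, ψ a ((stage F a).adj k) = star (ψ a k)) :
    ∃ T : C_c(c.pt.Arr, ℂ) →ₗ[ℂ] B, (∀ f g, T (c.pt.conv f g) = T f * T g) ∧
      (∀ f, T (c.pt.adj f) = star (T f)) ∧ (∀ f, ‖T f‖ ≤ c.pt.rnormI f) ∧
      ∀ a k, T ((coneProj c a).pullCc k) = ψ a k := by
  have hS := cone_surjective hF hc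
  obtain ⟨E, _, _, e, T, hT, hD⟩ := ConeValue.exists_linearMap hψ hS hn
  have hu : ∀ f x, ConeValue ψ c (e f) x → T f = x := fun f x h => (hT f).unique hψ hS hn h
  have he : ∀ f, ∀ ε > 0, ∃ x, c.pt.seminormI (f - e x) ≤ ε := fun f ε hε => by
    obtain ⟨a, k, hk⟩ := exists_rnormI_sub_cone_le hF hc f hε
    obtain ⟨x, hx⟩ := hD _ _ ⟨a, k, rfl, rfl⟩
    exact ⟨x, by rw [hx]; exact hk⟩
  have hTn : ∀ f, ‖T f‖ ≤ c.pt.seminormI (e f) := fun f => by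
    obtain ⟨a, k, h, h'⟩ := hT f
    rw [h, h']
    exact (hn a k).trans ((hS a).rnormI_le k)
  have hTm : ∀ f g, ∃ z, e z = c.pt.convₗ (e f) (e g) ∧ T z = T f * T g := fun f g => by
    obtain ⟨a, k, k', h, h', h'', h'''⟩ := (hT f).common hψ (hT g)
    have hv : ConeValue ψ c (c.pt.convₗ (e f) (e g)) (T f * T g) :=
      ⟨a, (stage F a).conv k k', by rw [h, h'', PartialMorphism.pullCc_conv]; rfl, by rw [h', h''', hm]⟩
    obtain ⟨z, hz⟩ := hD _ _ hv
    exact ⟨z, hz, hu _ _ (hz.symm ▸ hv)⟩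
  have hTs : ∀ f, ∃ z, e z = c.pt.adj (e f) ∧ T z = star (T f) := fun f => by
    obtain ⟨a, k, h, h'⟩ := hT f
    have hv : ConeValue ψ c (c.pt.adj (e f)) (star (T f)) :=
      ⟨a, (stage F a).adj k, by rw [h, PartialMorphism.pullCc_adj], by rw [h', hs]⟩
    obtain ⟨z, hz⟩ := hD _ _ hv
    exact ⟨z, hz, hu _ _ (hz.symm ▸ hv)⟩
  obtain ⟨T', h1, h2, h3, h4⟩ := exists_extend_of_seminorm c.pt.seminormI c.pt.convₗ (s := c.pt.adj)
    HaarGroupoid.rnormI_conv_le HaarGroupoid.rnormI_adj_le HaarGroupoid.adj_sub e he T hTn hTm hTs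
  refine ⟨T', h1, h2, h3, fun a k => ?_⟩
  have hv : ConeValue ψ c ((coneProj c a).pullCc k) (ψ a k) := ⟨a, k, rfl, rfl⟩
  obtain ⟨z, hz⟩ := hD _ _ hv
  rw [← hz, h4]
  exact hu _ _ (hz.symm ▸ hv)

end Limit

/-! ### From inverse limits to direct limits -/

namespace IsCompletionFunctor

variable {N : ∀ G : HaarGroupoid.{u}, C_c(G.Arr, ℂ) → ℝ≥0∞} {Γ : HaarGroupoid.{u}ᵒᵖ ⥤ CStarAlg.{u}}
  {ι : ∀ G : HaarGroupoid.{u}, C_c(G.Arr, ℂ) →ₗ[ℂ] (Γ.obj (op G) : Type u)}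

/-- A functor of completions sends inverse limits with surjective bonding maps to direct limits,
if it satisfies an extension property. -/
theorem mapsInverseLimitsToDirectLimits (h : IsCompletionFunctor N Γ ι)
    (hN : ∀ G f, N G f ≤ G.normI f)
    (hext : ∀ (G : HaarGroupoid.{u}) (B : Type u) [NonUnitalCStarAlgebra B]
      (T : C_c(G.Arr, ℂ) →ₗ[ℂ] B), (∀ f g, T (G.conv f g) = T f * T g) →
      (∀ f, T (G.adj f) = star (T f)) → (∀ f, ‖T f‖ ≤ G.rnormI f) →
      (∀ f, ∀ ε > 0, ∃ (H : HaarGroupoid.{u}) (φ : PartialMorphism G H) (k : C_c(H.Arr, ℂ)),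
        φ.Surjective ∧ G.rnormI (f - φ.pullCc k) ≤ ε ∧ ‖T (φ.pullCc k)‖ ≤ (N H k).toReal) →
      ∀ f, ‖T f‖ ≤ (N G f).toReal) : MapsInverseLimitsToDirectLimits Γ := by
  intro Δ _ _ _ F hsurj c ⟨hc⟩
  have hF : ∀ {a b : Δ} (h : a ≤ b), (bond F h).Surjective := fun h => hsurj _
  have hι : ∀ G f, ‖ι G f‖ ≤ G.rnormI f := fun G f => by
    rw [h.norm_eq]
    exact ENNReal.toReal_mono (HaarGroupoid.normI_ne_top f) (hN G f)
  have hdesc : ∀ s : Cocone (F.rightOp ⋙ Γ), ∃ Φ : Γ.obj (op c.pt) ⟶ s.pt, ∀ a k,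
      CStarAlg.starHom Φ (ι c.pt ((coneProj c a).pullCc k))
        = CStarAlg.starHom (A := Γ.obj (op (stage F a))) (s.ι.app a) (ι (stage F a) k) := fun s => by
    let t : ∀ a, Γ.obj (op (stage F a)) ⟶ s.pt := fun a => s.ι.app a
    let ψ : ∀ a, C_c((stage F a).Arr, ℂ) →ₗ[ℂ] s.pt := fun a =>
      { toFun := fun k => CStarAlg.starHom (t a) (ι (stage F a) k)
        map_add' := fun k k' => by rw [map_add, map_add]
        map_smul' := fun r k => by rw [map_smul, map_smul]; rfl }
    have hle : ∀ a k, ‖ψ a k‖ ≤ ‖ι (stage F a) k‖ := fun a k =>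
      NonUnitalStarAlgHom.norm_apply_le (CStarAlg.starHom (t a)) _
    obtain ⟨T, hm, hs, hn, hT⟩ := exists_extend_of_isLimit (ψ := ψ) hF hc
      (fun {a b} hab k => by
        have e : Γ.map (Quiver.Hom.op (V := HaarGroupoid.{u}) (bond F hab)) ≫ t b = t a := s.w (homOfLE hab)
        change CStarAlg.starHom (t b) (ι (stage F b) _) = CStarAlg.starHom (t a) (ι (stage F a) k)
        rw [← h.map_induced, ← e]
        rfl)
      (fun a k => (hle a k).trans (hι _ _))
      (fun a k k' => by
        change CStarAlg.starHom (t a) _ = CStarAlg.starHom (t a) _ * CStarAlg.starHom (t a) _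
        rw [h.map_conv, map_mul])
      (fun a k => by
        change CStarAlg.starHom (t a) _ = star (CStarAlg.starHom (t a) _)
        rw [h.map_adj, map_star])
    -- So far `T` is contractive for the `I`-norm only. To obtain the bound by `N`, `hext` receives
    -- approximations from the stages, on which the cocone already gives that bound.
    have hT' := hext c.pt s.pt T hm hs hn fun f ε hε => by
      obtain ⟨a, k, hk⟩ := exists_rnormI_sub_cone_le hF hc f hε
      refine ⟨stage F a, coneProj c a, k, cone_surjective hF hc a, hk, ?_⟩
      rw [hT, ← h.norm_eq]
      exact hle a k
    obtain ⟨Φ, hΦ⟩ := exists_starHom_extend (h.denseRange c.pt) (h.map_conv c.pt) (h.map_adj c.pt)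
      hm hs fun f => by
        rw [h.norm_eq]
        exact hT' f
    exact ⟨Φ, fun a k => (hΦ _).trans (hT a k)⟩
  choose Φ hΦ using hdesc
  refine ⟨⟨Φ, fun s a => h.hom_ext fun k => ?_, fun s m hm => h.hom_ext fun f => ?_⟩⟩
  · refine Eq.trans ?_ (hΦ s a k)
    exact congrArg (CStarAlg.starHom (Φ s)) (h.map_induced _ _ (coneProj c a) k)
  · have hm' : ∀ a k, CStarAlg.starHom m (ι c.pt ((coneProj c a).pullCc k))
        = CStarAlg.starHom (Φ s) (ι c.pt ((coneProj c a).pullCc k)) := fun a k => by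
      rw [hΦ, ← hm a]
      exact congrArg (CStarAlg.starHom m) (h.map_induced _ _ (coneProj c a) k).symm
    -- The two homomorphisms agree on pull-backs, which are dense for the `I`-norm, and both are
    -- contractive for it.
    refine sub_eq_zero.1 (norm_le_zero_iff.1 (nonpos_of_forall_le_mul (C := 2) fun ε hε => ?_))
    obtain ⟨a, k, hk⟩ := exists_rnormI_sub_cone_le hF hc f hε
    have e : CStarAlg.starHom m (ι c.pt f) - CStarAlg.starHom (Φ s) (ι c.pt f)
        = CStarAlg.starHom m (ι c.pt (f - (coneProj c a).pullCc k))
          - CStarAlg.starHom (Φ s) (ι c.pt (f - (coneProj c a).pullCc k)) := by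
      rw [map_sub (ι c.pt), map_sub (CStarAlg.starHom m), map_sub (CStarAlg.starHom (Φ s)), hm']
      abel
    rw [e]
    have hb : ∀ m : Γ.obj (op c.pt) ⟶ s.pt,
        ‖CStarAlg.starHom m (ι c.pt (f - (coneProj c a).pullCc k))‖ ≤ ε := fun m =>
      (NonUnitalStarAlgHom.norm_apply_le (CStarAlg.starHom m) _).trans ((hι _ _).trans hk)
    calc _ ≤ _ := norm_sub_le _ _
      _ ≤ ε + ε := add_le_add (hb m) (hb (Φ s))
      _ = ε * 2 := by ring

theorem mapsInverseLimitsToDirectLimits_max (h : IsCompletionFunctor HaarGroupoid.normMax Γ ι) :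
    MapsInverseLimitsToDirectLimits Γ :=
  h.mapsInverseLimitsToDirectLimits (fun _ => HaarGroupoid.normMax_le_normI)
    fun _ _ _ T hm hs hn _ => HaarGroupoid.norm_le_normMax T hm hs hn

/-- Let `φ*k` be a pull-back within `ε` of `f` in the `I`-norm. Since `φ` is surjective, `‖T (φ*k)‖`
is at most the minimal norm of `k`, which is at most that of `φ*k`, hence at most that of `f` plus
`ε`. -/
theorem mapsInverseLimitsToDirectLimits_min (h : IsCompletionFunctor HaarGroupoid.normMin Γ ι) :
    MapsInverseLimitsToDirectLimits Γ := by
  refine h.mapsInverseLimitsToDirectLimits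
    (fun _ f => (HaarGroupoid.normMin_le_normMax f).trans (HaarGroupoid.normMax_le_normI f))
    fun G B _ T _ _ hn hd f => ?_
  change ‖T f‖ ≤ G.rnormMin f
  refine sub_nonpos.1 (nonpos_of_forall_le_mul (C := 2) fun ε hε => ?_)
  obtain ⟨H, φ, k, hφ, hk, hTk⟩ := hd f ε hε
  have h1 : T f = T (f - φ.pullCc k) + T (φ.pullCc k) := by rw [map_sub, sub_add_cancel]
  have h2 : φ.pullCc k = f + (-(1 : ℂ)) • (f - φ.pullCc k) := by
    ext x
    simp
  have h3 : G.rnormMin (φ.pullCc k) ≤ G.rnormMin f + ε := by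
    conv_lhs => rw [h2]
    refine (HaarGroupoid.rnormMin_add_le _ _).trans (add_le_add le_rfl ?_)
    refine (HaarGroupoid.rnormMin_le_rnormI _).trans ((HaarGroupoid.rnormI_smul_le _ _).trans ?_)
    rw [norm_neg, norm_one, one_mul]
    exact hk
  have h4 : ‖T f‖ ≤ ε + (G.rnormMin f + ε) := by
    rw [h1]
    exact (norm_add_le _ _).trans (add_le_add ((hn _).trans hk)
      (hTk.trans ((hφ.rnormMin_le k).trans h3)))
  linarith

end IsCompletionFunctor

theorem theorem1 :
    -- finite disjoint unions exist in the category of groupoids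
    (∀ (I : Type) [Finite I] (G : I → HaarGroupoid.{u}),
      ∃ (D : HaarGroupoid.{u}) (j : ∀ i, G i ⟶ D), IsDisjointUnion G D j) ∧
    ∃ (Γmax Γmin : HaarGroupoid.{u}ᵒᵖ ⥤ CStarAlg.{u})
      (ιmax : ∀ G : HaarGroupoid.{u}, C_c(G.Arr, ℂ) →ₗ[ℂ] (Γmax.obj (op G) : Type u))
      (ιmin : ∀ G : HaarGroupoid.{u}, C_c(G.Arr, ℂ) →ₗ[ℂ] (Γmin.obj (op G) : Type u)),
      -- they send `G` to its maximal (minimal) C*-algebra and `φ` to its induced map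
      (IsCompletionFunctor HaarGroupoid.normMax Γmax ιmax ∧
        IsCompletionFunctor HaarGroupoid.normMin Γmin ιmin) ∧
      (RespectsFiniteSums Γmax ∧ RespectsFiniteSums Γmin) ∧
      (MapsInverseLimitsToDirectLimits Γmax ∧ MapsInverseLimitsToDirectLimits Γmin) ∧
      (ExtendsGelfand Γmax ιmax ∧ ExtendsGelfand Γmin ιmin) ∧
      (RestrictsToAntiEquivalence Γmax ∧ RestrictsToAntiEquivalence Γmin) := by
  refine ⟨fun I _ G => ⟨sigmaGroupoid G, sigmaInclusion G, isDisjointUnion_sigmaGroupoid G⟩, ?_⟩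
  obtain ⟨Γmax, ιmax, hmax⟩ := exists_isCompletionFunctor
    HaarGroupoid.exists_completion_normMax fun _ _ φ => φ.normMax_pullCc_le
  obtain ⟨Γmin, ιmin, hmin⟩ := exists_isCompletionFunctor
    HaarGroupoid.exists_completion_normMin fun _ _ φ => φ.normMin_pullCc_le
  have h1 := hmax.extendsGelfand (fun _ => HaarGroupoid.normMin_le_normMax)
    fun _ => HaarGroupoid.normMax_le_normI
  have h2 := hmin.extendsGelfand (fun _ _ => le_rfl) fun _ f =>
    (HaarGroupoid.normMin_le_normMax f).trans (HaarGroupoid.normMax_le_normI f)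
  refine ⟨Γmax, Γmin, ιmax, ιmin, ⟨hmax, hmin⟩, ⟨hmax.respectsFiniteSums, hmin.respectsFiniteSums⟩,
    ⟨?_, ?_⟩, ⟨h1, h2⟩, ?_⟩
  · exact hmax.mapsInverseLimitsToDirectLimits_max
  · exact hmin.mapsInverseLimitsToDirectLimits_min
  · obtain ⟨e, -⟩ := h1
    obtain ⟨e', -⟩ := h2
    exact ⟨restrictsToAntiEquivalence e, restrictsToAntiEquivalence e'⟩
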